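/- **Setting.** For $n\ge 1$ let $\mathbb H^n=\mathbb R^{2n}\times\mathbb R$ be the Heisenberg group in exponential coordinates $(z,t)$, $z=(x_1,y_1,\dots,x_n,y_n)$, with the left-invariant Riemannian metric for which $X_i=\partial_{x_i}-\frac{y_i}{2}\partial_t$, $Y_i=\partial_{y_i}+\frac{x_i}{2}\partial_t$, $T=\partial_t$ are orthonormal, and let $H=\mathrm{span}\{X_i,Y_i\}$. For horizontal $X$ let $X^\perp$ be its image under $X_i\mapsto Y_i$, $Y_i\mapsto -X_i$; $\nabla^H$ is the connection on $H$ for which the frame $X_i,Y_i$ is parallel, and $\mathrm{vol}$ is the Riemannian volume form. For an embedded $C^2$ hypersurface $S\subset\mathbb H^n$ without boundary with unit normal $\nu$, let $C_S=\{P_H\nu=0\}$ be the characteristic set and, on $S\setminus C_S$, $$\nu_H=\frac{P_H\nu}{|P_H\nu|},\qquad \varpi=\frac{\langle\nu,T\rangle}{|P_H\nu|},\qquad HS=H\cap TS,$$ $B_H(X,Y)=\langle\nabla^H_XY,\nu_H\rangle$ on $HS$, $\mathcal H_H=\mathrm{Tr}\,B_H$, $S_H$ the symmetric part of $B_H$ with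 Gram norm $\|S_H\|$, $\mathrm{grad}_{HS}$ the gradient along $HS$, $\sigma_R=(\nu\lrcorner\mathrm{vol})|_S$ the Riemannian measure and $\sigma_H=(\nu_H\lrcorner\mathrm{vol})|_S=|P_H\nu|\,\sigma_R$ (zero on $C_S$) the $H$-perimeter. A field $X\in C^1(S\setminus C_S,HS)$ is *admissible* if the forms $\alpha_X=(X\lrcorner\sigma_H)|_S$ and $d\alpha_X$ extend continuously to all of $S$. **(1)** Let $n\ge1$ and let $S\subset\mathbb H^n$ be a compact $C^2$ hypersurface without boundary such that $\varpi^3\nu_H^\perp$ is admissible. Then $2\varpi^2\frac{\partial\varpi}{\partial\nu_H^\perp}-\frac{2n}{3}\varpi^4$ is $\sigma_H$-integrable and $$\int_S\Big(2\varpi^2\frac{\partial\varpi}{\partial\nu_H^\perp}-\frac{2n}{3}\varpi^4\Big)\sigma_H=0 .$$ **(2)** Let $n\ge2$ and let $D\subset\mathbb H^n$ be a compact domain with $C^2$ boundary $S=\partial D$ and outward normal $\nu$, such that $\mathcal H_H$ is constant on $S\setminus C_S$ and $\varpi^3\nu_H^\perp$ is admissible. A *test variation* with function $\varphi$ is a smooth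 family of immersions $\vartheta_t:D\to\mathbb H^n$, $|t|<\epsilon$, $\vartheta_0=\mathrm{id}$, which preserves the volume of $D$, is normal along $S$ (i.e. $\partial_t\vartheta_t$ is parallel to the unit normal $\nu^t$ of $\vartheta_t(S)$), has variation vector $W=\varphi|P_H\nu|\nu$ on $S\setminus C_S$ with $\varphi\in C^2(S\setminus C_S)$, and for which the forms $\chi_1=-\mathcal H_H\varphi\,\sigma_H$, $\chi_2=\big(-\mathcal H_H\,\partial_t\varphi_t|_{t=0}+|\mathrm{grad}_{HS}\varphi|^2+\varphi^2(\mathcal H_H^2-\|S_H\|^2+2\frac{\partial\varpi}{\partial\nu_H^\perp}-\frac{n+1}{2}\varpi^2)\big)\sigma_H$ and $\chi_3=-(\varphi\,\mathrm{grad}_{HS}\varphi)\lrcorner\sigma_H$ extend continuously to $S$, where $\varphi_t=\langle\partial_t\vartheta_t,\nu^t\rangle/|P_H\nu^t|$. Its second variation is $II_S(W,\sigma_H)=\int_{S\setminus C_S}\ddot\Gamma(0)$, where $\Gamma(t)=\vartheta_t^*(\sigma_H)_t$ and $(\sigma_H)_t$ is the $H$-perimeter on $\vartheta_t(S)$. Suppose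 that there is a test variation with function $\varphi=\varpi$. Then, for each such variation, $$II_S(W,\sigma_H)=\int_S\Big(|\mathrm{grad}_{HS}\varpi|^2-\varpi^2\big(\|S_H\|^2+\tfrac{3-n}{6}\varpi^2\big)\Big)\sigma_H ,$$ where $|\mathrm{grad}_{HS}\varpi|^2$ and $\varpi^2(\|S_H\|^2+\frac{3-n}{6}\varpi^2)$ are $\sigma_H$-integrable. Consequently, if $S$ is stable, i.e. $D$ is a critical point of $\sigma_H(\partial D)/\mathrm{vol}(D)^{1-1/(2n+2)}$ under volume-preserving variations and $II_S>0$ (or only $II_S\ge0$) for every test variation with $W\not\equiv0$, then $$\int_S|\mathrm{grad}_{HS}\varpi|^2\,\sigma_H\ \ge\ \int_S\varpi^2\Big(\|S_H\|^2+\frac{3-n}{6}\varpi^2\Big)\sigma_H .$$ **(3)** Let $n\ge2$. The isoperimetric profile $\mathbb S_{\mathbb H^n}=\{(z,t):|z|\le1,\ t=\pm u_0(|z|)\}$, where $u_0(\rho)=\frac{\pi}{8}+\frac{\rho}{4}\sqrt{1-\rho^2}-\frac14\arcsin\rho$, is an orientable $C^2$ hypersurface without boundary, both sides of the last inequality are finite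 for $S=\mathbb S_{\mathbb H^n}$, and they are equal. -/

import Mathlib

open MeasureTheory Set
open scoped ContDiff

noncomputable section

namespace Heisenberg

/-! ## The Heisenberg group and its left-invariant frame -/

/-- Horizontal vectors `∑ᵢ aᵢ Xᵢ + bᵢ Yᵢ`, written in the left-invariant orthonormal frame:
the entry `(i, 0)` is the coefficient of `Xᵢ`, the entry `(i, 1)` that of `Yᵢ`. -/
abbrev Hor (n : ℕ) := EuclideanSpace ℝ (Fin n × Fin 2)

/-- Points of `ℍⁿ` in exponential coordinates `(z, t)`, with `z (i, 0) = xᵢ`, `z (i, 1) = yᵢ`.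
Coordinate tangent vectors have the same type. -/
abbrev Heis (n : ℕ) := Hor n × ℝ

/-- Tangent vectors of `ℍⁿ` written in the left-invariant orthonormal frame
`X₁, Y₁, …, Xₙ, Yₙ, T`: the horizontal part and the coefficient of `T`. -/
abbrev FrameVec (n : ℕ) := Hor n × ℝ

variable {n : ℕ}

/-- `w ↦ ∑ᵢ (xᵢ(z) yᵢ(w) - yᵢ(z) xᵢ(w))`, i.e. `⟨[z, w], T⟩`. -/
def symp (z : Hor n) : Hor n →L[ℝ] ℝ :=
  ∑ i : Fin n, (z (i, 0) • EuclideanSpace.proj (i, 1) - z (i, 1) • EuclideanSpace.proj (i, 0))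

/-- `z^⊥ = (-y₁, x₁, …, -yₙ, xₙ)`. -/
def perp (z : Hor n) : Hor n :=
  WithLp.toLp 2 fun b => if b.2 = 0 then -z (b.1, 1) else z (b.1, 0)

/-- From frame components at `p` to coordinate components; encodes
`Xᵢ = ∂/∂xᵢ - (yᵢ/2) ∂/∂t`, `Yᵢ = ∂/∂yᵢ + (xᵢ/2) ∂/∂t`, `T = ∂/∂t`. -/
def toCoord (p : Heis n) : FrameVec n →L[ℝ] Heis n :=
  (ContinuousLinearMap.fst ℝ (Hor n) ℝ).prod
    (ContinuousLinearMap.snd ℝ (Hor n) ℝ +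
      (1 / 2 : ℝ) • (symp p.1 ∘L ContinuousLinearMap.fst ℝ (Hor n) ℝ))

/-- From coordinate components at `p` to frame components; the last entry is the contact form
`θ = dt + ½ ∑ᵢ (yᵢ dxᵢ - xᵢ dyᵢ)`. -/
def toFrame (p : Heis n) : Heis n →L[ℝ] FrameVec n :=
  (ContinuousLinearMap.fst ℝ (Hor n) ℝ).prod
    (ContinuousLinearMap.snd ℝ (Hor n) ℝ -
      (1 / 2 : ℝ) • (symp p.1 ∘L ContinuousLinearMap.fst ℝ (Hor n) ℝ))

theorem toFrame_toCoord (p : Heis n) (v : FrameVec n) : toFrame p (toCoord p v) = v := by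
  simp [toFrame, toCoord]

/-- The left-invariant Riemannian metric in frame components. -/
def metric (v w : FrameVec n) : ℝ := inner ℝ v.1 w.1 + v.2 * w.2

/-- The Riemannian norm in frame components. -/
def rnorm (v : FrameVec n) : ℝ := Real.sqrt (metric v v)

/-- The Riemannian gradient, in frame components. -/
def rgrad (f : Heis n → ℝ) (p : Heis n) : FrameVec n :=
  ((InnerProductSpace.toDual ℝ (Hor n)).symm
      (fderiv ℝ f p ∘L toCoord p ∘L ContinuousLinearMap.inl ℝ (Hor n) ℝ),
    fderiv ℝ f p (toCoord p (0, 1)))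

/-- The left-invariant frame in the order `X₁, Y₁, …, Xₙ, Yₙ, T`, indexed by `Fin m` where
`m = 2 * n + 1`. -/
def frameBasis (n m : ℕ) (h : m = 2 * n + 1) : Module.Basis (Fin m) ℝ (FrameVec n) :=
  ((EuclideanSpace.basisFun (Fin n × Fin 2) ℝ).toBasis.prod (Module.Basis.singleton (Fin 1) ℝ)).reindex
    (((finProdFinEquiv.sumCongr (Equiv.refl (Fin 1))).trans finSumFinEquiv).trans
      (finCongr (by omega)))

/-- The Riemannian volume form `(⋀ᵢ dxᵢ ∧ dyᵢ) ∧ θ` on frame components. -/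
def volForm (n m : ℕ) (h : m = 2 * n + 1) : FrameVec n [⋀^Fin m]→L[ℝ] ℝ :=
  { (frameBasis n m h).det with
    cont := by
      change Continuous fun v : Fin m → FrameVec n => (frameBasis n m h).det v
      simp only [Module.Basis.det_apply]
      refine Continuous.matrix_det (continuous_matrix fun i j => ?_)
      simp only [Module.Basis.toMatrix_apply]
      exact (LinearMap.continuous_of_finiteDimensional ((frameBasis n m h).coord i)).comp
        (continuous_apply j) }

/-! ## Hypersurfaces -/

/-- `S` is an embedded hypersurface of class `C²` without boundary, oriented by the unit normal
`ν` (in frame components): near each of its points `S` is the zero set of a `C²` function with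
nonvanishing gradient, whose normalised Riemannian gradient along `S` is `ν`. -/
def IsOrientedHypersurface (S : Set (Heis n)) (ν : Heis n → FrameVec n) : Prop :=
  ∀ p ∈ S, ∃ (U : Set (Heis n)) (f : Heis n → ℝ), IsOpen U ∧ p ∈ U ∧ ContDiffOn ℝ 2 f U ∧
    S ∩ U = {q ∈ U | f q = 0} ∧
    ∀ q ∈ S ∩ U, rgrad f q ≠ 0 ∧ ν q = (rnorm (rgrad f q))⁻¹ • rgrad f q

/-- The characteristic set `C_S`: the points where `|P_H ν| = 0`, i.e. where the horizontal space
is tangent to `S`. -/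
def charSet (S : Set (Heis n)) (ν : Heis n → FrameVec n) : Set (Heis n) :=
  {p ∈ S | (ν p).1 = 0}

/-- The unit horizontal normal `ν_H = P_H ν / |P_H ν|` (it is `0` at characteristic points). -/
def nuH (ν : Heis n → FrameVec n) (p : Heis n) : Hor n := ‖(ν p).1‖⁻¹ • (ν p).1

/-- The characteristic direction `ν_H^⊥`. -/
def nuPerp (ν : Heis n → FrameVec n) (p : Heis n) : Hor n := perp (nuH ν p)

/-- `ϖ = ν_T / |P_H ν|`. -/
def varpi (ν : Heis n → FrameVec n) (p : Heis n) : ℝ := (ν p).2 / ‖(ν p).1‖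

/-- The horizontal tangent space `H_p S = H_p ∩ T_p S`. -/
def HS (ν : Heis n → FrameVec n) (p : Heis n) : Submodule ℝ (Hor n) := (ℝ ∙ (ν p).1)ᗮ

/-- The derivative along `S` of a function on `S`, at `p`, in the direction of a vector `h` of
`H_p S`.  As the frame is parallel for the `H`-connection, for horizontal fields
`f : S → Hor n` this is `∇^H_h f`.  (On vectors tangent to `S` the value of a derivative within
`S` does not depend on the choice of that derivative.) -/
def dS {F : Type*} [NormedAddCommGroup F] [NormedSpace ℝ F] (S : Set (Heis n)) (f : Heis n → F)
    (p : Heis n) (h : Hor n) : F :=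
  fderivWithin ℝ f S p (toCoord p (h, 0))

/-- The `HS`-gradient of `φ`: the vector of `H_p S` that represents `dφ` on `H_p S`. -/
def gradHS (S : Set (Heis n)) (ν : Heis n → FrameVec n) (φ : Heis n → ℝ) (p : Heis n) : Hor n :=
  (InnerProductSpace.toDual ℝ (Hor n)).symm
    (fderivWithin ℝ φ S p ∘L toCoord p ∘L ContinuousLinearMap.inl ℝ (Hor n) ℝ ∘L
      (HS ν p).starProjection)

/-- The horizontal second fundamental form `B_H(h, k) = ⟨∇^H_h k, ν_H⟩ = -⟨∇^H_h ν_H, k⟩` for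
`h, k ∈ H_p S`. -/
def secondForm (S : Set (Heis n)) (ν : Heis n → FrameVec n) (p : Heis n) (h k : Hor n) : ℝ :=
  -inner ℝ (dS S (nuH ν) p h) k

/-- The horizontal mean curvature `Tr B_H`. -/
def meanCurv (S : Set (Heis n)) (ν : Heis n → FrameVec n) (p : Heis n) : ℝ :=
  ∑ i, secondForm S ν p (stdOrthonormalBasis ℝ (HS ν p) i) (stdOrthonormalBasis ℝ (HS ν p) i)

/-- `‖S_H‖²`: the squared Gram norm of the symmetric part of `B_H`. -/
def normSqSymm (S : Set (Heis n)) (ν : Heis n → FrameVec n) (p : Heis n) : ℝ :=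
  ∑ i, ∑ j,
    ((secondForm S ν p (stdOrthonormalBasis ℝ (HS ν p) i) (stdOrthonormalBasis ℝ (HS ν p) j) +
      secondForm S ν p (stdOrthonormalBasis ℝ (HS ν p) j)
        (stdOrthonormalBasis ℝ (HS ν p) i)) / 2) ^ 2

/-- `∂ϖ/∂ν_H^⊥`. -/
def dVarpi (S : Set (Heis n)) (ν : Heis n → FrameVec n) (p : Heis n) : ℝ :=
  dS S (varpi ν) p (nuPerp ν p)

/-! ## Differential forms and measures on hypersurfaces -/

/-- A regular local parametrisation, of class `C²`, of (a part of) `S`. -/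
structure LocalParam (n : ℕ) (S : Set (Heis n)) where
  dom : Set (Fin (2 * n) → ℝ)
  map : (Fin (2 * n) → ℝ) → Heis n
  isOpen_dom : IsOpen dom
  contDiffOn : ContDiffOn ℝ 2 map dom
  injOn : InjOn map dom
  immersion : ∀ u ∈ dom, Function.Injective (fderiv ℝ map u)
  mapsTo : MapsTo map dom S

namespace LocalParam

variable {S : Set (Heis n)}

/-- The differential of the parametrisation, with values in frame components. -/
def frameDeriv (P : LocalParam n S) (u : Fin (2 * n) → ℝ) :
    (Fin (2 * n) → ℝ) →L[ℝ] FrameVec n :=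
  toFrame (P.map u) ∘L fderiv ℝ P.map u

/-- The density `|vol(V, ∂₁, …, ∂₂ₙ)|` of the pull-back of `V ⌟ vol`. -/
def density (P : LocalParam n S) (V : Heis n → FrameVec n) (u : Fin (2 * n) → ℝ) : ℝ :=
  |volForm n (2 * n + 1) rfl
    (Fin.cons (V (P.map u)) fun j => P.frameDeriv u (Pi.single j 1))|

/-- The measure that the form `V ⌟ vol` induces on the image of the parametrisation. -/
def measure (P : LocalParam n S) (V : Heis n → FrameVec n) : Measure (Heis n) :=
  ((volume.restrict P.dom).withDensity fun u => ENNReal.ofReal (P.density V u)).map P.map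

/-- The pull-back of the `k`-form `α_X = X ⌟ (ν_H ⌟ vol)`, where `k = 2 n - 1`. -/
def pullback (P : LocalParam n S) (ν : Heis n → FrameVec n) (X : Heis n → Hor n) {k : ℕ}
    (h : k + 2 = 2 * n + 1) (u : Fin (2 * n) → ℝ) : (Fin (2 * n) → ℝ) [⋀^Fin k]→L[ℝ] ℝ :=
  (((volForm n (k + 2) h).curryLeft (nuH ν (P.map u), 0)).curryLeft
    (X (P.map u), 0)).compContinuousLinearMap (P.frameDeriv u)

end LocalParam

/-- The measure on `S` given by integration of (the absolute value of) the form `(V ⌟ vol)|_S`: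
the measures obtained from the local parametrisations agree on overlaps, and this is their
common extension. -/
def contractionMeasure (S : Set (Heis n)) (V : Heis n → FrameVec n) : Measure (Heis n) :=
  ⨆ P : LocalParam n S, P.measure V

/-- The Riemannian measure `ν ⌟ vol` on `S`. -/
def sigmaR (S : Set (Heis n)) (ν : Heis n → FrameVec n) : Measure (Heis n) :=
  contractionMeasure S ν

/-- The `H`-perimeter measure `ν_H ⌟ vol` on `S` (it vanishes on `C_S`). -/
def sigmaH (S : Set (Heis n)) (ν : Heis n → FrameVec n) : Measure (Heis n) :=
  contractionMeasure S fun p => (nuH ν p, 0)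

/-- The `(2n-1)`-form `α_X = (X ⌟ σ_H)|_S`, defined on `S ∖ C_S`, extends continuously to `S`
(in terms of its pull-backs under local parametrisations; `k` stands for `2 n - 1`). -/
def ContractionContinuous (S : Set (Heis n)) (ν : Heis n → FrameVec n) (X : Heis n → Hor n) :
    Prop :=
  ∀ (k : ℕ) (h : k + 2 = 2 * n + 1) (P : LocalParam n S),
    ∃ β : (Fin (2 * n) → ℝ) → (Fin (2 * n) → ℝ) [⋀^Fin k]→L[ℝ] ℝ,
      ContinuousOn β P.dom ∧ ∀ u ∈ P.dom, P.map u ∉ charSet S ν → β u = P.pullback ν X h u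

/-- The `2n`-form `d α_X`, defined on `S ∖ C_S`, extends continuously to `S`. -/
def ExtDerivContinuous (S : Set (Heis n)) (ν : Heis n → FrameVec n) (X : Heis n → Hor n) :
    Prop :=
  ∀ (k : ℕ) (h : k + 2 = 2 * n + 1) (P : LocalParam n S),
    ∃ γ : (Fin (2 * n) → ℝ) → (Fin (2 * n) → ℝ) [⋀^Fin (k + 1)]→L[ℝ] ℝ,
      ContinuousOn γ P.dom ∧
        ∀ u ∈ P.dom, P.map u ∉ charSet S ν → γ u = extDeriv (P.pullback ν X h) u

/-- `X ∈ C¹(S ∖ C_S, HS)` is admissible (for the horizontal divergence formula): the forms `α_X`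
and `d α_X` are continuous on all of `S`. -/
def Admissible (S : Set (Heis n)) (ν : Heis n → FrameVec n) (X : Heis n → Hor n) : Prop :=
  ContDiffOn ℝ 1 X (S \ charSet S ν) ∧ (∀ p ∈ S \ charSet S ν, X p ∈ HS ν p) ∧
    ContractionContinuous S ν X ∧ ExtDerivContinuous S ν X

/-- The `2n`-form `g σ_H = g |P_H ν| σ_R`, with `g` a function on `S ∖ C_S`, extends continuously
to `S`. -/
def TopFormContinuous (S : Set (Heis n)) (ν : Heis n → FrameVec n) (g : Heis n → ℝ) : Prop :=
  ∃ G : Heis n → ℝ, ContinuousOn G S ∧ ∀ p ∈ S \ charSet S ν, G p = g p * ‖(ν p).1‖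

/-! ## Domains, variations and stability -/

/-- `D` is a compact domain with boundary of class `C²`, and `ν` is its outward unit normal. -/
def IsC2Domain (D : Set (Heis n)) (ν : Heis n → FrameVec n) : Prop :=
  IsCompact D ∧ IsConnected (interior D) ∧ closure (interior D) = D ∧
    ∀ p ∈ frontier D, ∃ (U : Set (Heis n)) (f : Heis n → ℝ), IsOpen U ∧ p ∈ U ∧
      ContDiffOn ℝ 2 f U ∧ D ∩ U = {q ∈ U | f q ≤ 0} ∧
      ∀ q ∈ U, f q = 0 → rgrad f q ≠ 0 ∧ ν q = (rnorm (rgrad f q))⁻¹ • rgrad f q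

/-- The horizontal mean curvature is constant on `S ∖ C_S`. -/
def HasConstantMeanCurv (S : Set (Heis n)) (ν : Heis n → FrameVec n) : Prop :=
  ∃ c : ℝ, ∀ p ∈ S \ charSet S ν, meanCurv S ν p = c

/-- The differential of `ϑ_t` at `p ∈ D`, in frame components at both ends. -/
def diffVar (D : Set (Heis n)) (ϑ : ℝ → Heis n → Heis n) (t : ℝ) (p : Heis n) :
    FrameVec n →L[ℝ] FrameVec n :=
  toFrame (ϑ t p) ∘L fderivWithin ℝ (ϑ t) D p ∘L toCoord p

/-- The variation field `∂ϑ_t(p)/∂t`, in frame components at `ϑ_t(p)`. -/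
def velocity (ϑ : ℝ → Heis n → Heis n) (t : ℝ) (p : Heis n) : FrameVec n :=
  toFrame (ϑ t p) (deriv (fun s => ϑ s p) t)

/-- `ϑ_t`, `|t| < ε`, is a smooth variation of `D` through immersions, starting at the
inclusion. -/
def IsVariation (D : Set (Heis n)) (ϑ : ℝ → Heis n → Heis n) (ε : ℝ) : Prop :=
  0 < ε ∧ ContDiffOn ℝ ∞ (fun x : ℝ × Heis n => ϑ x.1 x.2) (Ioo (-ε) ε ×ˢ D) ∧
    (∀ t ∈ Ioo (-ε) ε, ∀ p ∈ D, Function.Injective (fderivWithin ℝ (ϑ t) D p)) ∧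
    ∀ p ∈ D, ϑ 0 p = p

/-- The volume of `ϑ_t(D)`, counted with multiplicity: the integral over `D` of the pull-back of
the volume form (which is Lebesgue measure in exponential coordinates). -/
def volAlong (D : Set (Heis n)) (ϑ : ℝ → Heis n → Heis n) (t : ℝ) : ℝ :=
  ∫ p in D, |(fderivWithin ℝ (ϑ t) D p).det|

/-- The variation keeps the volume of `D` fixed. -/
def IsVolumePreserving (D : Set (Heis n)) (ϑ : ℝ → Heis n → Heis n) (ε : ℝ) : Prop :=
  ∀ t ∈ Ioo (-ε) ε, volAlong D ϑ t = volume.real D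

/-- `w ↦ vol(w, dϑ_t τ₁, …, dϑ_t τ₂ₙ)`, where `τ₁, …, τ₂ₙ` is an orthonormal basis of `T_p S` such
that `ν(p), τ₁, …, τ₂ₙ` is positively oriented, written as the determinant of the linear map
that is `dϑ_t` on `T_p S` and sends `ν(p)` to `w`. -/
def conormal (D : Set (Heis n)) (ν : Heis n → FrameVec n) (ϑ : ℝ → Heis n → Heis n) (t : ℝ)
    (p : Heis n) (w : FrameVec n) : ℝ :=
  LinearMap.det ({
    toFun := fun v => diffVar D ϑ t p (v - metric v (ν p) • ν p) + metric v (ν p) • w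
    map_add' := by
      intro x y
      have h : metric (x + y) (ν p) = metric x (ν p) + metric y (ν p) := by
        simp [metric, inner_add_left]; ring
      rw [h, add_smul, add_smul, add_sub_add_comm, map_add]
      abel
    map_smul' := by
      intro c x
      have h : metric (c • x) (ν p) = c * metric x (ν p) := by
        simp [metric, inner_smul_left]; ring
      rw [h, mul_smul, mul_smul, ← smul_sub, map_smul, RingHom.id_apply, smul_add] } :
    FrameVec n →ₗ[ℝ] FrameVec n)

/-- The vector dual to `conormal`: it is a positive multiple of the unit normal `ν^t` of `ϑ_t(S)`
at `ϑ_t(p)`, and its norm is the Jacobian of `ϑ_t` on `S`. -/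
def normalVar (D : Set (Heis n)) (ν : Heis n → FrameVec n) (ϑ : ℝ → Heis n → Heis n) (t : ℝ)
    (p : Heis n) : FrameVec n :=
  (WithLp.toLp 2 fun b => conormal D ν ϑ t p (EuclideanSpace.single b 1, 0),
    conormal D ν ϑ t p (0, 1))

/-- The variation is normal: its variation field is parallel to `ν^t` along `∂D`. -/
def IsNormalVariation (D : Set (Heis n)) (ν : Heis n → FrameVec n) (ϑ : ℝ → Heis n → Heis n)
    (ε : ℝ) : Prop :=
  ∀ t ∈ Ioo (-ε) ε, ∀ p ∈ frontier D, ∃ c : ℝ, velocity ϑ t p = c • normalVar D ν ϑ t p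

/-- The density of `Γ(t) = ϑ_t^* (σ_H)_t` with respect to the Riemannian measure of `S = ∂D`. -/
def perimDensity (D : Set (Heis n)) (ν : Heis n → FrameVec n) (ϑ : ℝ → Heis n → Heis n) (t : ℝ)
    (p : Heis n) : ℝ :=
  ‖(normalVar D ν ϑ t p).1‖

/-- The second variation `II_S(W, σ_H)`: the integral of `Γ''(0)` over `S ∖ C_S`, `S = ∂D`. -/
def secondVariation (D : Set (Heis n)) (ν : Heis n → FrameVec n) (ϑ : ℝ → Heis n → Heis n) : ℝ :=
  ∫ p in frontier D \ charSet (frontier D) ν,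
    iteratedDeriv 2 (fun t => perimDensity D ν ϑ t p) 0 ∂(sigmaR (frontier D) ν)

/-- The isoperimetric functional `σ_H(∂D) / vol(D)^(1 - 1/Q)`, `Q = 2n + 2`, at `ϑ_t(D)`. -/
def isopFunctional (D : Set (Heis n)) (ν : Heis n → FrameVec n) (ϑ : ℝ → Heis n → Heis n)
    (t : ℝ) : ℝ :=
  (∫ p, perimDensity D ν ϑ t p ∂(sigmaR (frontier D) ν)) /
    volAlong D ϑ t ^ (1 - 1 / (2 * (n : ℝ) + 2))

/-- `D` is a critical point of the isoperimetric functional under volume-preserving variations. -/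
def IsCritical (D : Set (Heis n)) (ν : Heis n → FrameVec n) : Prop :=
  ∀ (ϑ : ℝ → Heis n → Heis n) (ε : ℝ), IsVariation D ϑ ε → IsVolumePreserving D ϑ ε →
    HasDerivAt (isopFunctional D ν ϑ) 0 0

/-- `w_t = ⟨W, ν^t⟩ / |P_H ν^t|`. -/
def weightVar (D : Set (Heis n)) (ν : Heis n → FrameVec n) (ϑ : ℝ → Heis n → Heis n) (t : ℝ)
    (p : Heis n) : ℝ :=
  metric (velocity ϑ t p) (normalVar D ν ϑ t p) / ‖(normalVar D ν ϑ t p).1‖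

/-- `ϑ` is a volume-preserving normal variation with variation vector `W = φ |P_H ν| ν`, where `φ`
is of class `C²` on `S ∖ C_S`, `S = ∂D`, and the three forms that enter the first and second
variation formulas, `χ₁ = -H φ σ_H`,
`χ₂ = (-H W(φ_t)|_{t=0} + |grad φ|² + φ² (H² - ‖S_H‖² + 2 ∂ϖ/∂ν_H^⊥ - (n+1)/2 ϖ²)) σ_H` and
`χ₃ = -(φ grad φ) ⌟ σ_H`, are continuous on all of `S`. -/
def IsTestVariation (D : Set (Heis n)) (ν : Heis n → FrameVec n) (φ : Heis n → ℝ)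
    (ϑ : ℝ → Heis n → Heis n) : Prop :=
  (∃ ε : ℝ, IsVariation D ϑ ε ∧ IsVolumePreserving D ϑ ε ∧ IsNormalVariation D ν ϑ ε) ∧
  ContDiffOn ℝ 2 φ (frontier D \ charSet (frontier D) ν) ∧
  (∀ p ∈ frontier D \ charSet (frontier D) ν, velocity ϑ 0 p = (φ p * ‖(ν p).1‖) • ν p) ∧
  TopFormContinuous (frontier D) ν (fun p => -meanCurv (frontier D) ν p * φ p) ∧
  TopFormContinuous (frontier D) ν (fun p =>
    -meanCurv (frontier D) ν p * deriv (fun t => weightVar D ν ϑ t p) 0 +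
      ‖gradHS (frontier D) ν φ p‖ ^ 2 +
      φ p ^ 2 * (meanCurv (frontier D) ν p ^ 2 - normSqSymm (frontier D) ν p +
        2 * dVarpi (frontier D) ν p - ((n : ℝ) + 1) / 2 * varpi ν p ^ 2)) ∧
  ContractionContinuous (frontier D) ν (fun p => -(φ p • gradHS (frontier D) ν φ p))

/-- Stability of `∂D`: `D` is critical and the second variation is positive for every nonzero
test variation. -/
def IsStable (D : Set (Heis n)) (ν : Heis n → FrameVec n) : Prop :=
  IsCritical D ν ∧ ∀ (φ : Heis n → ℝ) (ϑ : ℝ → Heis n → Heis n), IsTestVariation D ν φ ϑ →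
    (∃ p ∈ frontier D, velocity ϑ 0 p ≠ 0) → 0 < secondVariation D ν ϑ

/-- The weak form of stability, with `≥ 0` in place of `> 0`. -/
def IsWeaklyStable (D : Set (Heis n)) (ν : Heis n → FrameVec n) : Prop :=
  IsCritical D ν ∧ ∀ (φ : Heis n → ℝ) (ϑ : ℝ → Heis n → Heis n), IsTestVariation D ν φ ϑ →
    (∃ p ∈ frontier D, velocity ϑ 0 p ≠ 0) → 0 ≤ secondVariation D ν ϑ

theorem IsStable.isWeaklyStable {D : Set (Heis n)} {ν : Heis n → FrameVec n}
    (h : IsStable D ν) : IsWeaklyStable D ν :=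
  ⟨h.1, fun φ ϑ h1 h2 => (h.2 φ ϑ h1 h2).le⟩

/-! ## The isoperimetric profile -/

/-- The profile function `u₀`, as a function of `ρ = |z|`. -/
def profileFun (r : ℝ) : ℝ :=
  Real.pi / 8 + r / 4 * Real.sqrt (1 - r ^ 2) - 1 / 4 * Real.arcsin r

/-- The Heisenberg unit isoperimetric profile. -/
def profile (n : ℕ) : Set (Heis n) :=
  {p | ‖p.1‖ ≤ 1 ∧ (p.2 = profileFun ‖p.1‖ ∨ p.2 = -profileFun ‖p.1‖)}

end Heisenberg

end

noncomputable section

namespace Heisenberg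

variable {n : ℕ}

open Filter Topology

/-- Projections and inclusions for the splitting of frame vectors. -/
local notation "fstH" => ContinuousLinearMap.fst ℝ (Hor _) ℝ
local notation "sndH" => ContinuousLinearMap.snd ℝ (Hor _) ℝ
local notation "inlH" => ContinuousLinearMap.inl ℝ (Hor _) ℝ
local notation "inrH" => ContinuousLinearMap.inr ℝ (Hor _) ℝ

/-! ## Linear algebra of the frame -/

theorem symp_apply (z w : Hor n) :
    symp z w = ∑ i : Fin n, (z (i, 0) * w (i, 1) - z (i, 1) * w (i, 0)) := by
  simp [symp]

@[simp] theorem perp_apply_zero (z : Hor n) (i : Fin n) : perp z (i, 0) = -z (i, 1) := by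
  simp [perp]

@[simp] theorem perp_apply_one (z : Hor n) (i : Fin n) : perp z (i, 1) = z (i, 0) := by
  simp [perp]

theorem hor_inner (z w : Hor n) :
    inner ℝ z w = ∑ i : Fin n, (z (i, 0) * w (i, 0) + z (i, 1) * w (i, 1)) := by
  rw [PiLp.inner_apply, Fintype.sum_prod_type]
  refine Finset.sum_congr rfl fun i _ => ?_
  simp [Fin.sum_univ_two, mul_comm]

theorem symp_eq_inner (z w : Hor n) : symp z w = inner ℝ (perp z) w := by
  rw [symp_apply, hor_inner]
  refine Finset.sum_congr rfl fun i _ => ?_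
  rw [perp_apply_zero, perp_apply_one]; ring

theorem hor_ext {z w : Hor n} (h0 : ∀ i, z (i, 0) = w (i, 0)) (h1 : ∀ i, z (i, 1) = w (i, 1)) :
    z = w := by
  ext ⟨i, j⟩
  fin_cases j
  exacts [h0 i, h1 i]

/-- `perp` as a continuous linear map. -/
def perpL : Hor n →L[ℝ] Hor n :=
  LinearMap.toContinuousLinearMap
    { toFun := perp
      map_add' := fun x y => hor_ext (fun i => by simp; ring) (fun i => by simp)
      map_smul' := fun c x => hor_ext (fun i => by simp) (fun i => by simp) }

@[simp] theorem perpL_apply (z : Hor n) : perpL z = perp z := rfl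

theorem perp_smul (c : ℝ) (z : Hor n) : perp (c • z) = c • perp z := perpL.map_smul c z

theorem perp_add (z w : Hor n) : perp (z + w) = perp z + perp w := perpL.map_add z w

theorem perp_zero : perp (0 : Hor n) = 0 := perpL.map_zero

theorem inner_perp_perp (z w : Hor n) : inner ℝ (perp z) (perp w) = inner ℝ z w := by
  rw [hor_inner, hor_inner]
  refine Finset.sum_congr rfl fun i _ => ?_
  simp only [perp_apply_zero, perp_apply_one]; ring

theorem inner_perp_left (z w : Hor n) : inner ℝ (perp z) w = -inner ℝ z (perp w) := by
  rw [hor_inner, hor_inner, ← Finset.sum_neg_distrib]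
  refine Finset.sum_congr rfl fun i _ => ?_
  simp only [perp_apply_zero, perp_apply_one]; ring

@[simp] theorem inner_perp_self (z : Hor n) : inner ℝ (perp z) z = 0 := by
  rw [hor_inner]
  refine Finset.sum_eq_zero fun i _ => ?_
  simp only [perp_apply_zero, perp_apply_one]; ring

@[simp] theorem inner_self_perp (z : Hor n) : inner ℝ z (perp z) = 0 := by
  rw [real_inner_comm, inner_perp_self]

@[simp] theorem norm_perp (z : Hor n) : ‖perp z‖ = ‖z‖ := by
  rw [@norm_eq_sqrt_real_inner _ _ _ (perp z), inner_perp_perp, ← norm_eq_sqrt_real_inner]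

theorem symp_swap (z w : Hor n) : symp z w = -symp w z := by
  rw [symp_eq_inner, symp_eq_inner, inner_perp_left, real_inner_comm]

@[simp] theorem symp_self (z : Hor n) : symp z z = 0 := by
  rw [symp_eq_inner, inner_perp_self]

theorem symp_add_left (z z' w : Hor n) : symp (z + z') w = symp z w + symp z' w := by
  simp [symp_eq_inner, perp_add, inner_add_left]

theorem symp_smul_left (c : ℝ) (z w : Hor n) : symp (c • z) w = c * symp z w := by
  simp [symp_eq_inner, perp_smul, inner_smul_left]

/-- `symp` as a continuous bilinear map. -/
def sympL : Hor n →L[ℝ] Hor n →L[ℝ] ℝ := (innerSL ℝ) ∘L perpL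

@[simp] theorem sympL_apply (z w : Hor n) : sympL z w = symp z w := by
  rw [symp_eq_inner]; rfl

@[simp] theorem toCoord_fst (p : Heis n) (v : FrameVec n) : (toCoord p v).1 = v.1 := rfl

theorem toCoord_apply (p : Heis n) (v : FrameVec n) :
    toCoord p v = (v.1, v.2 + 1 / 2 * symp p.1 v.1) := by
  simp [toCoord]

theorem toFrame_apply (p : Heis n) (v : Heis n) :
    toFrame p v = (v.1, v.2 - 1 / 2 * symp p.1 v.1) := by
  simp [toFrame]

theorem toCoord_toFrame (p : Heis n) (v : Heis n) : toCoord p (toFrame p v) = v := by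
  simp [toFrame, toCoord]

theorem toCoord_vert (p : Heis n) (c : ℝ) : toCoord p (0, c) = (0, c) := by
  simp [toCoord_apply]

/-- The bundle map `toCoord` as a continuous affine function of the base point. -/
theorem toCoord_eq (p : Heis n) (v : FrameVec n) :
    toCoord p v = v + ((0 : Hor n), 1 / 2 * sympL p.1 v.1) := by
  simp [toCoord_apply, Prod.ext_iff]

theorem toFrame_eq (p : Heis n) (v : Heis n) :
    toFrame p v = v - ((0 : Hor n), 1 / 2 * sympL p.1 v.1) := by
  simp [toFrame_apply, Prod.ext_iff]

/-- `toCoord` as a bundled smooth map into operators. -/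
theorem contDiff_toCoord {k : WithTop ℕ∞} :
    ContDiff ℝ k (toCoord : Heis n → FrameVec n →L[ℝ] Heis n) := by
  refine contDiff_clm_apply_iff.2 fun v => ?_
  simp only [toCoord_eq]
  fun_prop

theorem contDiff_toFrame {k : WithTop ℕ∞} :
    ContDiff ℝ k (toFrame : Heis n → Heis n →L[ℝ] FrameVec n) := by
  refine contDiff_clm_apply_iff.2 fun v => ?_
  simp only [toFrame_eq]
  fun_prop

theorem metric_comm (v w : FrameVec n) : metric v w = metric w v := by
  simp [metric, real_inner_comm, mul_comm]

theorem metric_self_nonneg (v : FrameVec n) : 0 ≤ metric v v :=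
  add_nonneg real_inner_self_nonneg (mul_self_nonneg _)

theorem metric_self_eq_zero {v : FrameVec n} : metric v v = 0 ↔ v = 0 := by
  constructor
  · intro h
    have h1 : inner ℝ v.1 v.1 = (0 : ℝ) := by
      have := mul_self_nonneg v.2
      have := real_inner_self_nonneg (x := v.1)
      simp only [metric] at h; linarith
    have h2 : v.2 * v.2 = 0 := by
      simp only [metric] at h; linarith
    exact Prod.ext (inner_self_eq_zero.1 h1) (mul_self_eq_zero.1 h2)
  · rintro rfl; simp [metric]

theorem metric_add_left (u v w : FrameVec n) : metric (u + v) w = metric u w + metric v w := by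
  simp [metric, inner_add_left]; ring

theorem metric_smul_left (c : ℝ) (v w : FrameVec n) : metric (c • v) w = c * metric v w := by
  simp [metric, inner_smul_left]; ring

theorem metric_add_right (u v w : FrameVec n) : metric w (u + v) = metric w u + metric w v := by
  rw [metric_comm, metric_add_left, metric_comm u, metric_comm v]

theorem metric_smul_right (c : ℝ) (v w : FrameVec n) : metric w (c • v) = c * metric w v := by
  rw [metric_comm, metric_smul_left, metric_comm]

/-- The metric as a continuous bilinear map. -/
def metricL : FrameVec n →L[ℝ] FrameVec n →L[ℝ] ℝ :=
  (ContinuousLinearMap.compL ℝ (FrameVec n) (Hor n) ℝ).flip (fstH) ∘L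
      (innerSL ℝ) ∘L (fstH) +
    (ContinuousLinearMap.compL ℝ (FrameVec n) ℝ ℝ).flip (sndH) ∘L
      (ContinuousLinearMap.mul ℝ ℝ) ∘L (sndH)

@[simp] theorem metricL_apply (v w : FrameVec n) : metricL v w = metric v w := by
  simp [metricL, metric]; rfl

theorem metric_sub_left (u v w : FrameVec n) : metric (u - v) w = metric u w - metric v w := by
  simp [← metricL_apply]

theorem rnorm_pos {v : FrameVec n} (hv : v ≠ 0) : 0 < rnorm v :=
  Real.sqrt_pos.2 ((metric_self_nonneg v).lt_of_ne fun h => hv (metric_self_eq_zero.1 h.symm))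

theorem rnorm_sq (v : FrameVec n) : rnorm v ^ 2 = metric v v :=
  Real.sq_sqrt (metric_self_nonneg v)

theorem rnorm_smul {c : ℝ} (hc : 0 ≤ c) (v : FrameVec n) : rnorm (c • v) = c * rnorm v := by
  rw [rnorm, metric_smul_left, metric_smul_right, ← mul_assoc, Real.sqrt_mul (mul_self_nonneg c),
    Real.sqrt_mul_self hc, rnorm]

theorem metric_normalize {v : FrameVec n} (hv : v ≠ 0) :
    metric ((rnorm v)⁻¹ • v) ((rnorm v)⁻¹ • v) = 1 := by
  have := rnorm_pos hv
  rw [metric_smul_left, metric_smul_right, ← rnorm_sq]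
  field_simp

/-! ## Derivatives along the frame -/

/-- The differential of `f` at `p` on vectors given in the left-invariant frame. -/
def fd {F : Type*} [NormedAddCommGroup F] [NormedSpace ℝ F] (f : Heis n → F) (p : Heis n) :
    FrameVec n →L[ℝ] F :=
  fderiv ℝ f p ∘L toCoord p

section fd

variable {F : Type*} [NormedAddCommGroup F] [NormedSpace ℝ F]

theorem fd_apply (f : Heis n → F) (p : Heis n) (v : FrameVec n) :
    fd f p v = fderiv ℝ f p (toCoord p v) := rfl

theorem fderiv_eq_fd (f : Heis n → F) (p : Heis n) (v : Heis n) :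
    fderiv ℝ f p v = fd f p (toFrame p v) := by
  rw [fd_apply, toCoord_toFrame]

theorem inner_rgrad_fst (f : Heis n → ℝ) (p : Heis n) (h : Hor n) :
    inner ℝ (rgrad f p).1 h = fd f p (h, 0) := by
  simp [rgrad, fd_apply, InnerProductSpace.toDual_symm_apply]

theorem rgrad_snd (f : Heis n → ℝ) (p : Heis n) : (rgrad f p).2 = fd f p (0, 1) := rfl

theorem fd_eq_metric (f : Heis n → ℝ) (p : Heis n) (v : FrameVec n) :
    fd f p v = metric (rgrad f p) v := by
  have : v = (v.1, 0) + v.2 • (0, 1) := by simp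
  conv_lhs => rw [this]
  rw [map_add, map_smul, metric, inner_rgrad_fst, rgrad_snd, smul_eq_mul, mul_comm]

theorem rgrad_eq_zero_iff {f : Heis n → ℝ} {p : Heis n} : rgrad f p = 0 ↔ fderiv ℝ f p = 0 := by
  constructor
  · intro h
    ext v <;> simp [fderiv_eq_fd, fd_eq_metric, h, metric]
  · intro h
    apply metric_self_eq_zero.1
    rw [← fd_eq_metric, fd_apply, h]; simp

theorem rgrad_eq_of_metric {f : Heis n → ℝ} {p : Heis n} {w : FrameVec n}
    (h : ∀ v, fd f p v = metric w v) : rgrad f p = w := by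
  rw [← sub_eq_zero]
  apply metric_self_eq_zero.1
  rw [metric_sub_left, ← fd_eq_metric, h, sub_self]

theorem contDiffOn_fd {f : Heis n → F} {U : Set (Heis n)} (hU : IsOpen U) {k l : WithTop ℕ∞}
    (hf : ContDiffOn ℝ l f U) (hkl : k + 1 ≤ l) : ContDiffOn ℝ k (fd f) U :=
  (hf.fderiv_of_isOpen hU hkl).clm_comp contDiff_toCoord.contDiffOn

theorem contDiffOn_rgrad {f : Heis n → ℝ} {U : Set (Heis n)} (hU : IsOpen U) {k l : WithTop ℕ∞}
    (hf : ContDiffOn ℝ l f U) (hkl : k + 1 ≤ l) : ContDiffOn ℝ k (rgrad f) U := by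
  have h := contDiffOn_fd hU hf hkl
  refine ContDiffOn.prodMk ?_ (h.clm_apply contDiffOn_const)
  refine (InnerProductSpace.toDual ℝ (Hor n)).symm.contDiff.comp_contDiffOn ?_
  exact h.clm_comp contDiffOn_const

/-- Second derivatives along the frame commute up to the structure constants. -/
theorem fd_fd_comm {f : Heis n → F} {p : Heis n} (hf : ContDiffAt ℝ 2 f p) (v w : FrameVec n) :
    fd (fun p' => fd f p' w) p v - fd (fun p' => fd f p' v) p w =
      symp v.1 w.1 • fd f p (0, 1) := by
  have hd : DifferentiableAt ℝ (fderiv ℝ f) p :=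
    (hf.fderiv_right (m := 1) (by norm_num)).differentiableAt (by norm_num)
  have key : ∀ v w : FrameVec n, fd (fun p' => fd f p' w) p v =
      fderiv ℝ (fderiv ℝ f) p (toCoord p v) (toCoord p w) +
        (1 / 2 * symp v.1 w.1) • fd f p (0, 1) := by
    intro v w
    have h1 : HasFDerivAt (fun p' : Heis n => toCoord p' w)
        (inrH ∘L ((1 / 2 : ℝ) • (sympL.flip w.1)) ∘L
          fstH) p := by
      have h2 : (fun p' : Heis n => toCoord p' w) = fun p' => w +
          (inrH ∘L ((1 / 2 : ℝ) • (sympL.flip w.1)) ∘L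
          fstH) p' := by
        ext1 p'; rw [toCoord_eq]; simp
      rw [h2]
      exact (ContinuousLinearMap.hasFDerivAt _).const_add w
    have h3 := hd.hasFDerivAt.clm_apply h1
    rw [fd_apply]
    have h4 : (fun p' => fd f p' w) = fun y => (fderiv ℝ f y) (toCoord y w) := rfl
    rw [h4, h3.fderiv]
    simp only [add_apply, ContinuousLinearMap.flip_apply,
      ContinuousLinearMap.comp_apply]
    rw [add_comm]
    congr 1
    have e : (inrH ∘L ((1 / 2 : ℝ) • (sympL.flip w.1)) ∘L
        fstH) (toCoord p v) =
        (1 / 2 * symp v.1 w.1) • ((0 : Hor n), (1 : ℝ)) := by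
      ext <;> simp
    rw [fd_apply, toCoord_vert]
    exact (congrArg (fderiv ℝ f p) e).trans (map_smul _ _ _)
  have hs := (hf.isSymmSndFDerivAt (by simp)).eq (toCoord p v) (toCoord p w)
  rw [key, key, hs, symp_swap w.1 v.1, add_sub_add_left_eq_sub, ← sub_smul]
  congr 1; ring

end fd

/-! ## Divergence -/

instance : (volume : Measure (Heis n)).IsAddHaarMeasure :=
  inferInstanceAs ((volume : Measure (Hor n)).prod (volume : Measure ℝ)).IsAddHaarMeasure

/-- The divergence, with respect to the left-invariant volume, of a vector field given in the
left-invariant frame. -/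
def frameDiv (X : Heis n → FrameVec n) (p : Heis n) : ℝ :=
  LinearMap.trace ℝ (FrameVec n) (fd X p : FrameVec n →ₗ[ℝ] FrameVec n)

theorem integral_trace_fderiv_eq_zero {E : Type*} [NormedAddCommGroup E] [NormedSpace ℝ E]
    [FiniteDimensional ℝ E] [MeasurableSpace E] [BorelSpace E] (μ : Measure E)
    [μ.IsAddHaarMeasure] {Y : E → E} (hY : ContDiff ℝ 1 Y) (hc : HasCompactSupport Y) :
    ∫ p, LinearMap.trace ℝ E (fderiv ℝ Y p : E →ₗ[ℝ] E) ∂μ = 0 := by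
  let b := Module.finBasis ℝ E
  have h1 : ∀ p, LinearMap.trace ℝ E (fderiv ℝ Y p : E →ₗ[ℝ] E) =
      ∑ i, (b.coord i).toContinuousLinearMap (fderiv ℝ Y p (b i)) := by
    intro p
    rw [LinearMap.trace_eq_matrix_trace ℝ b, Matrix.trace]
    simp [LinearMap.toMatrix_apply]
  simp only [h1]
  have hcont : ∀ i, Continuous fun p => (b.coord i).toContinuousLinearMap (fderiv ℝ Y p (b i)) :=
    fun i => (b.coord i).toContinuousLinearMap.continuous.comp
      ((hY.continuous_fderiv (by norm_num)).clm_apply continuous_const)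
  have hcs : ∀ i, HasCompactSupport
      fun p => (b.coord i).toContinuousLinearMap (fderiv ℝ Y p (b i)) := by
    intro i
    have := hc.fderiv_apply (𝕜 := ℝ) (b i)
    exact this.comp_left (map_zero _)
  rw [integral_finsetSum _ fun i _ => (hcont i).integrable_of_hasCompactSupport (hcs i)]
  refine Finset.sum_eq_zero fun i _ => ?_
  set c := (b.coord i).toContinuousLinearMap
  have hg : ContDiff ℝ 1 fun p => c (Y p) := c.contDiff.comp hY
  have hgc : HasCompactSupport fun p => c (Y p) := hc.comp_left (map_zero _)
  have h2 : ∀ p, c (fderiv ℝ Y p (b i)) = 1 * fderiv ℝ (fun p => c (Y p)) p (b i) := by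
    intro p
    have h3 := (c.hasFDerivAt.comp p ((hY.differentiable (by norm_num)) p).hasFDerivAt).fderiv
    have h4 : fderiv ℝ (fun p => c (Y p)) p = c ∘L fderiv ℝ Y p := h3
    rw [h4]; simp
  simp only [h2]
  rw [integral_mul_fderiv_eq_neg_fderiv_mul_of_integrable]
  · simp
  · simp
  · have := (hcont i).integrable_of_hasCompactSupport (μ := μ) (hcs i)
    refine this.congr (Eventually.of_forall fun p => ?_)
    exact h2 p
  · simpa using hg.continuous.integrable_of_hasCompactSupport hgc
  · intro x _; fun_prop
  · intro x _; exact hg.differentiable (by norm_num) x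

theorem trace_smulRight {E : Type*} [AddCommGroup E] [Module ℝ E] [Module.Finite ℝ E]
    (l : E →ₗ[ℝ] ℝ) (x : E) : LinearMap.trace ℝ E (l.smulRight x) = l x := by
  simp

theorem trace_fderiv_toCoord {X : Heis n → FrameVec n} {p : Heis n}
    (hX : DifferentiableAt ℝ X p) :
    LinearMap.trace ℝ (Heis n)
      (fderiv ℝ (fun p => toCoord p (X p)) p : Heis n →ₗ[ℝ] Heis n) = frameDiv X p := by
  have h0 : (fun p : Heis n => toCoord p (X p)) = fun p => X p +
      (inrH) ((1 / 2 : ℝ) * sympL p.1 (X p).1) := by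
    ext1 p; rw [toCoord_eq]; simp
  have h1 : HasFDerivAt (fun p : Heis n => sympL p.1 (X p).1)
      ((sympL p.1) ∘L (fstH ∘L fderiv ℝ X p) +
        (sympL.flip (X p).1) ∘L (fstH)) p := by
    have ha : HasFDerivAt (fun p : Heis n => sympL p.1) (sympL ∘L (fstH)) p :=
      sympL.hasFDerivAt.comp p hasFDerivAt_fst
    have hb : HasFDerivAt (fun p : Heis n => (X p).1)
      (fstH ∘L fderiv ℝ X p) p :=
      (fstH).hasFDerivAt.comp p hX.hasFDerivAt
    have := ha.clm_apply hb
    exact this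
  have h2 := hX.hasFDerivAt.add
    ((inrH).hasFDerivAt.comp p (h1.const_mul (1 / 2 : ℝ)))
  have h3 : fderiv ℝ (fun p => toCoord p (X p)) p = toCoord p ∘L fderiv ℝ X p +
      (((1 / 2 : ℝ) • (sympL.flip (X p).1)) ∘L (fstH)).smulRight
        ((0 : Hor n), (1 : ℝ)) := by
    rw [h0]
    refine h2.fderiv.trans ?_
    ext v <;> simp [toCoord_eq]
    all_goals ring
  rw [h3, frameDiv]
  simp only [ContinuousLinearMap.toLinearMap_add, map_add]
  have h4 : LinearMap.trace ℝ (Heis n) (((((1 / 2 : ℝ) • (sympL.flip (X p).1)) ∘L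
      (fstH)).smulRight ((0 : Hor n), (1 : ℝ)) :
      Heis n →L[ℝ] Heis n) : Heis n →ₗ[ℝ] Heis n) = 0 := by
    have := trace_smulRight (((((1 / 2 : ℝ) • (sympL.flip (X p).1)) ∘L
      (fstH)) : Heis n →L[ℝ] ℝ) : Heis n →ₗ[ℝ] ℝ) ((0 : Hor n), (1 : ℝ))
    refine Eq.trans ?_ (this.trans ?_)
    · rfl
    · simp
  rw [h4, add_zero]
  have h5 := LinearMap.trace_comp_comm' (R := ℝ) (toCoord p : FrameVec n →ₗ[ℝ] Heis n)
    (fderiv ℝ X p : Heis n →ₗ[ℝ] FrameVec n)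
  exact h5.symm

theorem integral_frameDiv_eq_zero {X : Heis n → FrameVec n} (hX : ContDiff ℝ 1 X)
    (hc : HasCompactSupport X) : ∫ p, frameDiv X p = 0 := by
  have h := integral_trace_fderiv_eq_zero (volume : Measure (Heis n))
    (Y := fun p => toCoord p (X p)) (contDiff_toCoord.clm_apply hX) (by
      refine hc.mono' ?_
      intro p hp
      apply subset_tsupport
      intro h0
      apply hp
      simp [h0])
  rw [← h]
  exact integral_congr_ae (Eventually.of_forall fun p =>
    (trace_fderiv_toCoord ((hX.differentiable (by norm_num)) p)).symm)

/-! ## Charts that straighten a level set -/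

/-- A `C²` chart of an open subset of `ℍⁿ` in which `f` is the last coordinate. -/
structure LevelChart (n : ℕ) (f : Heis n → ℝ) where
  toPH : OpenPartialHomeomorph (Heis n) (Heis n)
  smooth : ContDiffOn ℝ 2 toPH toPH.source
  smooth_symm : ContDiffOn ℝ 2 toPH.symm toPH.target
  snd_eq : ∀ q ∈ toPH.source, (toPH q).2 = f q

theorem exists_equiv_snd_eq (l : Heis n →L[ℝ] ℝ) (hl : l ≠ 0) :
    ∃ A : Heis n ≃L[ℝ] Heis n, ∀ q, (A q).2 = l q := by
  obtain ⟨v0, hv0⟩ : ∃ v, l v ≠ 0 := by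
    by_contra! h
    exact hl (by ext <;> simp [h])
  obtain ⟨v, hv⟩ : ∃ v, l v = 1 := ⟨(l v0)⁻¹ • v0, by simp [hv0]⟩
  have hr : Module.finrank ℝ (LinearMap.ker (l : Heis n →ₗ[ℝ] ℝ)) = Module.finrank ℝ (Hor n) := by
    have h1 := LinearMap.finrank_range_add_finrank_ker (l : Heis n →ₗ[ℝ] ℝ)
    have h2 : LinearMap.range (l : Heis n →ₗ[ℝ] ℝ) = ⊤ := by
      rw [LinearMap.range_eq_top]
      intro c
      exact ⟨c • v, by simp [hv]⟩
    rw [h2, finrank_top, Module.finrank_prod] at h1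
    simp only [Module.finrank_self] at h1
    omega
  let e := LinearEquiv.ofFinrankEq _ _ hr
  have hmem : ∀ q, q - l q • v ∈ LinearMap.ker (l : Heis n →ₗ[ℝ] ℝ) := fun q => by simp [hv]
  let A : Heis n ≃ₗ[ℝ] Heis n :=
    { toFun := fun q => (e ⟨q - l q • v, hmem q⟩, l q)
      map_add' := fun x y => by
        refine Prod.ext ?_ (by simp)
        simp only [Prod.fst_add, ← map_add]
        congr 1
        ext1
        simp only [map_add, add_smul, Submodule.coe_add]
        abel
      map_smul' := fun c x => by
        refine Prod.ext ?_ (by simp)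
        simp only [Prod.smul_fst, RingHom.id_apply, ← map_smul]
        congr 1
        ext1
        simp [smul_sub, smul_smul]
      invFun := fun y => (e.symm y.1 : Heis n) + y.2 • v
      left_inv := fun q => by simp
      right_inv := fun y => by
        have h0 : l (e.symm y.1 : Heis n) = 0 := (e.symm y.1).2
        refine Prod.ext ?_ (by simp [h0, hv])
        simp only [map_add, h0, map_smul, hv, smul_eq_mul, mul_one, zero_add,
          add_sub_cancel_right, Subtype.coe_eta, LinearEquiv.apply_symm_apply] }
  exact ⟨A.toContinuousLinearEquiv, fun q => rfl⟩

theorem exists_levelChart {f : Heis n → ℝ} {U : Set (Heis n)} (hU : IsOpen U) {p : Heis n}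
    (hp : p ∈ U) (hf : ContDiffOn ℝ 2 f U) (hd : fderiv ℝ f p ≠ 0) :
    ∃ c : LevelChart n f, p ∈ c.toPH.source ∧ c.toPH.source ⊆ U := by
  obtain ⟨A, hA⟩ := exists_equiv_snd_eq (fderiv ℝ f p) hd
  let F : Heis n → Heis n := fun q => ((A q).1, f q)
  have hF : ContDiffOn ℝ 2 F U :=
    (contDiff_fst.comp A.contDiff).contDiffOn.prodMk hf
  have hFp : ContDiffAt ℝ 2 F p := hF.contDiffAt (hU.mem_nhds hp)
  have hd' : HasFDerivAt F (A : Heis n →L[ℝ] Heis n) p := by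
    have h1 : HasFDerivAt f (fderiv ℝ f p) p :=
      ((hf.contDiffAt (hU.mem_nhds hp)).differentiableAt (by norm_num)).hasFDerivAt
    have h2 : HasFDerivAt (fun q => (A q).1) (fstH ∘L
      (A : Heis n →L[ℝ] Heis n)) p := by
      exact (fstH ∘L (A : Heis n →L[ℝ] Heis n)).hasFDerivAt
    have h3 := h2.prodMk h1
    refine h3.congr_fderiv ?_
    refine ContinuousLinearMap.ext fun v => ?_
    exact Prod.ext rfl (hA v).symm
  let Φ := hFp.toOpenPartialHomeomorph F hd' (by norm_num)
  have hΦ : (Φ : Heis n → Heis n) = F := rfl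
  have hpΦ : p ∈ Φ.source := hFp.mem_toOpenPartialHomeomorph_source hd' (by norm_num)
  have hloc : ContDiffAt ℝ 2 Φ.symm (Φ p) :=
    hFp.to_localInverse hd' (by norm_num)
  obtain ⟨W, hW, hWo, hpW⟩ := _root_.eventually_nhds_iff.1 (hloc.eventually (by norm_num))
  let Φ1 := Φ.restrOpen U hU
  let Φ2 := (Φ1.symm.restrOpen W hWo).symm
  have hs2 : Φ2.source ⊆ U := by
    intro q hq
    simp only [Φ2, Φ1, OpenPartialHomeomorph.symm_source, OpenPartialHomeomorph.restrOpen] at hq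
    simp at hq
    tauto
  have ht2 : Φ2.target ⊆ W := by
    intro q hq
    simp [Φ2] at hq
    tauto
  refine ⟨⟨Φ2, ?_, ?_, fun q _ => rfl⟩, ?_, hs2⟩
  · exact hF.mono hs2
  · intro y hy
    exact (hW y (ht2 hy)).contDiffWithinAt
  · have hy : Φ p ∈ (Φ1.symm.restrOpen W hWo).source := by
      rw [OpenPartialHomeomorph.restrOpen_source]
      refine ⟨?_, hpW⟩
      rw [OpenPartialHomeomorph.symm_source]
      refine Φ1.map_source ?_
      rw [OpenPartialHomeomorph.restrOpen_source]
      exact ⟨hpΦ, hp⟩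
    have := (Φ1.symm.restrOpen W hWo).map_source hy
    have h3 : (Φ1.symm.restrOpen W hWo) (Φ p) = p := Φ.left_inv hpΦ
    rw [h3] at this
    exact this

/-! ## The volume form and determinants -/

theorem det_toFrame (p : Heis n) : LinearMap.det (toFrame p : Heis n →ₗ[ℝ] FrameVec n) = 1 := by
  have h : (toFrame p : Heis n →ₗ[ℝ] FrameVec n) = LinearMap.transvection
      ((-(1 / 2 : ℝ)) • ((symp p.1 : Hor n →ₗ[ℝ] ℝ) ∘ₗ LinearMap.fst ℝ (Hor n) ℝ)) ((0 : Hor n), (1 : ℝ)) := by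
    ext v <;> simp [toFrame_apply, LinearMap.transvection]
  rw [h, LinearMap.transvection.det]
  simp

theorem volForm_comp {m : ℕ} (h : m = 2 * n + 1) (T : FrameVec n →ₗ[ℝ] FrameVec n)
    (w : Fin m → FrameVec n) :
    volForm n m h (fun k => T (w k)) = LinearMap.det T * volForm n m h w :=
  (frameBasis n m h).det_comp T w

/-- The coordinates of the horizontal space used for parameter domains. -/
def horCoord (n : ℕ) : (Fin (2 * n) → ℝ) ≃L[ℝ] Hor n :=
  (((LinearEquiv.funCongrLeft ℝ ℝ (finProdFinEquiv.trans (finCongr (by omega)) :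
    Fin n × Fin 2 ≃ Fin (2 * n)))).trans
    (WithLp.linearEquiv 2 ℝ (Fin n × Fin 2 → ℝ)).symm).toContinuousLinearEquiv

/-- The standard frame with `T` put first. -/
def stdTuple (n : ℕ) : Fin (2 * n + 1) → FrameVec n :=
  Fin.cons (0, 1) fun j => (horCoord n (Pi.single j 1), 0)

/-- The absolute value of the volume form on the standard frame. -/
def frameConst (n : ℕ) : ℝ := |volForm n (2 * n + 1) rfl (stdTuple n)|

theorem frameConst_pos (n : ℕ) : 0 < frameConst n := by
  rw [frameConst, abs_pos]
  have hli : LinearIndependent ℝ (stdTuple n) := by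
    rw [stdTuple, linearIndependent_finCons]
    constructor
    · have h1 := ((Pi.basisFun ℝ (Fin (2 * n))).map (horCoord n).toLinearEquiv).linearIndependent
      have h2 : ⇑((Pi.basisFun ℝ (Fin (2 * n))).map (horCoord n).toLinearEquiv) =
          fun j => horCoord n (Pi.single j 1) := by
        ext1 j; simp
      rw [h2] at h1
      exact h1.map' (LinearMap.inl ℝ (Hor n) ℝ) (LinearMap.ker_eq_bot.2 LinearMap.inl_injective)
    · intro hmem
      have : ∀ x ∈ Submodule.span ℝ (range fun j => ((horCoord n (Pi.single j 1), 0) : FrameVec n)),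
          x.2 = 0 := by
        intro x hx
        induction hx using Submodule.span_induction with
        | mem x h => obtain ⟨j, rfl⟩ := h; rfl
        | zero => rfl
        | add x y _ _ h1 h2 => simp [h1, h2]
        | smul c x _ h => simp [h]
      simpa using this _ hmem
  have hcard : Fintype.card (Fin (2 * n + 1)) = Module.finrank ℝ (FrameVec n) := by
    simp [Module.finrank_prod]; ring
  let b := basisOfLinearIndependentOfCardEqFinrank hli hcard
  have hb : ⇑b = stdTuple n := coe_basisOfLinearIndependentOfCardEqFinrank hli hcard
  have := ((frameBasis n (2 * n + 1) rfl).isUnit_det b).ne_zero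
  rw [hb] at this
  exact this

/-- The alternating form on the parameter space obtained by inserting `v` in the volume form and
pulling back. -/
def pullForm (v : FrameVec n) (L : (Fin (2 * n) → ℝ) →ₗ[ℝ] FrameVec n) :
    (Fin (2 * n) → ℝ) [⋀^Fin (2 * n)]→ₗ[ℝ] ℝ :=
  ((volForm n (2 * n + 1) rfl).toAlternatingMap.curryLeft v).compLinearMap L

theorem pullForm_apply (v : FrameVec n) (L : (Fin (2 * n) → ℝ) →ₗ[ℝ] FrameVec n)
    (w : Fin (2 * n) → Fin (2 * n) → ℝ) :
    pullForm v L w = volForm n (2 * n + 1) rfl (Fin.cons v fun j => L (w j)) := rfl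

theorem pullForm_comp (v : FrameVec n) (L : (Fin (2 * n) → ℝ) →ₗ[ℝ] FrameVec n)
    (T : (Fin (2 * n) → ℝ) →ₗ[ℝ] (Fin (2 * n) → ℝ)) :
    volForm n (2 * n + 1) rfl (Fin.cons v fun j => L (T (Pi.single j 1))) =
      LinearMap.det T * volForm n (2 * n + 1) rfl (Fin.cons v fun j => L (Pi.single j 1)) := by
  have h1 := (pullForm v L).eq_smul_basis_det (Pi.basisFun ℝ (Fin (2 * n)))
  have h2 : ∀ w, pullForm v L w = pullForm v L (Pi.basisFun ℝ (Fin (2 * n))) *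
      (Pi.basisFun ℝ (Fin (2 * n))).det w := fun w => by
    conv_lhs => rw [h1]
    rfl
  have h3 := h2 fun j => T (Pi.single j 1)
  have h4 := (Pi.basisFun ℝ (Fin (2 * n))).det_comp T fun j => Pi.single j 1
  have h5 : (Pi.basisFun ℝ (Fin (2 * n))).det (fun j => (Pi.single j 1 : Fin (2 * n) → ℝ)) = 1 := by
    have e : (fun j => (Pi.single j 1 : Fin (2 * n) → ℝ)) = Pi.basisFun ℝ (Fin (2 * n)) := by
      ext1 j; simp
    rw [e, Module.Basis.det_self]
  rw [h5, mul_one] at h4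
  rw [pullForm_apply, pullForm_apply] at h3
  have e : (Pi.basisFun ℝ (Fin (2 * n)) : Fin (2 * n) → Fin (2 * n) → ℝ) =
      fun j => Pi.single j 1 := by
    ext1 j; simp
  rw [h3, mul_comm, e]
  congr 1

/-- Inserting `v` into the volume form together with a frame of a hyperplane. -/
theorem volForm_cons_hyperplane (T : FrameVec n →ₗ[ℝ] FrameVec n) (a : Hor n) (s : ℝ) :
    volForm n (2 * n + 1) rfl
      (Fin.cons (T (a, s)) fun j => T (horCoord n (Pi.single j 1), 0)) =
      s * LinearMap.det T * volForm n (2 * n + 1) rfl (stdTuple n) := by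
  have h0 : (Fin.cons (T (a, s)) fun j => T (horCoord n (Pi.single j 1), 0)) =
      fun k => T ((Fin.cons (a, s) fun j => (horCoord n (Pi.single j 1), 0) :
        Fin (2 * n + 1) → FrameVec n) k) := by
    ext1 k
    refine Fin.cases ?_ (fun j => ?_) k <;> simp
  rw [h0, volForm_comp]
  have h1 : volForm n (2 * n + 1) rfl (Fin.cons (a, s) fun j => (horCoord n (Pi.single j 1), 0)) =
      s * volForm n (2 * n + 1) rfl (stdTuple n) := by
    let g : FrameVec n →ₗ[ℝ] ℝ :=
      { toFun := fun v => (volForm n (2 * n + 1) rfl).toAlternatingMap.curryLeft v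
          (fun j => (horCoord n (Pi.single j 1), 0))
        map_add' := fun x y => by rw [map_add]; rfl
        map_smul' := fun c x => by rw [map_smul]; rfl }
    have e1 : ∀ v, volForm n (2 * n + 1) rfl (Fin.cons v fun j => (horCoord n (Pi.single j 1), 0)) =
      g v := fun v => rfl
    have e2 : ((a, s) : FrameVec n) = s • ((0 : Hor n), (1 : ℝ)) +
        ∑ j, (horCoord n).symm a j • ((horCoord n (Pi.single j 1), (0 : ℝ)) : FrameVec n) := by
      have : a = ∑ j, (horCoord n).symm a j • horCoord n (Pi.single j 1) := by
        conv_lhs => rw [← (horCoord n).apply_symm_apply a, pi_eq_sum_univ' ((horCoord n).symm a)]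
        simp [map_sum, map_smul]
      refine Prod.ext ?_ ?_
      · simp only [Prod.fst_add, Prod.smul_fst, smul_zero, zero_add, Prod.fst_sum]
        exact this
      · simp [Prod.snd_sum]
    rw [e1, e2, map_add, map_smul, map_sum]
    have e3 : ∀ j, g ((horCoord n (Pi.single j 1), (0 : ℝ)) : FrameVec n) = 0 := by
      intro j
      rw [← e1]
      refine (volForm n (2 * n + 1) rfl).toAlternatingMap.map_eq_zero_of_eq _ (i := 0) (j := j.succ)
        ?_ (Fin.succ_ne_zero j).symm
      simp
    simp only [map_smul, e3, smul_eq_mul, mul_zero, Finset.sum_const_zero,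
      add_zero]
    rfl
  rw [h1]; ring

/-! ## Local parametrisations and the measures they induce -/

namespace LevelChart

variable {f : Heis n → ℝ} (c : LevelChart n f)

theorem differentiableAt_symm {y : Heis n} (hy : y ∈ c.toPH.target) :
    DifferentiableAt ℝ c.toPH.symm y :=
  (c.smooth_symm.contDiffAt (c.toPH.open_target.mem_nhds hy)).differentiableAt (by norm_num)

theorem differentiableAt {q : Heis n} (hq : q ∈ c.toPH.source) :
    DifferentiableAt ℝ c.toPH q :=
  (c.smooth.contDiffAt (c.toPH.open_source.mem_nhds hq)).differentiableAt (by norm_num)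

theorem snd_symm {y : Heis n} (hy : y ∈ c.toPH.target) : f (c.toPH.symm y) = y.2 := by
  rw [← c.snd_eq _ (c.toPH.map_target hy), c.toPH.right_inv hy]

theorem fderiv_comp_fderiv_symm {y : Heis n} (hy : y ∈ c.toPH.target) (v : Heis n) :
    fderiv ℝ c.toPH (c.toPH.symm y) (fderiv ℝ c.toPH.symm y v) = v := by
  have h1 := (c.differentiableAt (c.toPH.map_target hy)).hasFDerivAt.comp y
    (c.differentiableAt_symm hy).hasFDerivAt
  have h2 : (c.toPH ∘ c.toPH.symm) =ᶠ[nhds y] id := by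
    filter_upwards [c.toPH.open_target.mem_nhds hy] with z hz
    exact c.toPH.right_inv hz
  have h3 := (h1.congr_of_eventuallyEq h2.symm).unique (hasFDerivAt_id y)
  exact DFunLike.congr_fun h3 v

theorem fderiv_symm_comp_fderiv {q : Heis n} (hq : q ∈ c.toPH.source) (v : Heis n) :
    fderiv ℝ c.toPH.symm (c.toPH q) (fderiv ℝ c.toPH q v) = v := by
  have h1 := (c.differentiableAt_symm (c.toPH.map_source hq)).hasFDerivAt.comp q
    (c.differentiableAt hq).hasFDerivAt
  have h2 : (c.toPH.symm ∘ c.toPH) =ᶠ[nhds q] id := by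
    filter_upwards [c.toPH.open_source.mem_nhds hq] with z hz
    exact c.toPH.left_inv hz
  have h3 := (h1.congr_of_eventuallyEq h2.symm).unique (hasFDerivAt_id q)
  exact DFunLike.congr_fun h3 v

theorem fderiv_snd {q : Heis n} (hq : q ∈ c.toPH.source) (v : Heis n) :
    (fderiv ℝ c.toPH q v).2 = fderiv ℝ f q v := by
  have h1 : HasFDerivAt (fun x => (c.toPH x).2)
      (sndH ∘L fderiv ℝ c.toPH q) q :=
    (sndH).hasFDerivAt.comp q (c.differentiableAt hq).hasFDerivAt
  have h2 : f =ᶠ[nhds q] fun x => (c.toPH x).2 := by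
    filter_upwards [c.toPH.open_source.mem_nhds hq] with z hz
    exact (c.snd_eq z hz).symm
  rw [(h1.congr_of_eventuallyEq h2).fderiv]
  rfl

/-- The affine embedding of the parameter space as the hyperplane `s = 0` of the chart. -/
def slice (n : ℕ) : (Fin (2 * n) → ℝ) →L[ℝ] Heis n :=
  (inlH) ∘L (horCoord n : (Fin (2 * n) → ℝ) →L[ℝ] Hor n)

@[simp] theorem slice_apply (u : Fin (2 * n) → ℝ) : slice n u = (horCoord n u, 0) := rfl

theorem hasFDerivAt_param {u : Fin (2 * n) → ℝ} (hu : slice n u ∈ c.toPH.target) :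
    HasFDerivAt (fun u => c.toPH.symm (slice n u))
      (fderiv ℝ c.toPH.symm (slice n u) ∘L slice n) u :=
  (c.differentiableAt_symm hu).hasFDerivAt.comp u (slice n).hasFDerivAt

/-- The parametrisation of `S` by the hyperplane `s = 0` of a chart. -/
def param {S : Set (Heis n)} (hS : S ∩ c.toPH.source = {q ∈ c.toPH.source | f q = 0}) :
    LocalParam n S where
  dom := slice n ⁻¹' c.toPH.target
  map := fun u => c.toPH.symm (slice n u)
  isOpen_dom := c.toPH.open_target.preimage (slice n).continuous
  contDiffOn := c.smooth_symm.comp (slice n).contDiff.contDiffOn fun _ h => h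
  injOn := fun u hu v hv huv => by
    have := c.toPH.symm.injOn (by simpa using hu) (by simpa using hv) huv
    simpa using this
  immersion := fun u hu v w hvw => by
    rw [(c.hasFDerivAt_param hu).fderiv] at hvw
    have := congrArg (fderiv ℝ c.toPH (c.toPH.symm (slice n u))) hvw
    simp only [ContinuousLinearMap.comp_apply] at this
    rw [c.fderiv_comp_fderiv_symm hu, c.fderiv_comp_fderiv_symm hu] at this
    simpa using this
  mapsTo := fun u hu => by
    have h : c.toPH.symm (slice n u) ∈ {q ∈ c.toPH.source | f q = 0} :=
      ⟨c.toPH.map_target hu, by rw [c.snd_symm hu]; rfl⟩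
    rw [← hS] at h
    exact h.1

variable {S : Set (Heis n)} (hS : S ∩ c.toPH.source = {q ∈ c.toPH.source | f q = 0})

theorem image_param : (c.param hS).map '' (c.param hS).dom = S ∩ c.toPH.source := by
  rw [hS]
  ext q
  constructor
  · rintro ⟨u, hu, rfl⟩
    exact ⟨c.toPH.map_target hu, by
      change f (c.toPH.symm (slice n u)) = 0
      rw [c.snd_symm hu]; rfl⟩
  · rintro ⟨hq, hf⟩
    have h : slice n ((horCoord n).symm (c.toPH q).1) = c.toPH q := by
      rw [slice_apply, (horCoord n).apply_symm_apply, ← hf, ← c.snd_eq q hq]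
    refine ⟨(horCoord n).symm (c.toPH q).1, ?_, ?_⟩
    · change slice n _ ∈ c.toPH.target
      rw [h]; exact c.toPH.map_source hq
    · change c.toPH.symm (slice n _) = q
      rw [h]; exact c.toPH.left_inv hq

/-- The density of the parametrisation of a level set. -/
theorem density_param (V : Heis n → FrameVec n) {u : Fin (2 * n) → ℝ}
    (hu : u ∈ (c.param hS).dom) :
    (c.param hS).density V u = frameConst n * |fd f ((c.param hS).map u) (V ((c.param hS).map u))| *
      |(fderiv ℝ c.toPH.symm (slice n u)).det| := by
  set q := c.toPH.symm (slice n u) with hq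
  have hqs : q ∈ c.toPH.source := c.toPH.map_target hu
  have hmap : (c.param hS).map u = q := rfl
  rw [hmap]
  have hcq : c.toPH q = slice n u := c.toPH.right_inv hu
  set T : FrameVec n →ₗ[ℝ] FrameVec n :=
    (toFrame q : Heis n →ₗ[ℝ] FrameVec n) ∘ₗ (fderiv ℝ c.toPH.symm (slice n u) : Heis n →ₗ[ℝ] Heis n)
  set y := fderiv ℝ c.toPH q (toCoord q (V q)) with hy
  have hTV : T (y.1, y.2) = V q := by
    have h1 := c.fderiv_symm_comp_fderiv hqs (toCoord q (V q))
    rw [hcq] at h1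
    change toFrame q (fderiv ℝ c.toPH.symm (slice n u) y) = V q
    rw [hy, h1, toFrame_toCoord]
  have hTe : ∀ j, (c.param hS).frameDeriv u (Pi.single j 1) =
      T (horCoord n (Pi.single j 1), 0) := by
    intro j
    rw [LocalParam.frameDeriv]
    have h1 : fderiv ℝ (c.param hS).map u = fderiv ℝ c.toPH.symm (slice n u) ∘L slice n :=
      (c.hasFDerivAt_param hu).fderiv
    rw [h1]; rfl
  rw [LocalParam.density]
  simp only [hTe, hmap]
  rw [← hTV, volForm_cons_hyperplane, hTV]
  have hy2 : y.2 = fd f q (V q) := by rw [hy, c.fderiv_snd hqs]; rfl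
  have hdet : LinearMap.det T = (fderiv ℝ c.toPH.symm (slice n u)).det := by
    rw [LinearMap.det_comp, det_toFrame, one_mul]
  rw [hy2, hdet, abs_mul, abs_mul, frameConst]
  ring

end LevelChart

namespace LocalParam

variable {S : Set (Heis n)} (P : LocalParam n S)

theorem continuousOn : ContinuousOn P.map P.dom := P.contDiffOn.continuousOn

theorem differentiableAt {u : Fin (2 * n) → ℝ} (hu : u ∈ P.dom) : DifferentiableAt ℝ P.map u :=
  (P.contDiffOn.contDiffAt (P.isOpen_dom.mem_nhds hu)).differentiableAt (by norm_num)

theorem measure_apply (V : Heis n → FrameVec n) {s : Set (Heis n)} (hs : MeasurableSet s) :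
    P.measure V s = ∫⁻ u in P.dom ∩ P.map ⁻¹' s, ENNReal.ofReal (P.density V u) := by
  have hm : AEMeasurable P.map ((volume.restrict P.dom).withDensity
      fun u => ENNReal.ofReal (P.density V u)) :=
    (P.continuousOn.aemeasurable P.isOpen_dom.measurableSet).mono_ac
      (withDensity_absolutelyContinuous _ _)
  rw [measure, Measure.map_apply_of_aemeasurable hm hs, withDensity_apply',
    Measure.restrict_restrict' P.isOpen_dom.measurableSet, inter_comm]

theorem measurableSet_inter_preimage {s : Set (Heis n)} (hs : MeasurableSet s) :
    MeasurableSet (P.dom ∩ P.map ⁻¹' s) := by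
  classical
  have h1 := P.continuousOn.measurable_piecewise (g := fun _ => 0) continuousOn_const
    P.isOpen_dom.measurableSet
  have h2 : P.dom ∩ P.map ⁻¹' s = P.dom ∩ (P.dom.piecewise P.map fun _ => 0) ⁻¹' s := by
    ext u
    simp only [mem_inter_iff, mem_preimage, and_congr_right_iff]
    intro hu
    rw [piecewise_eq_of_mem _ _ _ hu]
  rw [h2]
  exact P.isOpen_dom.measurableSet.inter (by convert h1 hs)

theorem measurableSet_image {s : Set (Fin (2 * n) → ℝ)} (hs : MeasurableSet s) (h : s ⊆ P.dom) :
    MeasurableSet (P.map '' s) :=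
  hs.image_of_continuousOn_injOn (P.continuousOn.mono h) (P.injOn.mono h)

theorem measure_compl_image (V : Heis n → FrameVec n) : P.measure V (P.map '' P.dom)ᶜ = 0 := by
  rw [P.measure_apply V (P.measurableSet_image P.isOpen_dom.measurableSet subset_rfl).compl]
  have : P.dom ∩ P.map ⁻¹' (P.map '' P.dom)ᶜ = ∅ := by
    ext u
    simp only [mem_inter_iff, mem_preimage, mem_compl_iff, mem_image, not_exists, not_and,
      mem_empty_iff_false, iff_false]
    intro hu h
    exact h u hu rfl
  rw [this]; simp

open LevelChart in
/-- The measure of a parametrisation is determined, on the domain of a chart, by the chart. -/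
theorem measure_eq_chart {f : Heis n → ℝ} (c : LevelChart n f)
    (hS : S ∩ c.toPH.source = {q ∈ c.toPH.source | f q = 0}) (V : Heis n → FrameVec n)
    {s : Set (Heis n)} (hs : MeasurableSet s) (hsc : s ⊆ c.toPH.source) :
    P.measure V s = (c.param hS).measure V (s ∩ P.map '' P.dom) := by
  set Q := c.param hS
  have hPim : MeasurableSet (P.map '' P.dom) :=
    P.measurableSet_image P.isOpen_dom.measurableSet subset_rfl
  rw [P.measure_apply V hs, Q.measure_apply V (hs.inter hPim)]
  set A := P.dom ∩ P.map ⁻¹' s with hA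
  have hAo : ∀ u ∈ A, P.map u ∈ c.toPH.source := fun u hu => hsc hu.2
  have hAm : MeasurableSet A := P.measurableSet_inter_preimage hs
  let φ : (Fin (2 * n) → ℝ) → (Fin (2 * n) → ℝ) := fun u => (horCoord n).symm (c.toPH (P.map u)).1
  have hf0 : ∀ u ∈ A, f (P.map u) = 0 := by
    intro u hu
    have : P.map u ∈ S ∩ c.toPH.source := ⟨P.mapsTo hu.1, hAo u hu⟩
    rw [hS] at this
    exact this.2
  have hslice0 : ∀ u ∈ P.dom, P.map u ∈ c.toPH.source → slice n (φ u) = c.toPH (P.map u) := by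
    intro u hu hus
    have : P.map u ∈ S ∩ c.toPH.source := ⟨P.mapsTo hu, hus⟩
    rw [hS] at this
    rw [slice_apply, (horCoord n).apply_symm_apply, ← this.2, ← c.snd_eq _ hus]
  have hQφ0 : ∀ u ∈ P.dom, P.map u ∈ c.toPH.source → Q.map (φ u) = P.map u := by
    intro u hu hus
    change c.toPH.symm (slice n (φ u)) = _
    rw [hslice0 u hu hus, c.toPH.left_inv hus]
  have hQdom : ∀ u ∈ A, φ u ∈ Q.dom := by
    intro u hu
    change slice n (φ u) ∈ c.toPH.target
    rw [hslice0 u hu.1 (hAo u hu)]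
    exact c.toPH.map_source (hAo u hu)
  have himage : Q.dom ∩ Q.map ⁻¹' (s ∩ P.map '' P.dom) = φ '' A := by
    ext w
    constructor
    · rintro ⟨hw, hws, u, hu, huw⟩
      have huA : u ∈ A := ⟨hu, by rw [mem_preimage, huw]; exact hws⟩
      exact ⟨u, huA, Q.injOn (hQdom u huA) hw (by rw [hQφ0 u hu (hAo u huA), huw])⟩
    · rintro ⟨u, hu, rfl⟩
      refine ⟨hQdom u hu, ?_⟩
      rw [mem_preimage, hQφ0 u hu.1 (hAo u hu)]
      exact ⟨hu.2, u, hu.1, rfl⟩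
  let φ' : (Fin (2 * n) → ℝ) → (Fin (2 * n) → ℝ) →L[ℝ] (Fin (2 * n) → ℝ) := fun u =>
    ((horCoord n).symm : Hor n →L[ℝ] (Fin (2 * n) → ℝ)) ∘L (fstH) ∘L
      fderiv ℝ c.toPH (P.map u) ∘L fderiv ℝ P.map u
  have hφ' : ∀ u ∈ A, HasFDerivAt φ (φ' u) u := by
    intro u hu
    have h1 := (c.differentiableAt (hAo u hu)).hasFDerivAt.comp u
      (P.differentiableAt hu.1).hasFDerivAt
    exact (((horCoord n).symm : Hor n →L[ℝ] (Fin (2 * n) → ℝ)) ∘L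
      (fstH)).hasFDerivAt.comp u h1
  have hinj : InjOn φ A := by
    intro u hu v hv huv
    refine P.injOn hu.1 hv.1 ?_
    rw [← hQφ0 u hu.1 (hAo u hu), huv, hQφ0 v hv.1 (hAo v hv)]
  rw [himage, lintegral_image_eq_lintegral_abs_det_fderiv_mul volume hAm
    (fun u hu => (hφ' u hu).hasFDerivWithinAt) hinj]
  refine setLIntegral_congr_fun hAm fun u hu => ?_
  have hder : fderiv ℝ P.map u = fderiv ℝ Q.map (φ u) ∘L φ' u := by
    have h1 := (Q.differentiableAt (hQdom u hu)).hasFDerivAt.comp u (hφ' u hu)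
    have h2 : P.map =ᶠ[nhds u] Q.map ∘ φ := by
      filter_upwards [(P.continuousOn.isOpen_inter_preimage P.isOpen_dom
        c.toPH.open_source).mem_nhds ⟨hu.1, hAo u hu⟩] with v hv
      exact (hQφ0 v hv.1 hv.2).symm
    exact (h1.congr_of_eventuallyEq h2).fderiv
  have hdens : P.density V u = |(φ' u).det| * Q.density V (φ u) := by
    have h1 := pullForm_comp (V (P.map u)) (Q.frameDeriv (φ u) : (Fin (2 * n) → ℝ) →ₗ[ℝ] FrameVec n)
      (φ' u : (Fin (2 * n) → ℝ) →ₗ[ℝ] (Fin (2 * n) → ℝ))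
    have h2 : ∀ j, P.frameDeriv u (Pi.single j 1) =
        Q.frameDeriv (φ u) (φ' u (Pi.single j 1)) := by
      intro j
      rw [frameDeriv, frameDeriv, hder, hQφ0 u hu.1 (hAo u hu)]
      rfl
    rw [density, density, hQφ0 u hu.1 (hAo u hu)]
    simp only [h2]
    rw [← abs_mul]
    exact congrArg _ h1
  change ENNReal.ofReal (P.density V u) = _
  rw [hdens, ENNReal.ofReal_mul (abs_nonneg _)]

end LocalParam

/-! ## The measures induced on hypersurfaces -/

/-- `f` is a `C²` defining function of `S` on the open set `U`, compatible with the normal `ν`. -/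
structure IsDefiningOn (S : Set (Heis n)) (ν : Heis n → FrameVec n) (f : Heis n → ℝ)
    (U : Set (Heis n)) : Prop where
  isOpen : IsOpen U
  contDiffOn : ContDiffOn ℝ 2 f U
  inter_eq : S ∩ U = {q ∈ U | f q = 0}
  rgrad_ne : ∀ q ∈ S ∩ U, rgrad f q ≠ 0
  normal_eq : ∀ q ∈ S ∩ U, ν q = (rnorm (rgrad f q))⁻¹ • rgrad f q

theorem isOrientedHypersurface_iff {S : Set (Heis n)} {ν : Heis n → FrameVec n} :
    IsOrientedHypersurface S ν ↔ ∀ p ∈ S, ∃ U f, p ∈ U ∧ IsDefiningOn S ν f U := by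
  constructor
  · intro h p hp
    obtain ⟨U, f, hU, hpU, hf, hS, h⟩ := h p hp
    exact ⟨U, f, hpU, hU, hf, hS, fun q hq => (h q hq).1, fun q hq => (h q hq).2⟩
  · intro h p hp
    obtain ⟨U, f, hpU, h⟩ := h p hp
    exact ⟨U, f, h.isOpen, hpU, h.contDiffOn, h.inter_eq, fun q hq =>
      ⟨h.rgrad_ne q hq, h.normal_eq q hq⟩⟩

namespace IsDefiningOn

variable {S : Set (Heis n)} {ν : Heis n → FrameVec n} {f : Heis n → ℝ} {U : Set (Heis n)}

theorem mono (h : IsDefiningOn S ν f U) {W : Set (Heis n)} (hW : IsOpen W) (hWU : W ⊆ U) :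
    IsDefiningOn S ν f W where
  isOpen := hW
  contDiffOn := h.contDiffOn.mono hWU
  inter_eq := by
    have := congrArg (· ∩ W) h.inter_eq
    simp only [inter_assoc, inter_eq_self_of_subset_right hWU] at this
    rw [this]
    ext q
    simp only [mem_inter_iff, mem_ofPred_eq]
    exact ⟨fun h => ⟨h.2, h.1.2⟩, fun h => ⟨⟨hWU h.1, h.2⟩, h.1⟩⟩
  rgrad_ne := fun q hq => h.rgrad_ne q ⟨hq.1, hWU hq.2⟩
  normal_eq := fun q hq => h.normal_eq q ⟨hq.1, hWU hq.2⟩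

theorem eq_zero (h : IsDefiningOn S ν f U) {q : Heis n} (hq : q ∈ S) (hU : q ∈ U) : f q = 0 := by
  have : q ∈ S ∩ U := ⟨hq, hU⟩
  rw [h.inter_eq] at this
  exact this.2

theorem mem (h : IsDefiningOn S ν f U) {q : Heis n} (hU : q ∈ U) (hq : f q = 0) : q ∈ S := by
  have : q ∈ {q ∈ U | f q = 0} := ⟨hU, hq⟩
  rw [← h.inter_eq] at this
  exact this.1

theorem exists_chart (h : IsDefiningOn S ν f U) {p : Heis n} (hp : p ∈ S) (hU : p ∈ U) :
    ∃ c : LevelChart n f, p ∈ c.toPH.source ∧ c.toPH.source ⊆ U :=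
  exists_levelChart h.isOpen hU h.contDiffOn
    (fun h0 => h.rgrad_ne p ⟨hp, hU⟩ (rgrad_eq_zero_iff.2 h0))

theorem metric_normal (h : IsDefiningOn S ν f U) {q : Heis n} (hq : q ∈ S) (hU : q ∈ U) :
    metric (ν q) (ν q) = 1 := by
  rw [h.normal_eq q ⟨hq, hU⟩]
  exact metric_normalize (h.rgrad_ne q ⟨hq, hU⟩)

theorem rgrad_eq (h : IsDefiningOn S ν f U) {q : Heis n} (hq : q ∈ S) (hU : q ∈ U) :
    rgrad f q = rnorm (rgrad f q) • ν q := by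
  rw [h.normal_eq q ⟨hq, hU⟩, smul_smul, mul_inv_cancel₀ (rnorm_pos (h.rgrad_ne q ⟨hq, hU⟩)).ne',
    one_smul]

theorem fd_eq (h : IsDefiningOn S ν f U) {q : Heis n} (hq : q ∈ S) (hU : q ∈ U) (v : FrameVec n) :
    fd f q v = rnorm (rgrad f q) * metric (ν q) v := by
  rw [fd_eq_metric, ← metric_smul_left, ← h.rgrad_eq hq hU]

theorem continuousOn_rgrad (h : IsDefiningOn S ν f U) : ContinuousOn (rgrad f) U :=
  (contDiffOn_rgrad h.isOpen h.contDiffOn (k := 1) (by norm_num)).continuousOn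

end IsDefiningOn

theorem continuous_rnorm : Continuous (rnorm : FrameVec n → ℝ) := by
  have : (rnorm : FrameVec n → ℝ) = fun v => Real.sqrt (metricL v v) := by
    ext v; rw [metricL_apply]; rfl
  rw [this]
  fun_prop

namespace IsOrientedHypersurface

variable {S : Set (Heis n)} {ν : Heis n → FrameVec n}

theorem exists_chart (h : IsOrientedHypersurface S ν) {p : Heis n} (hp : p ∈ S) :
    ∃ (f : Heis n → ℝ) (c : LevelChart n f), p ∈ c.toPH.source ∧
      IsDefiningOn S ν f c.toPH.source := by
  obtain ⟨U, f, hpU, hd⟩ := isOrientedHypersurface_iff.1 h p hp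
  obtain ⟨c, hpc, hc⟩ := hd.exists_chart hp hpU
  exact ⟨f, c, hpc, hd.mono c.toPH.open_source hc⟩

theorem metric_normal (h : IsOrientedHypersurface S ν) {p : Heis n} (hp : p ∈ S) :
    metric (ν p) (ν p) = 1 := by
  obtain ⟨f, c, hpc, hd⟩ := h.exists_chart hp
  exact hd.metric_normal hp hpc

theorem continuousOn_normal (h : IsOrientedHypersurface S ν) : ContinuousOn ν S := by
  intro p hp
  obtain ⟨f, c, hpc, hd⟩ := h.exists_chart hp
  have h1 := hd.continuousOn_rgrad
  have h2 : ContinuousOn (fun q => (rnorm (rgrad f q))⁻¹ • rgrad f q) (S ∩ c.toPH.source) :=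
    ((continuous_rnorm.comp_continuousOn (h1.mono inter_subset_right)).inv₀ fun q hq =>
      (rnorm_pos (hd.rgrad_ne q hq)).ne').smul (h1.mono inter_subset_right)
  have h3 : ContinuousOn ν (S ∩ c.toPH.source) := h2.congr fun q hq => hd.normal_eq q hq
  exact (h3 p ⟨hp, hpc⟩).mono_of_mem_nhdsWithin
    (inter_mem_nhdsWithin S (c.toPH.open_source.mem_nhds hpc))

end IsOrientedHypersurface

section contraction

variable {S : Set (Heis n)} {V : Heis n → FrameVec n}

theorem contractionMeasure_apply_chart {f : Heis n → ℝ} (c : LevelChart n f)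
    (hS : S ∩ c.toPH.source = {q ∈ c.toPH.source | f q = 0}) {s : Set (Heis n)}
    (hs : MeasurableSet s) (hsc : s ⊆ c.toPH.source) :
    contractionMeasure S V s = (c.param hS).measure V s := by
  refine le_antisymm ?_ (le_iSup (fun P : LocalParam n S => P.measure V) (c.param hS) s)
  have hle : contractionMeasure S V ≤ (c.param hS).measure V +
      (⊤ : Measure (Heis n)).restrict c.toPH.sourceᶜ := by
    refine iSup_le fun P => ?_
    refine Measure.le_iff.2 fun t ht => ?_
    have hm := c.toPH.open_source.measurableSet
    rw [← measure_inter_add_sdiff t hm, Measure.add_apply, Measure.restrict_apply ht]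
    refine add_le_add ?_ ?_
    · rw [P.measure_eq_chart c hS V (ht.inter hm) inter_subset_right]
      exact measure_mono (inter_subset_left.trans inter_subset_left)
    · exact Measure.le_iff'.1 le_top _
  refine (Measure.le_iff'.1 hle s).trans ?_
  rw [Measure.add_apply, Measure.restrict_apply hs]
  have : s ∩ c.toPH.sourceᶜ = ∅ := by
    rw [← disjoint_iff_inter_eq_empty]
    exact disjoint_compl_right.mono_left hsc
  rw [this]; simp

theorem contractionMeasure_restrict_chart {f : Heis n → ℝ} (c : LevelChart n f)
    (hS : S ∩ c.toPH.source = {q ∈ c.toPH.source | f q = 0}) :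
    (contractionMeasure S V).restrict c.toPH.source = (c.param hS).measure V := by
  ext t ht
  have hm := c.toPH.open_source.measurableSet
  rw [Measure.restrict_apply ht, contractionMeasure_apply_chart c hS (ht.inter hm)
    inter_subset_right, ← measure_inter_add_sdiff t hm (μ := (c.param hS).measure V)]
  have h0 : (c.param hS).measure V (t \ c.toPH.source) = 0 := by
    refine measure_mono_null ?_ ((c.param hS).measure_compl_image V)
    rw [c.image_param hS]
    intro q hq h
    exact hq.2 h.2
  rw [h0, add_zero]

theorem contractionMeasure_compl (hS : MeasurableSet S) : contractionMeasure S V Sᶜ = 0 := by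
  have hle : contractionMeasure S V ≤ (⊤ : Measure (Heis n)).restrict S := by
    refine iSup_le fun P => ?_
    refine Measure.le_iff.2 fun t ht => ?_
    rw [← measure_inter_add_sdiff t hS, Measure.restrict_apply ht]
    have h0 : P.measure V (t \ S) = 0 := by
      refine measure_mono_null ?_ (P.measure_compl_image V)
      rintro q hq ⟨u, hu, rfl⟩
      exact hq.2 (P.mapsTo hu)
    rw [h0, add_zero]
    exact Measure.le_iff'.1 le_top _
  refine le_antisymm ((Measure.le_iff'.1 hle _).trans ?_) zero_le
  rw [Measure.restrict_apply hS.compl]; simp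

end contraction

namespace LevelChart

variable {S : Set (Heis n)} {ν : Heis n → FrameVec n} {f : Heis n → ℝ} (c : LevelChart n f)

/-- The Jacobian of a chart along its slice. -/
def jac (u : Fin (2 * n) → ℝ) : ℝ := |(fderiv ℝ c.toPH.symm (slice n u)).det|

theorem continuousOn_det : ContinuousOn (fun y => (fderiv ℝ c.toPH.symm y).det) c.toPH.target :=
  ContinuousLinearMap.continuous_det.comp_continuousOn
    (c.smooth_symm.continuousOn_fderiv_of_isOpen c.toPH.open_target (by norm_num))

theorem continuousOn_jac (hS : S ∩ c.toPH.source = {q ∈ c.toPH.source | f q = 0}) :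
    ContinuousOn c.jac (c.param hS).dom :=
  (c.continuousOn_det.comp (slice n).continuous.continuousOn fun _ h => h).abs

variable (h : IsDefiningOn S ν f c.toPH.source)
include h

theorem density_normal {u : Fin (2 * n) → ℝ} (hu : u ∈ (c.param h.inter_eq).dom) :
    (c.param h.inter_eq).density ν u =
      frameConst n * rnorm (rgrad f ((c.param h.inter_eq).map u)) * c.jac u := by
  set q := (c.param h.inter_eq).map u
  have hq : q ∈ S := (c.param h.inter_eq).mapsTo hu
  have hqs : q ∈ c.toPH.source := c.toPH.map_target hu
  rw [c.density_param _ _ hu, h.fd_eq hq hqs, h.metric_normal hq hqs, mul_one,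
    abs_of_pos (rnorm_pos (h.rgrad_ne q ⟨hq, hqs⟩))]
  rfl

theorem density_horizontal {u : Fin (2 * n) → ℝ} (hu : u ∈ (c.param h.inter_eq).dom) :
    (c.param h.inter_eq).density (fun p => (nuH ν p, 0)) u =
      ‖(ν ((c.param h.inter_eq).map u)).1‖ * (c.param h.inter_eq).density ν u := by
  set q := (c.param h.inter_eq).map u with hqd
  have hq : q ∈ S := (c.param h.inter_eq).mapsTo hu
  have hqs : q ∈ c.toPH.source := c.toPH.map_target hu
  rw [c.density_normal h hu, c.density_param _ _ hu, ← hqd, h.fd_eq hq hqs]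
  have h1 : metric (ν q) (nuH ν q, 0) = ‖(ν q).1‖ := by
    simp only [metric, nuH, inner_smul_right, real_inner_self_eq_norm_sq, mul_zero, add_zero]
    by_cases h0 : ‖(ν q).1‖ = 0
    · simp [h0]
    · field_simp
  rw [h1, abs_of_nonneg (mul_nonneg (rnorm_pos (h.rgrad_ne q ⟨hq, hqs⟩)).le (norm_nonneg _)), jac]
  ring

theorem continuousOn_density :
    ContinuousOn ((c.param h.inter_eq).density ν) (c.param h.inter_eq).dom := by
  have h1 : ContinuousOn (fun u => frameConst n *
      rnorm (rgrad f ((c.param h.inter_eq).map u)) * c.jac u) (c.param h.inter_eq).dom := by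
    refine (continuousOn_const.mul (continuous_rnorm.comp_continuousOn
      (h.continuousOn_rgrad.comp (c.param h.inter_eq).continuousOn ?_))).mul
      (c.continuousOn_jac h.inter_eq)
    intro u hu
    exact c.toPH.map_target hu
  exact h1.congr fun u hu => c.density_normal h hu

theorem lintegral_sigmaR {g : Heis n → ENNReal}
    (hg : AEMeasurable g ((sigmaR S ν).restrict c.toPH.source)) :
    ∫⁻ q in c.toPH.source, g q ∂(sigmaR S ν) = ∫⁻ u in (c.param h.inter_eq).dom,
      ENNReal.ofReal ((c.param h.inter_eq).density ν u) * g ((c.param h.inter_eq).map u) := by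
  rw [sigmaR, contractionMeasure_restrict_chart c h.inter_eq] at hg ⊢
  set Q := c.param h.inter_eq
  have hQm : AEMeasurable Q.map (volume.restrict Q.dom) :=
    Q.continuousOn.aemeasurable Q.isOpen_dom.measurableSet
  have hdm : AEMeasurable (fun u => ENNReal.ofReal (Q.density ν u)) (volume.restrict Q.dom) :=
    ((c.continuousOn_density h).aemeasurable Q.isOpen_dom.measurableSet).ennreal_ofReal
  have hQm' := hQm.mono_ac (withDensity_absolutelyContinuous (volume.restrict Q.dom)
    fun u => ENNReal.ofReal (Q.density ν u))
  rw [LocalParam.measure] at hg ⊢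
  rw [lintegral_map' hg hQm']
  exact lintegral_withDensity_eq_lintegral_mul₀' hdm (hg.comp_aemeasurable hQm')

theorem integral_sigmaR {g : Heis n → ℝ}
    (hg : AEStronglyMeasurable g ((sigmaR S ν).restrict c.toPH.source)) :
    ∫ q in c.toPH.source, g q ∂(sigmaR S ν) = ∫ u in (c.param h.inter_eq).dom,
      (c.param h.inter_eq).density ν u * g ((c.param h.inter_eq).map u) := by
  rw [sigmaR, contractionMeasure_restrict_chart c h.inter_eq] at hg ⊢
  set Q := c.param h.inter_eq
  have hQm : AEMeasurable Q.map (volume.restrict Q.dom) :=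
    Q.continuousOn.aemeasurable Q.isOpen_dom.measurableSet
  have hdm : AEMeasurable (fun u => ENNReal.ofReal (Q.density ν u)) (volume.restrict Q.dom) :=
    ((c.continuousOn_density h).aemeasurable Q.isOpen_dom.measurableSet).ennreal_ofReal
  have hQm' := hQm.mono_ac (withDensity_absolutelyContinuous (volume.restrict Q.dom)
    fun u => ENNReal.ofReal (Q.density ν u))
  rw [LocalParam.measure] at hg ⊢
  rw [integral_map hQm' hg, integral_withDensity_eq_integral_toReal_smul₀ hdm
    (Eventually.of_forall fun _ => ENNReal.ofReal_lt_top)]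
  refine integral_congr_ae (Eventually.of_forall fun u => ?_)
  change (ENNReal.ofReal (Q.density ν u)).toReal • _ = _
  rw [ENNReal.toReal_ofReal (show 0 ≤ Q.density ν u from abs_nonneg _)]; rfl

end LevelChart

namespace IsOrientedHypersurface

variable {S : Set (Heis n)} {ν : Heis n → FrameVec n}

theorem sigmaR_compl (hSm : MeasurableSet S) : sigmaR S ν Sᶜ = 0 := contractionMeasure_compl hSm

theorem restrict_sigmaR (hSm : MeasurableSet S) : (sigmaR S ν).restrict S = sigmaR S ν :=
  Measure.restrict_eq_self_of_ae_mem (mem_ae_iff.2 (sigmaR_compl hSm))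

theorem aestronglyMeasurable_of_continuousOn (hSm : MeasurableSet S) {g : Heis n → ℝ}
    (hg : ContinuousOn g S) : AEStronglyMeasurable g (sigmaR S ν) := by
  rw [← restrict_sigmaR hSm]
  exact hg.aestronglyMeasurable hSm

theorem aemeasurable_norm_normal (h : IsOrientedHypersurface S ν) (hSm : MeasurableSet S) :
    AEMeasurable (fun p => ENNReal.ofReal ‖(ν p).1‖) (sigmaR S ν) :=
  (aestronglyMeasurable_of_continuousOn hSm
    (continuous_fst.comp_continuousOn h.continuousOn_normal).norm).aemeasurable.ennreal_ofReal

theorem sigmaH_eq (h : IsOrientedHypersurface S ν) (hSm : MeasurableSet S) :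
    sigmaH S ν = (sigmaR S ν).withDensity fun p => ENNReal.ofReal ‖(ν p).1‖ := by
  have hN := h.aemeasurable_norm_normal hSm
  choose F c hc hd using fun p : S => h.exists_chart p.2
  obtain ⟨T, hTc, hT⟩ := TopologicalSpace.isOpen_iUnion_countable (fun p : S => (c p).toPH.source)
    fun p => (c p).toPH.open_source
  have hcov : ⋃₀ (insert Sᶜ ((fun p => (c p).toPH.source) '' T)) = univ := by
    rw [sUnion_insert, sUnion_image, hT, eq_univ_iff_forall]
    intro q
    by_cases hq : q ∈ S
    · exact Or.inr (mem_iUnion.2 ⟨⟨q, hq⟩, hc ⟨q, hq⟩⟩)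
    · exact Or.inl hq
  refine Measure.ext_of_sUnion_eq_univ ((hTc.image _).insert _) hcov ?_
  intro s hs
  rcases hs with rfl | ⟨p, hp, rfl⟩
  · have h1 : (sigmaH S ν) Sᶜ = 0 := contractionMeasure_compl hSm
    have h2 : ((sigmaR S ν).withDensity fun p => ENNReal.ofReal ‖(ν p).1‖) Sᶜ = 0 :=
      withDensity_absolutelyContinuous _ _ (sigmaR_compl hSm)
    rw [Measure.restrict_zero_set h1, Measure.restrict_zero_set h2]
  · ext t ht
    have hm := (c p).toPH.open_source.measurableSet
    have hd' := hd p
    set Q := (c p).param hd'.inter_eq with hQ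
    rw [Measure.restrict_apply ht, Measure.restrict_apply ht, sigmaH,
      contractionMeasure_apply_chart (c p) hd'.inter_eq (ht.inter hm) inter_subset_right,
      Q.measure_apply _ (ht.inter hm), withDensity_apply _ (ht.inter hm)]
    have e1 : ∫⁻ q in t ∩ (c p).toPH.source, ENNReal.ofReal ‖(ν q).1‖ ∂(sigmaR S ν) =
        ∫⁻ q in (c p).toPH.source, t.indicator (fun q => ENNReal.ofReal ‖(ν q).1‖) q
          ∂(sigmaR S ν) := by
      rw [lintegral_indicator ht, Measure.restrict_restrict ht]
    rw [e1, (c p).lintegral_sigmaR hd' (hN.restrict.indicator ht), ← hQ,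
      ← lintegral_indicator (Q.measurableSet_inter_preimage (ht.inter hm)),
      ← lintegral_indicator Q.isOpen_dom.measurableSet]
    refine lintegral_congr fun u => ?_
    by_cases hu : u ∈ Q.dom
    · have hus : Q.map u ∈ (c p).toPH.source := (c p).toPH.map_target hu
      by_cases hut : Q.map u ∈ t
      · rw [indicator_of_mem (show u ∈ Q.dom ∩ Q.map ⁻¹' (t ∩ (c p).toPH.source) from
          ⟨hu, hut, hus⟩), indicator_of_mem hu, indicator_of_mem hut,
          (c p).density_horizontal hd' hu, ENNReal.ofReal_mul (norm_nonneg _), mul_comm]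
      · rw [indicator_of_notMem (show u ∉ Q.dom ∩ Q.map ⁻¹' (t ∩ (c p).toPH.source) from
          fun h => hut h.2.1), indicator_of_mem hu, indicator_of_notMem hut, mul_zero]
    · rw [indicator_of_notMem (fun h => hu h.1), indicator_of_notMem hu]

end IsOrientedHypersurface

/-- A compactly supported continuous function is a finite sum of such functions with small
supports. -/
theorem exists_sum_eq_of_hasCompactSupport {E : Type*} [TopologicalSpace E] [T2Space E]
    [LocallyCompactSpace E] {u : E → ℝ} (hu : Continuous u) (hc : HasCompactSupport u)
    {P : Set E → Prop} (hP : ∀ p ∈ tsupport u, ∃ W, IsOpen W ∧ p ∈ W ∧ P W) :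
    ∃ (m : ℕ) (w : Fin m → E → ℝ), (∀ i, Continuous (w i) ∧ HasCompactSupport (w i) ∧
      tsupport (w i) ⊆ tsupport u ∧ ∃ W, P W ∧ tsupport (w i) ⊆ W) ∧ ∀ x, u x = ∑ i, w i x := by
  choose! W hWo hpW hPW using hP
  obtain ⟨T, hT⟩ := hc.elim_finite_subcover (fun p : tsupport u => W p) (fun p => hWo p p.2)
    fun p hp => mem_iUnion.2 ⟨⟨p, hp⟩, hpW p hp⟩
  obtain ⟨g, hg1, hg2, -, hg4⟩ := exists_continuous_sum_one_of_isOpen_isCompact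
    (s := fun i : Fin T.card => W (T.equivFin.symm i).1) (fun i => hWo _ (T.equivFin.symm i).1.2)
    hc (by
      refine hT.trans fun x hx => ?_
      obtain ⟨p, hp, hx⟩ := mem_iUnion₂.1 hx
      exact mem_iUnion.2 ⟨T.equivFin ⟨p, hp⟩, by simpa using hx⟩)
  refine ⟨T.card, fun i x => g i x * u x, fun i => ⟨(g i).continuous.mul hu, hc.mul_left,
    tsupport_mul_subset_right, _, hPW _ (T.equivFin.symm i).1.2,
    tsupport_mul_subset_left.trans (hg1 i)⟩, fun x => ?_⟩
  rw [← Finset.sum_mul]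
  by_cases hx : x ∈ tsupport u
  · have := hg2 hx
    simp only [Finset.sum_apply, Pi.one_apply] at this
    rw [show ∑ i, g i x = 1 by simpa using this, one_mul]
  · rw [image_eq_zero_of_notMem_tsupport hx, mul_zero]

theorem exists_volume_hor (n : ℕ) : ∃ K : ℝ, 0 < K ∧ ∀ g : Hor n → ℝ,
    ∫ z, g z = K * ∫ u : Fin (2 * n) → ℝ, g (horCoord n u) := by
  have : (Measure.map (horCoord n) (volume : Measure (Fin (2 * n) → ℝ))).IsAddHaarMeasure :=
    (horCoord n).isAddHaarMeasure_map _
  obtain ⟨c, hc0, hc, h⟩ : ∃ c : ENNReal, c ≠ 0 ∧ c ≠ ⊤ ∧ (volume : Measure (Hor n)) =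
      c • Measure.map (horCoord n) (volume : Measure (Fin (2 * n) → ℝ)) :=
    ⟨_, by simpa using (Measure.addHaarScalarFactor_pos_of_isAddHaarMeasure _ _).ne',
      ENNReal.coe_ne_top, Measure.isAddLeftInvariant_eq_smul _ _⟩
  refine ⟨c.toReal, ENNReal.toReal_pos hc0 hc, fun g => ?_⟩
  rw [h, integral_smul_measure, smul_eq_mul]
  congr 1
  exact (horCoord n).toHomeomorph.measurableEmbedding.integral_map g

/-- Concentration of an approximate identity in the last variable. -/
theorem tendsto_integral_scaled {U : Heis n → ℝ} (hU : Continuous U) (hc : HasCompactSupport U)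
    {h : ℝ → ℝ} (hh : Continuous h) (hhc : HasCompactSupport h) :
    Tendsto (fun ε : ℝ => ∫ y : Heis n, ε⁻¹ * h (y.2 / ε) * U y) (𝓝[>] 0)
      (𝓝 ((∫ r, h r) * ∫ z : Hor n, U (z, 0))) := by
  set K : Set (Heis n) := (Prod.fst '' tsupport U) ×ˢ tsupport h
  have hK : IsCompact K := (hc.image continuous_fst).prod hhc
  have hcont : Continuous fun ε : ℝ => ∫ y in K, h y.2 * U (y.1, ε * y.2) := by
    refine continuous_parametric_integral_of_continuous (f := fun (ε : ℝ) (y : Heis n) =>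
      h y.2 * U (y.1, ε * y.2)) ?_ hK
    simp only [Function.uncurry_def]
    fun_prop
  have hfull : ∀ ε : ℝ, ∫ y in K, h y.2 * U (y.1, ε * y.2) =
      ∫ y : Heis n, h y.2 * U (y.1, ε * y.2) := by
    intro ε
    refine setIntegral_eq_integral_of_forall_compl_eq_zero fun y hy => ?_
    by_contra h0
    refine hy ⟨⟨_, subset_tsupport _ (right_ne_zero_of_mul h0), rfl⟩,
      subset_tsupport _ (left_ne_zero_of_mul h0)⟩
  have hlim : Tendsto (fun ε : ℝ => ∫ y : Heis n, h y.2 * U (y.1, ε * y.2)) (𝓝[>] 0)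
      (𝓝 (∫ y : Heis n, h y.2 * U (y.1, 0 * y.2))) := by
    simp only [← hfull]
    exact (hcont.tendsto 0).mono_left nhdsWithin_le_nhds
  have h0 : ∫ y : Heis n, h y.2 * U (y.1, 0 * y.2) = (∫ r, h r) * ∫ z : Hor n, U (z, 0) := by
    simp only [zero_mul]
    have := integral_prod_mul (μ := (volume : Measure (Hor n))) (ν := (volume : Measure ℝ))
      (fun z => U (z, 0)) h
    rw [mul_comm (∫ r, h r), ← this]
    exact integral_congr_ae (Eventually.of_forall fun y => mul_comm _ _)
  rw [h0] at hlim
  refine hlim.congr' ?_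
  filter_upwards [self_mem_nhdsWithin] with ε (hε : 0 < ε)
  have hi1 : Integrable (fun y : Heis n => h y.2 * U (y.1, ε * y.2))
      ((volume : Measure (Hor n)).prod volume) := by
    refine Continuous.integrable_of_hasCompactSupport (by fun_prop) (HasCompactSupport.intro hK ?_)
    intro y hy
    by_contra h0
    exact hy ⟨⟨_, subset_tsupport _ (right_ne_zero_of_mul h0), rfl⟩,
      subset_tsupport _ (left_ne_zero_of_mul h0)⟩
  have hi2 : Integrable (fun y : Heis n => ε⁻¹ * h (y.2 / ε) * U y)
      ((volume : Measure (Hor n)).prod volume) :=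
    Continuous.integrable_of_hasCompactSupport (by fun_prop) hc.mul_left
  rw [Measure.volume_eq_prod, integral_prod _ hi1, integral_prod _ hi2]
  refine integral_congr_ae (Eventually.of_forall fun z => ?_)
  have := Measure.integral_comp_mul_left (fun s => ε⁻¹ * h (s / ε) * U (z, s)) ε
  simp only [smul_eq_mul, abs_of_pos (inv_pos.2 hε)] at this
  have e2 : ∫ s, ε⁻¹ * h (s / ε) * U (z, s) = ε * ∫ x, ε⁻¹ * h (ε * x / ε) * U (z, ε * x) := by
    rw [this, ← mul_assoc, mul_inv_cancel₀ hε.ne', one_mul]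
  change ∫ s, h s * U (z, ε * s) = ∫ s, ε⁻¹ * h (s / ε) * U (z, s)
  rw [e2, ← integral_const_mul]
  refine integral_congr_ae (Eventually.of_forall fun x => ?_)
  simp only [mul_div_cancel_left₀ x hε.ne']
  field_simp

/-- Extension by zero of a continuous function through an open partial homeomorphism. -/
theorem _root_.OpenPartialHomeomorph.continuous_indicator_comp_symm {E F : Type*}
    [TopologicalSpace E] [TopologicalSpace F] [T2Space F] (e : OpenPartialHomeomorph E F)
    {g : F → ℝ} (hg : ContinuousOn g e.target) {K : Set E} (hK : IsCompact K) (hKs : K ⊆ e.source)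
    (h0 : ∀ y ∈ e.target, e.symm y ∉ K → g y = 0) :
    Continuous (e.target.indicator g) ∧ HasCompactSupport (e.target.indicator g) := by
  have hKi : IsCompact (e '' K) := hK.image_of_continuousOn (e.continuousOn.mono hKs)
  have hz : ∀ y ∉ e '' K, e.target.indicator g y = 0 := by
    intro y hy
    by_cases hyt : y ∈ e.target
    · rw [indicator_of_mem hyt]
      exact h0 y hyt fun h => hy ⟨_, h, e.right_inv hyt⟩
    · exact indicator_of_notMem hyt _
  refine ⟨?_, HasCompactSupport.intro hKi hz⟩
  rw [continuous_iff_continuousAt]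
  intro y
  by_cases hy : y ∈ e '' K
  · obtain ⟨x, hx, rfl⟩ := hy
    have ht : e x ∈ e.target := e.map_source (hKs hx)
    have h1 := hg.continuousAt (e.open_target.mem_nhds ht)
    refine h1.congr ?_
    filter_upwards [e.open_target.mem_nhds ht] with z hz using (indicator_of_mem hz g).symm
  · refine (continuousAt_const (y := (0 : ℝ))).congr ?_
    filter_upwards [hKi.isClosed.isOpen_compl.mem_nhds hy] with z hz' using (hz z hz').symm

section

open Filter Topology LevelChart

/-- The ratio between Lebesgue measure on horizontal vectors and the normalisation of `volForm`. -/
def lerayConst (n : ℕ) : ℝ := (exists_volume_hor n).choose / frameConst n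

theorem lerayConst_pos (n : ℕ) : 0 < lerayConst n :=
  div_pos (exists_volume_hor n).choose_spec.1 (frameConst_pos n)

theorem integral_hor (g : Hor n → ℝ) :
    ∫ z, g z = lerayConst n * frameConst n * ∫ u : Fin (2 * n) → ℝ, g (horCoord n u) := by
  rw [lerayConst, div_mul_cancel₀ _ (frameConst_pos n).ne']
  exact (exists_volume_hor n).choose_spec.2 g

section

variable {S : Set (Heis n)} {ν : Heis n → FrameVec n}

theorem IsOrientedHypersurface.isFiniteMeasure (hS : IsOrientedHypersurface S ν)
    (hc : IsCompact S) : IsFiniteMeasure (sigmaR S ν) := by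
  constructor
  rw [← measure_add_measure_compl hc.measurableSet,
    IsOrientedHypersurface.sigmaR_compl hc.measurableSet, add_zero]
  refine hc.measure_lt_top_of_nhdsWithin fun p hp => ?_
  obtain ⟨f, c, hpc, hd⟩ := hS.exists_chart hp
  obtain ⟨K, hK, hpK, hKs⟩ := exists_compact_subset c.toPH.open_source hpc
  refine ⟨K, mem_nhdsWithin_of_mem_nhds (mem_interior_iff_mem_nhds.1 hpK), ?_⟩
  rw [sigmaR, contractionMeasure_apply_chart c hd.inter_eq hK.measurableSet hKs,
    LocalParam.measure_apply _ _ hK.measurableSet]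
  set Q := c.param hd.inter_eq
  set K' : Set (Fin (2 * n) → ℝ) := slice n ⁻¹' (c.toPH '' K)
  have hK' : IsCompact K' := by
    have h1 : IsCompact (c.toPH '' K) := hK.image_of_continuousOn (c.toPH.continuousOn.mono hKs)
    refine Topology.IsClosedEmbedding.isCompact_preimage ?_ h1
    refine (slice n).isClosedEmbedding_of_injective ?_
    refine LinearMap.ker_eq_bot.2 fun u v huv => ?_
    exact (horCoord n).injective (congrArg Prod.fst huv)
  have hK'd : K' ⊆ Q.dom := by
    rintro u ⟨q, hq, hqu⟩
    change slice n u ∈ c.toPH.target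
    rw [← hqu]
    exact c.toPH.map_source (hKs hq)
  have hsub : Q.dom ∩ Q.map ⁻¹' K ⊆ K' := by
    intro u hu
    exact ⟨_, hu.2, c.toPH.right_inv hu.1⟩
  refine (lintegral_mono_set hsub).trans_lt ?_
  obtain ⟨C, hC⟩ := hK'.exists_bound_of_continuousOn ((c.continuousOn_density hd).mono hK'd)
  refine (setLIntegral_lt_top_of_bddAbove (hK'.measure_lt_top.ne) ⟨C.toNNReal, ?_⟩)
  rintro _ ⟨u, hu, rfl⟩
  exact Real.toNNReal_le_toNNReal ((le_abs_self _).trans (hC u hu))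

theorem IsOrientedHypersurface.integrable_of_continuousOn (hS : IsOrientedHypersurface S ν)
    (hc : IsCompact S) {g : Heis n → ℝ} (hg : ContinuousOn g S) : Integrable g (sigmaR S ν) := by
  have := hS.isFiniteMeasure hc
  obtain ⟨C, hC⟩ := hc.exists_bound_of_continuousOn hg
  refine Integrable.of_bound
    (IsOrientedHypersurface.aestronglyMeasurable_of_continuousOn hc.measurableSet hg) C ?_
  rw [ae_iff]
  refine measure_mono_null (fun q hq hqS => hq (hC q hqS))
    (IsOrientedHypersurface.sigmaR_compl hc.measurableSet)

theorem continuousOn_div_rnorm {f : Heis n → ℝ} {V : Set (Heis n)} (hd : IsDefiningOn S ν f V)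
    {u : Heis n → ℝ} (hu : ContinuousOn u S) (hV : tsupport u ⊆ V) :
    ContinuousOn (fun q => u q / rnorm (rgrad f q)) S := by
  intro p hp
  by_cases hpV : p ∈ V
  · have h1 : ContinuousAt (fun q => rnorm (rgrad f q)) p :=
      (continuous_rnorm.comp_continuousOn hd.continuousOn_rgrad).continuousAt
        (hd.isOpen.mem_nhds hpV)
    exact (hu p hp).div h1.continuousWithinAt (rnorm_pos (hd.rgrad_ne p ⟨hp, hpV⟩)).ne'
  · have h0 : (tsupport u)ᶜ ∈ 𝓝 p :=
      (isClosed_tsupport u).isOpen_compl.mem_nhds fun h => hpV (hV h)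
    refine ((continuousAt_const (y := (0 : ℝ))).congr ?_).continuousWithinAt
    filter_upwards [h0] with q hq
    rw [image_eq_zero_of_notMem_tsupport hq, zero_div]

theorem tendsto_integral_chart {f : Heis n → ℝ} (c : LevelChart n f)
    (hd : IsDefiningOn S ν f c.toPH.source) (hSm : MeasurableSet S)
    {u : Heis n → ℝ} (hu : Continuous u) (huc : HasCompactSupport u)
    (hus : tsupport u ⊆ c.toPH.source) {h : ℝ → ℝ} (hh : Continuous h)
    (hhc : HasCompactSupport h) :
    Tendsto (fun ε : ℝ => ∫ p, ε⁻¹ * h (f p / ε) * u p) (𝓝[>] 0)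
      (𝓝 (lerayConst n * (∫ r, h r) * ∫ p, u p / rnorm (rgrad f p) ∂(sigmaR S ν))) := by
  set g : Heis n → ℝ := fun y => |(fderiv ℝ c.toPH.symm y).det| * u (c.toPH.symm y) with hg
  obtain ⟨hU, hUc⟩ := c.toPH.continuous_indicator_comp_symm (g := g)
    (c.continuousOn_det.abs.mul (hu.comp_continuousOn c.toPH.continuousOn_symm)) huc hus (by
      intro y _ hy
      simp only [hg, image_eq_zero_of_notMem_tsupport hy, mul_zero])
  set U := c.toPH.target.indicator g
  have hlim := tendsto_integral_scaled hU hUc hh hhc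
  have e1 : ∀ ε : ℝ, ∫ y : Heis n, ε⁻¹ * h (y.2 / ε) * U y = ∫ p, ε⁻¹ * h (f p / ε) * u p := by
    intro ε
    have h1 := integral_target_eq_integral_abs_det_fderiv_smul (μ := volume)
      (f := c.toPH.symm) (f' := fun y => fderiv ℝ c.toPH.symm y)
      (fun y hy => (c.differentiableAt_symm hy).hasFDerivAt) fun p => ε⁻¹ * h (f p / ε) * u p
    simp only [OpenPartialHomeomorph.symm_target, OpenPartialHomeomorph.symm_source] at h1
    rw [← setIntegral_eq_integral_of_forall_compl_eq_zero (s := c.toPH.source)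
      (f := fun p => ε⁻¹ * h (f p / ε) * u p), h1,
      ← setIntegral_eq_integral_of_forall_compl_eq_zero (s := c.toPH.target)
      (f := fun y : Heis n => ε⁻¹ * h (y.2 / ε) * U y)]
    · refine setIntegral_congr_fun c.toPH.open_target.measurableSet fun y hy => ?_
      simp only [U, indicator_of_mem hy, hg, smul_eq_mul, c.snd_symm hy]
      ring
    · intro y hy
      simp only [U, indicator_of_notMem hy, mul_zero]
    · intro p hp
      rw [image_eq_zero_of_notMem_tsupport fun h => hp (hus h), mul_zero]
  simp only [e1] at hlim
  have e2 : (∫ r, h r) * ∫ z : Hor n, U (z, 0) =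
      lerayConst n * (∫ r, h r) * ∫ p, u p / rnorm (rgrad f p) ∂(sigmaR S ν) := by
    have h2 : ∫ p, u p / rnorm (rgrad f p) ∂(sigmaR S ν) =
        frameConst n * ∫ w : Fin (2 * n) → ℝ, U (slice n w) := by
      rw [← setIntegral_eq_integral_of_forall_compl_eq_zero (s := c.toPH.source)
        (f := fun p => u p / rnorm (rgrad f p)), c.integral_sigmaR hd, ← integral_const_mul,
        ← setIntegral_eq_integral_of_forall_compl_eq_zero (s := (c.param hd.inter_eq).dom)
        (f := fun w => frameConst n * U (slice n w))]
      · refine setIntegral_congr_fun (c.param hd.inter_eq).isOpen_dom.measurableSet fun w hw => ?_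
        have hw' : slice n w ∈ c.toPH.target := hw
        simp only [U, indicator_of_mem hw', hg, c.density_normal hd hw]
        have : rnorm (rgrad f ((c.param hd.inter_eq).map w)) ≠ 0 :=
          (rnorm_pos (hd.rgrad_ne _ ⟨(c.param hd.inter_eq).mapsTo hw, c.toPH.map_target hw⟩)).ne'
        rw [LevelChart.jac]
        field_simp
        rfl
      · intro w hw
        have hw' : slice n w ∉ c.toPH.target := hw
        simp only [U, indicator_of_notMem hw', mul_zero]
      · exact (IsOrientedHypersurface.aestronglyMeasurable_of_continuousOn hSm
          (continuousOn_div_rnorm hd hu.continuousOn hus)).restrict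
      · intro p hp
        rw [image_eq_zero_of_notMem_tsupport fun h => hp (hus h), zero_div]
    rw [h2, integral_hor fun z => U (z, 0)]
    simp only [slice_apply]
    ring
  rwa [e2] at hlim

theorem integrable_leray_integrand {f : Heis n → ℝ} {V : Set (Heis n)} (hd : IsDefiningOn S ν f V)
    {u : Heis n → ℝ} (hu : Continuous u) (huc : HasCompactSupport u) (huV : tsupport u ⊆ V)
    {h : ℝ → ℝ} (hh : Continuous h) (ε : ℝ) :
    Integrable (fun p => ε⁻¹ * h (f p / ε) * u p) := by
  refine Continuous.integrable_of_hasCompactSupport ?_ huc.mul_left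
  refine continuous_iff_continuousAt.2 fun p => ?_
  by_cases hp : p ∈ V
  · have h1 : ContinuousAt f p := hd.contDiffOn.continuousOn.continuousAt (hd.isOpen.mem_nhds hp)
    exact (continuousAt_const.mul (hh.continuousAt.comp (h1.div_const ε))).mul hu.continuousAt
  · refine (continuousAt_const (y := (0 : ℝ))).congr ?_
    filter_upwards [(isClosed_tsupport u).isOpen_compl.mem_nhds fun h => hp (huV h)] with q hq
    rw [image_eq_zero_of_notMem_tsupport hq, mul_zero]

/-- The layer-cake description of the measure `σ_R / |∇ f|`. -/
theorem tendsto_integral_leray (hSc : IsCompact S) {f : Heis n → ℝ} {V : Set (Heis n)}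
    (hS : IsOrientedHypersurface S ν) (hd : IsDefiningOn S ν f V)
    {u : Heis n → ℝ} (hu : Continuous u) (huc : HasCompactSupport u) (huV : tsupport u ⊆ V)
    {h : ℝ → ℝ} (hh : Continuous h) (hhc : HasCompactSupport h) :
    Tendsto (fun ε : ℝ => ∫ p, ε⁻¹ * h (f p / ε) * u p) (𝓝[>] 0)
      (𝓝 (lerayConst n * (∫ r, h r) * ∫ p, u p / rnorm (rgrad f p) ∂(sigmaR S ν))) := by
  obtain ⟨m, w, hw, hsum⟩ := exists_sum_eq_of_hasCompactSupport hu huc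
    (P := fun W => (∃ c : LevelChart n f, c.toPH.source = W ∧ W ⊆ V) ∨ W = Sᶜ) (by
      intro p hp
      by_cases hpS : p ∈ S
      · obtain ⟨c, hc1, hc2⟩ := hd.exists_chart hpS (huV hp)
        exact ⟨_, c.toPH.open_source, hc1, Or.inl ⟨c, rfl, hc2⟩⟩
      · exact ⟨_, hSc.isClosed.isOpen_compl, hpS, Or.inr rfl⟩)
  have hlim : ∀ i, Tendsto (fun ε : ℝ => ∫ p, ε⁻¹ * h (f p / ε) * w i p) (𝓝[>] 0)
      (𝓝 (lerayConst n * (∫ r, h r) * ∫ p, w i p / rnorm (rgrad f p) ∂(sigmaR S ν))) := by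
    intro i
    obtain ⟨hwc, hwk, hws, W, hW, hwW⟩ := hw i
    rcases hW with ⟨c, rfl, hcV⟩ | rfl
    · exact tendsto_integral_chart c (hd.mono c.toPH.open_source hcV) hSc.measurableSet hwc hwk
        hwW hh hhc
    · have h0 : ∫ p, w i p / rnorm (rgrad f p) ∂(sigmaR S ν) = 0 := by
        rw [← IsOrientedHypersurface.restrict_sigmaR hSc.measurableSet]
        refine setIntegral_eq_zero_of_forall_eq_zero fun p hp => ?_
        rw [image_eq_zero_of_notMem_tsupport fun h => hwW h hp, zero_div]
      rw [h0, mul_zero]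
      refine tendsto_const_nhds.congr' ?_
      obtain ⟨R, hR⟩ : ∃ R, ∀ r, R < |r| → h r = 0 := by
        obtain ⟨R, hR⟩ := hhc.isBounded.exists_norm_le
        refine ⟨R, fun r hr => image_eq_zero_of_notMem_tsupport fun h => ?_⟩
        exact absurd (hR r h) (not_le.2 hr)
      have hne : ∀ p ∈ tsupport (w i), |f p| ≠ 0 := fun p hp h0 =>
        hwW hp (hd.mem (huV (hws hp)) (abs_eq_zero.1 h0))
      obtain ⟨δ, hδ, hδ'⟩ : ∃ δ > 0, ∀ p ∈ tsupport (w i), δ ≤ |f p| := by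
        rcases (tsupport (w i)).eq_empty_or_nonempty with he | hne'
        · exact ⟨1, one_pos, by simp [he]⟩
        obtain ⟨p, hp, hmin⟩ := hwk.isCompact.exists_isMinOn hne'
          ((hd.contDiffOn.continuousOn.mono (hws.trans huV)).abs)
        exact ⟨_, lt_of_le_of_ne (abs_nonneg _) (hne p hp).symm, fun q hq => hmin hq⟩
      have hev : ∀ᶠ ε in 𝓝[>] (0 : ℝ), R < δ / ε :=
        ((tendsto_inv_nhdsGT_zero (𝕜 := ℝ)).const_mul_atTop hδ).eventually_gt_atTop R
      filter_upwards [hev, self_mem_nhdsWithin] with ε hε (hε0 : 0 < ε)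
      symm
      refine integral_eq_zero_of_ae (Eventually.of_forall fun p => ?_)
      by_cases hp : p ∈ tsupport (w i)
      · have : h (f p / ε) = 0 := by
          refine hR _ (hε.trans_le ?_)
          rw [abs_div, abs_of_pos hε0]
          exact div_le_div_of_nonneg_right (hδ' p hp) hε0.le
        simp [this]
      · simp [image_eq_zero_of_notMem_tsupport hp]
  have hsumlim := tendsto_finsetSum Finset.univ fun i _ => hlim i
  have e1 : ∑ i, lerayConst n * (∫ r, h r) * ∫ p, w i p / rnorm (rgrad f p) ∂(sigmaR S ν) =
      lerayConst n * (∫ r, h r) * ∫ p, u p / rnorm (rgrad f p) ∂(sigmaR S ν) := by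
    rw [← Finset.mul_sum, ← integral_finsetSum]
    · simp only [hsum, Finset.sum_div]
    · intro i _
      exact hS.integrable_of_continuousOn hSc (continuousOn_div_rnorm hd (hw i).1.continuousOn
        ((hw i).2.2.1.trans huV))
  rw [e1] at hsumlim
  refine hsumlim.congr fun ε => ?_
  rw [← integral_finsetSum]
  · simp only [hsum, Finset.mul_sum]
  · intro i _
    exact integrable_leray_integrand hd (hw i).1 (hw i).2.1 ((hw i).2.2.1.trans huV) hh ε

end

end

/-! ## Cutoffs and the divergence theorem on a level set -/

theorem contDiff_smul_of_tsupport_subset {E F : Type*} [NormedAddCommGroup E] [NormedSpace ℝ E] [NormedAddCommGroup F] [NormedSpace ℝ F]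
    {χ : E → ℝ} {X : E → F} {V : Set E} {k : WithTop ℕ∞} (hχ : ContDiffOn ℝ k χ V)
    (hV : IsOpen V) (hX : ContDiffOn ℝ k X V) {K : Set E} (hK : IsClosed K) (hKV : K ⊆ V)
    (h0 : ∀ x ∉ K, χ x • X x = 0) :
    ContDiff ℝ k fun x => χ x • X x := by
  rw [contDiff_iff_contDiffAt]
  intro x
  by_cases hx : x ∈ V
  · exact (hχ.contDiffAt (hV.mem_nhds hx)).smul (hX.contDiffAt (hV.mem_nhds hx))
  · refine (contDiffAt_const (c := (0 : F))).congr_of_eventuallyEq ?_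
    filter_upwards [hK.isOpen_compl.mem_nhds fun h => hx (hKV h)] with y hy using h0 y hy

section cutoff

variable {E : Type*} [NormedAddCommGroup E] [NormedSpace ℝ E] [FiniteDimensional ℝ E]

theorem exists_smooth_cutoff {K V : Set E} (hK : IsCompact K) (hV : IsOpen V) (hKV : K ⊆ V) :
    ∃ χ : E → ℝ, ContDiff ℝ ∞ χ ∧ HasCompactSupport χ ∧ tsupport χ ⊆ V ∧
      (∀ᶠ x in 𝓝ˢ K, χ x = 1) ∧ ∀ x, χ x ∈ Icc (0 : ℝ) 1 := by
  obtain ⟨K', hK', hK1, hK2⟩ := exists_compact_between hK hV hKV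
  obtain ⟨f, hf1, hf0, hf⟩ := exists_contMDiffMap_one_nhds_of_subset_interior
    (modelWithCornersSelf ℝ E) (n := (⊤ : ℕ∞)) hK.isClosed hK1
  have hsub : tsupport f ⊆ K' := closure_minimal
    (fun x hx => by_contra fun h => hx (hf0 x h)) hK'.isClosed
  exact ⟨f, f.contMDiff.contDiff, HasCompactSupport.of_support_subset_isCompact hK'
    ((subset_tsupport _).trans hsub), hsub.trans hK2, hf1, hf⟩

theorem exists_smooth_partition {K : Set E} (hK : IsCompact K) {P : Set E → Prop}
    (hP : ∀ p ∈ K, ∃ W, IsOpen W ∧ p ∈ W ∧ P W) :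
    ∃ (ι : Type) (_ : Fintype ι) (χ : ι → E → ℝ), (∀ i, ContDiff ℝ ∞ (χ i) ∧
      (∀ x, 0 ≤ χ i x) ∧ HasCompactSupport (χ i) ∧ ∃ W, P W ∧ tsupport (χ i) ⊆ W) ∧
      ∀ᶠ x in 𝓝ˢ K, ∑ i, χ i x = 1 := by
  choose! W hWo hpW hPW using hP
  obtain ⟨T, hT⟩ := hK.elim_finite_subcover (fun p : K => W p) (fun p => hWo p p.2)
    fun p hp => mem_iUnion.2 ⟨⟨p, hp⟩, hpW p hp⟩
  have hVo : IsOpen (⋃ p ∈ T, W p) := isOpen_biUnion fun p _ => hWo p p.2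
  obtain ⟨K', hK', hK1, hK2⟩ := exists_compact_between hK hVo hT
  obtain ⟨K'', hK'', hK3, -⟩ := exists_compact_between hK' isOpen_univ (subset_univ _)
  obtain ⟨f, hf⟩ := SmoothPartitionOfUnity.exists_isSubordinate (modelWithCornersSelf ℝ E)
    hK'.isClosed (fun i : Fin T.card => W (T.equivFin.symm i).1 ∩ interior K'')
    (fun i => (hWo _ (T.equivFin.symm i).1.2).inter isOpen_interior) (by
      intro x hx
      obtain ⟨p, hp, hx'⟩ := mem_iUnion₂.1 (hK2 hx)
      exact mem_iUnion.2 ⟨T.equivFin ⟨p, hp⟩, by simpa using hx', hK3 hx⟩)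
  refine ⟨Fin T.card, inferInstance, fun i => f i, fun i => ⟨(f i).contMDiff.contDiff,
    fun x => f.nonneg i x, ?_, _, hPW _ (T.equivFin.symm i).1.2, (hf i).trans inter_subset_left⟩,
    ?_⟩
  · exact HasCompactSupport.of_support_subset_isCompact hK''
      ((subset_tsupport _).trans ((hf i).trans (inter_subset_right.trans interior_subset)))
  · rw [eventually_nhdsSet_iff_exists]
    refine ⟨interior K', isOpen_interior, hK1, fun x hx => ?_⟩
    have := f.sum_eq_one (interior_subset hx)
    rwa [finsum_eq_sum_of_fintype] at this

end cutoff

section div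

theorem fd_smul {F : Type*} [NormedAddCommGroup F] [NormedSpace ℝ F] {a : Heis n → ℝ}
    {X : Heis n → F} {p : Heis n} (ha : DifferentiableAt ℝ a p) (hX : DifferentiableAt ℝ X p)
    (v : FrameVec n) : fd (fun q => a q • X q) p v = a p • fd X p v + fd a p v • X p := by
  have h := (ha.hasFDerivAt.smul hX.hasFDerivAt).fderiv
  rw [fd_apply, show fderiv ℝ (fun q => a q • X q) p = _ from h]
  simp [fd_apply]

theorem trace_eq_of_forall_apply {E : Type*} [AddCommGroup E] [Module ℝ E] [Module.Finite ℝ E]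
    {A B : E →ₗ[ℝ] E} {l : E →ₗ[ℝ] ℝ} {x : E} {c : ℝ} (h : ∀ v, A v = c • B v + l v • x) :
    LinearMap.trace ℝ E A = c * LinearMap.trace ℝ E B + l x := by
  have : A = c • B + l.smulRight x := by ext v; simp [h]
  rw [this, map_add, map_smul, trace_smulRight, smul_eq_mul]

theorem frameDiv_smul {a : Heis n → ℝ} {X : Heis n → FrameVec n} {p : Heis n}
    (ha : DifferentiableAt ℝ a p) (hX : DifferentiableAt ℝ X p) :
    frameDiv (fun q => a q • X q) p = a p * frameDiv X p + fd a p (X p) :=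
  trace_eq_of_forall_apply (l := (fd a p : FrameVec n →ₗ[ℝ] ℝ)) fun v => fd_smul ha hX v

theorem fd_congr {F : Type*} [NormedAddCommGroup F] [NormedSpace ℝ F] {X Y : Heis n → F}
    {p : Heis n} (h : X =ᶠ[𝓝 p] Y) : fd X p = fd Y p := by
  rw [fd, fd, h.fderiv_eq]

theorem frameDiv_congr {X Y : Heis n → FrameVec n} {p : Heis n} (h : X =ᶠ[𝓝 p] Y) :
    frameDiv X p = frameDiv Y p := by rw [frameDiv, frameDiv, fd_congr h]

theorem fd_comp_real {g : ℝ → ℝ} {a : Heis n → ℝ} {p : Heis n} (hg : DifferentiableAt ℝ g (a p))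
    (ha : DifferentiableAt ℝ a p) (v : FrameVec n) :
    fd (fun q => g (a q)) p v = deriv g (a p) * fd a p v := by
  have h := (hg.hasDerivAt.comp_hasFDerivAt p ha.hasFDerivAt).fderiv
  rw [fd_apply, show fderiv ℝ (fun q => g (a q)) p = _ from h]
  simp [fd_apply]

theorem continuous_frameDiv {X : Heis n → FrameVec n} (hX : ContDiff ℝ 1 X) :
    Continuous (frameDiv X) := by
  have h1 : Continuous (fd X) :=
    (hX.continuous_fderiv (by norm_num)).clm_comp (contDiff_toCoord (k := 0)).continuous
  let T : (FrameVec n →L[ℝ] FrameVec n) →ₗ[ℝ] ℝ :=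
    LinearMap.trace ℝ (FrameVec n) ∘ₗ ContinuousLinearMap.coeLM ℝ
  exact (LinearMap.continuous_of_finiteDimensional T).comp h1

theorem tsupport_frameDiv_subset (X : Heis n → FrameVec n) :
    tsupport (frameDiv X) ⊆ tsupport X := by
  refine closure_minimal (fun p hp => ?_) (isClosed_tsupport X)
  by_contra h
  refine hp ?_
  have : X =ᶠ[𝓝 p] fun _ => 0 := notMem_tsupport_iff_eventuallyEq.1 h
  rw [frameDiv_congr this, frameDiv, fd]
  simp

variable {S : Set (Heis n)} {ν : Heis n → FrameVec n}

/-- The divergence theorem on a compact hypersurface, for fields that are tangent to the level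
sets of the defining function. -/
theorem integral_frameDiv_div_rnorm (hSc : IsCompact S) (hS : IsOrientedHypersurface S ν)
    {f : Heis n → ℝ} {V : Set (Heis n)} (hd : IsDefiningOn S ν f V) {X : Heis n → FrameVec n}
    (hX : ContDiff ℝ 1 X) (hc : HasCompactSupport X) (hV : tsupport X ⊆ V)
    (hX0 : ∀ p ∈ V, fd f p (X p) = 0) :
    ∫ p, frameDiv X p / rnorm (rgrad f p) ∂(sigmaR S ν) = 0 := by
  let b : ContDiffBump (0 : ℝ) := ⟨1, 2, one_pos, one_lt_two⟩
  have hb : ContDiff ℝ 1 b := b.contDiff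
  have hlim := tendsto_integral_leray hSc hS hd (continuous_frameDiv hX)
    (HasCompactSupport.of_support_subset_isCompact hc
      ((subset_tsupport _).trans (tsupport_frameDiv_subset X)))
    ((tsupport_frameDiv_subset X).trans hV) b.continuous b.hasCompactSupport
  have h0 : ∀ ε : ℝ, ∫ p, ε⁻¹ * b (f p / ε) * frameDiv X p = 0 := by
    intro ε
    have hsm : ContDiffOn ℝ 1 (fun p => b (f p / ε)) V :=
      hb.comp_contDiffOn ((hd.contDiffOn.of_le (by norm_num)).div_const ε)
    have hY : ContDiff ℝ 1 fun p => b (f p / ε) • X p :=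
      contDiff_smul_of_tsupport_subset hsm hd.isOpen hX.contDiffOn (isClosed_tsupport X) hV
        fun x hx => by rw [image_eq_zero_of_notMem_tsupport hx, smul_zero]
    have hYc : HasCompactSupport fun p => b (f p / ε) • X p :=
      hc.mono fun x hx h0 => hx (by simp [h0])
    have h1 := integral_frameDiv_eq_zero hY hYc
    have h2 : ∀ p, frameDiv (fun p => b (f p / ε) • X p) p = b (f p / ε) * frameDiv X p := by
      intro p
      by_cases hp : p ∈ V
      · have hfd : DifferentiableAt ℝ f p :=
          (hd.contDiffOn.contDiffAt (hd.isOpen.mem_nhds hp)).differentiableAt (by norm_num)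
        have hsd := (hsm.contDiffAt (hd.isOpen.mem_nhds hp)).differentiableAt (by norm_num)
        rw [frameDiv_smul hsd (hX.differentiable (by norm_num) p)]
        have h3 := fd_comp_real (g := fun s => b (s / ε)) (a := f) (p := p)
          ((hb.differentiable (by norm_num)).differentiableAt.comp _
            (differentiableAt_id.div_const ε)) hfd (X p)
        rw [h3, hX0 p hp, mul_zero, add_zero]
      · have hp' : p ∉ tsupport X := fun h => hp (hV h)
        have hz : (fun p => b (f p / ε) • X p) =ᶠ[𝓝 p] fun _ => 0 := by
          filter_upwards [(isClosed_tsupport X).isOpen_compl.mem_nhds hp'] with q hq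
          rw [image_eq_zero_of_notMem_tsupport hq, smul_zero]
        rw [frameDiv_congr hz, image_eq_zero_of_notMem_tsupport
          (fun h => hp' (tsupport_frameDiv_subset X h)), mul_zero, frameDiv, fd]
        simp
    simp only [h2] at h1
    simp only [mul_assoc]
    rw [integral_const_mul, h1, mul_zero]
  simp only [h0] at hlim
  have h3 := tendsto_nhds_unique hlim tendsto_const_nhds
  have h4 : lerayConst n * ∫ r, b r ≠ 0 := (mul_pos (lerayConst_pos n) b.integral_pos).ne'
  exact (mul_eq_zero.1 h3).resolve_left h4

/-- The divergence theorem for fields defined near the hypersurface and vanishing, along it, off a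
compact set. -/
theorem setIntegral_frameDiv_div_rnorm (hSc : IsCompact S) (hS : IsOrientedHypersurface S ν)
    {f : Heis n → ℝ} {V : Set (Heis n)} (hd : IsDefiningOn S ν f V) {X : Heis n → FrameVec n}
    (hX : ContDiffOn ℝ 1 X V) (hX0 : ∀ p ∈ V, fd f p (X p) = 0) {K : Set (Heis n)}
    (hK : IsCompact K) (hKV : K ⊆ V) (hXK : ∀ p ∈ S ∩ V, p ∉ K → X =ᶠ[𝓝 p] fun _ => 0) :
    ∫ p in K, frameDiv X p / rnorm (rgrad f p) ∂(sigmaR S ν) = 0 := by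
  obtain ⟨χ, hχ, hχc, hχV, hχ1, -⟩ := exists_smooth_cutoff hK hd.isOpen hKV
  have hY : ContDiff ℝ 1 fun p => χ p • X p :=
    contDiff_smul_of_tsupport_subset (hχ.of_le (by norm_num)).contDiffOn hd.isOpen hX
      (isClosed_tsupport χ) hχV fun x hx => by
        rw [image_eq_zero_of_notMem_tsupport hx, zero_smul]
  have h := integral_frameDiv_div_rnorm hSc hS hd hY (hχc.mono fun x hx h0 => hx (by simp [h0]))
    ((tsupport_smul_subset_left χ X).trans hχV) fun p hp => by
      rw [map_smul, hX0 p hp, smul_zero]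
  rw [← h, ← integral_indicator hK.measurableSet]
  refine integral_congr_ae ?_
  filter_upwards [mem_ae_iff.2 (IsOrientedHypersurface.sigmaR_compl hSc.measurableSet)] with p hp
  by_cases hpK : p ∈ K
  · rw [indicator_of_mem hpK]
    congr 1
    refine frameDiv_congr ?_
    filter_upwards [hχ1.filter_mono (nhds_le_nhdsSet hpK)] with q hq
    rw [hq, one_smul]
  · rw [indicator_of_notMem hpK]
    have hz : (fun p => χ p • X p) =ᶠ[𝓝 p] fun _ => 0 := by
      by_cases hpV : p ∈ V
      · filter_upwards [hXK p ⟨hp, hpV⟩ hpK] with q hq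
        rw [hq, smul_zero]
      · filter_upwards [(isClosed_tsupport χ).isOpen_compl.mem_nhds fun h => hpV (hχV h)]
          with q hq
        rw [image_eq_zero_of_notMem_tsupport hq, zero_smul]
    rw [frameDiv_congr hz, frameDiv, fd]
    simp

end div

/-! ## Tangential derivatives, extensions and global defining functions -/

section tangent

variable {S : Set (Heis n)} {ν : Heis n → FrameVec n} {F : Type*} [NormedAddCommGroup F]
  [NormedSpace ℝ F]

namespace LevelChart

variable {f : Heis n → ℝ} (c : LevelChart n f)

/-- The retraction onto the zero level in a chart. -/
def retr (q : Heis n) : Heis n := c.toPH.symm ((c.toPH q).1, 0)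

/-- The domain of the retraction. -/
def retrDom : Set (Heis n) := c.toPH.source ∩ c.toPH ⁻¹' ((fun y => (y.1, 0)) ⁻¹' c.toPH.target)

theorem isOpen_retrDom : IsOpen c.retrDom :=
  c.toPH.continuousOn.isOpen_inter_preimage c.toPH.open_source
    (c.toPH.open_target.preimage (by fun_prop))

theorem contDiffOn_retr : ContDiffOn ℝ 2 c.retr c.retrDom := by
  refine c.smooth_symm.comp (t := c.toPH.target) (f := fun q => ((c.toPH q).1, (0 : ℝ))) ?_
    fun q hq => hq.2
  exact (contDiff_fst.comp_contDiffOn (c.smooth.mono inter_subset_left)).prodMk contDiffOn_const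

theorem retr_mem_source {q : Heis n} (hq : q ∈ c.retrDom) : c.retr q ∈ c.toPH.source :=
  c.toPH.map_target hq.2

theorem apply_retr {q : Heis n} (hq : q ∈ c.retrDom) : f (c.retr q) = 0 := c.snd_symm hq.2

theorem retr_eq_self {q : Heis n} (hq : q ∈ c.toPH.source) (h0 : f q = 0) : c.retr q = q := by
  have : ((c.toPH q).1, (0 : ℝ)) = c.toPH q := by rw [← h0, ← c.snd_eq q hq]
  rw [retr, this, c.toPH.left_inv hq]

theorem mem_retrDom {q : Heis n} (hq : q ∈ c.toPH.source) (h0 : f q = 0) : q ∈ c.retrDom := by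
  have : ((c.toPH q).1, (0 : ℝ)) = c.toPH q := by rw [← h0, ← c.snd_eq q hq]
  exact ⟨hq, by rw [mem_preimage, mem_preimage, this]; exact c.toPH.map_source hq⟩

end LevelChart

theorem IsOrientedHypersurface.mem_tangentConeAt (hS : IsOrientedHypersurface S ν) {p : Heis n}
    (hp : p ∈ S) {v : FrameVec n} (hv : metric (ν p) v = 0) :
    toCoord p v ∈ tangentConeAt ℝ S p := by
  obtain ⟨f, c, hpc, hd⟩ := hS.exists_chart hp
  have hf0 := hd.eq_zero hp hpc
  have hfv : fderiv ℝ f p (toCoord p v) = 0 := by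
    rw [← fd_apply, hd.fd_eq hp hpc, hv, mul_zero]
  set w := fderiv ℝ c.toPH p (toCoord p v) with hw
  have hw2 : w.2 = 0 := by rw [hw, c.fderiv_snd hpc, hfv]
  set γ : ℝ → Heis n := fun t => c.toPH.symm (c.toPH p + t • w) with hγ
  have hγ0 : γ 0 = p := by simp [hγ, c.toPH.left_inv hpc]
  have hγd : HasDerivAt γ (toCoord p v) 0 := by
    have h1 : HasDerivAt (fun t : ℝ => c.toPH p + t • w) w 0 := by
      simpa using ((hasDerivAt_id (0 : ℝ)).smul_const w).const_add (c.toPH p)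
    have h2 := (c.differentiableAt_symm (c.toPH.map_source hpc)).hasFDerivAt
    have h3 : HasFDerivAt c.toPH.symm (fderiv ℝ c.toPH.symm (c.toPH p))
        (c.toPH p + (0 : ℝ) • w) := by simpa using h2
    have h4 := h3.comp_hasDerivAt (0 : ℝ) h1
    rw [hw, c.fderiv_symm_comp_fderiv hpc] at h4
    exact h4
  refine mem_tangentConeAt_of_seq (𝓝[>] (0 : ℝ)) (fun t => t⁻¹) (fun t => γ t - p) ?_ ?_ ?_
  · have := hγd.continuousAt.tendsto
    rw [hγ0] at this
    simpa using (this.mono_left nhdsWithin_le_nhds).sub_const p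
  · have h5 : ∀ᶠ t in 𝓝 (0 : ℝ), c.toPH p + t • w ∈ c.toPH.target := by
      have : ContinuousAt (fun t : ℝ => c.toPH p + t • w) 0 := by fun_prop
      refine this.eventually (c.toPH.open_target.mem_nhds ?_)
      simpa using c.toPH.map_source hpc
    filter_upwards [h5.filter_mono nhdsWithin_le_nhds] with t ht
    rw [add_sub_cancel]
    refine hd.mem (c.toPH.map_target ht) ?_
    rw [c.snd_symm ht]
    simp [hw2, c.snd_eq p hpc, hf0]
  · have h6 := hγd.tendsto_slope.mono_left (nhdsWithin_mono 0 (fun t (ht : 0 < t) => ht.ne'))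
    refine h6.congr fun t => ?_
    rw [slope, hγ0, sub_zero]; rfl

theorem IsOrientedHypersurface.fderivWithin_eq (hS : IsOrientedHypersurface S ν) {p : Heis n}
    (hp : p ∈ S) {v : FrameVec n} (hv : metric (ν p) v = 0) {A : Set (Heis n)} (hA : S ⊆ A)
    {φ ψ : Heis n → F} (hφ : DifferentiableWithinAt ℝ φ A p) (hψ : DifferentiableAt ℝ ψ p)
    (h : φ =ᶠ[𝓝[S] p] ψ) : fderivWithin ℝ φ A p (toCoord p v) = fd ψ p v := by
  have h1 : HasFDerivWithinAt φ (fderiv ℝ ψ p) S p :=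
    hψ.hasFDerivAt.hasFDerivWithinAt.congr_of_eventuallyEq h (h.self_of_nhdsWithin hp)
  exact (hφ.hasFDerivWithinAt.mono hA).unique_on h1 (hS.mem_tangentConeAt hp hv)

theorem IsOrientedHypersurface.fderivWithin_self_eq (hS : IsOrientedHypersurface S ν) {p : Heis n}
    (hp : p ∈ S) {v : FrameVec n} (hv : metric (ν p) v = 0)
    {φ ψ : Heis n → F} (hψ : DifferentiableAt ℝ ψ p)
    (h : φ =ᶠ[𝓝[S] p] ψ) : fderivWithin ℝ φ S p (toCoord p v) = fd ψ p v := by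
  refine hS.fderivWithin_eq hp hv subset_rfl ?_ hψ h
  exact (hψ.differentiableWithinAt.congr_of_eventuallyEq h (h.self_of_nhdsWithin hp))

theorem IsOrientedHypersurface.fd_eq_of_eqOn (hS : IsOrientedHypersurface S ν) {p : Heis n}
    (hp : p ∈ S) {v : FrameVec n} (hv : metric (ν p) v = 0)
    {φ ψ : Heis n → F} (hφ : DifferentiableAt ℝ φ p) (hψ : DifferentiableAt ℝ ψ p)
    (h : φ =ᶠ[𝓝[S] p] ψ) : fd φ p v = fd ψ p v := by
  rw [← hS.fderivWithin_self_eq hp hv hψ h,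
    hS.fderivWithin_self_eq hp hv hφ (EventuallyEq.refl _ _)]

/-- Functions of class `C¹` on a compact hypersurface extend to the whole space. -/
theorem IsOrientedHypersurface.exists_extension (hS : IsOrientedHypersurface S ν)
    (hSc : IsCompact S) {g : Heis n → F} (hg : ContDiffOn ℝ 1 g S) :
    ∃ G : Heis n → F, ContDiff ℝ 1 G ∧ HasCompactSupport G ∧ EqOn G g S := by
  obtain ⟨ι, _, χ, hχ, hsum⟩ := exists_smooth_partition hSc
    (P := fun W => ∃ (f : Heis n → ℝ) (c : LevelChart n f), IsDefiningOn S ν f c.toPH.source ∧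
      W = c.retrDom) (by
      intro p hp
      obtain ⟨f, c, hpc, hd⟩ := hS.exists_chart hp
      exact ⟨_, c.isOpen_retrDom, c.mem_retrDom hpc (hd.eq_zero hp hpc), f, c, hd, rfl⟩)
  choose hχd hχ0 hχc W hW hχW using hχ
  choose f c hd hWc using hW
  have hmem : ∀ i, ∀ x ∈ (c i).retrDom, (c i).retr x ∈ S := fun i x hx =>
    (hd i).mem ((c i).retr_mem_source hx) ((c i).apply_retr hx)
  have hterm : ∀ i, ContDiff ℝ 1 fun x => χ i x • g ((c i).retr x) := by
    intro i
    refine contDiff_smul_of_tsupport_subset ((hχd i).of_le (by norm_num)).contDiffOn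
      (c i).isOpen_retrDom (hg.comp ((c i).contDiffOn_retr.of_le (by norm_num)) (hmem i))
      (isClosed_tsupport (χ i)) (by rw [← hWc i]; exact hχW i) fun x hx => ?_
    rw [image_eq_zero_of_notMem_tsupport hx, zero_smul]
  refine ⟨fun x => ∑ i, χ i x • g ((c i).retr x), ContDiff.sum fun i _ => hterm i, ?_, ?_⟩
  · refine HasCompactSupport.of_support_subset_isCompact
      (isCompact_iUnion fun i => (hχc i).isCompact) fun x hx => ?_
    by_contra h
    simp only [mem_iUnion, not_exists] at h
    exact hx (Finset.sum_eq_zero fun i _ => by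
      rw [image_eq_zero_of_notMem_tsupport (h i), zero_smul])
  · intro x hx
    have h1 : ∀ i, χ i x • g ((c i).retr x) = χ i x • g x := by
      intro i
      by_cases hxi : x ∈ tsupport (χ i)
      · have : x ∈ (c i).retrDom := by rw [← hWc i]; exact hχW i hxi
        rw [(c i).retr_eq_self this.1 ((hd i).eq_zero hx this.1)]
      · rw [image_eq_zero_of_notMem_tsupport hxi, zero_smul, zero_smul]
    simp only [h1]
    rw [← Finset.sum_smul, hsum.self_of_nhdsSet x hx, one_smul]

theorem IsDefiningOn.sign_eq {f₁ f₂ : Heis n → ℝ} {U U' : Set (Heis n)}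
    (hd : IsDefiningOn S ν f₁ U) {p : Heis n} (hp : p ∈ S) (hU : p ∈ U) (hU' : U' ∈ 𝓝 p)
    (hf₂ : ContDiffOn ℝ 1 f₂ U') (h0 : ∀ q ∈ S ∩ U', f₂ q = 0) {a : ℝ} (ha : 0 < a)
    (h : ∀ v, fd f₂ p v = a * metric (ν p) v) :
    ∀ᶠ q in 𝓝 p, SignType.sign (f₂ q) = SignType.sign (f₁ q) := by
  obtain ⟨c, hpc, hcU⟩ := hd.exists_chart hp hU
  obtain ⟨U'', hU''s, hU''o, hpU''⟩ := mem_nhds_iff.1 hU'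
  have hy0 : c.toPH p ∈ c.toPH.target := c.toPH.map_source hpc
  have hp0 : f₁ p = 0 := hd.eq_zero hp hU
  have hb0 : (c.toPH p).2 = 0 := by rw [c.snd_eq p hpc, hp0]
  have hO : IsOpen (c.toPH.target ∩ c.toPH.symm ⁻¹' U'') :=
    c.toPH.symm.continuousOn.isOpen_inter_preimage c.toPH.open_target hU''o
  have hyO : c.toPH p ∈ c.toPH.target ∩ c.toPH.symm ⁻¹' U'' :=
    ⟨hy0, by rwa [mem_preimage, c.toPH.left_inv hpc]⟩
  set h₂ : Heis n → ℝ := fun y => f₂ (c.toPH.symm y) with hh₂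
  have hsm : ContDiffOn ℝ 1 h₂ (c.toPH.target ∩ c.toPH.symm ⁻¹' U'') :=
    hf₂.comp ((c.smooth_symm.of_le (by norm_num)).mono inter_subset_left) fun y hy => hU''s hy.2
  have hcont : ContinuousOn (fun y => fderiv ℝ h₂ y (0, 1))
      (c.toPH.target ∩ c.toPH.symm ⁻¹' U'') :=
    (hsm.continuousOn_fderiv_of_isOpen hO (by norm_num)).clm_apply continuousOn_const
  have hpos : 0 < fderiv ℝ h₂ (c.toPH p) (0, 1) := by
    have hdf : DifferentiableAt ℝ f₂ (c.toPH.symm (c.toPH p)) := by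
      rw [c.toPH.left_inv hpc]
      exact (hf₂.contDiffAt hU').differentiableAt (by norm_num)
    have h1 : fderiv ℝ h₂ (c.toPH p) = _ :=
      (hdf.hasFDerivAt.comp (c.toPH p) (c.differentiableAt_symm hy0).hasFDerivAt).fderiv
    rw [h1, ContinuousLinearMap.comp_apply, c.toPH.left_inv hpc]
    set w := fderiv ℝ c.toPH.symm (c.toPH p) (0, 1) with hw
    have h2 : fderiv ℝ f₁ p w = 1 := by
      rw [← c.fderiv_snd hpc, hw]
      have := c.fderiv_comp_fderiv_symm hy0 (0, 1)
      rw [c.toPH.left_inv hpc] at this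
      rw [this]
    rw [fderiv_eq_fd, hd.fd_eq hp hU] at h2
    rw [fderiv_eq_fd, h]
    have h3 := rnorm_pos (hd.rgrad_ne p ⟨hp, hU⟩)
    refine mul_pos ha ?_
    by_contra hneg
    push Not at hneg
    have := mul_nonpos_of_nonneg_of_nonpos h3.le hneg
    linarith
  obtain ⟨r, hr, hball⟩ := Metric.isOpen_iff.1 (hcont.isOpen_inter_preimage hO
    (isOpen_Ioi (a := (0 : ℝ)))) (c.toPH p) ⟨hyO, hpos⟩
  have hev : ∀ᶠ q in 𝓝 p, c.toPH q ∈ Metric.ball (c.toPH p) r :=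
    (c.toPH.continuousAt hpc).eventually (Metric.ball_mem_nhds _ hr)
  filter_upwards [hev, c.toPH.open_source.mem_nhds hpc] with q hq hqs
  set y := c.toPH q with hy
  have hy1 : (y.1, (0 : ℝ)) ∈ Metric.ball (c.toPH p) r := by
    rw [Metric.mem_ball, Prod.dist_eq, max_lt_iff] at hq ⊢
    refine ⟨hq.1, ?_⟩
    rw [hb0]; simpa using hr
  have hbO : Metric.ball (c.toPH p) r ⊆ c.toPH.target ∩ c.toPH.symm ⁻¹' U'' :=
    fun z hz => (hball hz).1
  obtain ⟨z, hz, hzeq⟩ := domain_mvt (f := h₂) (f' := fun z => fderiv ℝ h₂ z)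
    (s := Metric.ball (c.toPH p) r)
    (fun z hz => ((hsm.contDiffAt (hO.mem_nhds (hbO hz))).differentiableAt
      (by norm_num)).hasFDerivAt.hasFDerivWithinAt) (convex_ball _ _) hy1 hq
  have hzb : z ∈ Metric.ball (c.toPH p) r := (convex_ball _ _).segment_subset hy1 hq hz
  have hz0 : 0 < fderiv ℝ h₂ z (0, 1) := (hball hzb).2
  have e1 : h₂ (y.1, 0) = 0 := by
    refine h0 _ ⟨hd.mem (hcU (c.toPH.map_target (hbO hy1).1)) ?_, hU''s (hbO hy1).2⟩
    rw [c.snd_symm (hbO hy1).1]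
  have e2 : h₂ y = f₂ q := by rw [hh₂, hy]; simp only; rw [c.toPH.left_inv hqs]
  have e3 : y - (y.1, 0) = y.2 • ((0 : Hor n), (1 : ℝ)) := by ext <;> simp
  rw [e1, e2, sub_zero, e3, map_smul, smul_eq_mul, hy, c.snd_eq q hqs] at hzeq
  rw [hzeq, sign_mul, sign_pos hz0, mul_one]

end tangent

section glue

variable {S : Set (Heis n)} {ν : Heis n → FrameVec n}

theorem fd_sum {ι : Type*} {s : Finset ι} {F : Type*} [NormedAddCommGroup F] [NormedSpace ℝ F]
    {a : ι → Heis n → F} {p : Heis n} (ha : ∀ i ∈ s, DifferentiableAt ℝ (a i) p)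
    (v : FrameVec n) : fd (fun q => ∑ i ∈ s, a i q) p v = ∑ i ∈ s, fd (a i) p v := by
  rw [fd_apply, fderiv_fun_sum ha]
  simp [fd_apply]

/-- A compact hypersurface is the regular zero set of a function defined everywhere. -/
theorem IsOrientedHypersurface.exists_global (hS : IsOrientedHypersurface S ν)
    (hSc : IsCompact S) :
    ∃ (f : Heis n → ℝ) (V : Set (Heis n)), ContDiff ℝ 2 f ∧ S ⊆ V ∧ IsDefiningOn S ν f V ∧
      ∀ p ∈ S, ∀ (f₁ : Heis n → ℝ) (U : Set (Heis n)), IsDefiningOn S ν f₁ U → p ∈ U →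
        ∀ᶠ q in 𝓝 p, SignType.sign (f q) = SignType.sign (f₁ q) := by
  obtain ⟨ι, _, χ, hχ, hsum⟩ := exists_smooth_partition hSc
    (P := fun W => ∃ f : Heis n → ℝ, IsDefiningOn S ν f W) (by
      intro p hp
      obtain ⟨U, f, hpU, hd⟩ := isOrientedHypersurface_iff.1 hS p hp
      exact ⟨U, hd.isOpen, hpU, f, hd⟩)
  choose hχd hχ0 hχc W hW hχW using hχ
  choose F hF using hW
  have hterm : ∀ i, ContDiff ℝ 2 fun x => χ i x • F i x := fun i =>
    contDiff_smul_of_tsupport_subset ((hχd i).of_le (by norm_cast)).contDiffOn (hF i).isOpen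
      (hF i).contDiffOn (isClosed_tsupport (χ i)) (hχW i) fun x hx => by
        rw [image_eq_zero_of_notMem_tsupport hx, zero_smul]
  set f : Heis n → ℝ := fun x => ∑ i, χ i x • F i x with hf
  have hfc : ContDiff ℝ 2 f := ContDiff.sum fun i _ => hterm i
  have hzero : ∀ i, ∀ p ∈ S, χ i p • F i p = 0 := by
    intro i p hp
    by_cases h : p ∈ tsupport (χ i)
    · rw [(hF i).eq_zero hp (hχW i h), smul_zero]
    · rw [image_eq_zero_of_notMem_tsupport h, zero_smul]
  have hf0 : ∀ p ∈ S, f p = 0 := fun p hp => Finset.sum_eq_zero fun i _ => hzero i p hp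
  have hfd : ∀ p ∈ S, ∃ a : ℝ, 0 < a ∧ ∀ v, fd f p v = a * metric (ν p) v := by
    intro p hp
    have hterm' : ∀ i v, fd (fun x => χ i x • F i x) p v =
        χ i p * rnorm (rgrad (F i) p) * metric (ν p) v := by
      intro i v
      by_cases h : p ∈ tsupport (χ i)
      · have hpW := hχW i h
        rw [fd_smul ((hχd i).differentiable (by norm_num) p)
          (((hF i).contDiffOn.contDiffAt ((hF i).isOpen.mem_nhds hpW)).differentiableAt
            (by norm_num)), (hF i).eq_zero hp hpW, (hF i).fd_eq hp hpW]
        simp only [smul_eq_mul]; ring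
      · have hz : (fun x => χ i x • F i x) =ᶠ[𝓝 p] fun _ => 0 := by
          filter_upwards [(isClosed_tsupport (χ i)).isOpen_compl.mem_nhds h] with q hq
          rw [image_eq_zero_of_notMem_tsupport hq, zero_smul]
        rw [fd_congr hz, image_eq_zero_of_notMem_tsupport h]
        simp [fd]
    refine ⟨∑ i, χ i p * rnorm (rgrad (F i) p), ?_, fun v => ?_⟩
    · have h1 := hsum.self_of_nhdsSet p hp
      have hnn : ∀ i, 0 ≤ χ i p * rnorm (rgrad (F i) p) := fun i =>
        mul_nonneg (hχ0 i p) (Real.sqrt_nonneg _)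
      obtain ⟨i, -, hi⟩ : ∃ i ∈ Finset.univ, 0 < χ i p := by
        refine Finset.exists_lt_of_sum_lt (f := fun _ => (0 : ℝ)) ?_
        rw [h1]; simp
      refine Finset.sum_pos' (fun i _ => hnn i) ⟨i, Finset.mem_univ i, mul_pos hi ?_⟩
      refine rnorm_pos ((hF i).rgrad_ne p ⟨hp, hχW i (subset_tsupport _ hi.ne')⟩)
    · rw [hf, fd_sum fun i _ => (hterm i).differentiable (by norm_num) p, Finset.sum_mul]
      exact Finset.sum_congr rfl fun i _ => hterm' i v
  have hsign : ∀ p ∈ S, ∀ (f₁ : Heis n → ℝ) (U : Set (Heis n)), IsDefiningOn S ν f₁ U → p ∈ U →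
        ∀ᶠ q in 𝓝 p, SignType.sign (f q) = SignType.sign (f₁ q) := by
    intro p hp f₁ U hd hpU
    obtain ⟨a, ha, h⟩ := hfd p hp
    exact hd.sign_eq hp hpU univ_mem (hfc.of_le (by norm_num)).contDiffOn
      (fun q hq => hf0 q hq.1) ha h
  refine ⟨f, interior {q | q ∈ S ↔ f q = 0}, hfc, ?_, ?_, hsign⟩
  · intro p hp
    obtain ⟨U, f₁, hpU, hd⟩ := isOrientedHypersurface_iff.1 hS p hp
    rw [mem_interior_iff_mem_nhds]
    filter_upwards [hsign p hp f₁ U hd hpU, hd.isOpen.mem_nhds hpU] with q hq hqU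
    constructor
    · exact hf0 q
    · intro h
      rw [h, sign_zero, eq_comm, sign_eq_zero_iff] at hq
      exact hd.mem hqU hq
  · have hgrad : ∀ p ∈ S, ∃ a : ℝ, 0 < a ∧ rgrad f p = a • ν p := by
      intro p hp
      obtain ⟨a, ha, h⟩ := hfd p hp
      exact ⟨a, ha, rgrad_eq_of_metric fun v => by rw [h, metric_smul_left]⟩
    refine ⟨isOpen_interior, hfc.contDiffOn, ?_, ?_, ?_⟩
    · ext q
      simp only [mem_inter_iff, mem_ofPred_eq]
      constructor
      · exact fun h => ⟨h.2, hf0 q h.1⟩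
      · exact fun h => ⟨(interior_subset h.1).2 h.2, h.1⟩
    · intro q hq
      obtain ⟨a, ha, h⟩ := hgrad q hq.1
      rw [h]
      refine smul_ne_zero ha.ne' fun h0 => ?_
      have := hS.metric_normal hq.1
      rw [h0] at this
      simp [metric] at this
    · intro q hq
      obtain ⟨a, ha, h⟩ := hgrad q hq.1
      rw [h, rnorm_smul ha.le, rnorm, hS.metric_normal hq.1, Real.sqrt_one, mul_one, smul_smul,
        inv_mul_cancel₀ ha.ne', one_smul]

/-- Characteristic points are limits of noncharacteristic ones. -/
theorem IsOrientedHypersurface.frequently_notMem_charSet (hS : IsOrientedHypersurface S ν)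
    (hn : 1 ≤ n) {p : Heis n} (hp : p ∈ S) : ∃ᶠ q in 𝓝[S] p, (ν q).1 ≠ 0 := by
  intro hev
  simp only [not_not] at hev
  obtain ⟨U, f, hpU, hd⟩ := isOrientedHypersurface_iff.1 hS p hp
  have hU : U ∈ 𝓝 p := hd.isOpen.mem_nhds hpU
  have hp0 : (ν p).1 = 0 := hev.self_of_nhdsWithin hp
  have h1 : ∀ v w : Hor n, fd (fun q => fd f q (w, 0)) p (v, 0) = 0 := by
    intro v w
    have hmet : metric (ν p) (v, 0) = 0 := by simp [metric, hp0]
    have hdiff : DifferentiableAt ℝ (fun q => fd f q (w, 0)) p :=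
      (((contDiffOn_fd hd.isOpen hd.contDiffOn (k := 1) (by norm_num)).contDiffAt hU).differentiableAt
        (by norm_num)).clm_apply (differentiableAt_const _)
    rw [hS.fd_eq_of_eqOn hp hmet hdiff (differentiableAt_const (0 : ℝ))]
    · simp [fd]
    · filter_upwards [hev, mem_nhdsWithin_of_mem_nhds hU, self_mem_nhdsWithin] with q hq hqU hqS
      rw [hd.fd_eq hqS hqU]
      simp [metric, hq]
  have hf2 : ContDiffAt ℝ 2 f p := hd.contDiffOn.contDiffAt hU
  let i : Fin n := ⟨0, hn⟩
  have h2 := fd_fd_comm hf2 (EuclideanSpace.single (i, 0) 1, 0) (EuclideanSpace.single (i, 1) 1, 0)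
  rw [h1, h1] at h2
  have h3 : symp (EuclideanSpace.single (i, (0 : Fin 2)) (1 : ℝ))
      (EuclideanSpace.single (i, 1) 1) = 1 := by
    rw [symp_apply]
    rw [Finset.sum_eq_single i]
    · simp
    · intro j _ hj; simp [hj]
    · simp
  simp only [h3] at h2
  have h4 : fd f p (0, 1) = 0 := by simpa using h2.symm
  rw [hd.fd_eq hp hpU] at h4
  have h5 := hS.metric_normal hp
  have h6 := rnorm_pos (hd.rgrad_ne p ⟨hp, hpU⟩)
  simp only [metric, hp0, inner_zero_left, mul_one, zero_add] at h4 h5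
  rcases mul_eq_zero.1 h4 with h | h
  · exact h6.ne' h
  · simp [h] at h5

end glue

/-! ## Characteristic points and admissible fields -/

section char

theorem volForm_ne_zero {m : ℕ} (h : m = 2 * n + 1) {w : Fin m → FrameVec n}
    (hw : LinearIndependent ℝ w) : volForm n m h w ≠ 0 := by
  have hcard : Fintype.card (Fin m) = Module.finrank ℝ (FrameVec n) := by
    simp [Module.finrank_prod, h]; ring
  subst h
  let b := basisOfLinearIndependentOfCardEqFinrank hw hcard
  have hb : ⇑b = w := coe_basisOfLinearIndependentOfCardEqFinrank hw hcard
  have := ((frameBasis n _ rfl).isUnit_det b).ne_zero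
  rw [hb] at this
  exact this

/-- A frame adapted to a unit horizontal vector. -/
theorem exists_volForm_ne_zero {m : ℕ} (h : 2 * m + 1 + 2 = 2 * n + 1) {q : Hor n} (hq : ‖q‖ = 1) :
    ∃ b : Fin (2 * m) → Hor n, (∀ j, inner ℝ (b j) q = 0) ∧
      volForm n (2 * m + 1 + 2) h (Fin.cons (q, 0) (Fin.cons (perp q, 0)
        (Fin.cons (0, 1) fun j => (b j, 0)))) ≠ 0 := by
  have hqq : inner ℝ q q = (1 : ℝ) := by rw [real_inner_self_eq_norm_sq, hq]; norm_num
  obtain ⟨b, hb⟩ := Orthonormal.exists_orthonormalBasis_extension_of_card_eq (𝕜 := ℝ)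
    (E := Hor n) (ι := Fin (2 * m + 2)) (by simp; omega)
    (v := fun i => if i = 0 then q else perp q) (s := {0, 1}) (by
      rw [orthonormal_iff_ite]
      rintro ⟨i, hi⟩ ⟨j, hj⟩
      simp only [mem_insert_iff, mem_singleton_iff] at hi hj
      rcases hi with rfl | rfl <;> rcases hj with rfl | rfl <;>
        simp [Set.domRestrict, hq])
  have hb0 : b 0 = q := by simpa using hb 0 (by simp)
  have hb1 : b 1 = perp q := by simpa using hb 1 (by simp)
  refine ⟨fun j => b j.succ.succ, fun j => ?_, volForm_ne_zero h ?_⟩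
  · rw [← hb0]
    exact b.orthonormal.2 (Fin.succ_ne_zero _)
  · rw [Fintype.linearIndependent_iff]
    intro g hg
    rw [Fin.sum_univ_succ, Fin.sum_univ_succ, Fin.sum_univ_succ] at hg
    simp only [Fin.cons_zero, Fin.cons_succ] at hg
    have h2 : g 2 = 0 := by
      have := congrArg Prod.snd hg
      simpa [Prod.snd_sum] using this
    have h1 : ∑ i, (Fin.cons (g 0) (Fin.cons (g 1) fun j => g j.succ.succ.succ) :
        Fin (2 * m + 2) → ℝ) i • b i = 0 := by
      rw [Fin.sum_univ_succ, Fin.sum_univ_succ]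
      have := congrArg Prod.fst hg
      simp only [Prod.fst_add, Prod.smul_fst, Prod.fst_sum, smul_zero, zero_add, Prod.fst_zero] at this
      rw [← this, hb0, show (Fin.succ 0 : Fin (2 * m + 2)) = 1 from rfl, hb1]
      rfl
    have h3 := Fintype.linearIndependent_iff.1 b.toBasis.linearIndependent _ (by simpa using h1)
    refine Fin.cases ?_ (Fin.cases ?_ (Fin.cases ?_ fun j => ?_))
    · exact h3 0
    · exact h3 1
    · exact h2
    · exact h3 j.succ.succ

variable {S : Set (Heis n)} {ν : Heis n → FrameVec n}

theorem norm_nuH {p : Heis n} (h : (ν p).1 ≠ 0) : ‖nuH ν p‖ = 1 := by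
  rw [nuH, norm_smul, norm_inv, norm_norm, inv_mul_cancel₀ (norm_ne_zero_iff.2 h)]

theorem smul_nuH (ν : Heis n → FrameVec n) (p : Heis n) : ‖(ν p).1‖ • nuH ν p = (ν p).1 := by
  rw [nuH, smul_smul]
  by_cases h : (ν p).1 = 0
  · simp [h]
  · rw [mul_inv_cancel₀ (norm_ne_zero_iff.2 h), one_smul]

namespace LevelChart

variable {f : Heis n → ℝ} (c : LevelChart n f)

/-- The parameter of a point of the level set. -/
def paramInv (q : Heis n) : Fin (2 * n) → ℝ := (horCoord n).symm (c.toPH q).1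

/-- The parameter components of a tangent vector of the level set. -/
def liftTangent (q : Heis n) : FrameVec n →L[ℝ] (Fin (2 * n) → ℝ) :=
  ((horCoord n).symm : Hor n →L[ℝ] (Fin (2 * n) → ℝ)) ∘L fstH ∘L
    fderiv ℝ c.toPH q ∘L toCoord q

theorem slice_paramInv {q : Heis n} (hq : q ∈ c.toPH.source) (h0 : f q = 0) :
    slice n (c.paramInv q) = c.toPH q := by
  rw [slice_apply, paramInv, (horCoord n).apply_symm_apply, ← h0, ← c.snd_eq q hq]

theorem frameDeriv_liftTangent (hS : S ∩ c.toPH.source = {q ∈ c.toPH.source | f q = 0})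
    {q : Heis n} (hq : q ∈ c.toPH.source) (h0 : f q = 0) {w : FrameVec n} (hw : fd f q w = 0) :
    (c.param hS).frameDeriv (c.paramInv q) (c.liftTangent q w) = w := by
  have hs := c.slice_paramInv hq h0
  have ht : slice n (c.paramInv q) ∈ c.toPH.target := by rw [hs]; exact c.toPH.map_source hq
  have hm : (c.param hS).map (c.paramInv q) = q := by
    change c.toPH.symm (slice n (c.paramInv q)) = q
    rw [hs, c.toPH.left_inv hq]
  have h1 : fderiv ℝ (c.param hS).map (c.paramInv q) =
      fderiv ℝ c.toPH.symm (slice n (c.paramInv q)) ∘L slice n := (c.hasFDerivAt_param ht).fderiv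
  have h2 : slice n (c.liftTangent q w) = fderiv ℝ c.toPH q (toCoord q w) := by
    have : (fderiv ℝ c.toPH q (toCoord q w)).2 = 0 := by rw [c.fderiv_snd hq, ← fd_apply, hw]
    rw [slice_apply, ← this]
    simp [liftTangent]
  rw [LocalParam.frameDeriv, hm, ContinuousLinearMap.comp_apply, h1,
    ContinuousLinearMap.comp_apply, h2, hs, c.fderiv_symm_comp_fderiv hq, toFrame_toCoord]

theorem continuousOn_paramInv : ContinuousOn c.paramInv c.toPH.source :=
  ((horCoord n).symm.continuous.comp continuous_fst).comp_continuousOn c.toPH.continuousOn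

theorem continuousOn_liftTangent : ContinuousOn c.liftTangent c.toPH.source :=
  continuousOn_const.clm_comp (continuousOn_const.clm_comp
    ((c.smooth.continuousOn_fderiv_of_isOpen c.toPH.open_source (by norm_num)).clm_comp
      (contDiff_toCoord (k := 0)).continuous.continuousOn))

end LevelChart

/-- If the form `X ⌟ σ_H` of `X = ϖ³ ν_H^⊥` is continuous, then there are no characteristic
points: near such points it is unbounded. -/
theorem charSet_eq_empty (hS : IsOrientedHypersurface S ν) (hn : 1 ≤ n)
    (hX : ContractionContinuous S ν fun p => varpi ν p ^ 3 • nuPerp ν p) : charSet S ν = ∅ := by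
  obtain ⟨m, rfl⟩ : ∃ m, n = m + 1 := ⟨n - 1, by omega⟩
  by_contra hne
  obtain ⟨p, hpS, hp0⟩ := nonempty_iff_ne_empty.2 hne
  obtain ⟨f, c, hpc, hd⟩ := hS.exists_chart hpS
  have hidx : 2 * m + 1 + 2 = 2 * (m + 1) + 1 := by ring
  let Ω := volForm (m + 1) (2 * m + 1 + 2) hidx
  obtain ⟨β, hβ, hβeq⟩ := hX (2 * m + 1) hidx (c.param hd.inter_eq)
  set F₀ : Filter (Heis (m + 1)) := 𝓝[S] p ⊓ 𝓟 {q | (ν q).1 ≠ 0}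
  have hF₀ : F₀.NeBot := frequently_mem_iff_neBot.1 (hS.frequently_notMem_charSet hn hpS)
  have hsphere : ∀ᶠ x in F₀, nuH ν x ∈ Metric.sphere (0 : Hor (m + 1)) 1 := by
    have : ∀ᶠ x in F₀, (ν x).1 ≠ 0 := mem_inf_of_right (mem_principal_self _)
    filter_upwards [this] with x hx
    simpa using norm_nuH hx
  obtain ⟨q₀, hq₀, hq₀'⟩ := (isCompact_sphere (0 : Hor (m + 1)) 1).exists_clusterPt
    (f := map (nuH ν) F₀) (by rwa [le_principal_iff])
  obtain ⟨𝒰, h𝒰, h𝒰q⟩ : ∃ 𝒰 : Filter (Heis (m + 1)), 𝒰.NeBot ∧ 𝒰 ≤ F₀ ∧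
      Tendsto (nuH ν) 𝒰 (𝓝 q₀) := by
    have h1 : MapClusterPt q₀ F₀ (nuH ν) := hq₀'
    obtain ⟨U, hU, hUq⟩ := mapClusterPt_iff_ultrafilter.1 h1
    exact ⟨U, inferInstance, hU, hUq⟩
  obtain ⟨h𝒰F, htq⟩ := h𝒰q
  obtain ⟨b, hbq, hb⟩ := exists_volForm_ne_zero hidx (by simpa using hq₀ : ‖q₀‖ = 1)
  have h𝒰S : 𝒰 ≤ 𝓝[S] p := h𝒰F.trans inf_le_left
  have h𝒰p : 𝒰 ≤ 𝓝 p := h𝒰S.trans nhdsWithin_le_nhds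
  have hevS : ∀ᶠ x in 𝒰, x ∈ S := h𝒰S self_mem_nhdsWithin
  have hevN : ∀ᶠ x in 𝒰, (ν x).1 ≠ 0 := h𝒰F (mem_inf_of_right (mem_principal_self _))
  have hevc : ∀ᶠ x in 𝒰, x ∈ c.toPH.source := h𝒰p (c.toPH.open_source.mem_nhds hpc)
  have htν : Tendsto ν 𝒰 (𝓝 (ν p)) := (hS.continuousOn_normal p hpS).mono_left h𝒰S
  have htN : Tendsto (fun x => ‖(ν x).1‖) 𝒰 (𝓝 0) := by
    have := (continuous_fst.norm.tendsto (ν p)).comp htν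
    rwa [hp0, norm_zero] at this
  have htT : Tendsto (fun x => (ν x).2) 𝒰 (𝓝 (ν p).2) := (continuous_snd.tendsto _).comp htν
  have hT0 : (ν p).2 ≠ 0 := by
    intro h
    have := hS.metric_normal hpS
    simp [metric, hp0, h] at this
  -- the test vectors
  set w₀ : Heis (m + 1) → FrameVec (m + 1) := fun x => (-(ν x).2 • nuH ν x, ‖(ν x).1‖) with hw₀
  set w : Fin (2 * m) → Heis (m + 1) → FrameVec (m + 1) :=
    fun j x => (b j - inner ℝ (b j) (nuH ν x) • nuH ν x, 0) with hw
  have htw : ∀ j, Tendsto (w j) 𝒰 (𝓝 (b j, 0)) := by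
    intro j
    have : Tendsto (w j) 𝒰 (𝓝 (b j - inner ℝ (b j) q₀ • q₀, 0)) :=
      (tendsto_const_nhds.sub ((tendsto_const_nhds.inner htq).smul htq)).prodMk_nhds
        tendsto_const_nhds
    rwa [hbq, zero_smul, sub_zero] at this
  have htw₀ : Tendsto w₀ 𝒰 (𝓝 (-(ν p).2 • q₀, 0)) := (htT.neg.smul htq).prodMk_nhds htN
  have htan : ∀ᶠ x in 𝒰, fd f x (w₀ x) = 0 ∧ ∀ j, fd f x (w j x) = 0 := by
    filter_upwards [hevS, hevN, hevc] with x hxS hxN hxc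
    have hi : inner ℝ (ν x).1 (nuH ν x) = ‖(ν x).1‖ := by
      conv_lhs => rw [← smul_nuH ν x]
      rw [inner_smul_left, real_inner_self_eq_norm_sq, norm_nuH hxN]; simp
    have hi2 : ∀ v, inner ℝ (ν x).1 v = ‖(ν x).1‖ * inner ℝ v (nuH ν x) := by
      intro v
      conv_lhs => rw [← smul_nuH ν x]
      rw [inner_smul_left, real_inner_comm]; simp
    constructor
    · rw [hd.fd_eq hxS hxc]
      simp only [metric, hw₀, inner_smul_right, hi]
      ring
    · intro j
      rw [hd.fd_eq hxS hxc]
      simp only [metric, hw]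
      rw [inner_sub_right, inner_smul_right, hi, hi2]
      ring
  set W : Heis (m + 1) → Fin (2 * m + 1) → FrameVec (m + 1) :=
    fun x => Fin.cons (w₀ x) fun j => w j x with hW
  set Φ : Heis (m + 1) → ℝ := fun x => Ω
    (Fin.cons (nuH ν x, 0) (Fin.cons (perp (nuH ν x), 0)
      (Fin.cons (0, 1) fun j => w j x))) with hΦ
  have htΦ : Tendsto Φ 𝒰 (𝓝 (Ω (Fin.cons (q₀, 0)
      (Fin.cons (perp q₀, 0) (Fin.cons (0, 1) fun j => (b j, 0)))))) := by
    refine (Ω.cont.tendsto _).comp ?_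
    refine tendsto_pi_nhds.2 (Fin.cases ?_ (Fin.cases ?_ (Fin.cases ?_ fun j => ?_)))
    · exact htq.prodMk_nhds tendsto_const_nhds
    · exact ((perpL.continuous.tendsto q₀).comp htq).prodMk_nhds tendsto_const_nhds
    · exact tendsto_const_nhds
    · exact htw j
  have hkey : ∀ᶠ x in 𝒰, ‖(ν x).1‖ ^ 2 *
      β (c.paramInv x) (fun i => c.liftTangent x (W x i)) = (ν x).2 ^ 3 * Φ x := by
    filter_upwards [hevS, hevN, hevc, htan] with x hxS hxN hxc hxt
    have hx0 := hd.eq_zero hxS hxc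
    have hdom : c.paramInv x ∈ (c.param hd.inter_eq).dom := by
      change LevelChart.slice (m + 1) (c.paramInv x) ∈ c.toPH.target
      rw [c.slice_paramInv hxc hx0]; exact c.toPH.map_source hxc
    have hm : (c.param hd.inter_eq).map (c.paramInv x) = x := by
      change c.toPH.symm (LevelChart.slice (m + 1) (c.paramInv x)) = x
      rw [c.slice_paramInv hxc hx0, c.toPH.left_inv hxc]
    rw [hβeq _ hdom (by rw [hm]; exact fun h => hxN h.2)]
    have hWx : (fun i => (c.param hd.inter_eq).frameDeriv (c.paramInv x)
        (c.liftTangent x (W x i))) = W x := by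
      funext i
      refine Fin.cases ?_ (fun j => ?_) i
      · exact c.frameDeriv_liftTangent hd.inter_eq hxc hx0 hxt.1
      · exact c.frameDeriv_liftTangent hd.inter_eq hxc hx0 (hxt.2 j)
    set ψ := (Ω.curryLeft (nuH ν x, 0)).curryLeft
      (perp (nuH ν x), 0) with hψ
    have e1 : (c.param hd.inter_eq).pullback ν (fun p => varpi ν p ^ 3 • nuPerp ν p) hidx
        (c.paramInv x) (fun i => c.liftTangent x (W x i)) = varpi ν x ^ 3 * ψ (W x) := by
      rw [LocalParam.pullback, hm, ContinuousAlternatingMap.compContinuousLinearMap_apply]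
      have : ((varpi ν x ^ 3 • nuPerp ν x, 0) : FrameVec (m + 1)) =
        varpi ν x ^ 3 • (perp (nuH ν x), 0) := by simp [nuPerp]
      rw [this, map_smul]
      change varpi ν x ^ 3 * ψ _ = _
      congr 2
    have e2 : ψ (W x) = ‖(ν x).1‖ * Φ x := by
      have h3 : ψ (W x) = ψ.curryLeft (w₀ x) fun j => w j x := rfl
      have h4 : w₀ x = ‖(ν x).1‖ • (0, 1) + (-(ν x).2) • (nuH ν x, 0) := by simp [hw₀]
      have h5 : ψ.curryLeft (nuH ν x, 0) (fun j => w j x) = 0 := by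
        change Ω (Fin.cons (nuH ν x, 0)
          (Fin.cons (perp (nuH ν x), 0) (Fin.cons (nuH ν x, 0) fun j => w j x))) = 0
        refine Ω.map_eq_zero_of_eq _ (i := 0)
          (j := (Fin.succ (Fin.succ 0))) rfl ?_
        exact (Fin.succ_ne_zero _).symm
      rw [h3, h4, map_add, map_smul, map_smul, ContinuousAlternatingMap.add_apply,
        ContinuousAlternatingMap.smul_apply, ContinuousAlternatingMap.smul_apply, h5, smul_zero,
        add_zero, smul_eq_mul]
      rfl
    rw [e1, e2, varpi]
    have := norm_ne_zero_iff.2 hxN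
    field_simp
  have htu : Tendsto c.paramInv 𝒰 (𝓝 (c.paramInv p)) :=
    (c.continuousOn_paramInv.continuousAt (c.toPH.open_source.mem_nhds hpc)).tendsto.mono_left h𝒰p
  have htL : Tendsto c.liftTangent 𝒰 (𝓝 (c.liftTangent p)) :=
    (c.continuousOn_liftTangent.continuousAt
      (c.toPH.open_source.mem_nhds hpc)).tendsto.mono_left h𝒰p
  have hβt : Tendsto (fun x => β (c.paramInv x)) 𝒰 (𝓝 (β (c.paramInv p))) := by
    have hdom : c.paramInv p ∈ (c.param hd.inter_eq).dom := by
      change LevelChart.slice (m + 1) (c.paramInv p) ∈ c.toPH.target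
      rw [c.slice_paramInv hpc (hd.eq_zero hpS hpc)]; exact c.toPH.map_source hpc
    exact (hβ.continuousAt ((c.param hd.inter_eq).isOpen_dom.mem_nhds hdom)).tendsto.comp htu
  obtain ⟨W₀, htW⟩ : ∃ W₀ : Fin (2 * m + 1) → FrameVec (m + 1),
      ∀ i, Tendsto (fun x => W x i) 𝒰 (𝓝 (W₀ i)) :=
    ⟨Fin.cons (-(ν p).2 • q₀, 0) fun j => (b j, 0), Fin.cases htw₀ htw⟩
  have hbd : Tendsto (fun x => ‖(ν x).1‖ ^ 2 *
      β (c.paramInv x) (fun i => c.liftTangent x (W x i))) 𝒰 (𝓝 0) := by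
    have h1 : Tendsto (fun x => ‖(ν x).1‖ ^ 2 * (‖β (c.paramInv x)‖ *
        ∏ i, ‖c.liftTangent x (W x i)‖)) 𝒰
        (𝓝 (0 ^ 2 * (‖β (c.paramInv p)‖ * ∏ i, ‖c.liftTangent p (W₀ i)‖))) :=
      (htN.pow 2).mul (hβt.norm.mul (tendsto_finsetProd _ fun i _ => ((isBoundedBilinearMap_apply.continuous.tendsto
        (c.liftTangent p, W₀ i)).comp (htL.prodMk_nhds (htW i))).norm))
    rw [zero_pow two_ne_zero, zero_mul] at h1
    refine squeeze_zero_norm (fun x => ?_) h1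
    rw [norm_mul, norm_pow, norm_norm]
    exact mul_le_mul_of_nonneg_left ((β (c.paramInv x)).le_opNorm _) (by positivity)
  have hfin := tendsto_nhds_unique (hbd.congr' hkey) ((htT.pow 3).mul htΦ)
  exact mul_ne_zero (pow_ne_zero 3 hT0) hb hfin.symm

end char

/-! ## Horizontal calculus of a defining function -/

/-- The horizontal gradient. -/
def hgrad (f : Heis n → ℝ) (p : Heis n) : Hor n := (rgrad f p).1

/-- The vertical derivative. -/
def vder (f : Heis n → ℝ) (p : Heis n) : ℝ := (rgrad f p).2

/-- The normalised horizontal gradient. -/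
def unitH (f : Heis n → ℝ) (p : Heis n) : Hor n := ‖hgrad f p‖⁻¹ • hgrad f p

/-- The quotient of the vertical derivative and the length of the horizontal gradient. -/
def slope (f : Heis n → ℝ) (p : Heis n) : ℝ := vder f p / ‖hgrad f p‖

/-- The horizontal Hessian. -/
def hess (f : Heis n → ℝ) (p : Heis n) : Hor n →L[ℝ] Hor n :=
  fd (hgrad f) p ∘L inlH

/-- The vertical derivative of the horizontal gradient. -/
def tgrad (f : Heis n → ℝ) (p : Heis n) : Hor n := fd (hgrad f) p (0, 1)

/-- A `C²` function without characteristic points on an open set. -/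
structure IsHorizontallyRegular (f : Heis n → ℝ) (V : Set (Heis n)) : Prop where
  isOpen : IsOpen V
  contDiffOn : ContDiffOn ℝ 2 f V
  hgrad_ne : ∀ p ∈ V, hgrad f p ≠ 0

section calculus

variable {f : Heis n → ℝ} {p : Heis n}

theorem fd_norm {Y : Heis n → Hor n} (hY : DifferentiableAt ℝ Y p) (h0 : Y p ≠ 0)
    (v : FrameVec n) : fd (fun q => ‖Y q‖) p v = inner ℝ (‖Y p‖⁻¹ • Y p) (fd Y p v) := by
  have h1 : HasFDerivAt (fun q => Real.sqrt (inner ℝ (Y q) (Y q))) _ p :=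
    (hY.hasFDerivAt.inner ℝ hY.hasFDerivAt).sqrt (by simpa using h0)
  have h2 : (fun q => ‖Y q‖) = fun q => Real.sqrt (inner ℝ (Y q) (Y q)) := by
    ext q; rw [real_inner_self_eq_norm_sq, Real.sqrt_sq (norm_nonneg _)]
  have h3 := norm_ne_zero_iff.2 h0
  rw [fd_apply, h2, h1.fderiv]
  simp only [smul_apply, ContinuousLinearMap.comp_apply, smul_eq_mul,
    ContinuousLinearMap.prod_apply, fderivInnerCLM_apply, real_inner_self_eq_norm_sq,
    Real.sqrt_sq (norm_nonneg (Y p)), inner_smul_left, fd_apply, real_inner_comm (Y p)]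
  simp only [conj_trivial]
  field_simp
  ring

theorem fd_inv_norm_smul {Y : Heis n → Hor n} (hY : DifferentiableAt ℝ Y p) (h0 : Y p ≠ 0)
    (v : FrameVec n) : fd (fun q => ‖Y q‖⁻¹ • Y q) p v =
      ‖Y p‖⁻¹ • (fd Y p v - inner ℝ (‖Y p‖⁻¹ • Y p) (fd Y p v) • (‖Y p‖⁻¹ • Y p)) := by
  have h3 := norm_ne_zero_iff.2 h0
  have hn : DifferentiableAt ℝ (fun q => ‖Y q‖) p := hY.norm ℝ h0
  have hi : DifferentiableAt ℝ (fun q => ‖Y q‖⁻¹) p := hn.inv h3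
  rw [fd_smul hi hY, fd_comp_real (g := fun x => x⁻¹) (differentiableAt_inv h3) hn,
    fd_norm hY h0, deriv_inv]
  module

theorem inner_fd_hgrad (hf : ContDiffAt ℝ 2 f p) (v : FrameVec n) (w : Hor n) :
    inner ℝ (fd (hgrad f) p v) w = fd (fun q => fd f q (w, 0)) p v := by
  obtain ⟨U, hU, hfU⟩ := hf.contDiffOn le_rfl (by simp)
  have hd : DifferentiableAt ℝ (hgrad f) p := by
    obtain ⟨W, hWU, hWo, hpW⟩ := mem_nhds_iff.1 hU
    have := contDiffOn_rgrad hWo (hfU.mono (by simpa using hWU)) (k := 1) (by norm_num)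
    exact ((this.contDiffAt (hWo.mem_nhds hpW)).differentiableAt (by norm_num)).fst
  have h1 : (fun q => fd f q (w, 0)) = fun q => innerSL ℝ w (hgrad f q) := by
    ext q; rw [innerSL_apply_apply, real_inner_comm, hgrad, inner_rgrad_fst]
  have h2 : HasFDerivAt (fun q => innerSL ℝ w (hgrad f q)) (innerSL ℝ w ∘L fderiv ℝ (hgrad f) p) p :=
    (innerSL ℝ w).hasFDerivAt.comp p hd.hasFDerivAt
  rw [h1]
  change _ = fderiv ℝ (fun q => innerSL ℝ w (hgrad f q)) p (toCoord p v)
  rw [h2.fderiv, ContinuousLinearMap.comp_apply, innerSL_apply_apply, real_inner_comm, fd_apply]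

theorem hess_comm (hf : ContDiffAt ℝ 2 f p) (v w : Hor n) :
    inner ℝ (hess f p v) w - inner ℝ (hess f p w) v = symp v w * vder f p := by
  have h := fd_fd_comm hf (v, 0) (w, 0)
  rw [← inner_fd_hgrad hf, ← inner_fd_hgrad hf] at h
  exact h

theorem fd_vder (hf : ContDiffAt ℝ 2 f p) (v : Hor n) :
    fd (vder f) p (v, 0) = inner ℝ (tgrad f p) v := by
  have h := fd_fd_comm hf (v, 0) (0, 1)
  rw [← inner_fd_hgrad hf] at h
  simp only [map_zero, zero_smul, sub_eq_zero] at h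
  exact h

theorem fd_hgrad (f : Heis n → ℝ) (p : Heis n) (v : FrameVec n) :
    fd (hgrad f) p v = hess f p v.1 + v.2 • tgrad f p := by
  have : v = (v.1, 0) + v.2 • (0, 1) := by simp
  conv_lhs => rw [this]
  rw [map_add, map_smul]; rfl

namespace IsHorizontallyRegular

variable {V : Set (Heis n)} (h : IsHorizontallyRegular f V)
include h

theorem contDiffAt (hp : p ∈ V) : ContDiffAt ℝ 2 f p := h.contDiffOn.contDiffAt (h.isOpen.mem_nhds hp)

theorem contDiffOn_hgrad : ContDiffOn ℝ 1 (hgrad f) V :=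
  contDiff_fst.comp_contDiffOn (contDiffOn_rgrad h.isOpen h.contDiffOn (k := 1) (by norm_num))

theorem contDiffOn_vder : ContDiffOn ℝ 1 (vder f) V :=
  contDiff_snd.comp_contDiffOn (contDiffOn_rgrad h.isOpen h.contDiffOn (k := 1) (by norm_num))

theorem contDiffOn_norm : ContDiffOn ℝ 1 (fun p => ‖hgrad f p‖) V :=
  h.contDiffOn_hgrad.norm ℝ h.hgrad_ne

theorem contDiffOn_unitH : ContDiffOn ℝ 1 (unitH f) V :=
  (h.contDiffOn_norm.inv fun p hp => norm_ne_zero_iff.2 (h.hgrad_ne p hp)).smul h.contDiffOn_hgrad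

theorem contDiffOn_slope : ContDiffOn ℝ 1 (slope f) V :=
  h.contDiffOn_vder.div h.contDiffOn_norm fun p hp => norm_ne_zero_iff.2 (h.hgrad_ne p hp)

theorem differentiableAt {F : Type*} [NormedAddCommGroup F] [NormedSpace ℝ F]
    {Y : Heis n → F} (hY : ContDiffOn ℝ 1 Y V) (hp : p ∈ V) : DifferentiableAt ℝ Y p :=
  (hY.contDiffAt (h.isOpen.mem_nhds hp)).differentiableAt (by norm_num)

theorem differentiableAt_hgrad (hp : p ∈ V) : DifferentiableAt ℝ (hgrad f) p :=
  h.differentiableAt h.contDiffOn_hgrad hp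

theorem differentiableAt_vder (hp : p ∈ V) : DifferentiableAt ℝ (vder f) p :=
  h.differentiableAt h.contDiffOn_vder hp

theorem differentiableAt_unitH (hp : p ∈ V) : DifferentiableAt ℝ (unitH f) p :=
  h.differentiableAt h.contDiffOn_unitH hp

theorem differentiableAt_slope (hp : p ∈ V) : DifferentiableAt ℝ (slope f) p :=
  h.differentiableAt h.contDiffOn_slope hp

theorem norm_unitH (hp : p ∈ V) : ‖unitH f p‖ = 1 := by
  rw [unitH, norm_smul, norm_inv, norm_norm,
    inv_mul_cancel₀ (norm_ne_zero_iff.2 (h.hgrad_ne p hp))]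

theorem norm_smul_unitH (hp : p ∈ V) : ‖hgrad f p‖ • unitH f p = hgrad f p := by
  rw [unitH, smul_smul, mul_inv_cancel₀ (norm_ne_zero_iff.2 (h.hgrad_ne p hp)), one_smul]

theorem norm_mul_slope (hp : p ∈ V) : ‖hgrad f p‖ * slope f p = vder f p :=
  mul_div_cancel₀ _ (norm_ne_zero_iff.2 (h.hgrad_ne p hp))

theorem fd_norm_hgrad (hp : p ∈ V) (v : FrameVec n) :
    fd (fun q => ‖hgrad f q‖) p v = inner ℝ (unitH f p) (fd (hgrad f) p v) :=
  fd_norm (h.differentiableAt_hgrad hp) (h.hgrad_ne p hp) v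

theorem fd_unitH (hp : p ∈ V) (v : FrameVec n) :
    fd (unitH f) p v = ‖hgrad f p‖⁻¹ • (fd (hgrad f) p v -
      inner ℝ (unitH f p) (fd (hgrad f) p v) • unitH f p) :=
  fd_inv_norm_smul (h.differentiableAt_hgrad hp) (h.hgrad_ne p hp) v

theorem fd_slope (hp : p ∈ V) (v : FrameVec n) :
    fd (slope f) p v = ‖hgrad f p‖⁻¹ * (fd (vder f) p v -
      slope f p * inner ℝ (unitH f p) (fd (hgrad f) p v)) := by
  have h3 := norm_ne_zero_iff.2 (h.hgrad_ne p hp)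
  have hn := h.differentiableAt h.contDiffOn_norm hp
  have hv := h.differentiableAt_vder hp
  have hi : DifferentiableAt ℝ (fun q => ‖hgrad f q‖⁻¹) p := hn.inv h3
  have h1 : fd (slope f) p = fd (fun q => ‖hgrad f q‖⁻¹ • vder f q) p := by
    congr 1; ext q; rw [slope, smul_eq_mul, div_eq_inv_mul]
  rw [h1, fd_smul hi hv, fd_comp_real (g := fun x => x⁻¹) (differentiableAt_inv h3) hn,
    h.fd_norm_hgrad hp, deriv_inv, slope]
  simp only [smul_eq_mul]
  field_simp
  ring

end IsHorizontallyRegular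

/-- The trace of a map on frame vectors. -/
theorem trace_frame (A : FrameVec n →ₗ[ℝ] FrameVec n) : LinearMap.trace ℝ _ A =
    LinearMap.trace ℝ (Hor n) (LinearMap.fst ℝ (Hor n) ℝ ∘ₗ A ∘ₗ LinearMap.inl ℝ (Hor n) ℝ) +
      (A (0, 1)).2 := by
  have h1 : A = (LinearMap.inl ℝ (Hor n) ℝ ∘ₗ LinearMap.fst ℝ (Hor n) ℝ) ∘ₗ A +
      (LinearMap.snd ℝ (Hor n) ℝ ∘ₗ A).smulRight ((0 : Hor n), (1 : ℝ)) := by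
    ext v <;> simp
  conv_lhs => rw [h1]
  rw [map_add, trace_smulRight]
  congr 1
  exact (LinearMap.trace_comp_comm' (LinearMap.inl ℝ (Hor n) ℝ)
    (LinearMap.fst ℝ (Hor n) ℝ ∘ₗ A)).symm

theorem frameDiv_eq {X : Heis n → FrameVec n} (hX : DifferentiableAt ℝ X p) :
    frameDiv X p = LinearMap.trace ℝ (Hor n) ((fd (fun q => (X q).1) p ∘L
      inlH : Hor n →L[ℝ] Hor n) : Hor n →ₗ[ℝ] Hor n) +
      fd (fun q => (X q).2) p (0, 1) := by
  have h1 : ∀ v, fd (fun q => (X q).1) p v = (fd X p v).1 := fun v => by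
    rw [fd_apply, hX.hasFDerivAt.fst.fderiv]; rfl
  have h2 : ∀ v, fd (fun q => (X q).2) p v = (fd X p v).2 := fun v => by
    rw [fd_apply, hX.hasFDerivAt.snd.fderiv]; rfl
  rw [frameDiv, trace_frame, h2]
  congr 2
  ext1 v
  exact (h1 (v, 0)).symm

theorem trace_hor_eq_sum (A : Hor n →ₗ[ℝ] Hor n) : LinearMap.trace ℝ (Hor n) A =
    ∑ i : Fin n × Fin 2, inner ℝ (EuclideanSpace.single i 1) (A (EuclideanSpace.single i 1)) := by
  rw [LinearMap.trace_eq_sum_inner A (EuclideanSpace.basisFun (Fin n × Fin 2) ℝ)]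
  simp

theorem fd_perp {Y : Heis n → Hor n} (hY : DifferentiableAt ℝ Y p) (v : FrameVec n) :
    fd (fun q => perp (Y q)) p v = perp (fd Y p v) := by
  have : HasFDerivAt (fun q => perpL (Y q)) (perpL ∘L fderiv ℝ Y p) p :=
    perpL.hasFDerivAt.comp p hY.hasFDerivAt
  rw [fd_apply]
  change fderiv ℝ (fun q => perpL (Y q)) p _ = _
  rw [this.fderiv]; rfl

theorem trace_perp_comp {A : Hor n →L[ℝ] Hor n} {τ : ℝ}
    (hA : ∀ v w, inner ℝ (A v) w - inner ℝ (A w) v = symp v w * τ) :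
    LinearMap.trace ℝ (Hor n) ((perpL ∘L A : Hor n →L[ℝ] Hor n) : Hor n →ₗ[ℝ] Hor n) = -(n * τ) := by
  rw [trace_hor_eq_sum, Fintype.sum_prod_type]
  have h1 : ∀ i : Fin n, symp (EuclideanSpace.single (i, (0 : Fin 2)) (1 : ℝ))
      (EuclideanSpace.single (i, 1) 1) = 1 := by
    intro i
    rw [symp_apply, Finset.sum_eq_single i]
    · simp
    · intro j _ hj; simp [hj]
    · simp
  have h2 : ∀ i : Fin n, ∑ j : Fin 2, inner ℝ (EuclideanSpace.single (i, j) (1 : ℝ))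
      ((perpL ∘L A) (EuclideanSpace.single (i, j) 1)) = -τ := by
    intro i
    have h3 := hA (EuclideanSpace.single (i, 0) 1) (EuclideanSpace.single (i, 1) 1)
    rw [h1, one_mul] at h3
    simp only [EuclideanSpace.inner_single_right, conj_trivial, one_mul] at h3
    rw [Fin.sum_univ_two]
    simp [EuclideanSpace.inner_single_left]
    linarith
  refine (Finset.sum_congr rfl fun i _ => ?_).trans (b := ∑ i : Fin n, -τ) ?_
  · exact h2 i
  · simp

end calculus

section surface

variable {S : Set (Heis n)} {ν : Heis n → FrameVec n} {f : Heis n → ℝ} {V : Set (Heis n)}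
  {p : Heis n}

theorem IsOrientedHypersurface.integral_sigmaH (hS : IsOrientedHypersurface S ν)
    (hSm : MeasurableSet S) (g : Heis n → ℝ) :
    ∫ p, g p ∂(sigmaH S ν) = ∫ p, ‖(ν p).1‖ * g p ∂(sigmaR S ν) := by
  rw [hS.sigmaH_eq hSm, integral_withDensity_eq_integral_toReal_smul₀ (hS.aemeasurable_norm_normal hSm)
    (Eventually.of_forall fun _ => ENNReal.ofReal_lt_top)]
  refine integral_congr_ae (Eventually.of_forall fun p => ?_)
  change (ENNReal.ofReal ‖(ν p).1‖).toReal • _ = _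
  rw [ENNReal.toReal_ofReal (norm_nonneg _)]; rfl

theorem IsOrientedHypersurface.integrable_sigmaH_iff (hS : IsOrientedHypersurface S ν)
    (hSm : MeasurableSet S) (g : Heis n → ℝ) :
    Integrable g (sigmaH S ν) ↔ Integrable (fun p => ‖(ν p).1‖ * g p) (sigmaR S ν) := by
  rw [hS.sigmaH_eq hSm, integrable_withDensity_iff_integrable_smul₀'
    (hS.aemeasurable_norm_normal hSm)
    (Eventually.of_forall fun _ => ENNReal.ofReal_lt_top)]
  refine integrable_congr (Eventually.of_forall fun p => ?_)
  change (ENNReal.ofReal ‖(ν p).1‖).toReal • _ = _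
  rw [ENNReal.toReal_ofReal (norm_nonneg _)]; rfl

theorem IsOrientedHypersurface.integrable_sigmaH_of_continuousOn
    (hS : IsOrientedHypersurface S ν) (hSc : IsCompact S) {g : Heis n → ℝ}
    (hg : ContinuousOn g S) : Integrable g (sigmaH S ν) := by
  rw [hS.integrable_sigmaH_iff hSc.measurableSet]
  exact hS.integrable_of_continuousOn hSc
    ((continuous_fst.comp_continuousOn hS.continuousOn_normal).norm.mul hg)

theorem ae_mem_sigmaR (hSm : MeasurableSet S) : ∀ᵐ p ∂(sigmaR S ν), p ∈ S :=
  mem_ae_iff.2 (IsOrientedHypersurface.sigmaR_compl hSm)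

namespace IsDefiningOn

variable (hd : IsDefiningOn S ν f V)
include hd

/-- Restriction of a defining function to the noncharacteristic points. -/
theorem restrict_hgrad : IsDefiningOn S ν f (V ∩ {q | hgrad f q ≠ 0}) ∧
    IsHorizontallyRegular f (V ∩ {q | hgrad f q ≠ 0}) := by
  have ho : IsOpen (V ∩ {q | hgrad f q ≠ 0}) :=
    (continuous_fst.comp_continuousOn hd.continuousOn_rgrad).isOpen_inter_preimage hd.isOpen
      isOpen_compl_singleton
  exact ⟨hd.mono ho inter_subset_left, ho, hd.contDiffOn.mono inter_subset_left, fun q hq => hq.2⟩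

theorem hgrad_eq (hp : p ∈ S) (hV : p ∈ V) : hgrad f p = rnorm (rgrad f p) • (ν p).1 := by
  rw [hgrad, hd.rgrad_eq hp hV]
  simp only [Prod.smul_fst]
  rw [← hd.rgrad_eq hp hV]

theorem vder_eq (hp : p ∈ S) (hV : p ∈ V) : vder f p = rnorm (rgrad f p) * (ν p).2 := by
  rw [vder, hd.rgrad_eq hp hV]
  simp only [Prod.smul_snd, smul_eq_mul]
  rw [← hd.rgrad_eq hp hV]

theorem rnorm_pos (hp : p ∈ S) (hV : p ∈ V) : 0 < rnorm (rgrad f p) :=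
  Heisenberg.rnorm_pos (hd.rgrad_ne p ⟨hp, hV⟩)

theorem norm_hgrad (hp : p ∈ S) (hV : p ∈ V) :
    ‖hgrad f p‖ = rnorm (rgrad f p) * ‖(ν p).1‖ := by
  rw [hd.hgrad_eq hp hV, norm_smul, Real.norm_of_nonneg (hd.rnorm_pos hp hV).le]

theorem norm_hgrad_div (hp : p ∈ S) (hV : p ∈ V) :
    ‖hgrad f p‖ / rnorm (rgrad f p) = ‖(ν p).1‖ := by
  rw [hd.norm_hgrad hp hV, mul_div_cancel_left₀ _ (hd.rnorm_pos hp hV).ne']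

theorem nuH_eq (hp : p ∈ S) (hV : p ∈ V) : nuH ν p = unitH f p := by
  rw [nuH, unitH, hd.norm_hgrad hp hV, hd.hgrad_eq hp hV, smul_smul]
  have := (hd.rnorm_pos hp hV).ne'
  congr 1
  rw [mul_inv, mul_comm, ← mul_assoc, mul_inv_cancel₀ this, one_mul]

theorem varpi_eq (hp : p ∈ S) (hV : p ∈ V) : varpi ν p = slope f p := by
  rw [varpi, slope, hd.norm_hgrad hp hV, hd.vder_eq hp hV,
    mul_div_mul_left _ _ (hd.rnorm_pos hp hV).ne']

theorem eventually_nuH_eq (hV : p ∈ V) : nuH ν =ᶠ[𝓝[S] p] unitH f := by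
  filter_upwards [self_mem_nhdsWithin, mem_nhdsWithin_of_mem_nhds (hd.isOpen.mem_nhds hV)]
    with q hq hqV using hd.nuH_eq hq hqV

theorem eventually_varpi_eq (hV : p ∈ V) : varpi ν =ᶠ[𝓝[S] p] slope f := by
  filter_upwards [self_mem_nhdsWithin, mem_nhdsWithin_of_mem_nhds (hd.isOpen.mem_nhds hV)]
    with q hq hqV using hd.varpi_eq hq hqV

theorem metric_normal_hor_eq_zero (hp : p ∈ S) (hV : p ∈ V) {v : Hor n}
    (hv : inner ℝ (unitH f p) v = 0) : metric (ν p) (v, 0) = 0 := by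
  have : (ν p).1 = ‖(ν p).1‖ • unitH f p := by rw [← hd.nuH_eq hp hV, smul_nuH]
  rw [metric, this, inner_smul_left, hv]
  simp

variable (hr : IsHorizontallyRegular f V) (hS : IsOrientedHypersurface S ν)

include hr

theorem normal_fst_ne (hp : p ∈ S) (hV : p ∈ V) : (ν p).1 ≠ 0 := by
  intro h
  have := hr.hgrad_ne p hV
  rw [hd.hgrad_eq hp hV, h, smul_zero] at this
  exact this rfl

include hS

theorem dS_varpi (hp : p ∈ S) (hV : p ∈ V) {v : Hor n} (hv : inner ℝ (unitH f p) v = 0) :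
    dS S (varpi ν) p v = fd (slope f) p (v, 0) :=
  hS.fderivWithin_self_eq hp (hd.metric_normal_hor_eq_zero hp hV hv)
    (hr.differentiableAt_slope hV) (hd.eventually_varpi_eq hV)

theorem dS_nuH (hp : p ∈ S) (hV : p ∈ V) {v : Hor n} (hv : inner ℝ (unitH f p) v = 0) :
    dS S (nuH ν) p v = fd (unitH f) p (v, 0) :=
  hS.fderivWithin_self_eq hp (hd.metric_normal_hor_eq_zero hp hV hv)
    (hr.differentiableAt_unitH hV) (hd.eventually_nuH_eq hV)

theorem dVarpi_eq (hp : p ∈ S) (hV : p ∈ V) :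
    dVarpi S ν p = fd (slope f) p (perp (unitH f p), 0) := by
  rw [dVarpi, nuPerp, hd.nuH_eq hp hV, hd.dS_varpi hr hS hp hV (inner_self_perp _)]

end IsDefiningOn

theorem IsHorizontallyRegular.frameDiv_perp (hr : IsHorizontallyRegular f V) (hp : p ∈ V) :
    frameDiv (fun q => (perp (hgrad f q), 0)) p = -(n * vder f p) := by
  have h1 := hr.differentiableAt_hgrad hp
  have h2 : DifferentiableAt ℝ (fun q => ((perpL (hgrad f q), 0) : FrameVec n)) p :=
    (perpL.differentiableAt.comp p h1).prodMk (differentiableAt_const _)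
  change frameDiv (fun q => ((perpL (hgrad f q), 0) : FrameVec n)) p = _
  rw [frameDiv_eq h2]
  have h3 : fd (fun q : Heis n => (0 : ℝ)) p = 0 := by simp [fd]
  rw [show (fun q : Heis n => ((perpL (hgrad f q), 0) : FrameVec n).2) = fun _ => (0 : ℝ) from rfl, h3]
  have h4 : fd (fun q => ((perpL (hgrad f q), 0) : FrameVec n).1) p ∘L
      inlH = perpL ∘L hess f p := by
    refine ContinuousLinearMap.ext fun v => ?_
    exact fd_perp h1 _
  rw [h4, trace_perp_comp fun v w => hess_comm (hr.contDiffAt hp) v w]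
  simp

/-- Integration by parts in the characteristic direction. -/
theorem IsDefiningOn.setIntegral_perp (hd : IsDefiningOn S ν f V) (hr : IsHorizontallyRegular f V)
    (hS : IsOrientedHypersurface S ν) (hSc : IsCompact S) {F : Heis n → ℝ}
    (hF : ContDiffOn ℝ 1 F V) {K : Set (Heis n)} (hK : IsCompact K) (hKV : K ⊆ V)
    (hFK : ∀ p ∈ S ∩ V, p ∉ K → F =ᶠ[𝓝 p] fun _ => 0) :
    ∫ p in K, ‖(ν p).1‖ * (fd F p (perp (unitH f p), 0) - n * slope f p * F p) ∂(sigmaR S ν) = 0 := by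
  have hY : ContDiffOn ℝ 1 (fun q => ((perp (hgrad f q), 0) : FrameVec n)) V :=
    (perpL.contDiff.comp_contDiffOn hr.contDiffOn_hgrad).prodMk contDiffOn_const
  have h := setIntegral_frameDiv_div_rnorm hSc hS hd (X := fun q => F q • (perp (hgrad f q), 0))
    (hF.smul hY) (fun p hp => by
      rw [map_smul, ← inner_rgrad_fst]
      change F p • inner ℝ (hgrad f p) (perp (hgrad f p)) = 0
      rw [inner_self_perp, smul_zero]) hK hKV fun p hp hpK => by
        filter_upwards [hFK p hp hpK] with q hq
        rw [hq, zero_smul]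
  refine Eq.trans ?_ h
  refine setIntegral_congr_ae hK.measurableSet ?_
  filter_upwards [ae_mem_sigmaR hSc.measurableSet] with p hpS hpK
  have hpV := hKV hpK
  rw [frameDiv_smul (hr.differentiableAt hF hpV)
    (hr.differentiableAt hY hpV), hr.frameDiv_perp hpV, ← hd.norm_hgrad_div hpS hpV,
    ← hr.norm_mul_slope hpV]
  have h1 : ((perp (hgrad f p), 0) : FrameVec n) = ‖hgrad f p‖ • (perp (unitH f p), 0) := by
    rw [← hr.norm_smul_unitH hpV, perp_smul, norm_smul, hr.norm_unitH hpV]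
    simp
  rw [h1, map_smul, smul_eq_mul]
  ring

/-- The first integral formula. -/
theorem IsOrientedHypersurface.integral_varpi (hS : IsOrientedHypersurface S ν)
    (hSc : IsCompact S) (hchar : charSet S ν = ∅) :
    ContinuousOn (varpi ν) S ∧ ContinuousOn (dVarpi S ν) S ∧
    ∫ p, (3 * varpi ν p ^ 2 * dVarpi S ν p - n * varpi ν p ^ 4) ∂(sigmaH S ν) = 0 := by
  obtain ⟨f, V₀, -, hSV₀, hd₀, -⟩ := hS.exists_global hSc
  obtain ⟨hd, hr⟩ := hd₀.restrict_hgrad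
  set V := V₀ ∩ {q | hgrad f q ≠ 0}
  have hSV : S ⊆ V := by
    intro p hp
    refine ⟨hSV₀ hp, ?_⟩
    have h1 : (ν p).1 ≠ 0 := fun h => by
      have : p ∈ charSet S ν := ⟨hp, h⟩
      rw [hchar] at this; exact this
    change hgrad f p ≠ 0
    rw [hd₀.hgrad_eq hp (hSV₀ hp)]
    exact smul_ne_zero (hd₀.rnorm_pos hp (hSV₀ hp)).ne' h1
  have hc1 : ContinuousOn (varpi ν) S :=
    (hr.contDiffOn_slope.continuousOn.mono hSV).congr fun p hp => hd.varpi_eq hp (hSV hp)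
  have hc2 : ContinuousOn (dVarpi S ν) S := by
    have : ContinuousOn (fun p => fd (slope f) p (perpL (unitH f p), 0)) V :=
      (contDiffOn_fd hr.isOpen hr.contDiffOn_slope (k := 0) (by norm_num)).continuousOn.clm_apply
        ((perpL.continuous.comp_continuousOn hr.contDiffOn_unitH.continuousOn).prodMk
          continuousOn_const)
    exact (this.mono hSV).congr fun p hp => hd.dVarpi_eq hr hS hp (hSV hp)
  refine ⟨hc1, hc2, ?_⟩
  have hF : ContDiffOn ℝ 1 (fun p => slope f p ^ 3) V := hr.contDiffOn_slope.pow 3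
  have h := hd.setIntegral_perp hr hS hSc hF hSc hSV fun p hp hpS => absurd hp.1 hpS
  rw [IsOrientedHypersurface.restrict_sigmaR hSc.measurableSet] at h
  rw [hS.integral_sigmaH hSc.measurableSet]
  refine Eq.trans (integral_congr_ae ?_) h
  filter_upwards [ae_mem_sigmaR hSc.measurableSet] with p hp
  have h3 : deriv (fun x : ℝ => x ^ 3) (slope f p) = 3 * slope f p ^ 2 := by simp
  rw [fd_comp_real (g := fun x => x ^ 3) (by fun_prop)
    (hr.differentiableAt_slope (hSV hp)), h3,
    hd.dVarpi_eq hr hS hp (hSV hp), hd.varpi_eq hp (hSV hp)]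
  ring

/-- The integral formula for admissible `ϖ³ ν_H^⊥`. -/
theorem IsOrientedHypersurface.integral_of_admissible (hn : 1 ≤ n)
    (hS : IsOrientedHypersurface S ν) (hSc : IsCompact S)
    (hX : Admissible S ν fun p => varpi ν p ^ 3 • nuPerp ν p) :
    Integrable (fun p => 2 * varpi ν p ^ 2 * dVarpi S ν p - 2 * (n : ℝ) / 3 * varpi ν p ^ 4)
      (sigmaH S ν) ∧
    ∫ p, (2 * varpi ν p ^ 2 * dVarpi S ν p - 2 * (n : ℝ) / 3 * varpi ν p ^ 4)
      ∂(sigmaH S ν) = 0 := by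
  obtain ⟨h1, h2, h3⟩ := hS.integral_varpi hSc (charSet_eq_empty hS hn hX.2.2.1)
  refine ⟨hS.integrable_sigmaH_of_continuousOn hSc (by fun_prop), ?_⟩
  have h4 := congrArg (fun x => 2 / 3 * x) h3
  simp only [← integral_const_mul, mul_zero] at h4
  rw [← h4]
  refine integral_congr_ae (Eventually.of_forall fun p => ?_)
  simp only
  ring

end surface

/-! ## Weak symmetry of second derivatives -/

section weak

variable {E : Type*} [NormedAddCommGroup E] [NormedSpace ℝ E] [FiniteDimensional ℝ E]
  [MeasurableSpace E] [BorelSpace E] {μ : Measure E} [μ.IsAddHaarMeasure]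

theorem hasDerivAt_integral_mul_translate {A B : E → ℝ} (hA : Continuous A)
    (hB : ContDiff ℝ 1 B) (hBc : HasCompactSupport B) (w : E) :
    HasDerivAt (fun s : ℝ => ∫ x, A x * B (x + s • w) ∂μ) (∫ x, A x * fderiv ℝ B x w ∂μ) 0 := by
  set C : E → ℝ := fun z => B (-z) with hC
  have hCd : ContDiff ℝ 1 C := hB.comp contDiff_neg
  have hCc : HasCompactSupport C := hBc.comp_homeomorph (Homeomorph.neg E)
  have hAl : LocallyIntegrable A μ := hA.locallyIntegrable
  set L := ContinuousLinearMap.mul ℝ ℝ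
  have h1 := hCc.hasFDerivAt_convolution_right L hAl hCd (0 : E)
  have h2 : HasDerivAt (fun s : ℝ => s • (-w)) (-w) 0 := by
    simpa using (hasDerivAt_id (0 : ℝ)).smul_const (-w)
  have h1' : HasFDerivAt (convolution A C L μ)
      ((convolution A (fderiv ℝ C) (L.precompR E) μ) 0) ((0 : ℝ) • (-w)) := by rwa [zero_smul]
  have h3 := h1'.comp_hasDerivAt (0 : ℝ) h2
  have h4 : fderiv ℝ C = fun z => -fderiv ℝ B (-z) := by
    ext1 z
    have := ((hB.differentiable (by norm_num) (-z)).hasFDerivAt.comp z (hasFDerivAt_id z).neg).fderiv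
    rw [show fderiv ℝ C z = _ from this]
    ext v; simp
  rw [convolution_precompR_apply L hAl (hCc.fderiv ℝ) (hCd.continuous_fderiv (by norm_num))] at h3
  have e1 : (convolution A (fun a => fderiv ℝ C a (-w)) L μ) 0 =
      ∫ x, A x * fderiv ℝ B x w ∂μ := by
    simp only [convolution_def, h4, L, ContinuousLinearMap.mul_apply']
    refine integral_congr_ae (Eventually.of_forall fun x => ?_)
    simp
  rw [e1] at h3
  refine h3.congr_of_eventuallyEq (Eventually.of_forall fun s => ?_)
  simp only [Function.comp_apply, convolution_def, L, ContinuousLinearMap.mul_apply', hC]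
  refine integral_congr_ae (Eventually.of_forall fun x => ?_)
  simp only
  congr 2
  simp

/-- Weak form of the symmetry of second derivatives. -/
theorem integral_fderiv_mul_fderiv_symm {a b : E → ℝ} (ha : ContDiff ℝ 1 a)
    (hac : HasCompactSupport a) (hb : ContDiff ℝ 1 b) (hbc : HasCompactSupport b) (v w : E) :
    ∫ x, fderiv ℝ a x v * fderiv ℝ b x w ∂μ = ∫ x, fderiv ℝ a x w * fderiv ℝ b x v ∂μ := by
  have hav : Continuous fun x => fderiv ℝ a x v :=
    (ha.continuous_fderiv (by norm_num)).clm_apply continuous_const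
  have hbv : Continuous fun x => fderiv ℝ b x v :=
    (hb.continuous_fderiv (by norm_num)).clm_apply continuous_const
  have hac' : HasCompactSupport fun x => fderiv ℝ a x v := hac.fderiv_apply (𝕜 := ℝ) v
  have hbc' : HasCompactSupport fun x => fderiv ℝ b x v := hbc.fderiv_apply (𝕜 := ℝ) v
  have h1 := hasDerivAt_integral_mul_translate (μ := μ) hav hb hbc w
  have h2 := hasDerivAt_integral_mul_translate (μ := μ) hbv ha hac (-w)
  have h3 : ∀ s : ℝ, ∫ x, fderiv ℝ a x v * b (x + s • w) ∂μ =
      -∫ x, fderiv ℝ b x v * a (x + s • (-w)) ∂μ := by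
    intro s
    set b' : E → ℝ := fun x => b (x + s • w) with hb'
    have hb'd : ContDiff ℝ 1 b' := hb.comp (contDiff_id.add contDiff_const)
    have hb'c : HasCompactSupport b' := hbc.comp_homeomorph (Homeomorph.addRight (s • w))
    have hf : ∀ x, fderiv ℝ b' x = fderiv ℝ b (x + s • w) := fun x => by
      rw [hb', fderiv_comp_add_right]
    have hb'v : Continuous fun x => fderiv ℝ b' x v :=
      (hb'd.continuous_fderiv (by norm_num)).clm_apply continuous_const
    have h4 := integral_mul_fderiv_eq_neg_fderiv_mul_of_integrable (μ := μ) (f := a) (g := b')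
      (v := v) ((hav.mul hb'd.continuous).integrable_of_hasCompactSupport hb'c.mul_left)
      ((ha.continuous.mul hb'v).integrable_of_hasCompactSupport hac.mul_right)
      ((ha.continuous.mul hb'd.continuous).integrable_of_hasCompactSupport hac.mul_right)
      (fun x _ => ha.differentiable (by norm_num) x) (fun x _ => hb'd.differentiable (by norm_num) x)
    have h5 : ∫ x, a x * fderiv ℝ b' x v ∂μ = ∫ x, fderiv ℝ b x v * a (x + s • (-w)) ∂μ := by
      rw [← integral_sub_right_eq_self _ (s • w)]
      refine integral_congr_ae (Eventually.of_forall fun x => ?_)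
      simp only [hf, sub_add_cancel, smul_neg, ← sub_eq_add_neg]
      ring
    rw [← h5, h4, neg_neg]
  simp only [h3] at h1
  have h6 := h1.unique h2.neg
  rw [h6, ← integral_neg]
  refine integral_congr_ae (Eventually.of_forall fun x => ?_)
  simp only [map_neg]
  ring

/-- Weak form of the commutation relations of the left-invariant frame. -/
theorem integral_fd_mul_fd {a b : Heis n → ℝ} (ha : ContDiff ℝ 1 a)
    (hac : HasCompactSupport a) (hb : ContDiff ℝ 1 b) (hbc : HasCompactSupport b)
    (v w : FrameVec n) :
    ∫ p, (fd a p v * fd b p w - fd a p w * fd b p v) = ∫ p, symp v.1 w.1 * (fd a p (0, 1) * b p) := by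
  let e : Heis n := (0, 1)
  let c : FrameVec n → Heis n → ℝ := fun u p => u.2 + 1 / 2 * symp p.1 u.1
  have hc : ∀ u, ContDiff ℝ 1 (c u) := by
    intro u
    have h : ContDiff ℝ 1 fun p : Heis n => sympL p.1 u.1 :=
      (sympL.contDiff.comp contDiff_fst).clm_apply contDiff_const
    simp only [sympL_apply] at h
    exact contDiff_const.add (contDiff_const.mul h)
  have hcd : ∀ u (p : Heis n) x, fderiv ℝ (c u) p x = 1 / 2 * symp x.1 u.1 := by
    intro u p x
    have h : HasFDerivAt (fun p : Heis n => sympL.flip u.1 p.1)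
        (sympL.flip u.1 ∘L fstH) p :=
      (sympL.flip u.1).hasFDerivAt.comp p hasFDerivAt_fst
    have h2 := (h.const_mul (1 / 2 : ℝ)).const_add u.2
    have h3 : c u = fun p : Heis n => u.2 + 1 / 2 * sympL.flip u.1 p.1 := by
      ext p; simp [c]
    rw [h3, h2.fderiv]
    simp
  have hdec : ∀ (g : Heis n → ℝ) (p : Heis n) (u : FrameVec n),
      fd g p u = fderiv ℝ g p (u.1, 0) + c u p * fderiv ℝ g p e := by
    intro g p u
    have : toCoord p u = (u.1, 0) + c u p • e := by
      rw [toCoord_eq]; ext <;> simp [c, e]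
    rw [fd_apply, this, map_add, map_smul, smul_eq_mul]
  have hmulf : ∀ u (p : Heis n) x, fderiv ℝ (fun q => c u q * b q) p x =
      c u p * fderiv ℝ b p x + 1 / 2 * symp x.1 u.1 * b p := by
    intro u p x
    have := (((hc u).differentiable (by norm_num) p).hasFDerivAt.mul
      (hb.differentiable (by norm_num) p).hasFDerivAt).fderiv
    rw [show fderiv ℝ (fun q => c u q * b q) p = _ from this]
    simp [hcd]; ring
  have hI : ∀ (a' b' : Heis n → ℝ), ContDiff ℝ 1 a' → HasCompactSupport a' → ContDiff ℝ 1 b' →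
      ∀ x y, Integrable fun p => fderiv ℝ a' p x * fderiv ℝ b' p y := by
    intro a' b' ha' hac' hb' x y
    exact (((ha'.continuous_fderiv (by norm_num)).clm_apply continuous_const).mul
      ((hb'.continuous_fderiv (by norm_num)).clm_apply
        continuous_const)).integrable_of_hasCompactSupport (hac'.fderiv_apply (𝕜 := ℝ) x).mul_right
  have hcb : ∀ u, ContDiff ℝ 1 fun q => c u q * b q := fun u => (hc u).mul hb
  have hcbc : ∀ u, HasCompactSupport fun q => c u q * b q := fun u => hbc.mul_left
  have key : ∀ x y (b' : Heis n → ℝ), ContDiff ℝ 1 b' → HasCompactSupport b' →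
      ∫ p, (fderiv ℝ a p x * fderiv ℝ b' p y - fderiv ℝ a p y * fderiv ℝ b' p x) = 0 := by
    intro x y b' hb' hbc'
    rw [integral_sub (hI _ _ ha hac hb' _ _) (hI _ _ ha hac hb' _ _),
      integral_fderiv_mul_fderiv_symm ha hac hb' hbc' x y, sub_self]
  have k1 := key (v.1, 0) (w.1, 0) b hb hbc
  have k2 := key (v.1, 0) e _ (hcb w) (hcbc w)
  have k3 := key e (w.1, 0) _ (hcb v) (hcbc v)
  have i1 : Integrable fun p => fderiv ℝ a p (v.1, 0) * fderiv ℝ b p (w.1, 0) -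
      fderiv ℝ a p (w.1, 0) * fderiv ℝ b p (v.1, 0) := (hI _ _ ha hac hb (v.1, 0) (w.1, 0)).sub (hI _ _ ha hac hb (w.1, 0) (v.1, 0))
  have i2 : Integrable fun p => fderiv ℝ a p (v.1, 0) * fderiv ℝ (fun q => c w q * b q) p e -
      fderiv ℝ a p e * fderiv ℝ (fun q => c w q * b q) p (v.1, 0) := (hI _ _ ha hac (hcb w) (v.1, 0) e).sub (hI _ _ ha hac (hcb w) e (v.1, 0))
  have i3 : Integrable fun p => fderiv ℝ a p e * fderiv ℝ (fun q => c v q * b q) p (w.1, 0) -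
      fderiv ℝ a p (w.1, 0) * fderiv ℝ (fun q => c v q * b q) p e := (hI _ _ ha hac (hcb v) e (w.1, 0)).sub (hI _ _ ha hac (hcb v) (w.1, 0) e)
  have hpt : ∀ p, fd a p v * fd b p w - fd a p w * fd b p v -
      symp v.1 w.1 * (fd a p (0, 1) * b p) =
      (fderiv ℝ a p (v.1, 0) * fderiv ℝ b p (w.1, 0) -
        fderiv ℝ a p (w.1, 0) * fderiv ℝ b p (v.1, 0)) +
      (fderiv ℝ a p (v.1, 0) * fderiv ℝ (fun q => c w q * b q) p e -
        fderiv ℝ a p e * fderiv ℝ (fun q => c w q * b q) p (v.1, 0)) +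
      (fderiv ℝ a p e * fderiv ℝ (fun q => c v q * b q) p (w.1, 0) -
        fderiv ℝ a p (w.1, 0) * fderiv ℝ (fun q => c v q * b q) p e) := by
    intro p
    have hz : symp (0 : Hor n) = 0 := by ext x; simp [symp_apply]
    have he : fd a p (0, 1) = fderiv ℝ a p e := by rw [fd_apply, toCoord_vert]
    rw [he]
    simp only [hdec, hmulf, e, hz, zero_apply, symp_swap w.1 v.1]
    ring
  have hs : Integrable fun p => symp v.1 w.1 * (fd a p (0, 1) * b p) := by
    have : Continuous fun p => fd a p (0, 1) := by
      simp only [fd_apply, toCoord_vert]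
      exact (ha.continuous_fderiv (by norm_num)).clm_apply continuous_const
    exact ((this.mul hb.continuous).integrable_of_hasCompactSupport hbc.mul_left).const_mul _
  have hall := integral_congr_ae (μ := (volume : Measure (Heis n))) (Eventually.of_forall hpt)
  have e1 := integral_add (i1.add i2) i3
  simp only [Pi.add_apply] at e1
  rw [e1, integral_add i1 i2] at hall
  rw [k1, k2, k3] at hall
  have hL : Integrable fun p => fd a p v * fd b p w - fd a p w * fd b p v := by
    refine (((i1.add i2).add i3).add hs).congr (Eventually.of_forall fun p => ?_)
    have := hpt p
    simp only [Pi.add_apply]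
    linarith
  rw [integral_sub hL hs] at hall
  linarith

end weak

section

/-! ## The second integral identity -/

/-- The trace of a horizontal endomorphism. -/
def horTrace (A : Hor n →L[ℝ] Hor n) : ℝ := LinearMap.trace ℝ (Hor n) (A : Hor n →ₗ[ℝ] Hor n)

/-- The algebraic expression, in the derivatives `A` of a horizontal field and `B` of a field with
value `y`, whose integral vanishes by the symmetry of second derivatives. -/
def crossForm (A : FrameVec n →L[ℝ] Hor n) (B : FrameVec n →L[ℝ] FrameVec n) (y : FrameVec n) : ℝ :=
  horTrace (A ∘L B ∘L inlH) -
    horTrace (A ∘L inlH) *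
      LinearMap.trace ℝ _ (B : FrameVec n →ₗ[ℝ] FrameVec n) - symp y.1 (A (0, 1))

theorem horTrace_eq_sum (A : Hor n →L[ℝ] Hor n) :
    horTrace A = ∑ i : Fin n × Fin 2, A (EuclideanSpace.single i 1) i := by
  rw [horTrace, trace_hor_eq_sum]
  simp [EuclideanSpace.inner_single_left]

theorem frame_decomp (y : FrameVec n) :
    y = ∑ c : Fin n × Fin 2, y.1 c • ((EuclideanSpace.single c 1, 0) : FrameVec n) +
      y.2 • (0, 1) := by
  ext1
  · ext i; simp [Prod.fst_sum, Finset.sum_apply, Pi.single_apply]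
  · simp [Prod.snd_sum]

/-- The coordinates of a field in the left-invariant frame. -/
def frameEntry (y : FrameVec n) : Option (Fin n × Fin 2) → ℝ
  | none => y.2
  | some c => y.1 c

/-- The left-invariant frame. -/
def frameUnit : Option (Fin n × Fin 2) → FrameVec n
  | none => (0, 1)
  | some c => (EuclideanSpace.single c 1, 0)

theorem frame_decomp' (y : FrameVec n) :
    y = ∑ c : Option (Fin n × Fin 2), frameEntry y c • frameUnit c := by
  rw [Fintype.sum_option]
  conv_lhs => rw [frame_decomp y]
  rw [add_comm]; rfl

theorem crossForm_eq_sum (A : FrameVec n →L[ℝ] Hor n) (B : FrameVec n →L[ℝ] FrameVec n)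
    (y : FrameVec n) : crossForm A B y = ∑ i : Fin n × Fin 2, ∑ c,
      (A (frameUnit c) i * frameEntry (B (EuclideanSpace.single i 1, 0)) c -
        A (EuclideanSpace.single i 1, 0) i * frameEntry (B (frameUnit c)) c -
        symp (frameUnit c).1 (EuclideanSpace.single i 1) * (A (0, 1) i * frameEntry y c)) := by
  have h1 : ∀ (u : FrameVec n) i, A u i = ∑ c, A (frameUnit c) i * frameEntry u c := by
    intro u i
    conv_lhs => rw [frame_decomp' u]
    simp [mul_comm]
  have h2 : LinearMap.trace ℝ _ (B : FrameVec n →ₗ[ℝ] FrameVec n) =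
      ∑ c, frameEntry (B (frameUnit c)) c := by
    rw [trace_frame, trace_hor_eq_sum, Fintype.sum_option, add_comm]
    simp [EuclideanSpace.inner_single_left, frameEntry, frameUnit]
  have h3 : symp y.1 (A (0, 1)) = ∑ i : Fin n × Fin 2, ∑ c,
      symp (frameUnit c).1 (EuclideanSpace.single i 1) * (A (0, 1) i * frameEntry y c) := by
    have h4 : A (0, 1) = ∑ i : Fin n × Fin 2, A (0, 1) i • EuclideanSpace.single i (1 : ℝ) := by
      ext j; simp [Pi.single_apply]
    have h5 : ∀ u : Hor n, symp y.1 u = ∑ c, symp (frameUnit c).1 u * frameEntry y c := by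
      intro u
      conv_lhs => rw [frame_decomp' y]
      rw [← sympL_apply]
      simp [Prod.fst_sum, mul_comm]
    rw [h5]
    simp_rw [Finset.sum_comm (s := (Finset.univ : Finset (Fin n × Fin 2)))]
    refine Finset.sum_congr rfl fun c _ => ?_
    conv_lhs => rw [h4]
    simp only [map_sum, map_smul, smul_eq_mul, Finset.sum_mul]
    exact Finset.sum_congr rfl fun i _ => by ring
  rw [crossForm, horTrace_eq_sum, horTrace_eq_sum, h2, h3, Finset.sum_mul,
    ← Finset.sum_sub_distrib, ← Finset.sum_sub_distrib]
  refine Finset.sum_congr rfl fun i _ => ?_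
  rw [Finset.mul_sum, Finset.sum_sub_distrib, Finset.sum_sub_distrib, ← h1]
  rfl

theorem crossForm_rank_one (A : FrameVec n →L[ℝ] Hor n) (B B' : FrameVec n →L[ℝ] FrameVec n)
    (y : FrameVec n) {c : ℝ} {l : FrameVec n →L[ℝ] ℝ} (h : ∀ v, B' v = c • B v + l v • y) :
    crossForm A B' (c • y) = c * crossForm A B y + (l (A y, 0) -
      horTrace (A ∘L inlH) * l y) := by
  have h1 : horTrace (A ∘L B' ∘L inlH) =
      c * horTrace (A ∘L B ∘L inlH) + l (A y, 0) :=
    trace_eq_of_forall_apply (l := (l : FrameVec n →ₗ[ℝ] ℝ) ∘ₗ LinearMap.inl ℝ (Hor n) ℝ)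
      fun v => by simp [h]
  rw [crossForm, h1, trace_eq_of_forall_apply (A := (B' : FrameVec n →ₗ[ℝ] FrameVec n))
    (l := (l : FrameVec n →ₗ[ℝ] ℝ)) h, crossForm, Prod.smul_fst, symp_smul_left]
  simp only [ContinuousLinearMap.coe_coe]
  ring

theorem contDiff_frameEntry {k : WithTop ℕ∞} {Y : Heis n → FrameVec n} (hY : ContDiff ℝ k Y)
    (c : Option (Fin n × Fin 2)) : ContDiff ℝ k fun p => frameEntry (Y p) c := by
  cases c with
  | none => exact hY.snd
  | some c => exact (EuclideanSpace.proj c : Hor n →L[ℝ] ℝ).contDiff.comp hY.fst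

theorem fd_frameEntry {Y : Heis n → FrameVec n} {p : Heis n} (hY : DifferentiableAt ℝ Y p)
    (c : Option (Fin n × Fin 2)) (v : FrameVec n) :
    fd (fun p => frameEntry (Y p) c) p v = frameEntry (fd Y p v) c := by
  cases c with
  | none =>
    change fderiv ℝ (fun p => (Y p).2) p _ = _
    rw [hY.hasFDerivAt.snd.fderiv]; rfl
  | some c =>
    have := ((EuclideanSpace.proj c : Hor n →L[ℝ] ℝ).hasFDerivAt.comp p hY.hasFDerivAt.fst).fderiv
    change fderiv ℝ (fun p => (Y p).1 c) p _ = _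
    rw [show fderiv ℝ (fun p => (Y p).1 c) p = _ from this]; rfl

theorem integral_crossForm {q : Heis n → Hor n} {Y : Heis n → FrameVec n} (hq : ContDiff ℝ 1 q)
    (hqc : HasCompactSupport q) (hY : ContDiff ℝ 1 Y) (hYc : HasCompactSupport Y) :
    ∫ p, crossForm (fd q p) (fd Y p) (Y p) = 0 := by
  have ha : ∀ i, ContDiff ℝ 1 fun p => q p i := fun i =>
    (EuclideanSpace.proj i : Hor n →L[ℝ] ℝ).contDiff.comp hq
  have hac : ∀ i, HasCompactSupport fun p => q p i := fun i =>
    hqc.mono fun x hx h0 => hx (by simp [h0])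
  have hb := contDiff_frameEntry hY
  have hbc : ∀ c, HasCompactSupport fun p => frameEntry (Y p) c := fun c =>
    hYc.mono fun x hx h0 => hx (by cases c <;> simp [h0, frameEntry])
  have hfa : ∀ i p v, fd q p v i = fd (fun p => q p i) p v := fun i p v => by
    have := ((EuclideanSpace.proj i : Hor n →L[ℝ] ℝ).hasFDerivAt.comp p
      (hq.differentiable (by norm_num) p).hasFDerivAt).fderiv
    rw [fd_apply (fun p => q p i), show fderiv ℝ (fun p => q p i) p = _ from this]; rfl
  have hfc : ∀ {g : Heis n → ℝ}, ContDiff ℝ 1 g → ∀ v, Continuous fun p => fd g p v := by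
    intro g hg v
    have := contDiffOn_fd isOpen_univ hg.contDiffOn (k := 0) (by norm_num)
    exact (continuousOn_univ.1 this.continuousOn).clm_apply continuous_const
  have hfs : ∀ {g : Heis n → ℝ}, HasCompactSupport g → ∀ v, HasCompactSupport fun p => fd g p v := by
    intro g hg v
    refine (hg.fderiv ℝ).mono fun x hx h0 => hx ?_
    change fderiv ℝ g x _ = 0
    rw [h0]; rfl
  have key : ∀ i c, ∫ p, (fd q p (frameUnit c) i * frameEntry (fd Y p (EuclideanSpace.single i 1, 0)) c -
      fd q p (EuclideanSpace.single i 1, 0) i * frameEntry (fd Y p (frameUnit c)) c -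
      symp (frameUnit c).1 (EuclideanSpace.single i 1) *
        (fd q p (0, 1) i * frameEntry (Y p) c)) = 0 ∧
      Integrable fun p => (fd q p (frameUnit c) i * frameEntry (fd Y p (EuclideanSpace.single i 1, 0)) c -
      fd q p (EuclideanSpace.single i 1, 0) i * frameEntry (fd Y p (frameUnit c)) c -
      symp (frameUnit c).1 (EuclideanSpace.single i 1) *
        (fd q p (0, 1) i * frameEntry (Y p) c)) := by
    intro i c
    simp only [← fd_frameEntry (hY.differentiable (by norm_num) _), hfa]
    have hws := integral_fd_mul_fd (ha i) (hac i) (hb c) (hbc c) (frameUnit c)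
      (EuclideanSpace.single i 1, 0)
    have i1 : ∀ v w, Integrable fun p => fd (fun p => q p i) p v *
        fd (fun p => frameEntry (Y p) c) p w := fun v w =>
      ((hfc (ha i) v).mul (hfc (hb c) w)).integrable_of_hasCompactSupport (hfs (hac i) v).mul_right
    have i2 : Integrable fun p => symp (frameUnit c).1 (EuclideanSpace.single i 1) *
        (fd (fun p => q p i) p (0, 1) * frameEntry (Y p) c) :=
      (((hfc (ha i) _).mul (hb c).continuous).integrable_of_hasCompactSupport
        (hbc c).mul_left).const_mul _
    have i3 := (i1 (frameUnit c) (EuclideanSpace.single i 1, 0)).sub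
      (i1 (EuclideanSpace.single i 1, 0) (frameUnit c))
    refine ⟨?_, i3.sub i2⟩
    have := integral_sub i3 i2
    simp only [Pi.sub_apply] at this
    rw [this, hws, sub_self]
  simp only [crossForm_eq_sum]
  rw [integral_finsetSum _ fun i _ => integrable_finsetSum _ fun c _ => (key i c).2]
  refine Finset.sum_eq_zero fun i _ => ?_
  rw [integral_finsetSum _ fun c _ => (key i c).2]
  exact Finset.sum_eq_zero fun c _ => (key i c).1

theorem continuous_crossForm {q : Heis n → Hor n} {Y : Heis n → FrameVec n} (hq : ContDiff ℝ 1 q)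
    (hY : ContDiff ℝ 1 Y) : Continuous fun p => crossForm (fd q p) (fd Y p) (Y p) := by
  have h1 : Continuous (fd q) := continuousOn_univ.1
    (contDiffOn_fd isOpen_univ hq.contDiffOn (k := 0) (by norm_num)).continuousOn
  have h2 : Continuous (fd Y) := continuousOn_univ.1
    (contDiffOn_fd isOpen_univ hY.contDiffOn (k := 0) (by norm_num)).continuousOn
  have he : ∀ c, Continuous fun y : FrameVec n => frameEntry y c := by
    rintro (_ | c)
    · exact continuous_snd
    · exact (EuclideanSpace.proj c : Hor n →L[ℝ] ℝ).continuous.comp continuous_fst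
  have hp : ∀ i, Continuous fun y : Hor n => y i :=
    fun i => (EuclideanSpace.proj i : Hor n →L[ℝ] ℝ).continuous
  simp only [crossForm_eq_sum]
  refine continuous_finsetSum _ fun i _ => continuous_finsetSum _ fun c _ => ?_
  exact ((((hp i).comp (h1.clm_apply continuous_const)).mul
    ((he c).comp (h2.clm_apply continuous_const))).sub
    (((hp i).comp (h1.clm_apply continuous_const)).mul
    ((he c).comp (h2.clm_apply continuous_const)))).sub
    (continuous_const.mul (((hp i).comp (h1.clm_apply continuous_const)).mul
    ((he c).comp hY.continuous)))

theorem crossForm_zero (A : FrameVec n →L[ℝ] Hor n) : crossForm A 0 0 = 0 := by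
  simp [crossForm, horTrace, symp_eq_inner, perp_zero]

variable {S : Set (Heis n)} {ν : Heis n → FrameVec n} {f : Heis n → ℝ} {V : Set (Heis n)}

theorem IsDefiningOn.integral_crossForm_div_rnorm (hd : IsDefiningOn S ν f V)
    (hS : IsOrientedHypersurface S ν) (hSc : IsCompact S) (hSV : S ⊆ V) {q : Heis n → Hor n}
    (hq : ContDiffOn ℝ 1 q V) {X : Heis n → FrameVec n} (hX : ContDiffOn ℝ 1 X V)
    (hX0 : ∀ p ∈ V, fd f p (X p) = 0) (hqX : ∀ p ∈ V, fd f p (fd q p (X p), 0) = 0) :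
    ∫ p, crossForm (fd q p) (fd X p) (X p) / rnorm (rgrad f p) ∂(sigmaR S ν) = 0 := by
  obtain ⟨χ, hχ, hχc, hχV, hχ1, -⟩ := exists_smooth_cutoff hSc hd.isOpen hSV
  obtain ⟨ψ, hψ, hψc, hψV, hψ1, -⟩ := exists_smooth_cutoff hχc hd.isOpen hχV
  set X' : Heis n → FrameVec n := fun p => χ p • X p with hX'
  set q' : Heis n → Hor n := fun p => ψ p • q p with hq'
  have hY : ContDiff ℝ 1 X' :=
    contDiff_smul_of_tsupport_subset (hχ.of_le (by norm_num)).contDiffOn hd.isOpen hX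
      (isClosed_tsupport χ) hχV fun x hx => by
        rw [image_eq_zero_of_notMem_tsupport hx, zero_smul]
  have hQ : ContDiff ℝ 1 q' :=
    contDiff_smul_of_tsupport_subset (hψ.of_le (by norm_num)).contDiffOn hd.isOpen hq
      (isClosed_tsupport ψ) hψV fun x hx => by
        rw [image_eq_zero_of_notMem_tsupport hx, zero_smul]
  have hYc : HasCompactSupport X' := hχc.mono fun x hx h0 => hx (by simp [hX', h0])
  have hQc : HasCompactSupport q' := hψc.mono fun x hx h0 => hx (by simp [hq', h0])
  have hqq : ∀ p ∈ tsupport χ, fd q' p = fd q p := fun p hp => fd_congr (by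
    filter_upwards [hψ1.filter_mono (nhds_le_nhdsSet hp)] with x hx
    simp [hq', hx])
  have hX'z : ∀ p ∉ tsupport χ, X' =ᶠ[𝓝 p] fun _ => 0 := fun p hp => by
    filter_upwards [(isClosed_tsupport χ).isOpen_compl.mem_nhds hp] with x hx
    simp [hX', image_eq_zero_of_notMem_tsupport hx]
  have hfd0 : ∀ p : Heis n, fd (fun _ : Heis n => (0 : FrameVec n)) p = 0 := fun p => by simp [fd]
  have hsup : tsupport (fun p => crossForm (fd q' p) (fd X' p) (X' p)) ⊆ tsupport χ := by
    refine closure_minimal (fun p hp => by_contra fun h => hp ?_) (isClosed_tsupport χ)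
    simp only
    rw [fd_congr (hX'z p h), (hX'z p h).eq_of_nhds, hfd0, crossForm_zero]
  let b : ContDiffBump (0 : ℝ) := ⟨1, 2, one_pos, one_lt_two⟩
  have hb : ContDiff ℝ 1 b := b.contDiff
  have hlim := tendsto_integral_leray hSc hS hd (continuous_crossForm hQ hY)
    (HasCompactSupport.of_support_subset_isCompact hχc ((subset_tsupport _).trans hsup))
    (hsup.trans hχV) b.continuous b.hasCompactSupport
  have h0 : ∀ ε : ℝ, ∫ p, ε⁻¹ * b (f p / ε) * crossForm (fd q' p) (fd X' p) (X' p) = 0 := by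
    intro ε
    have hsm : ContDiffOn ℝ 1 (fun p => b (f p / ε)) V :=
      hb.comp_contDiffOn ((hd.contDiffOn.of_le (by norm_num)).div_const ε)
    have hZ : ContDiff ℝ 1 fun p => b (f p / ε) • X' p :=
      contDiff_smul_of_tsupport_subset hsm hd.isOpen hY.contDiffOn (isClosed_tsupport χ) hχV
        fun x hx => by rw [(hX'z x hx).eq_of_nhds, smul_zero]
    have h1 := integral_crossForm hQ hQc hZ (hYc.mono fun x hx h0 => hx (by simp [h0]))
    have h2 : ∀ p, crossForm (fd q' p) (fd (fun p => b (f p / ε) • X' p) p) (b (f p / ε) • X' p) =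
        b (f p / ε) * crossForm (fd q' p) (fd X' p) (X' p) := by
      intro p
      by_cases hp' : p ∈ tsupport χ
      · have hp := hχV hp'
        have hfd : DifferentiableAt ℝ f p :=
          (hd.contDiffOn.contDiffAt (hd.isOpen.mem_nhds hp)).differentiableAt (by norm_num)
        have hsd := (hsm.contDiffAt (hd.isOpen.mem_nhds hp)).differentiableAt (by norm_num)
        have h3 := fd_comp_real (g := fun s => b (s / ε)) (a := f) (p := p)
          ((hb.differentiable (by norm_num)).differentiableAt.comp _
            (differentiableAt_id.div_const ε)) hfd
        rw [crossForm_rank_one _ _ _ _ (fd_smul hsd (hY.differentiable (by norm_num) p)), h3, h3,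
          hqq p hp', hX', map_smul, map_smul, hX0 p hp]
        have : fd f p (χ p • fd q p (X p), 0) = 0 := by
          have := congrArg (fun x => χ p • x) (hqX p hp)
          simp only [← map_smul, smul_zero] at this
          simpa using this
        rw [this]; simp
      · have hz := hX'z p hp'
        have hz2 : (fun p => b (f p / ε) • X' p) =ᶠ[𝓝 p] fun _ => 0 := by
          filter_upwards [hz] with x hx
          rw [hx, smul_zero]
        rw [fd_congr hz, fd_congr hz2, hz.eq_of_nhds, smul_zero, hfd0, crossForm_zero, mul_zero]
    simp only [h2] at h1
    simp only [mul_assoc]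
    rw [integral_const_mul, h1, mul_zero]
  simp only [h0] at hlim
  have h3 := tendsto_nhds_unique hlim tendsto_const_nhds
  have h4 : lerayConst n * ∫ r, b r ≠ 0 := (mul_pos (lerayConst_pos n) b.integral_pos).ne'
  rw [← (mul_eq_zero.1 h3).resolve_left h4]
  refine integral_congr_ae ?_
  filter_upwards [ae_mem_sigmaR hSc.measurableSet] with p hp
  have hpc : ∀ᶠ x in 𝓝 p, χ x = 1 := hχ1.filter_mono (nhds_le_nhdsSet hp)
  have hpX : X' =ᶠ[𝓝 p] X := by filter_upwards [hpc] with x hx; simp [hX', hx]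
  rw [fd_congr hpX, hpX.eq_of_nhds, hqq p (subset_tsupport _ (by simp [hpc.self_of_nhds]))]

end

section

/-! ## Integral identities on a hypersurface without characteristic points -/

/-- The tangent field `T - ϖ ν_H`. -/
def transv (f : Heis n → ℝ) (p : Heis n) : FrameVec n := (-(slope f p • unitH f p), 1)

/-- The derivative of the horizontal normal along `T - ϖ ν_H`. -/
def transvU (f : Heis n → ℝ) (p : Heis n) : Hor n := fd (unitH f) p (transv f p)

/-- The horizontal derivative of the horizontal normal. -/
def shape (f : Heis n → ℝ) (p : Heis n) : Hor n →L[ℝ] Hor n :=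
  fd (unitH f) p ∘L inlH

variable {S : Set (Heis n)} {ν : Heis n → FrameVec n} {f : Heis n → ℝ} {V : Set (Heis n)}
  {p : Heis n}

theorem fd_eq_inner_add (f : Heis n → ℝ) (p : Heis n) (v : FrameVec n) :
    fd f p v = inner ℝ (hgrad f p) v.1 + vder f p * v.2 := fd_eq_metric f p v

theorem fd_inner {Y Z : Heis n → Hor n} (hY : DifferentiableAt ℝ Y p) (hZ : DifferentiableAt ℝ Z p)
    (v : FrameVec n) : fd (fun q => inner ℝ (Y q) (Z q)) p v =
      inner ℝ (fd Y p v) (Z p) + inner ℝ (Y p) (fd Z p v) := by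
  rw [fd_apply, fderiv_inner_apply ℝ hY hZ, add_comm]; rfl

theorem fd_fst {X : Heis n → FrameVec n} (hX : DifferentiableAt ℝ X p) (v : FrameVec n) :
    fd (fun q => (X q).1) p v = (fd X p v).1 := by
  rw [fd_apply, hX.hasFDerivAt.fst.fderiv]; rfl

theorem fd_snd {X : Heis n → FrameVec n} (hX : DifferentiableAt ℝ X p) (v : FrameVec n) :
    fd (fun q => (X q).2) p v = (fd X p v).2 := by
  rw [fd_apply, hX.hasFDerivAt.snd.fderiv]; rfl

theorem fd_prodMk {Y : Heis n → Hor n} {g : Heis n → ℝ} (hY : DifferentiableAt ℝ Y p)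
    (hg : DifferentiableAt ℝ g p) (v : FrameVec n) :
    fd (fun q => ((Y q, g q) : FrameVec n)) p v = (fd Y p v, fd g p v) := by
  rw [fd_apply, (hY.hasFDerivAt.prodMk hg.hasFDerivAt).fderiv]; rfl

theorem fd_mul {a b : Heis n → ℝ} (ha : DifferentiableAt ℝ a p) (hb : DifferentiableAt ℝ b p)
    (v : FrameVec n) : fd (fun q => a q * b q) p v = a p * fd b p v + fd a p v * b p := by
  have := fd_smul ha hb v
  simpa using this

theorem fd_neg {F : Type*} [NormedAddCommGroup F] [NormedSpace ℝ F] (Y : Heis n → F) (p : Heis n)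
    (v : FrameVec n) : fd (fun q => -Y q) p v = -fd Y p v := by
  rw [fd_apply, fderiv_fun_neg]; rfl

theorem fd_sub {F : Type*} [NormedAddCommGroup F] [NormedSpace ℝ F] {Y Z : Heis n → F}
    (hY : DifferentiableAt ℝ Y p) (hZ : DifferentiableAt ℝ Z p) (v : FrameVec n) :
    fd (fun q => Y q - Z q) p v = fd Y p v - fd Z p v := by
  rw [fd_apply, fderiv_fun_sub hY hZ]; rfl

theorem fd_add {F : Type*} [NormedAddCommGroup F] [NormedSpace ℝ F] {Y Z : Heis n → F}
    (hY : DifferentiableAt ℝ Y p) (hZ : DifferentiableAt ℝ Z p) (v : FrameVec n) :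
    fd (fun q => Y q + Z q) p v = fd Y p v + fd Z p v := by
  rw [fd_apply, fderiv_fun_add hY hZ]; rfl

theorem frameDiv_hor {Y : Heis n → Hor n} (hY : DifferentiableAt ℝ Y p) :
    frameDiv (fun q => ((Y q, 0) : FrameVec n)) p =
      horTrace (fd Y p ∘L inlH) := by
  rw [frameDiv_eq (hY.prodMk (differentiableAt_const _))]
  have : fd (fun q : Heis n => (0 : ℝ)) p = 0 := by simp [fd]
  simp only [this]
  exact add_zero _

namespace IsHorizontallyRegular

variable (hr : IsHorizontallyRegular f V)
include hr

theorem inner_unitH_fd (hp : p ∈ V) (v : FrameVec n) : inner ℝ (unitH f p) (fd (unitH f) p v) = 0 := by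
  rw [hr.fd_unitH hp, inner_smul_right, inner_sub_right, inner_smul_right,
    real_inner_self_eq_norm_sq, hr.norm_unitH hp]
  ring

/-- The tangent field `|∇_H f| (T - ϖ ν_H)`. -/
theorem norm_smul_transv (hp : p ∈ V) :
    ‖hgrad f p‖ • transv f p = (-(vder f p • unitH f p), ‖hgrad f p‖) := by
  rw [transv, ← hr.norm_mul_slope hp]
  simp [mul_smul]

theorem contDiffOn_transv : ContDiffOn ℝ 1 (transv f) V :=
  (hr.contDiffOn_slope.smul hr.contDiffOn_unitH).neg.prodMk contDiffOn_const

theorem contDiffOn_norm_transv :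
    ContDiffOn ℝ 1 (fun p => ((-(vder f p • unitH f p), ‖hgrad f p‖) : FrameVec n)) V :=
  (hr.contDiffOn_vder.smul hr.contDiffOn_unitH).neg.prodMk hr.contDiffOn_norm

theorem inner_hgrad (hp : p ∈ V) (v : Hor n) :
    inner ℝ (hgrad f p) v = ‖hgrad f p‖ * inner ℝ (unitH f p) v := by
  rw [← hr.norm_smul_unitH hp, inner_smul_left, norm_smul, hr.norm_unitH hp]
  simp

theorem fd_transv (hp : p ∈ V) : fd f p (transv f p) = 0 := by
  rw [fd_eq_inner_add, hr.inner_hgrad hp, transv, inner_neg_right, inner_smul_right,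
    real_inner_self_eq_norm_sq, hr.norm_unitH hp, ← hr.norm_mul_slope hp]
  ring

theorem fd_norm_transv (hp : p ∈ V) : fd f p (-(vder f p • unitH f p), ‖hgrad f p‖) = 0 := by
  rw [← hr.norm_smul_transv hp, map_smul, hr.fd_transv hp, smul_zero]

theorem inner_tgrad (hp : p ∈ V) (v : Hor n) : inner ℝ (tgrad f p) v = fd (vder f) p (v, 0) :=
  (fd_vder (hr.contDiffAt hp) v).symm

theorem frameDiv_norm_transv (hp : p ∈ V) :
    frameDiv (fun p => ((-(vder f p • unitH f p), ‖hgrad f p‖) : FrameVec n)) p =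
      -(vder f p * horTrace (shape f p)) := by
  have hv := hr.differentiableAt_vder hp
  have hu := hr.differentiableAt_unitH hp
  have hn := hr.differentiableAt hr.contDiffOn_norm hp
  have hs : DifferentiableAt ℝ (fun p => -(vder f p • unitH f p)) p := (hv.smul hu).neg
  rw [frameDiv_eq (hs.prodMk hn), hr.fd_norm_hgrad hp, fd_hgrad]
  rw [trace_eq_of_forall_apply (B := (shape f p : Hor n →ₗ[ℝ] Hor n)) (c := -vder f p)
    (l := -((fd (vder f) p : FrameVec n →ₗ[ℝ] ℝ) ∘ₗ LinearMap.inl ℝ (Hor n) ℝ)) (x := unitH f p)]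
  · simp only [horTrace, LinearMap.neg_apply, LinearMap.comp_apply, LinearMap.inl_apply,
      ContinuousLinearMap.coe_coe, ← hr.inner_tgrad hp, map_zero, zero_add, one_smul,
      real_inner_comm (unitH f p)]
    ring
  · intro v
    change fd (fun p => -(vder f p • unitH f p)) p (v, 0) = _
    rw [fd_neg, fd_smul hv hu]
    simp only [shape, LinearMap.neg_apply, LinearMap.comp_apply, LinearMap.inl_apply,
      ContinuousLinearMap.coe_coe, ContinuousLinearMap.comp_apply, ContinuousLinearMap.inl_apply]
    module

/-- The pointwise computation behind the second integral identity. -/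
theorem crossForm_norm_transv (hp : p ∈ V) :
    horTrace (fd (unitH f) p ∘L fd (fun p => ((-(vder f p • unitH f p), ‖hgrad f p‖) : FrameVec n)) p
      ∘L inlH) - symp (-(vder f p • unitH f p)) (fd (unitH f) p (0, 1)) =
      -(vder f p * horTrace (shape f p ∘L shape f p)) := by
  have hv := hr.differentiableAt_vder hp
  have hu := hr.differentiableAt_unitH hp
  have hn := hr.differentiableAt hr.contDiffOn_norm hp
  have hs : DifferentiableAt ℝ (fun p => -(vder f p • unitH f p)) p := (hv.smul hu).neg
  set A := fd (unitH f) p with hA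
  have h1 : ∀ v : Hor n, A (fd (fun p => ((-(vder f p • unitH f p), ‖hgrad f p‖) : FrameVec n)) p (v, 0)) =
      -(vder f p) • A (A (v, 0), 0) - inner ℝ (tgrad f p) v • A (unitH f p, 0) +
        inner ℝ (unitH f p) (hess f p v) • A (0, 1) := by
    intro v
    rw [fd_prodMk hs hn, fd_neg, fd_smul hv hu, hr.fd_norm_hgrad hp, fd_hgrad, ← hr.inner_tgrad hp]
    simp only [zero_smul, add_zero]
    have : ((-(vder f p • (fd (unitH f) p) (v, 0) + inner ℝ (tgrad f p) v • unitH f p),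
        inner ℝ (unitH f p) (hess f p v)) : FrameVec n) =
        -(vder f p) • (A (v, 0), 0) - inner ℝ (tgrad f p) v • (unitH f p, 0) +
          inner ℝ (unitH f p) (hess f p v) • (0, 1) := by
      ext1
      · simp [hA]; module
      · simp
    rw [this, map_add, map_sub, map_smul, map_smul, map_smul]
  have h2 : horTrace (A ∘L fd (fun p => ((-(vder f p • unitH f p), ‖hgrad f p‖) : FrameVec n)) p
      ∘L inlH) = -(vder f p * horTrace (shape f p ∘L shape f p)) -
        inner ℝ (tgrad f p) (A (unitH f p, 0)) + inner ℝ (unitH f p) (hess f p (A (0, 1))) := by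
    have h3 : A ∘L fd (fun p => ((-(vder f p • unitH f p), ‖hgrad f p‖) : FrameVec n)) p
      ∘L inlH = -(vder f p) • (shape f p ∘L shape f p) -
        (innerSL ℝ (tgrad f p)).smulRight (A (unitH f p, 0)) +
        (innerSL ℝ (unitH f p) ∘L hess f p).smulRight (A (0, 1)) :=
      ContinuousLinearMap.ext fun v => h1 v
    have h4 : ∀ (l : Hor n →L[ℝ] ℝ) (x : Hor n), horTrace (l.smulRight x) = l x := fun l x =>
      trace_smulRight (l : Hor n →ₗ[ℝ] ℝ) x
    have h5 : ∀ B C : Hor n →L[ℝ] Hor n, horTrace (B + C) = horTrace B + horTrace C := fun B C => by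
      simp [horTrace]
    have h6 : ∀ B C : Hor n →L[ℝ] Hor n, horTrace (B - C) = horTrace B - horTrace C := fun B C => by
      simp [horTrace]
    have h7 : ∀ (c : ℝ) (B : Hor n →L[ℝ] Hor n), horTrace (c • B) = c * horTrace B := fun c B => by
      simp [horTrace]
    rw [h3, h5, h6, h7, h4, h4]
    simp
  have h8 := hess_comm (hr.contDiffAt hp) (tgrad f p) (unitH f p)
  have h9 := symp_swap (tgrad f p) (unitH f p)
  have h3 := norm_ne_zero_iff.2 (hr.hgrad_ne p hp)
  rw [h2, hA, hr.fd_unitH hp, hr.fd_unitH hp, fd_hgrad, fd_hgrad]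
  simp only [zero_smul, add_zero, map_zero, zero_add, one_smul, map_smul, map_sub, smul_eq_mul,
    inner_smul_right, inner_sub_right, symp_self, ← neg_smul, symp_smul_left,
    real_inner_comm (unitH f p)] at h8 ⊢
  rw [real_inner_comm (tgrad f p)] at h8
  linear_combination ‖hgrad f p‖⁻¹ * h8 + ‖hgrad f p‖⁻¹ * vder f p * h9

end IsHorizontallyRegular

namespace IsDefiningOn

variable (hd : IsDefiningOn S ν f V) (hr : IsHorizontallyRegular f V)
  (hS : IsOrientedHypersurface S ν) (hSc : IsCompact S) (hSV : S ⊆ V)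
include hd hr hS hSc hSV

theorem integral_fd_transv {μ : Heis n → ℝ} (hμ : ContDiffOn ℝ 1 μ V) :
    ∫ p, ‖(ν p).1‖ * (fd μ p (transv f p) - slope f p * horTrace (shape f p) * μ p)
      ∂(sigmaR S ν) = 0 := by
  have h := setIntegral_frameDiv_div_rnorm hSc hS hd
    (X := fun p => μ p • ((-(vder f p • unitH f p), ‖hgrad f p‖) : FrameVec n))
    (hμ.smul hr.contDiffOn_norm_transv)
    (fun p hp => by rw [map_smul, hr.fd_norm_transv hp, smul_zero]) hSc hSV
    fun p hp hpS => absurd hp.1 hpS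
  rw [IsOrientedHypersurface.restrict_sigmaR hSc.measurableSet] at h
  refine Eq.trans (integral_congr_ae ?_) h
  filter_upwards [ae_mem_sigmaR hSc.measurableSet] with p hp
  have hpV := hSV hp
  rw [frameDiv_smul (hr.differentiableAt hμ hpV)
    (hr.differentiableAt hr.contDiffOn_norm_transv hpV),
    hr.frameDiv_norm_transv hpV, ← hr.norm_smul_transv hpV, map_smul, ← hr.norm_mul_slope hpV,
    ← hd.norm_hgrad_div hp hpV, smul_eq_mul]
  ring

/-- The first variation formula. -/
theorem integral_frameDiv_sub {Z : Heis n → FrameVec n} (hZ : ContDiffOn ℝ 1 Z V) :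
    ∫ p, (‖(ν p).1‖ * frameDiv Z p - metric (ν p) (fd Z p (unitH f p, 0)) -
      (ν p).2 * symp (unitH f p) (Z p).1 - horTrace (shape f p) * metric (ν p) (Z p))
      ∂(sigmaR S ν) = 0 := by
  have hZf : ContDiffOn ℝ 1 (fun p => inner ℝ (hgrad f p) (Z p).1 + vder f p * (Z p).2) V :=
    (hr.contDiffOn_hgrad.inner ℝ hZ.fst).add (hr.contDiffOn_vder.mul hZ.snd)
  have hU : ContDiffOn ℝ 1 (fun p => ((unitH f p, 0) : FrameVec n)) V :=
    hr.contDiffOn_unitH.prodMk contDiffOn_const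
  have h := setIntegral_frameDiv_div_rnorm hSc hS hd
    (X := fun p => ‖hgrad f p‖ • Z p - (inner ℝ (hgrad f p) (Z p).1 + vder f p * (Z p).2) •
      (unitH f p, 0)) ((hr.contDiffOn_norm.smul hZ).sub (hZf.smul hU))
    (fun p hp => by
      rw [map_sub, map_smul, map_smul, ← fd_eq_inner_add, fd_eq_inner_add f p (unitH f p, 0),
        hr.inner_hgrad hp, real_inner_self_eq_norm_sq, hr.norm_unitH hp]
      simp; ring) hSc hSV fun p hp hpS => absurd hp.1 hpS
  rw [IsOrientedHypersurface.restrict_sigmaR hSc.measurableSet] at h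
  refine Eq.trans (integral_congr_ae ?_) h
  filter_upwards [ae_mem_sigmaR hSc.measurableSet] with p hp
  have hpV := hSV hp
  have hZp := hr.differentiableAt hZ hpV
  have hnp := hr.differentiableAt hr.contDiffOn_norm hpV
  have hgp := hr.differentiableAt_hgrad hpV
  have hvp := hr.differentiableAt_vder hpV
  have hUp := hr.differentiableAt hU hpV
  have hup := hr.differentiableAt_unitH hpV
  have hfp := hr.differentiableAt hZf hpV
  have e1 : frameDiv (fun p => ‖hgrad f p‖ • Z p - (inner ℝ (hgrad f p) (Z p).1 +
      vder f p * (Z p).2) • ((unitH f p, 0) : FrameVec n)) p =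
      frameDiv (fun p => ‖hgrad f p‖ • Z p) p - frameDiv (fun p => (inner ℝ (hgrad f p) (Z p).1 +
      vder f p * (Z p).2) • ((unitH f p, 0) : FrameVec n)) p := by
    rw [frameDiv, frameDiv, frameDiv, ← map_sub]
    congr 1
    exact LinearMap.ext fun v => fd_sub (hnp.smul hZp) (hfp.smul hUp) v
  have hZ1 : DifferentiableAt ℝ (fun p => (Z p).1) p := hZp.fst
  have hZ2 : DifferentiableAt ℝ (fun p => (Z p).2) p := hZp.snd
  have hadd := fd_add (hgp.inner ℝ hZ1) (Z := fun p => vder f p * (Z p).2) (hvp.mul hZ2)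
  rw [e1, frameDiv_smul hnp hZp, frameDiv_smul hfp hUp, frameDiv_hor hup, hr.fd_norm_hgrad hpV,
    hadd, fd_inner hgp hZ1, fd_mul hvp hZ2, fd_fst hZp, fd_snd hZp,
    ← hr.inner_tgrad hpV, fd_hgrad, fd_hgrad, ← hd.norm_hgrad_div hp hpV]
  have hm : ∀ x : FrameVec n, metric (ν p) x = (inner ℝ (hgrad f p) x.1 + vder f p * x.2) /
      rnorm (rgrad f p) := by
    intro x
    have := (hd.rnorm_pos hp hpV).ne'
    rw [metric, hd.hgrad_eq hp hpV, hd.vder_eq hp hpV, inner_smul_left]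
    simp only [conj_trivial]
    field_simp
  have hm2 : (ν p).2 = vder f p / rnorm (rgrad f p) := by
    rw [hd.vder_eq hp hpV, mul_div_cancel_left₀ _ (hd.rnorm_pos hp hpV).ne']
  rw [hm, hm, hm2]
  have h8 := hess_comm (hr.contDiffAt hpV) (Z p).1 (unitH f p)
  have h9 := symp_swap (Z p).1 (unitH f p)
  simp only [shape, zero_smul, add_zero, inner_add_right, inner_smul_right,
    real_inner_comm (unitH f p)] at h8 ⊢
  rw [h9] at h8
  simp only [real_inner_comm (Z p).1, real_inner_comm (hess f p (Z p).1)] at h8 ⊢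
  field_simp
  linear_combination -(rnorm (rgrad f p))⁻¹ * h8

theorem integral_fd_transvU {κ : ℝ} (hκ : ∀ p ∈ S, horTrace (shape f p) = κ) {μ : Heis n → ℝ}
    (hμ : ContDiffOn ℝ 1 μ V) :
    ∫ p, ‖(ν p).1‖ * (fd μ p (transvU f p, 0) - slope f p * horTrace (shape f p ∘L shape f p) * μ p)
      ∂(sigmaR S ν) = 0 := by
  have hX : ContDiffOn ℝ 1 (fun p => μ p • ((-(vder f p • unitH f p), ‖hgrad f p‖) :
      FrameVec n)) V := hμ.smul hr.contDiffOn_norm_transv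
  have hX0 : ∀ p ∈ V, fd f p (μ p • (-(vder f p • unitH f p), ‖hgrad f p‖)) = 0 := fun p hp => by
    rw [map_smul, hr.fd_norm_transv hp, smul_zero]
  have hdiv := setIntegral_frameDiv_div_rnorm hSc hS hd hX hX0 hSc hSV
    fun p hp hpS => absurd hp.1 hpS
  rw [IsOrientedHypersurface.restrict_sigmaR hSc.measurableSet] at hdiv
  have hcr := hd.integral_crossForm_div_rnorm hS hSc hSV hr.contDiffOn_unitH hX hX0 fun p hp => by
    rw [fd_eq_inner_add, hr.inner_hgrad hp, hr.inner_unitH_fd hp]; simp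
  have hint : Integrable (fun p => frameDiv (fun p => μ p • ((-(vder f p • unitH f p), ‖hgrad f p‖) :
      FrameVec n)) p / rnorm (rgrad f p)) (sigmaR S ν) := by
    refine hS.integrable_of_continuousOn hSc ?_
    have hc : ContinuousOn (fun p => frameDiv (fun p => μ p • ((-(vder f p • unitH f p), ‖hgrad f p‖) :
      FrameVec n)) p) V := by
      have h1 := (contDiffOn_fd hr.isOpen hX (k := 0) (by norm_num)).continuousOn
      have h2 : Continuous fun B : FrameVec n →L[ℝ] FrameVec n =>
          LinearMap.trace ℝ _ (B : FrameVec n →ₗ[ℝ] FrameVec n) :=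
        LinearMap.continuous_of_finiteDimensional
          (LinearMap.trace ℝ (FrameVec n) ∘ₗ (ContinuousLinearMap.coeLM ℝ :
            (FrameVec n →L[ℝ] FrameVec n) →ₗ[ℝ] (FrameVec n →ₗ[ℝ] FrameVec n)))
      exact h2.comp_continuousOn h1
    exact (hc.mono hSV).div (continuous_rnorm.comp_continuousOn (hd.continuousOn_rgrad.mono hSV))
      fun p hp => (hd.rnorm_pos hp (hSV hp)).ne'
  have h3 : ∫ p, (crossForm (fd (unitH f) p) (fd (fun p => μ p • ((-(vder f p • unitH f p), ‖hgrad f p‖) :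
      FrameVec n)) p) (μ p • (-(vder f p • unitH f p), ‖hgrad f p‖)) / rnorm (rgrad f p) +
      κ * (frameDiv (fun p => μ p • ((-(vder f p • unitH f p), ‖hgrad f p‖) :
      FrameVec n)) p / rnorm (rgrad f p))) ∂(sigmaR S ν) = 0 := by
    by_cases hi : Integrable (fun p => crossForm (fd (unitH f) p) (fd (fun p => μ p •
      ((-(vder f p • unitH f p), ‖hgrad f p‖) : FrameVec n)) p)
      (μ p • (-(vder f p • unitH f p), ‖hgrad f p‖)) / rnorm (rgrad f p)) (sigmaR S ν)
    · rw [integral_add hi (hint.const_mul _), integral_const_mul, hdiv, hcr]; simp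
    · exact integral_undef fun h => hi (by
        have := h.sub (hint.const_mul κ)
        refine this.congr (Eventually.of_forall fun p => ?_)
        simp)
  refine Eq.trans (integral_congr_ae ?_) h3
  filter_upwards [ae_mem_sigmaR hSc.measurableSet] with p hp
  have hpV := hSV hp
  have hμp := hr.differentiableAt hμ hpV
  have hep := hr.differentiableAt hr.contDiffOn_norm_transv hpV
  rw [crossForm_rank_one _ _ _ _ (fd_smul hμp hep), crossForm, frameDiv_smul hμp hep]
  have h5 := hr.crossForm_norm_transv hpV
  have h6 : fd (unitH f) p (-(vder f p • unitH f p), ‖hgrad f p‖) = ‖hgrad f p‖ • transvU f p := by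
    rw [← hr.norm_smul_transv hpV, map_smul]; rfl
  have h7 : fd μ p (‖hgrad f p‖ • transvU f p, 0) = ‖hgrad f p‖ * fd μ p (transvU f p, 0) := by
    rw [← smul_eq_mul, ← map_smul]; simp
  have h8 : horTrace (fd (unitH f) p ∘L inlH) = κ := hκ p hp
  rw [h6, h7, h8, ← hd.norm_hgrad_div hp hpV]
  simp only [frameDiv]
  have h9 := hr.norm_mul_slope hpV
  rw [← h9] at h5 ⊢
  linear_combination (-(μ p) / rnorm (rgrad f p)) * h5

end IsDefiningOn

end

/-! ## Derivatives of determinants and of transformed normals -/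

section det

variable {E : Type*} [NormedAddCommGroup E] [NormedSpace ℝ E] [FiniteDimensional ℝ E]

/-- The trace of a continuous endomorphism. -/
def traceL (E : Type*) [NormedAddCommGroup E] [NormedSpace ℝ E] [FiniteDimensional ℝ E] :
    (E →L[ℝ] E) →L[ℝ] ℝ :=
  LinearMap.toContinuousLinearMap (LinearMap.trace ℝ E ∘ₗ (ContinuousLinearMap.coeLM ℝ :
    (E →L[ℝ] E) →ₗ[ℝ] (E →ₗ[ℝ] E)))

theorem traceL_apply (A : E →L[ℝ] E) : traceL E A = LinearMap.trace ℝ E (A : E →ₗ[ℝ] E) := rfl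

theorem contDiff_clm_det {k : WithTop ℕ∞} : ContDiff ℝ k fun A : E →L[ℝ] E => A.det := by
  let b := Module.finBasis ℝ E
  have h : (fun A : E →L[ℝ] E => A.det) = fun A => ∑ σ : Equiv.Perm (Fin (Module.finrank ℝ E)),
      ((Equiv.Perm.sign σ : ℤ) : ℝ) * ∏ i, LinearMap.toContinuousLinearMap (b.coord (σ i)) (A (b i)) := by
    ext A
    change LinearMap.det (A : E →ₗ[ℝ] E) = _
    rw [← LinearMap.det_toMatrix b, Matrix.det_apply']
    simp [LinearMap.toMatrix_apply]
  rw [h]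
  refine ContDiff.sum fun σ _ => contDiff_const.mul (contDiff_prod fun i _ => ?_)
  exact (ContinuousLinearMap.contDiff _).comp ((ContinuousLinearMap.apply ℝ E (b i)).contDiff)

theorem hasDerivAt_det_one_add (M : E →L[ℝ] E) :
    HasDerivAt (fun r : ℝ => (1 + r • M : E →L[ℝ] E).det) (traceL E M) 0 := by
  let b := Module.finBasis ℝ E
  have h : (fun r : ℝ => (1 + r • M : E →L[ℝ] E).det) = fun r => 1 +
      Matrix.trace (LinearMap.toMatrix b b (M : E →ₗ[ℝ] E)) * r +
      (Matrix.det (1 + (Polynomial.X : Polynomial ℝ) •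
        (LinearMap.toMatrix b b (M : E →ₗ[ℝ] E)).map Polynomial.C)).divX.divX.eval r * r ^ 2 := by
    ext r
    rw [← Matrix.det_one_add_smul]
    change LinearMap.det ((1 + r • M : E →L[ℝ] E) : E →ₗ[ℝ] E) = _
    rw [← LinearMap.det_toMatrix b]
    congr 1
    rw [ContinuousLinearMap.toLinearMap_add, map_add]
    congr 1
    · exact LinearMap.toMatrix_id b
    · rw [← map_smul]; rfl
  rw [h, traceL_apply, LinearMap.trace_eq_matrix_trace ℝ b]
  generalize (Matrix.det (1 + (Polynomial.X : Polynomial ℝ) •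
    (LinearMap.toMatrix b b (M : E →ₗ[ℝ] E)).map Polynomial.C)).divX.divX = P
  have h2 := (((hasDerivAt_id (0 : ℝ)).const_mul
    (Matrix.trace (LinearMap.toMatrix b b (M : E →ₗ[ℝ] E)))).const_add 1).add
    ((P.hasDerivAt 0).mul ((hasDerivAt_id (0 : ℝ)).pow 2))
  refine (h2.congr_of_eventuallyEq (Eventually.of_forall fun r => ?_)).congr_deriv ?_
  · simp
  · simp

variable [CompleteSpace E] {A A₁ : ℝ → E →L[ℝ] E} {t : ℝ}

omit [CompleteSpace E] in
theorem hasDerivAt_det {A' : E →L[ℝ] E} (hA : HasDerivAt A A' t) (hu : IsUnit (A t)) :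
    HasDerivAt (fun s => (A s).det) ((A t).det * traceL E (Ring.inverse (A t) * A')) t := by
  have hd : ∀ X Y : E →L[ℝ] E, (X * Y).det = X.det * Y.det := fun X Y => by
    rw [ContinuousLinearMap.det, ContinuousLinearMap.det, ContinuousLinearMap.det, ← map_mul]; rfl
  have h1 : ∀ s, (A s).det = (A t).det * (Ring.inverse (A t) * A s).det := fun s => by
    rw [← hd, ← mul_assoc, Ring.mul_inverse_cancel _ hu, one_mul]
  set M := Ring.inverse (A t) * A' with hM
  have h2 : HasDerivAt (fun s => Ring.inverse (A t) * A s) M t := hA.const_mul _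
  have h3 : HasFDerivAt (fun X : E →L[ℝ] E => X.det)
      (fderiv ℝ (fun X : E →L[ℝ] E => X.det) 1) 1 :=
    (contDiff_clm_det.differentiable (n := 1) (by norm_num) 1).hasFDerivAt
  have h4 : fderiv ℝ (fun X : E →L[ℝ] E => X.det) 1 M = traceL E M := by
    have h5 : HasDerivAt (fun r : ℝ => 1 + r • M) M 0 := by
      simpa using ((hasDerivAt_id (0 : ℝ)).smul_const M).const_add 1
    have h3' : HasFDerivAt (fun X : E →L[ℝ] E => X.det)
      (fderiv ℝ (fun X : E →L[ℝ] E => X.det) 1) (1 + (0 : ℝ) • M) := by simpa using h3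
    have h6 : HasDerivAt (fun r : ℝ => (1 + r • M : E →L[ℝ] E).det)
        (fderiv ℝ (fun X : E →L[ℝ] E => X.det) 1 M) 0 :=
      HasFDerivAt.comp_hasDerivAt (l := fun X : E →L[ℝ] E => X.det) (0 : ℝ) h3' h5
    exact h6.unique (hasDerivAt_det_one_add M)
  have h3' : HasFDerivAt (fun X : E →L[ℝ] E => X.det)
      (fderiv ℝ (fun X : E →L[ℝ] E => X.det) 1) (Ring.inverse (A t) * A t) := by
    rwa [Ring.inverse_mul_cancel _ hu]
  have h6 := (h3'.comp_hasDerivAt t h2).const_mul (A t).det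
  rw [h4] at h6
  exact h6.congr_of_eventuallyEq (Eventually.of_forall h1)

omit [FiniteDimensional ℝ E] in
theorem hasDerivAt_ringInverse_comp {A' : E →L[ℝ] E} (hA : HasDerivAt A A' t) (hu : IsUnit (A t)) :
    HasDerivAt (fun s => Ring.inverse (A s)) (-(Ring.inverse (A t) * A' * Ring.inverse (A t))) t := by
  obtain ⟨u, hu⟩ := hu
  have h1 : HasFDerivAt (Ring.inverse : (E →L[ℝ] E) → _)
      (-ContinuousLinearMap.mulLeftRight ℝ (E →L[ℝ] E) ↑u⁻¹ ↑u⁻¹) (A t) := by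
    rw [← hu]; exact hasFDerivAt_ringInverse u
  have h2 := h1.comp_hasDerivAt t hA
  refine HasDerivAt.congr_deriv (f := fun s => Ring.inverse (A s)) h2 ?_
  rw [← hu, Ring.inverse_unit]
  simp

theorem hasDerivAt_det_deriv {A₂ : E →L[ℝ] E} (hA : HasDerivAt A (A₁ t) t)
    (hA₁ : HasDerivAt A₁ A₂ t) (hu : IsUnit (A t)) :
    HasDerivAt (fun s => (A s).det * traceL E (Ring.inverse (A s) * A₁ s))
      ((A t).det * (traceL E (Ring.inverse (A t) * A₁ t) ^ 2 + traceL E (Ring.inverse (A t) * A₂) -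
        traceL E (Ring.inverse (A t) * A₁ t * (Ring.inverse (A t) * A₁ t)))) t := by
  have h1 := (traceL E).hasFDerivAt.comp_hasDerivAt t
    ((hasDerivAt_ringInverse_comp hA hu).mul hA₁)
  refine ((hasDerivAt_det hA hu).mul h1).congr_deriv ?_
  simp only [Function.comp_apply, Pi.mul_apply, map_add, neg_mul, map_neg, mul_assoc]
  ring

end det

/-- Twice differentiable curves: the second derivative of the norm. -/
theorem iteratedDeriv_two_norm {F : Type*} [NormedAddCommGroup F] [InnerProductSpace ℝ F]
    {y y₁ : ℝ → F} {y₂ : F} (hy : ∀ᶠ t in 𝓝 0, HasDerivAt y (y₁ t) t)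
    (hy₁ : HasDerivAt y₁ y₂ 0) (h0 : y 0 ≠ 0) {g : ℝ → ℝ} (hg : g =ᶠ[𝓝 0] fun t => ‖y t‖) :
    iteratedDeriv 2 g 0 = inner ℝ (‖y 0‖⁻¹ • y 0) y₂ +
      (‖y₁ 0‖ ^ 2 - inner ℝ (‖y 0‖⁻¹ • y 0) (y₁ 0) ^ 2) / ‖y 0‖ := by
  have hn : ∀ t, HasDerivAt y (y₁ t) t → y t ≠ 0 →
      HasDerivAt (fun t => ‖y t‖) (inner ℝ (y t) (y₁ t) / ‖y t‖) t := by
    intro t ht h0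
    have h1 : HasDerivAt (fun t => Real.sqrt (‖y t‖ ^ 2)) _ t :=
      ht.norm_sq.sqrt (by simpa using h0)
    have h2 : (fun t => Real.sqrt (‖y t‖ ^ 2)) = fun t => ‖y t‖ := by
      ext t; exact Real.sqrt_sq (norm_nonneg _)
    rw [h2, Real.sqrt_sq (norm_nonneg _)] at h1
    refine h1.congr_deriv ?_
    have := norm_ne_zero_iff.2 h0
    field_simp
  have h1 : deriv g =ᶠ[𝓝 0] fun t => inner ℝ (y t) (y₁ t) / ‖y t‖ := by
    have hc : ∀ᶠ t in 𝓝 0, y t ≠ 0 :=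
      (hy.self_of_nhds.continuousAt.eventually_ne h0)
    filter_upwards [hy, hc, hg.eventuallyEq_nhds] with t h2 h3 h4
    rw [h4.deriv_eq]
    exact (hn t h2 h3).deriv
  rw [iteratedDeriv_succ, iteratedDeriv_one, h1.deriv_eq]
  have h2 := hy.self_of_nhds
  have h3 := norm_ne_zero_iff.2 h0
  have h4 := (h2.inner ℝ hy₁).div (hn 0 h2 h0) h3
  have h5 : (fun t => inner ℝ (y t) (y₁ t) / ‖y t‖) =
    ((fun t => inner ℝ (y t) (y₁ t)) / fun t => ‖y t‖) := rfl
  rw [h5, h4.deriv, inner_smul_left, inner_smul_left, real_inner_self_eq_norm_sq]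
  simp only [conj_trivial]
  field_simp
  ring

/-- The horizontal vector dual to `v ↦ ⟨x, R v⟩`. -/
def horDual (x : FrameVec n) : (FrameVec n →L[ℝ] FrameVec n) →L[ℝ] Hor n :=
  LinearMap.toContinuousLinearMap
    { toFun := fun R => WithLp.toLp 2 fun b => metric x (R (EuclideanSpace.single b 1, 0))
      map_add' := fun R T => by ext b; simp [metric_add_right]
      map_smul' := fun c R => by ext b; simp [metric_smul_right] }

theorem inner_horDual (x : FrameVec n) (R : FrameVec n →L[ℝ] FrameVec n) (v : Hor n) :
    inner ℝ (horDual x R) v = metric x (R (v, 0)) := by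
  have h1 : ((v, 0) : FrameVec n) = ∑ b, v b • (EuclideanSpace.single b 1, 0) := by
    have := frame_decomp ((v, 0) : FrameVec n)
    simpa using this
  rw [h1, map_sum, ← metricL_apply, map_sum, PiLp.inner_apply]
  refine Finset.sum_congr rfl fun b _ => ?_
  rw [map_smul, map_smul, metricL_apply]
  change v b * metric x _ = _
  rfl

theorem horDual_one (x : FrameVec n) : horDual x 1 = x.1 := by
  refine ext_inner_right ℝ fun v => ?_
  rw [inner_horDual]
  simp [metric]

/-- The second derivative of the length of the horizontal part of the transformed normal. -/
theorem iteratedDeriv_two_norm_horDual {A A₁ : ℝ → FrameVec n →L[ℝ] FrameVec n}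
    {B C : FrameVec n →L[ℝ] FrameVec n} (hA : ∀ᶠ t in 𝓝 0, HasDerivAt A (A₁ t) t)
    (hA₁ : HasDerivAt A₁ C 0) (hA0 : A 0 = 1) (hB : A₁ 0 = B) {x : FrameVec n} (hx : x.1 ≠ 0)
    {g : ℝ → ℝ} (hg : g =ᶠ[𝓝 0] fun t => ‖(A t).det • horDual x (Ring.inverse (A t))‖) :
    iteratedDeriv 2 g 0 = ‖x.1‖ * (traceL _ C + traceL _ B ^ 2 - traceL _ (B * B)) -
      metric x (C (‖x.1‖⁻¹ • x.1, 0)) - 2 * traceL _ B * metric x (B (‖x.1‖⁻¹ • x.1, 0)) +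
      2 * metric x (B (B (‖x.1‖⁻¹ • x.1, 0))) +
      (‖horDual x B‖ ^ 2 - metric x (B (‖x.1‖⁻¹ • x.1, 0)) ^ 2) / ‖x.1‖ := by
  have hA0' := hA.self_of_nhds
  have hu : ∀ᶠ t in 𝓝 0, IsUnit (A t) := by
    have : IsUnit (A 0) := by rw [hA0]; exact isUnit_one
    exact hA0'.continuousAt.eventually (Units.isOpen.mem_nhds this)
  have hR : ∀ t, HasDerivAt A (A₁ t) t → IsUnit (A t) → HasDerivAt
      (fun s => horDual x (Ring.inverse (A s)))
      (horDual x (-(Ring.inverse (A t) * A₁ t * Ring.inverse (A t)))) t := fun t h1 h2 =>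
    (horDual x).hasFDerivAt.comp_hasDerivAt t (hasDerivAt_ringInverse_comp h1 h2)
  have h1 : ∀ᶠ t in 𝓝 0, HasDerivAt (fun t => (A t).det • horDual x (Ring.inverse (A t)))
      ((A t).det • horDual x (-(Ring.inverse (A t) * A₁ t * Ring.inverse (A t))) +
      ((A t).det * traceL _ (Ring.inverse (A t) * A₁ t)) • horDual x (Ring.inverse (A t))) t := by
    filter_upwards [hA, hu] with t h2 h3
    exact (hasDerivAt_det h2 h3).smul (hR t h2 h3)
  have hu0 := hu.self_of_nhds
  have hi := hasDerivAt_ringInverse_comp hA0' hu0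
  have h2 := ((hasDerivAt_det hA0' hu0).smul ((horDual x).hasFDerivAt.comp_hasDerivAt 0
    ((hi.mul hA₁).mul hi).neg)).add ((hasDerivAt_det_deriv hA0' hA₁ hu0).smul (hR 0 hA0' hu0))
  have hdet1 : (1 : FrameVec n →L[ℝ] FrameVec n).det = 1 := LinearMap.det_id
  have h0 : (A 0).det • horDual x (Ring.inverse (A 0)) = x.1 := by
    rw [hA0, Ring.inverse_one, horDual_one, hdet1, one_smul]
  have h3 := iteratedDeriv_two_norm h1 h2 (by rw [h0]; exact hx) hg
  rw [h3, h0]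
  simp only [hA0, hB, Ring.inverse_one, one_mul, mul_one, hdet1, one_smul, horDual_one,
    Function.comp_apply, Pi.mul_apply, Pi.neg_apply, map_neg, map_add, neg_mul, mul_neg]
  have hq : inner ℝ (‖x.1‖⁻¹ • x.1) x.1 = ‖x.1‖ := by
    rw [inner_smul_left, real_inner_self_eq_norm_sq]
    have := norm_ne_zero_iff.2 hx
    simp only [conj_trivial]
    field_simp
  have hn : ‖-horDual x B + traceL _ B • x.1‖ ^ 2 = ‖horDual x B‖ ^ 2 -
      2 * traceL _ B * (‖x.1‖ * metric x (B (‖x.1‖⁻¹ • x.1, 0))) + traceL _ B ^ 2 * ‖x.1‖ ^ 2 := by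
    have h5 : ‖x.1‖ * metric x (B (‖x.1‖⁻¹ • x.1, 0)) = inner ℝ (horDual x B) x.1 := by
      rw [← inner_horDual, inner_smul_right, ← mul_assoc, mul_inv_cancel₀ (norm_ne_zero_iff.2 hx),
        one_mul]
    rw [h5, ← real_inner_self_eq_norm_sq, inner_add_add_self, inner_neg_neg, inner_neg_left,
      inner_neg_right, inner_smul_left, inner_smul_right, inner_smul_left, inner_smul_right,
      real_inner_self_eq_norm_sq, real_inner_self_eq_norm_sq, real_inner_comm (horDual x B) x.1]
    simp only [conj_trivial]
    ring
  rw [hn]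
  have hc : ∀ R, inner ℝ (‖x.1‖⁻¹ • x.1) (horDual x R) = metric x (R (‖x.1‖⁻¹ • x.1, 0)) := fun R => by
    rw [real_inner_comm, inner_horDual]
  simp only [inner_add_right, inner_neg_right, inner_smul_right, hc, hq]
  have := norm_ne_zero_iff.2 hx
  simp only [mul_apply_eq_comp]
  field_simp
  ring

/-- The transformed normal in terms of any endomorphism that agrees with the differential of the
variation on the tangent space. -/
theorem normalVar_fst_eq {D : Set (Heis n)} {ν : Heis n → FrameVec n} {ϑ : ℝ → Heis n → Heis n}
    {t : ℝ} {p : Heis n} {A : FrameVec n →L[ℝ] FrameVec n} (hu : IsUnit A)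
    (hν : metric (ν p) (ν p) = 1)
    (hA : ∀ v, metric (ν p) v = 0 → diffVar D ϑ t p v = A v) :
    (normalVar D ν ϑ t p).1 = A.det • horDual (ν p) (Ring.inverse A) := by
  have key : ∀ w, conormal D ν ϑ t p w = A.det * metric (ν p) (Ring.inverse A w) := by
    intro w
    have h1 : A.det * metric (ν p) (Ring.inverse A w) = LinearMap.det ((A : FrameVec n →ₗ[ℝ] FrameVec n) ∘ₗ
        LinearMap.transvection (metricL (ν p) : FrameVec n →ₗ[ℝ] ℝ) (Ring.inverse A w - ν p)) := by
      rw [LinearMap.det_comp, LinearMap.transvection.det, ContinuousLinearMap.det]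
      congr 1
      simp only [ContinuousLinearMap.coe_coe, metricL_apply]
      rw [← metricL_apply _ (Ring.inverse A w - ν p), map_sub, metricL_apply, metricL_apply, hν]
      ring
    rw [h1, conormal]
    congr 1
    refine LinearMap.ext fun v => ?_
    have h2 : metric (ν p) (v - metric v (ν p) • ν p) = 0 := by
      rw [← metricL_apply, map_sub, map_smul, metricL_apply, metricL_apply, hν, metric_comm v]
      simp
    have h3 : A (Ring.inverse A w) = w := by
      rw [← mul_apply_eq_comp, Ring.mul_inverse_cancel _ hu]; rfl
    simp only [LinearMap.coe_mk, AddHom.coe_mk, LinearMap.comp_apply, LinearMap.transvection.apply,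
      ContinuousLinearMap.coe_coe, metricL_apply, map_add, map_smul, map_sub, h3]
    have h4 := hA _ h2
    rw [map_sub, map_smul] at h4
    rw [h4, map_sub, map_smul, metric_comm v, smul_sub]
    abel
  ext b
  simp only [normalVar, key]
  rfl

/-! ## Algebra of the second variation -/

theorem traceL_smulRight {E : Type*} [NormedAddCommGroup E] [NormedSpace ℝ E]
    [FiniteDimensional ℝ E] (l : E →L[ℝ] ℝ) (x : E) : traceL E (l.smulRight x) = l x :=
  trace_smulRight (l : E →ₗ[ℝ] ℝ) x

theorem traceL_smulRight_mul {E : Type*} [NormedAddCommGroup E] [NormedSpace ℝ E]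
    [FiniteDimensional ℝ E] (l : E →L[ℝ] ℝ) (x : E) (M : E →L[ℝ] E) :
    traceL E (l.smulRight x * M) = l (M x) := by
  exact traceL_smulRight (l ∘L M) x

theorem traceL_mul_smulRight {E : Type*} [NormedAddCommGroup E] [NormedSpace ℝ E]
    [FiniteDimensional ℝ E] (l : E →L[ℝ] ℝ) (x : E) (M : E →L[ℝ] E) :
    traceL E (M * l.smulRight x) = l (M x) := by
  have h : M * l.smulRight x = l.smulRight (M x) := ContinuousLinearMap.ext fun v => by simp
  rw [h, traceL_smulRight]

theorem traceL_inl_comp (A : FrameVec n →L[ℝ] Hor n) :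
    traceL _ (inlH ∘L A) =
      horTrace (A ∘L inlH) := by
  rw [traceL_apply, trace_frame]
  exact add_zero _

/-- The second variation of the perimeter density, in terms of the derivative `A` of the
horizontal normal `q` and the derivative `x` of `ϖ = w`. -/
theorem second_variation_algebra {q : Hor n} (hq : ‖q‖ = 1) {A : FrameVec n →L[ℝ] Hor n}
    (hA : ∀ v, inner ℝ q (A v) = 0) {x : FrameVec n →L[ℝ] ℝ} {w ℓ k s : ℝ} {ξ : Hor n}
    (hξ : A (-(w • q), 1) = ξ)
    (hx : ∀ v, inner ℝ q v = 0 → x (v, 0) = inner ℝ ξ v + w ^ 2 * inner ℝ (perp q) v)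
    {DW DZ B C : FrameVec n →L[ℝ] FrameVec n} {z : Hor n}
    (hDW : ∀ v, DW v = (((ℓ - w * k) * x v) • q + (w * ℓ) • A v, k * x v))
    (hB : ∀ v, B v = DW v + (0, symp v.1 ((w * ℓ) • q)))
    (hC : ∀ v, C v = DZ v + (0, symp v.1 z) + (0, symp (DW v).1 ((w * ℓ) • q)))
    {ν : FrameVec n} (hν : ν = s • (q, w)) :
    s * (traceL _ C + traceL _ B ^ 2 - traceL _ (B * B)) - metric ν (C (q, 0)) -
      2 * traceL _ B * metric ν (B (q, 0)) + 2 * metric ν (B (B (q, 0))) +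
      (‖horDual ν B‖ ^ 2 - metric ν (B (q, 0)) ^ 2) / s =
    s * ((w * ℓ) ^ 2 * (horTrace (A ∘L inlH) ^ 2 -
      horTrace ((A ∘L inlH) ∘L
        (A ∘L inlH)) + inner ℝ (perp q) ξ) +
      2 * (w * ℓ) * k * (horTrace (A ∘L inlH) * x (-(w • q), 1) -
        x (ξ, 0)) + ℓ ^ 2 * ‖ξ‖ ^ 2) +
    (s * traceL _ DZ - metric ν (DZ (q, 0)) - ν.2 * symp q z) := by
  set κ := horTrace (A ∘L inlH) with hκ
  set κ₂ := horTrace ((A ∘L inlH) ∘L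
        (A ∘L inlH)) with hκ₂
  have hqq : inner ℝ q q = (1 : ℝ) := by rw [real_inner_self_eq_norm_sq, hq]; norm_num
  have hmet : ∀ v : FrameVec n, metric ν v = s * (inner ℝ q v.1 + w * v.2) := by
    intro v; rw [hν, metric_smul_left]; rfl
  let om : FrameVec n →L[ℝ] ℝ := (sympL.flip q) ∘L fstH
  have hom : ∀ v, om v = symp v.1 q := fun v => by simp [om]
  set Ā : FrameVec n →L[ℝ] FrameVec n := inlH ∘L A with hĀ
  have hB' : B = (w * ℓ) • Ā + ((ℓ - w * k) • x).smulRight ((q, 0) : FrameVec n) +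
      (k • x + (w * ℓ) • om).smulRight ((0, 1) : FrameVec n) := by
    refine ContinuousLinearMap.ext fun v => ?_
    rw [hB, hDW]
    ext1
    · simp [hĀ]; abel
    · simp [hĀ, hom]
  have hC' : C = DZ + ((sympL.flip z) ∘L fstH).smulRight
      ((0, 1) : FrameVec n) + ((w * ℓ) ^ 2 • (om ∘L Ā)).smulRight ((0, 1) : FrameVec n) := by
    refine ContinuousLinearMap.ext fun v => ?_
    rw [hC, hDW]
    ext1
    · simp
    · simp [hom, hĀ, symp_add_left, symp_smul_left]; ring
  have hĀT : ∀ v, Ā v = (A v, 0) := fun v => rfl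
  have htrĀ : traceL _ Ā = κ := traceL_inl_comp A
  have htrĀĀ : traceL _ (Ā * Ā) = κ₂ := traceL_inl_comp (A ∘L Ā)
  have trB : traceL _ B = (w * ℓ) * κ + (ℓ - w * k) * x (q, 0) + k * x (0, 1) := by
    rw [hB', map_add, map_add, map_smul, traceL_smulRight, traceL_smulRight, htrĀ]
    simp [hom, symp_eq_inner, perp_zero]
  have trC : traceL _ C = traceL _ DZ + (w * ℓ) ^ 2 * symp (A (0, 1)) q := by
    rw [hC', map_add, map_add, traceL_smulRight, traceL_smulRight]
    simp [hom, hĀT, symp_eq_inner]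
  have hxadd : ∀ (u : Hor n) (c : ℝ), x (u, c) = x (u, 0) + c * x (0, 1) := by
    intro u c
    rw [← smul_eq_mul, ← map_smul, ← map_add]; simp
  have hxsm : ∀ (c : ℝ) (u u' : Hor n), x (c • u + u', 0) = c * x (u, 0) + x (u', 0) := by
    intro c u u'
    rw [← smul_eq_mul, ← map_smul, ← map_add]; simp
  have hxsm' : ∀ (c : ℝ) (u : Hor n), x (c • u, 0) = c * x (u, 0) := by
    intro c u
    rw [← smul_eq_mul, ← map_smul]; simp
  have Bq : B (q, 0) = (((ℓ - w * k) * x (q, 0)) • q + (w * ℓ) • A (q, 0), k * x (q, 0)) := by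
    rw [hB, hDW]; simp
  have BT : B (0, 1) = (((ℓ - w * k) * x (0, 1)) • q + (w * ℓ) • A (0, 1), k * x (0, 1)) := by
    rw [hB, hDW]; simp [symp_eq_inner, perp_zero]
  have trBB : traceL _ (B * B) = (w * ℓ) * ((w * ℓ) * κ₂ + (ℓ - w * k) * x (A (q, 0), 0) +
        (k * x (A (0, 1), 0) + (w * ℓ) * symp (A (0, 1)) q)) +
      (ℓ - w * k) * x (B (q, 0)) + (k * x (B (0, 1)) + (w * ℓ) * symp (B (0, 1)).1 q) := by
    have h1 : B * B = (w * ℓ) • (Ā * B) + ((ℓ - w * k) • x).smulRight ((q, 0) : FrameVec n) * B +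
        (k • x + (w * ℓ) • om).smulRight ((0, 1) : FrameVec n) * B := by
      change B ∘L B = (w * ℓ) • (Ā ∘L B) + _ ∘L B + _ ∘L B
      conv_lhs => enter [1]; rw [hB']
      rw [ContinuousLinearMap.add_comp, ContinuousLinearMap.add_comp, ContinuousLinearMap.smul_comp]
    have h2 : Ā * B = (w * ℓ) • (Ā * Ā) + Ā * ((ℓ - w * k) • x).smulRight ((q, 0) : FrameVec n) +
        Ā * (k • x + (w * ℓ) • om).smulRight ((0, 1) : FrameVec n) := by
      change Ā ∘L B = (w * ℓ) • (Ā ∘L Ā) + Ā ∘L _ + Ā ∘L _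
      rw [hB', ContinuousLinearMap.comp_add, ContinuousLinearMap.comp_add,
        ContinuousLinearMap.comp_smul]
    rw [h1, map_add, map_add, map_smul, traceL_smulRight_mul, traceL_smulRight_mul, h2, map_add,
      map_add, map_smul, traceL_mul_smulRight, traceL_mul_smulRight, htrĀĀ]
    simp [hom, hĀT]
  have hΛ : horDual ν B = (s * ℓ) • (ξ + x (q, 0) • q) := by
    refine ext_inner_right ℝ fun v => ?_
    rw [inner_horDual, hmet, hB, hDW]
    set v' := v - inner ℝ q v • q with hv'
    have hv : v = inner ℝ q v • q + v' := by rw [hv']; abel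
    have hv'q : inner ℝ q v' = 0 := by
      rw [hv', inner_sub_right, inner_smul_right, hqq]; ring
    have hξq : inner ℝ ξ q = 0 := by rw [← hξ, real_inner_comm, hA]
    have hpq : inner ℝ (perp q) v = inner ℝ (perp q) v' := by
      rw [hv', inner_sub_right, inner_smul_right, inner_perp_self]; ring
    have hξv : inner ℝ ξ v = inner ℝ ξ v' := by
      rw [hv', inner_sub_right, inner_smul_right, hξq]; ring
    have hxv : x (v, 0) = inner ℝ q v * x (q, 0) + (inner ℝ ξ v + w ^ 2 * inner ℝ (perp q) v) := by
      conv_lhs => rw [hv]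
      rw [hxsm, hx v' hv'q, hpq, hξv]
    have hsv : symp v q = -inner ℝ (perp q) v := by rw [symp_swap, symp_eq_inner]
    simp only [map_smul, hsv, inner_add_right, inner_smul_right, inner_smul_left, inner_add_left, hqq, hA, hxv,
      Prod.fst_add, Prod.snd_add, conj_trivial, smul_eq_mul, inner_zero_right]
    ring
  have hΛn : ‖horDual ν B‖ ^ 2 = (s * ℓ) ^ 2 * (‖ξ‖ ^ 2 + x (q, 0) ^ 2) := by
    have hξq : inner ℝ ξ q = 0 := by rw [← hξ, real_inner_comm, hA]
    rw [hΛ, ← real_inner_self_eq_norm_sq, ← real_inner_self_eq_norm_sq]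
    simp only [inner_add_right, inner_smul_right, inner_smul_left, inner_add_left, hqq, hξq,
      conj_trivial, real_inner_comm ξ q]
    ring
  have hξ' : ξ = A (0, 1) - w • A (q, 0) := by
    rw [← hξ, ← map_smul, ← map_sub]; simp
  have hxe : x (-(w • q), 1) = x (0, 1) - w * x (q, 0) := by
    rw [hxadd, ← neg_smul, hxsm']; ring
  have hxξ : x (ξ, 0) = x (A (0, 1), 0) - w * x (A (q, 0), 0) := by
    have := hxsm (-w) (A (q, 0)) (A (0, 1))
    rw [hξ', sub_eq_add_neg, ← neg_smul, add_comm, this]; ring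
  have hpξ : inner ℝ (perp q) ξ = -(symp (A (0, 1)) q - w * symp (A (q, 0)) q) := by
    rw [symp_swap, symp_swap (A (q, 0)), symp_eq_inner, symp_eq_inner, hξ', inner_sub_right,
      inner_smul_right]
    ring
  have hνC : metric ν (C (q, 0)) = metric ν (DZ (q, 0)) + ν.2 * symp q z +
      s * (w * ((w * ℓ) ^ 2 * symp (A (q, 0)) q)) := by
    rw [hC, hDW, metric_add_right, metric_add_right, hmet (0, _), hmet (0, _), hν]
    simp [symp_add_left, symp_smul_left]
    ring
  have e1 : metric ν (B (q, 0)) = s * (ℓ * x (q, 0)) := by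
    rw [hmet, Bq]
    simp only [inner_add_right, inner_smul_right, hqq, hA]
    ring
  have e2 : metric ν (B (B (q, 0))) = s * ((ℓ - w * k) * x (B (q, 0)) + w * (k * x (B (q, 0)) +
      (w * ℓ) * symp (B (q, 0)).1 q)) := by
    rw [hmet, hB (B (q, 0)), hDW (B (q, 0))]
    simp only [inner_add_right, inner_smul_right, hqq, hA, Prod.fst_add, Prod.snd_add, map_smul,
      smul_eq_mul, inner_zero_right]
    ring
  have e3 : x (B (q, 0)) = (ℓ - w * k) * x (q, 0) * x (q, 0) + (w * ℓ) * x (A (q, 0), 0) +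
      k * x (q, 0) * x (0, 1) := by
    rw [Bq, hxadd, hxsm, hxsm']
  have e4 : x (B (0, 1)) = (ℓ - w * k) * x (0, 1) * x (q, 0) + (w * ℓ) * x (A (0, 1), 0) +
      k * x (0, 1) * x (0, 1) := by
    rw [BT, hxadd, hxsm, hxsm']
  have e5 : symp (B (q, 0)).1 q = (w * ℓ) * symp (A (q, 0)) q := by
    rw [Bq, symp_add_left, symp_smul_left, symp_smul_left, symp_self]; ring
  have e6 : symp (B (0, 1)).1 q = (w * ℓ) * symp (A (0, 1)) q := by
    rw [BT, symp_add_left, symp_smul_left, symp_smul_left, symp_self]; ring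
  rw [hνC, hΛn, e1, e2, trBB, trB, trC, e3, e4, e5, e6, hxe, hxξ, hpξ]
  field_simp
  ring

namespace IsHorizontallyRegular

variable {f : Heis n → ℝ} {V : Set (Heis n)} {p : Heis n} (hr : IsHorizontallyRegular f V)
include hr

/-- The derivative of the horizontal normal along `T - ϖ ν_H` and the gradient of `ϖ`. -/
theorem fd_slope_eq (hp : p ∈ V) {v : Hor n} (hv : inner ℝ (unitH f p) v = 0) :
    fd (slope f) p (v, 0) =
      inner ℝ (transvU f p) v + slope f p ^ 2 * inner ℝ (perp (unitH f p)) v := by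
  rw [hr.fd_slope hp, transvU, hr.fd_unitH hp, inner_smul_left, inner_sub_left, inner_smul_left, hv,
    fd_hgrad, fd_hgrad, ← hr.inner_tgrad hp, transv, ← symp_eq_inner]
  have h8 := hess_comm (hr.contDiffAt hp) v (unitH f p)
  have h9 := symp_swap v (unitH f p)
  have h3 := norm_ne_zero_iff.2 (hr.hgrad_ne p hp)
  have h4 := hr.norm_mul_slope hp
  rw [h9] at h8
  simp only [map_neg, map_smul, inner_add_left, inner_neg_left, inner_smul_left, zero_smul,
    add_zero, one_smul, conj_trivial, real_inner_comm (hess f p v)] at h8 ⊢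
  rw [← h4] at h8
  field_simp
  linear_combination (-slope f p) * h8

end IsHorizontallyRegular

section

/-! ## The second fundamental form of a level set -/

section onb

variable {ν : Heis n → FrameVec n} {p : Heis n} {q : Hor n}

theorem mem_HS_iff (h0 : (ν p).1 ≠ 0) (hq : nuH ν p = q) {v : Hor n} :
    v ∈ HS ν p ↔ inner ℝ q v = 0 := by
  rw [HS, Submodule.mem_orthogonal_singleton_iff_inner_right, ← hq, nuH, inner_smul_left]
  simp [h0]

theorem starProjection_HS (h0 : (ν p).1 ≠ 0) (hq : nuH ν p = q) (v : Hor n) :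
    (HS ν p).starProjection v = v - inner ℝ q v • q := by
  have hqq : inner ℝ q q = (1 : ℝ) := by
    rw [real_inner_self_eq_norm_sq, ← hq, norm_nuH h0]; norm_num
  refine (Submodule.eq_starProjection_of_mem_of_inner_eq_zero (K := HS ν p) ?_
    fun w hw => ?_)
  · rw [mem_HS_iff h0 hq, inner_sub_right, inner_smul_right, hqq]; ring
  · rw [sub_sub_cancel, inner_smul_left, (mem_HS_iff h0 hq).1 hw, mul_zero]

/-- The trace over the horizontal tangent space. -/
theorem sum_inner_HS (h0 : (ν p).1 ≠ 0) (hq : nuH ν p = q) (T : Hor n →L[ℝ] Hor n) :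
    ∑ i, inner ℝ (stdOrthonormalBasis ℝ (HS ν p) i : Hor n)
      (T (stdOrthonormalBasis ℝ (HS ν p) i)) = horTrace T - inner ℝ q (T q) := by
  let π : Hor n →ₗ[ℝ] HS ν p := ((HS ν p).orthogonalProjectionOnto : Hor n →L[ℝ] HS ν p)
  have h1 := LinearMap.trace_eq_sum_inner (π ∘ₗ (T : Hor n →ₗ[ℝ] Hor n) ∘ₗ (HS ν p).subtype)
    (stdOrthonormalBasis ℝ (HS ν p))
  have h2 : ∀ i, inner ℝ (stdOrthonormalBasis ℝ (HS ν p) i)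
      ((π ∘ₗ (T : Hor n →ₗ[ℝ] Hor n) ∘ₗ (HS ν p).subtype) (stdOrthonormalBasis ℝ (HS ν p) i)) =
      inner ℝ (stdOrthonormalBasis ℝ (HS ν p) i : Hor n)
      (T (stdOrthonormalBasis ℝ (HS ν p) i)) := fun i =>
    Submodule.inner_orthogonalProjectionOnto_eq_of_mem_left _ _
  simp only [h2] at h1
  rw [← h1]
  rw [← LinearMap.comp_assoc, LinearMap.trace_comp_comm', ← LinearMap.comp_assoc,
    LinearMap.trace_comp_comm']
  rw [trace_eq_of_forall_apply (B := (T : Hor n →ₗ[ℝ] Hor n)) (c := 1)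
    (l := -((innerSL ℝ q : Hor n →L[ℝ] ℝ) : Hor n →ₗ[ℝ] ℝ)) (x := T q)]
  · simp [horTrace, sub_eq_add_neg]
  · intro v
    have h3 : (((HS ν p).subtype ∘ₗ π) v : Hor n) = v - inner ℝ q v • q := starProjection_HS h0 hq v
    rw [LinearMap.comp_apply, h3]
    simp [sub_eq_add_neg]

theorem sum_inner_mul_inner_HS (h0 : (ν p).1 ≠ 0) (hq : nuH ν p = q) (u v : Hor n) :
    ∑ i, inner ℝ u (stdOrthonormalBasis ℝ (HS ν p) i : Hor n) *
      inner ℝ v (stdOrthonormalBasis ℝ (HS ν p) i : Hor n) =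
      inner ℝ u v - inner ℝ q u * inner ℝ q v := by
  have h := sum_inner_HS h0 hq ((innerSL ℝ u).smulRight v)
  have h4 : horTrace ((innerSL ℝ u).smulRight v) = inner ℝ u v :=
    trace_smulRight (innerSL ℝ u : Hor n →ₗ[ℝ] ℝ) v
  rw [h4] at h
  simp only [ContinuousLinearMap.smulRight_apply, innerSL_apply_apply, inner_smul_right,
    real_inner_comm v] at h
  rw [h, real_inner_comm q u, real_inner_comm q v, real_inner_comm v u]

theorem horTrace_id : horTrace (ContinuousLinearMap.id ℝ (Hor n)) = 2 * n := by
  change LinearMap.trace ℝ (Hor n) LinearMap.id = _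
  rw [LinearMap.trace_id]
  simp [mul_comm]

theorem sum_symp_sq_HS (h0 : (ν p).1 ≠ 0) (hq : nuH ν p = q) :
    ∑ i, ∑ j, symp (stdOrthonormalBasis ℝ (HS ν p) i : Hor n)
      (stdOrthonormalBasis ℝ (HS ν p) j : Hor n) ^ 2 = 2 * n - 2 := by
  have hqn : ‖q‖ = 1 := by rw [← hq, norm_nuH h0]
  have h1 : ∀ i, ∑ j, symp (stdOrthonormalBasis ℝ (HS ν p) i : Hor n)
      (stdOrthonormalBasis ℝ (HS ν p) j : Hor n) ^ 2 =
      inner ℝ (stdOrthonormalBasis ℝ (HS ν p) i : Hor n)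
        ((ContinuousLinearMap.id ℝ (Hor n)) (stdOrthonormalBasis ℝ (HS ν p) i)) -
      inner ℝ (perp q) (stdOrthonormalBasis ℝ (HS ν p) i : Hor n) *
        inner ℝ (perp q) (stdOrthonormalBasis ℝ (HS ν p) i : Hor n) := by
    intro i
    simp only [symp_eq_inner, sq]
    rw [sum_inner_mul_inner_HS h0 hq, inner_perp_perp, inner_perp_left]
    simp
  simp only [h1]
  rw [Finset.sum_sub_distrib, sum_inner_HS h0 hq, sum_inner_mul_inner_HS h0 hq, inner_self_perp,
    inner_perp_perp]
  simp only [ContinuousLinearMap.id_apply, real_inner_self_eq_norm_sq, hqn]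
  rw [horTrace_id]
  ring

end onb

variable {S : Set (Heis n)} {ν : Heis n → FrameVec n} {f : Heis n → ℝ} {V : Set (Heis n)}
  {p : Heis n}

/-- The trace of the square of the horizontal shape operator. -/
def shapeSq (f : Heis n → ℝ) (p : Heis n) : ℝ := horTrace (shape f p ∘L shape f p)

namespace IsDefiningOn

variable (hd : IsDefiningOn S ν f V) (hr : IsHorizontallyRegular f V)
  (hS : IsOrientedHypersurface S ν)
include hd hr hS

theorem secondForm_eq (hp : p ∈ S) (hV : p ∈ V) {v : Hor n} (hv : inner ℝ (unitH f p) v = 0)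
    (u : Hor n) : secondForm S ν p v u = -inner ℝ (shape f p v) u := by
  rw [secondForm, hd.dS_nuH hr hS hp hV hv]; rfl

omit hS in
theorem inner_basis_HS (hp : p ∈ S) (hV : p ∈ V) (i) :
    inner ℝ (unitH f p) (stdOrthonormalBasis ℝ (HS ν p) i : Hor n) = 0 :=
  (mem_HS_iff (hd.normal_fst_ne hr hp hV) (hd.nuH_eq hp hV)).1 (stdOrthonormalBasis ℝ (HS ν p) i).2

theorem meanCurv_eq (hp : p ∈ S) (hV : p ∈ V) : meanCurv S ν p = -horTrace (shape f p) := by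
  have h := sum_inner_HS (hd.normal_fst_ne hr hp hV) (hd.nuH_eq hp hV) (shape f p)
  have h2 : inner ℝ (unitH f p) (shape f p (unitH f p)) = 0 := hr.inner_unitH_fd hV _
  rw [h2, sub_zero] at h
  rw [meanCurv, ← h, ← Finset.sum_neg_distrib]
  refine Finset.sum_congr rfl fun i _ => ?_
  rw [hd.secondForm_eq hr hS hp hV (hd.inner_basis_HS hr hp hV i), real_inner_comm]

theorem normSqSymm_eq (hp : p ∈ S) (hV : p ∈ V) :
    normSqSymm S ν p = shapeSq f p + (n - 1) / 2 * slope f p ^ 2 := by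
  set b := fun i => (stdOrthonormalBasis ℝ (HS ν p) i : Hor n)
  have hb := hd.inner_basis_HS hr hp hV
  have h0 := hd.normal_fst_ne hr hp hV
  have hq := hd.nuH_eq hp hV
  have h1 : ∀ i j, inner ℝ (shape f p (b i)) (b j) - inner ℝ (shape f p (b j)) (b i) =
      slope f p * symp (b i) (b j) := by
    intro i j
    have h8 := hess_comm (hr.contDiffAt hV) (b i) (b j)
    have h3 := norm_ne_zero_iff.2 (hr.hgrad_ne p hV)
    simp only [shape, ContinuousLinearMap.comp_apply, ContinuousLinearMap.inl_apply,
      hr.fd_unitH hV, fd_hgrad, inner_smul_left, inner_sub_left, hb i, hb j, b, slope]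
    simp only [b] at h8
    simp only [zero_smul, add_zero, mul_zero, sub_zero, conj_trivial]
    field_simp
    linear_combination h8
  have h2 : ∀ i j, ((secondForm S ν p (b i) (b j) + secondForm S ν p (b j) (b i)) / 2) ^ 2 =
      inner ℝ (shape f p (b i)) (b j) * inner ℝ (shape f p (b j)) (b i) +
        slope f p ^ 2 / 4 * symp (b i) (b j) ^ 2 := by
    intro i j
    rw [hd.secondForm_eq hr hS hp hV (hb i), hd.secondForm_eq hr hS hp hV (hb j)]
    linear_combination (inner ℝ (shape f p (b i)) (b j) - inner ℝ (shape f p (b j)) (b i) +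
      slope f p * symp (b i) (b j)) / 4 * h1 i j
  have h3 : ∀ i, ∑ j, inner ℝ (shape f p (b i)) (b j) * inner ℝ (shape f p (b j)) (b i) =
      inner ℝ (b i) ((shape f p ∘L shape f p) (b i)) := by
    intro i
    have h4 := sum_inner_mul_inner_HS h0 hq (shape f p (b i))
      ((shape f p).adjoint (b i))
    have h5 : inner ℝ (unitH f p) (shape f p (b i)) = 0 := hr.inner_unitH_fd hV _
    rw [h5, ContinuousLinearMap.adjoint_inner_right] at h4
    simp only [ContinuousLinearMap.adjoint_inner_left] at h4
    rw [ContinuousLinearMap.comp_apply, real_inner_comm]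
    rw [zero_mul, sub_zero] at h4
    rw [← h4]
    exact Finset.sum_congr rfl fun j _ => by rw [real_inner_comm (b i)]
  have h6 : normSqSymm S ν p = ∑ i, ∑ j,
      ((secondForm S ν p (b i) (b j) + secondForm S ν p (b j) (b i)) / 2) ^ 2 := rfl
  have h7 := sum_inner_HS h0 hq (shape f p ∘L shape f p)
  have h9 : inner ℝ (unitH f p) ((shape f p ∘L shape f p) (unitH f p)) = 0 := hr.inner_unitH_fd hV _
  rw [h9, sub_zero] at h7
  rw [h6]
  simp only [h2, Finset.sum_add_distrib, h3, ← Finset.mul_sum]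
  rw [sum_symp_sq_HS h0 hq, h7, shapeSq]
  ring

theorem gradHS_eq (hp : p ∈ S) (hV : p ∈ V) :
    gradHS S ν (varpi ν) p = transvU f p + slope f p ^ 2 • perp (unitH f p) := by
  have h0 := hd.normal_fst_ne hr hp hV
  have hq := hd.nuH_eq hp hV
  refine ext_inner_right ℝ fun v => ?_
  rw [gradHS, InnerProductSpace.toDual_symm_apply]
  set v' := v - inner ℝ (unitH f p) v • unitH f p with hv'
  have hqq : inner ℝ (unitH f p) (unitH f p) = (1 : ℝ) := by
    rw [real_inner_self_eq_norm_sq, hr.norm_unitH hV]; norm_num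
  have hv'q : inner ℝ (unitH f p) v' = 0 := by
    rw [hv', inner_sub_right, inner_smul_right, hqq]; ring
  have h1 : inner ℝ (transvU f p) (unitH f p) = 0 := by
    rw [real_inner_comm]; exact hr.inner_unitH_fd hV _
  have h2 := hd.dS_varpi hr hS hp hV hv'q
  rw [hr.fd_slope_eq hV hv'q] at h2
  simp only [ContinuousLinearMap.comp_apply, starProjection_HS h0 hq, ContinuousLinearMap.inl_apply]
  refine Eq.trans h2 ?_
  rw [inner_add_left, inner_smul_left, hv', inner_sub_right, inner_sub_right, inner_smul_right,
    inner_smul_right, h1, inner_perp_self]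
  simp

end IsDefiningOn

end

section

/-! ## Integration of the second variation -/

variable {S : Set (Heis n)} {ν : Heis n → FrameVec n} {f : Heis n → ℝ} {V : Set (Heis n)}
  {p : Heis n}

/-- `|P_H ν|²` in terms of `ϖ`. -/
def horWeight (w : ℝ) : ℝ := (1 + w ^ 2)⁻¹

theorem horWeight_mul (w : ℝ) : horWeight w * (1 + w ^ 2) = 1 :=
  inv_mul_cancel₀ (by positivity)

theorem hasDerivAt_horWeight (w : ℝ) : HasDerivAt horWeight (-(2 * w * horWeight w ^ 2)) w := by
  have h := ((hasDerivAt_pow 2 w).const_add 1).inv (by positivity : (1 + w ^ 2 : ℝ) ≠ 0)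
  refine HasDerivAt.congr_deriv (f := horWeight) h ?_
  rw [horWeight]
  field_simp
  norm_num
  ring

theorem contDiff_horWeight {k : WithTop ℕ∞} : ContDiff ℝ k horWeight :=
  (contDiff_const.add (contDiff_id.pow 2)).inv fun w => by simp only [id]; positivity

/-- The part of the second variation density (with respect to `σ_H`) that does not involve the
acceleration. -/
def secVar (f : Heis n → ℝ) (p : Heis n) : ℝ :=
  (slope f p * horWeight (slope f p)) ^ 2 * (horTrace (shape f p) ^ 2 - shapeSq f p +
    inner ℝ (perp (unitH f p)) (transvU f p)) +
  2 * (slope f p * horWeight (slope f p)) * (2 * slope f p * horWeight (slope f p) ^ 2) *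
    (horTrace (shape f p) * fd (slope f) p (transv f p) - fd (slope f) p (transvU f p, 0)) +
  horWeight (slope f p) ^ 2 * ‖transvU f p‖ ^ 2

/-- The corresponding part of the second derivative of the volume. -/
def volVar (f : Heis n → ℝ) (p : Heis n) : ℝ :=
  slope f p * (slope f p * horWeight (slope f p)) * horTrace (shape f p) +
  (slope f p * (2 * slope f p * horWeight (slope f p) ^ 2) -
    slope f p ^ 2 * horWeight (slope f p) ^ 2) * fd (slope f) p (transv f p)

namespace IsHorizontallyRegular

variable (hr : IsHorizontallyRegular f V)
include hr

theorem continuousOn_fd_slope {v : Heis n → FrameVec n} (hv : ContinuousOn v V) :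
    ContinuousOn (fun p => fd (slope f) p (v p)) V :=
  (contDiffOn_fd hr.isOpen hr.contDiffOn_slope (k := 0) (by norm_num)).continuousOn.clm_apply hv

theorem continuousOn_fd_unitH : ContinuousOn (fun p => fd (unitH f) p) V :=
  (contDiffOn_fd hr.isOpen hr.contDiffOn_unitH (k := 0) (by norm_num)).continuousOn

theorem continuousOn_transvU : ContinuousOn (transvU f) V :=
  hr.continuousOn_fd_unitH.clm_apply hr.contDiffOn_transv.continuousOn

theorem continuousOn_perp : ContinuousOn (fun p => perp (unitH f p)) V :=
  perpL.continuous.comp_continuousOn hr.contDiffOn_unitH.continuousOn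

theorem continuousOn_horTrace_shape : ContinuousOn (fun p => horTrace (shape f p)) V := by
  have h : ContinuousOn (fun p => shape f p) V :=
    hr.continuousOn_fd_unitH.clm_comp continuousOn_const
  exact (traceL (Hor n)).continuous.comp_continuousOn h

theorem continuousOn_shapeSq : ContinuousOn (shapeSq f) V := by
  have h : ContinuousOn (fun p => shape f p) V :=
    hr.continuousOn_fd_unitH.clm_comp continuousOn_const
  exact (traceL (Hor n)).continuous.comp_continuousOn (h.clm_comp h)

theorem continuousOn_horWeight : ContinuousOn (fun p => horWeight (slope f p)) V :=
  (contDiff_horWeight (k := 0)).continuous.comp_continuousOn hr.contDiffOn_slope.continuousOn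

theorem continuousOn_secVar : ContinuousOn (secVar f) V := by
  have h1 := hr.contDiffOn_slope.continuousOn
  have h2 := hr.continuousOn_horWeight
  have h3 := hr.continuousOn_horTrace_shape
  have h4 := hr.continuousOn_transvU
  have h5 := hr.continuousOn_shapeSq
  have h6 := hr.continuousOn_fd_slope hr.contDiffOn_transv.continuousOn
  have h7 := hr.continuousOn_fd_slope (h4.prodMk (continuousOn_const (c := (0 : ℝ))))
  have h8 : ContinuousOn (fun p => inner ℝ (perp (unitH f p)) (transvU f p)) V :=
    ContinuousOn.inner (𝕜 := ℝ) hr.continuousOn_perp h4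
  exact ((((h1.mul h2).pow 2).mul (((h3.pow 2).sub h5).add h8)).add
    (((continuousOn_const.mul (h1.mul h2)).mul ((continuousOn_const.mul h1).mul (h2.pow 2))).mul
      ((h3.mul h6).sub h7))).add ((h2.pow 2).mul (h4.norm.pow 2))

theorem continuousOn_volVar : ContinuousOn (volVar f) V := by
  have h1 := hr.contDiffOn_slope.continuousOn
  have h2 := hr.continuousOn_horWeight
  have h3 := hr.continuousOn_horTrace_shape
  have h6 := hr.continuousOn_fd_slope hr.contDiffOn_transv.continuousOn
  exact ((h1.mul (h1.mul h2)).mul h3).add (((h1.mul ((continuousOn_const.mul h1).mul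
    (h2.pow 2))).sub ((h1.pow 2).mul (h2.pow 2))).mul h6)

end IsHorizontallyRegular

namespace IsDefiningOn

variable (hd : IsDefiningOn S ν f V) (hr : IsHorizontallyRegular f V)
  (hS : IsOrientedHypersurface S ν) (hSV : S ⊆ V)
include hd hr hS hSV

theorem continuousOn_normSq_gradHS : ContinuousOn (fun p => ‖gradHS S ν (varpi ν) p‖ ^ 2) S := by
  have h := ((hr.continuousOn_transvU.add ((hr.contDiffOn_slope.continuousOn.pow 2).smul
    hr.continuousOn_perp)).mono hSV).norm.pow 2
  exact h.congr fun p hp => by rw [hd.gradHS_eq hr hS hp (hSV hp)]; rfl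

theorem continuousOn_normSqSymm : ContinuousOn (fun p => varpi ν p ^ 2 * (normSqSymm S ν p +
    (3 - (n : ℝ)) / 6 * varpi ν p ^ 2)) S := by
  have h1 := hr.contDiffOn_slope.continuousOn
  have h : ContinuousOn (fun p => slope f p ^ 2 * (shapeSq f p + (n - 1) / 2 * slope f p ^ 2 +
      (3 - (n : ℝ)) / 6 * slope f p ^ 2)) V :=
    (h1.pow 2).mul ((hr.continuousOn_shapeSq.add (continuousOn_const.mul (h1.pow 2))).add
      (continuousOn_const.mul (h1.pow 2)))
  exact (h.mono hSV).congr fun p hp => by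
    rw [hd.normSqSymm_eq hr hS hp (hSV hp), hd.varpi_eq hp (hSV hp)]

/-- The second variation after integration by parts. -/
theorem integral_secVar (hSc : IsCompact S) (hchar : charSet S ν = ∅) {κ : ℝ}
    (hκ : ∀ p ∈ S, horTrace (shape f p) = κ) :
    ∫ p, ‖(ν p).1‖ * (secVar f p - κ * volVar f p) ∂(sigmaR S ν) =
    ∫ p, (‖gradHS S ν (varpi ν) p‖ ^ 2 - varpi ν p ^ 2 * (normSqSymm S ν p +
      (3 - (n : ℝ)) / 6 * varpi ν p ^ 2)) ∂(sigmaH S ν) := by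
  have hw := hr.contDiffOn_slope
  have d3 : ∀ w, HasDerivAt (fun w => w ^ 3 * horWeight w ^ 2)
      (3 * w ^ 2 * horWeight w ^ 2 + w ^ 3 * (2 * horWeight w * -(2 * w * horWeight w ^ 2))) w :=
    fun w => by
      refine HasDerivAt.congr_deriv ((hasDerivAt_pow 3 w).mul ((hasDerivAt_horWeight w).pow 2)) ?_
      simp
  have d5 : ∀ w, HasDerivAt (fun w => w * (1 - horWeight w ^ 2))
      (1 * (1 - horWeight w ^ 2) + w * -(2 * horWeight w * -(2 * w * horWeight w ^ 2))) w :=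
    fun w => by
      refine HasDerivAt.congr_deriv ((hasDerivAt_id w).mul
        (((hasDerivAt_horWeight w).pow 2).const_sub 1)) ?_
      simp
  have c3 : ContDiffOn ℝ 1 (fun p => slope f p ^ 3 * horWeight (slope f p) ^ 2) V :=
    (hw.pow 3).mul ((contDiff_horWeight.comp_contDiffOn hw).pow 2)
  have c5 : ContDiffOn ℝ 1 (fun p => slope f p * (1 - horWeight (slope f p) ^ 2)) V :=
    hw.mul (contDiffOn_const.sub ((contDiff_horWeight.comp_contDiffOn hw).pow 2))
  have i3 := hd.integral_fd_transv hr hS hSc hSV c3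
  have i5 := hd.integral_fd_transvU hr hS hSc hSV hκ c5
  obtain ⟨hv1, hv2, i4⟩ := hS.integral_varpi hSc hchar
  have hN : ContinuousOn (fun p => ‖(ν p).1‖) S :=
    (continuous_fst.comp_continuousOn hS.continuousOn_normal).norm
  have hT : ContinuousOn (fun p => ‖gradHS S ν (varpi ν) p‖ ^ 2 - varpi ν p ^ 2 *
      (normSqSymm S ν p + (3 - (n : ℝ)) / 6 * varpi ν p ^ 2)) S :=
    (hd.continuousOn_normSq_gradHS hr hS hSV).sub (hd.continuousOn_normSqSymm hr hS hSV)
  rw [hS.integral_sigmaH hSc.measurableSet] at i4 ⊢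
  have j3 : ContinuousOn (fun p => ‖(ν p).1‖ * (fd (fun p => slope f p ^ 3 * horWeight (slope f p) ^ 2)
      p (transv f p) - slope f p * horTrace (shape f p) * (slope f p ^ 3 * horWeight (slope f p) ^ 2))) S :=
    hN.mul ((((contDiffOn_fd hr.isOpen c3 (k := 0) (by norm_num)).continuousOn.clm_apply
      hr.contDiffOn_transv.continuousOn).sub
      ((hw.continuousOn.mul hr.continuousOn_horTrace_shape).mul c3.continuousOn)).mono hSV)
  have j5 : ContinuousOn (fun p => ‖(ν p).1‖ * (fd (fun p => slope f p * (1 - horWeight (slope f p) ^ 2))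
      p (transvU f p, 0) - slope f p * horTrace (shape f p ∘L shape f p) *
      (slope f p * (1 - horWeight (slope f p) ^ 2)))) S :=
    hN.mul ((((contDiffOn_fd hr.isOpen c5 (k := 0) (by norm_num)).continuousOn.clm_apply
      (hr.continuousOn_transvU.prodMk continuousOn_const)).sub
      ((hw.continuousOn.mul hr.continuousOn_shapeSq).mul c5.continuousOn)).mono hSV)
  have j4 : ContinuousOn (fun p => ‖(ν p).1‖ * (3 * varpi ν p ^ 2 * dVarpi S ν p - n * varpi ν p ^ 4)) S := by
    fun_prop
  have k3 := (hS.integrable_of_continuousOn hSc j3).const_mul κ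
  have k5 := hS.integrable_of_continuousOn hSc j5
  have k4 := (hS.integrable_of_continuousOn hSc j4).const_mul (1 / 3)
  have kT : Integrable (fun p => ‖(ν p).1‖ * (‖gradHS S ν (varpi ν) p‖ ^ 2 - varpi ν p ^ 2 *
      (normSqSymm S ν p + (3 - (n : ℝ)) / 6 * varpi ν p ^ 2))) (sigmaR S ν) :=
    hS.integrable_of_continuousOn hSc (hN.mul hT)
  have e := integral_sub ((kT.add k3).sub k5) k4
  have e2 := integral_sub (kT.add k3) k5
  have e3 := integral_add kT k3
  simp only [Pi.add_apply, Pi.sub_apply, integral_const_mul] at e e2 e3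
  rw [e2, e3, i3, i5, i4, mul_zero, mul_zero, add_zero, sub_zero, sub_zero] at e
  rw [← e]
  refine integral_congr_ae ?_
  filter_upwards [ae_mem_sigmaR hSc.measurableSet] with p hp
  have hpV := hSV hp
  have hwp := hr.differentiableAt hw hpV
  rw [fd_comp_real (g := fun w => w ^ 3 * horWeight w ^ 2) (d3 _).differentiableAt hwp, (d3 _).deriv,
    fd_comp_real (g := fun w => w * (1 - horWeight w ^ 2)) (d5 _).differentiableAt hwp, (d5 _).deriv,
    hd.gradHS_eq hr hS hp hpV, hd.normSqSymm_eq hr hS hp hpV, hd.varpi_eq hp hpV,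
    hd.dVarpi_eq hr hS hp hpV, hr.fd_slope_eq hpV (inner_self_perp _),
    hr.fd_slope_eq hpV (v := transvU f p) (hr.inner_unitH_fd hpV _), secVar, volVar,
    hr.fd_slope_eq hpV (v := transvU f p) (hr.inner_unitH_fd hpV _), hκ p hp, shapeSq,
    inner_perp_perp]
  have hg : ‖transvU f p + slope f p ^ 2 • perp (unitH f p)‖ ^ 2 = ‖transvU f p‖ ^ 2 +
      2 * slope f p ^ 2 * inner ℝ (perp (unitH f p)) (transvU f p) + slope f p ^ 4 := by
    rw [norm_add_sq_real, norm_smul, norm_perp, hr.norm_unitH hpV, inner_smul_right,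
      real_inner_comm, Real.norm_eq_abs, mul_one, sq_abs]
    ring
  rw [hg, real_inner_self_eq_norm_sq, real_inner_self_eq_norm_sq, hr.norm_unitH hpV,
    real_inner_comm (perp (unitH f p)) (transvU f p)]
  have hl : horWeight (slope f p) = (1 + slope f p ^ 2)⁻¹ := rfl
  have hl2 : (1 + slope f p ^ 2 : ℝ) ≠ 0 := by positivity
  rw [hl]
  generalize fd (slope f) p (transv f p) = xe
  generalize inner ℝ (perp (unitH f p)) (transvU f p) = pi
  generalize horTrace (shape f p ∘L shape f p) = k2
  generalize ‖transvU f p‖ = X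
  generalize ‖(ν p).1‖ = N
  generalize slope f p = w at hl2 ⊢
  field_simp
  ring

end IsDefiningOn

end

section

/-! ## Domains with boundary of class `C²` -/

variable {D S : Set (Heis n)} {ν : Heis n → FrameVec n} {f : Heis n → ℝ} {V : Set (Heis n)}
  {p : Heis n}

theorem IsDefiningOn.congr {f₀ : Heis n → ℝ} {V₀ : Set (Heis n)} (hd : IsDefiningOn S ν f₀ V₀)
    (hV : IsOpen V) (hVV : V ⊆ V₀) (h : EqOn f f₀ V) : IsDefiningOn S ν f V := by
  have hr : ∀ q ∈ V, rgrad f q = rgrad f₀ q := fun q hq => by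
    have : f =ᶠ[𝓝 q] f₀ := by filter_upwards [hV.mem_nhds hq] with x hx using h hx
    rw [rgrad, rgrad, this.fderiv_eq]
  have hd' := hd.mono hV hVV
  refine ⟨hV, hd'.contDiffOn.congr h, ?_, fun q hq => ?_, fun q hq => ?_⟩
  · rw [hd'.inter_eq]
    ext q
    exact ⟨fun hq => ⟨hq.1, (h hq.1).trans hq.2⟩, fun hq => ⟨hq.1, (h hq.1).symm.trans hq.2⟩⟩
  · rw [hr q hq.2]; exact hd'.rgrad_ne q hq
  · rw [hr q hq.2]; exact hd'.normal_eq q hq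

namespace IsC2Domain

theorem isCompact_frontier (hD : IsC2Domain D ν) : IsCompact (frontier D) :=
  hD.1.of_isClosed_subset isClosed_frontier hD.1.isClosed.frontier_subset

theorem exists_defining (hD : IsC2Domain D ν) (hp : p ∈ frontier D) :
    ∃ U f, p ∈ U ∧ IsDefiningOn (frontier D) ν f U ∧ ∀ q ∈ U, (q ∈ D ↔ f q ≤ 0) := by
  obtain ⟨U, f, hU, hpU, hf, hDU, h⟩ := hD.2.2.2 p hp
  have hmem : ∀ q ∈ U, (q ∈ D ↔ f q ≤ 0) := fun q hq =>
    ⟨fun h => ((hDU ▸ ⟨h, hq⟩ : q ∈ {q ∈ U | f q ≤ 0})).2, fun h =>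
      ((hDU.symm ▸ ⟨hq, h⟩ : q ∈ D ∩ U)).1⟩
  have hcl := hD.1.isClosed
  have heq : frontier D ∩ U = {q ∈ U | f q = 0} := by
    ext q
    constructor
    · rintro ⟨hq, hqU⟩
      refine ⟨hqU, le_antisymm ((hmem q hqU).1 (hcl.frontier_subset hq)) ?_⟩
      by_contra hlt
      have h1 : ∀ᶠ x in 𝓝 q, f x < 0 :=
        (hf.continuousOn.continuousAt (hU.mem_nhds hqU)).eventually_lt_const (not_le.1 hlt)
      have h2 : q ∈ interior D := by
        rw [mem_interior_iff_mem_nhds]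
        filter_upwards [h1, hU.mem_nhds hqU] with x hx hxU using (hmem x hxU).2 hx.le
      exact hq.2 h2
    · rintro ⟨hqU, hq⟩
      refine ⟨⟨subset_closure ((hmem q hqU).2 hq.le), fun hi => ?_⟩, hqU⟩
      have hmax : IsLocalMax f q := by
        filter_upwards [mem_interior_iff_mem_nhds.1 hi, hU.mem_nhds hqU] with x hx hxU
        rw [hq]; exact (hmem x hxU).1 hx
      exact (h q hqU hq).1 (rgrad_eq_zero_iff.2 hmax.fderiv_eq_zero)
  refine ⟨U, f, hpU, ⟨hU, hf, heq, fun q hq => ?_, fun q hq => ?_⟩, hmem⟩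
  · exact (h q hq.2 (heq ▸ hq : q ∈ {q ∈ U | f q = 0}).2).1
  · exact (h q hq.2 (heq ▸ hq : q ∈ {q ∈ U | f q = 0}).2).2

theorem isOrientedHypersurface (hD : IsC2Domain D ν) : IsOrientedHypersurface (frontier D) ν :=
  isOrientedHypersurface_iff.2 fun p hp => by
    obtain ⟨U, f, hpU, hd, -⟩ := hD.exists_defining hp
    exact ⟨U, f, hpU, hd⟩

/-- A global defining function of the domain. -/
theorem exists_global (hD : IsC2Domain D ν) : ∃ (f : Heis n → ℝ) (V : Set (Heis n)),
    ContDiff ℝ 2 f ∧ frontier D ⊆ V ∧ IsDefiningOn (frontier D) ν f V ∧ (∀ q, q ∈ D ↔ f q ≤ 0) ∧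
      ∀ q, q ∈ frontier D ↔ f q = 0 := by
  have hS := hD.isOrientedHypersurface
  have hSc := hD.isCompact_frontier
  obtain ⟨f₀, V₀, hf₀, hSV₀, hd₀, hsign⟩ := hS.exists_global hSc
  set O := V₀ ∩ interior {q | q ∈ D ↔ f₀ q ≤ 0} with hO
  have hOo : IsOpen O := hd₀.isOpen.inter isOpen_interior
  have hSO : frontier D ⊆ O := by
    intro p hp
    refine ⟨hSV₀ hp, mem_interior_iff_mem_nhds.2 ?_⟩
    obtain ⟨U, f₁, hpU, hd₁, hm⟩ := hD.exists_defining hp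
    filter_upwards [hsign p hp f₁ U hd₁ hpU, hd₁.isOpen.mem_nhds hpU] with q hq hqU
    rw [hm q hqU, ← sign_nonpos_iff (a := f₀ q), ← sign_nonpos_iff (a := f₁ q), hq]
  obtain ⟨χ, hχ, hχc, hχO, hχ1, hχI⟩ := exists_smooth_cutoff hSc hOo hSO
  classical
  set g : Heis n → ℝ := fun q => if q ∈ D then -1 else 1 with hg
  set f : Heis n → ℝ := fun q => χ q * f₀ q + (1 - χ q) * g q with hf
  have hχS : ∀ p ∈ frontier D, ∀ᶠ q in 𝓝 p, χ q = 1 := fun p hp =>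
    hχ1.filter_mono (nhds_le_nhdsSet hp)
  have hff₀ : ∀ q, χ q = 1 → f q = f₀ q := fun q hq => by simp [hf, hq]
  have hχ0 : ∀ q, q ∉ O → χ q = 0 := fun q hq =>
    image_eq_zero_of_notMem_tsupport fun h => hq (hχO h)
  refine ⟨f, V₀ ∩ interior {q | χ q = 1}, ?_, fun p hp => ⟨hSV₀ hp,
    mem_interior_iff_mem_nhds.2 (hχS p hp)⟩, hd₀.congr (hd₀.isOpen.inter isOpen_interior)
    inter_subset_left fun q hq => hff₀ q (interior_subset hq.2 : q ∈ {q | χ q = 1}),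
    fun q => ?_, fun q => ?_⟩
  · rw [contDiff_iff_contDiffAt]
    intro q
    by_cases hq : q ∈ frontier D
    · refine hf₀.contDiffAt.congr_of_eventuallyEq ?_
      filter_upwards [hχS q hq] with x hx using hff₀ x hx
    · have hgl : ContDiffAt ℝ 2 g q := by
        by_cases hqD : q ∈ D
        · have hi : q ∈ interior D := by
            by_contra h
            exact hq ⟨subset_closure hqD, h⟩
          refine (contDiffAt_const (c := (-1 : ℝ))).congr_of_eventuallyEq ?_
          filter_upwards [mem_interior_iff_mem_nhds.1 hi] with x hx using if_pos hx
        · refine (contDiffAt_const (c := (1 : ℝ))).congr_of_eventuallyEq ?_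
          filter_upwards [hD.1.isClosed.isOpen_compl.mem_nhds hqD] with x hx using if_neg hx
      have hχ2 : ContDiffAt ℝ 2 χ q := (hχ.of_le (by norm_cast)).contDiffAt
      exact (hχ2.mul hf₀.contDiffAt).add ((contDiffAt_const.sub hχ2).mul hgl)
  · obtain ⟨h0, h1⟩ := hχI q
    by_cases hqO : q ∈ O
    · have hm : q ∈ D ↔ f₀ q ≤ 0 :=
        (interior_subset hqO.2 : q ∈ {q | q ∈ D ↔ f₀ q ≤ 0})
      by_cases hqD : q ∈ D
      · have := hm.1 hqD
        have hgq : g q = -1 := if_pos hqD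
        refine iff_of_true hqD ?_
        simp only [hf, hgq]
        nlinarith
      · have := not_le.1 (mt hm.2 hqD)
        have hgq : g q = 1 := if_neg hqD
        refine iff_of_false hqD (not_le.2 ?_)
        simp only [hf, hgq]
        rcases h0.eq_or_lt with h | h
        · rw [← h]; norm_num
        · nlinarith [mul_pos h this]
    · simp only [hf, hχ0 q hqO, hg]
      by_cases hqD : q ∈ D <;> simp [hqD]
  · constructor
    · intro hq
      rw [hff₀ q (hχS q hq).self_of_nhds]
      exact hd₀.eq_zero hq (hSV₀ hq)
    · intro hq
      by_cases hqO : q ∈ O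
      · have hm : q ∈ D ↔ f₀ q ≤ 0 :=
        (interior_subset hqO.2 : q ∈ {q | q ∈ D ↔ f₀ q ≤ 0})
        obtain ⟨h0, h1⟩ := hχI q
        by_cases hqD : q ∈ D
        · have h2 := hm.1 hqD
          simp only [hf, hg, if_pos hqD] at hq
          have h3 : χ q * f₀ q ≤ 0 := mul_nonpos_of_nonneg_of_nonpos h0 h2
          have h4 : χ q = 1 := by linarith
          rw [h4] at hq
          exact hd₀.mem hqO.1 (by linarith)
        · have := not_le.1 (mt hm.2 hqD)
          simp only [hf, hg, if_neg hqD] at hq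
          have h3 : 0 ≤ χ q * f₀ q := mul_nonneg h0 this.le
          have h4 : χ q = 1 := by linarith
          rw [h4] at hq; linarith
      · simp only [hf, hχ0 q hqO, hg] at hq
        by_cases hqD : q ∈ D <;> simp [hqD] at hq

theorem uniqueDiffOn (hD : IsC2Domain D ν) : UniqueDiffOn ℝ D := by
  obtain ⟨f, V, hf, hSV, hd, hDf, hSf⟩ := hD.exists_global
  intro p hp
  by_cases hpS : p ∈ frontier D
  · have hne : fderiv ℝ f p ≠ 0 := fun h =>
      hd.rgrad_ne p ⟨hpS, hSV hpS⟩ (rgrad_eq_zero_iff.2 h)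
    obtain ⟨u, hu⟩ : ∃ u, fderiv ℝ f p u < 0 := by
      obtain ⟨u, hu⟩ : ∃ u, fderiv ℝ f p u ≠ 0 := by
        by_contra! h
        exact hne (ContinuousLinearMap.ext h)
      rcases hu.lt_or_gt with h | h
      · exact ⟨u, h⟩
      · exact ⟨-u, by simpa using h⟩
    have hmem : ∀ v, fderiv ℝ f p v < 0 → v ∈ tangentConeAt ℝ D p := by
      intro v hv
      refine mem_tangentConeAt_of_add_smul_mem (tendsto_id'.2 (nhdsGT_le_nhdsNE 0)) ?_
      have h1 : HasDerivAt (fun t : ℝ => p + t • v) v 0 := by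
        simpa using ((hasDerivAt_id (0 : ℝ)).smul_const v).const_add p
      have h0 : HasFDerivAt f (fderiv ℝ f p) (p + (0 : ℝ) • v) := by
        simpa using (hf.differentiable (by norm_num) p).hasFDerivAt
      have h2 : HasDerivAt (fun t : ℝ => f (p + t • v)) (fderiv ℝ f p v) 0 :=
        HasFDerivAt.comp_hasDerivAt (0 : ℝ) h0 h1
      have h3 := h2.tendsto_slope.mono_left (nhdsGT_le_nhdsNE 0)
      filter_upwards [h3.eventually_lt_const hv, self_mem_nhdsWithin] with t ht ht0
      rw [hDf]
      rw [slope_def_field] at ht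
      have ht0' : (0 : ℝ) < t := ht0
      simp only [zero_smul, add_zero, (hSf p).1 hpS, sub_zero] at ht
      have := (div_neg_iff.1 ht)
      rcases this with h | h
      · linarith [h.2]
      · exact h.1.le
    refine ⟨?_, subset_closure hp⟩
    have htop : Submodule.span ℝ (tangentConeAt ℝ D p) = ⊤ := by
      refine eq_top_iff.2 fun v _ => ?_
      set c := (|fderiv ℝ f p v| + 1) / (-fderiv ℝ f p u) with hc
      have h1 : fderiv ℝ f p (v + c • u) < 0 := by
        have hu' : fderiv ℝ f p u ≠ 0 := hu.ne
        rw [map_add, map_smul, smul_eq_mul, hc, div_neg, neg_mul, div_mul_cancel₀ _ hu']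
        linarith [le_abs_self (fderiv ℝ f p v)]
      have h2 := Submodule.sub_mem _ (Submodule.subset_span (hmem _ h1))
        (Submodule.smul_mem _ c (Submodule.subset_span (hmem _ hu)))
      simpa using h2
    rw [htop]; exact dense_univ
  · have : p ∈ interior D := by
      by_contra h
      exact hpS ⟨subset_closure hp, h⟩
    exact uniqueDiffWithinAt_of_mem_nhds (mem_interior_iff_mem_nhds.1 this)

theorem volume_frontier (hD : IsC2Domain D ν) : volume (frontier D) = 0 := by
  have hS := hD.isOrientedHypersurface
  have hSc := hD.isCompact_frontier
  obtain ⟨f, V, hf, hSV, hd, -, hSf⟩ := hD.exists_global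
  obtain ⟨χ, hχ, hχc, hχV, hχ1, hχI⟩ := exists_smooth_cutoff hSc hd.isOpen hSV
  let b : ContDiffBump (0 : ℝ) := ⟨1, 2, one_pos, one_lt_two⟩
  have hlim := tendsto_integral_leray hSc hS hd hχ.continuous hχc hχV b.continuous
    b.hasCompactSupport
  have h1 : Tendsto (fun ε : ℝ => ε * ∫ p, ε⁻¹ * b (f p / ε) * χ p) (𝓝[>] 0) (𝓝 0) := by
    have := (tendsto_nhdsWithin_of_tendsto_nhds (s := Ioi 0) tendsto_id).mul hlim
    simpa using this
  have h2 : ∀ᶠ ε : ℝ in 𝓝[>] 0, volume.real (frontier D) ≤ ε * ∫ p, ε⁻¹ * b (f p / ε) * χ p := by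
    filter_upwards [self_mem_nhdsWithin] with ε hε
    have hε' : (ε : ℝ) ≠ 0 := ne_of_gt hε
    rw [← integral_const_mul]
    have h3 : ∀ p, ε * (ε⁻¹ * b (f p / ε) * χ p) = b (f p / ε) * χ p := fun p => by
      field_simp
    simp only [h3]
    have hi : Integrable (fun p => b (f p / ε) * χ p) :=
      ((b.continuous.comp (hf.continuous.div_const ε)).mul hχ.continuous).integrable_of_hasCompactSupport
        hχc.mul_left
    rw [← integral_indicator_one hSc.measurableSet]
    refine integral_mono ((integrable_indicator_iff hSc.measurableSet).2
      (integrableOn_const hSc.measure_ne_top)) hi fun p => ?_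
    by_cases hp : p ∈ frontier D
    · simp only [indicator_of_mem hp, Pi.one_apply]
      rw [(hSf p).1 hp, zero_div, (hχ1.filter_mono (nhds_le_nhdsSet hp)).self_of_nhds, mul_one,
        b.one_of_mem_closedBall (by simp [b])]
    · rw [indicator_of_notMem hp]
      exact mul_nonneg b.nonneg (hχI p).1
  have h3 : volume.real (frontier D) ≤ 0 := ge_of_tendsto h1 h2
  exact (measureReal_eq_zero_iff hSc.measure_ne_top).1 (le_antisymm h3 measureReal_nonneg)

end IsC2Domain

end

section

/-! ## The divergence theorem -/

variable {D : Set (Heis n)} {ν : Heis n → FrameVec n}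

/-- A smooth function that is `1` on `(-∞, -2]` and `0` on `[-1, ∞)`. -/
def leftStep (s : ℝ) : ℝ := Real.smoothTransition (-1 - s)

theorem contDiff_leftStep : ContDiff ℝ 1 leftStep :=
  Real.smoothTransition.contDiff.comp (contDiff_const.sub contDiff_id)

theorem leftStep_of_le {s : ℝ} (h : s ≤ -2) : leftStep s = 1 :=
  Real.smoothTransition.one_of_one_le (by linarith)

theorem leftStep_of_ge {s : ℝ} (h : -1 ≤ s) : leftStep s = 0 :=
  Real.smoothTransition.zero_of_nonpos (by linarith)

theorem abs_leftStep_le (s : ℝ) : |leftStep s| ≤ 1 :=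
  abs_le.2 ⟨le_trans (by norm_num) (Real.smoothTransition.nonneg (-1 - s)),
    Real.smoothTransition.le_one _⟩

theorem deriv_leftStep_of_lt {s : ℝ} (h : s < -2) : deriv leftStep s = 0 := by
  have : leftStep =ᶠ[𝓝 s] fun _ => 1 := by
    filter_upwards [Iio_mem_nhds h] with x hx using leftStep_of_le (le_of_lt hx)
  rw [this.deriv_eq, deriv_const]

theorem deriv_leftStep_of_gt {s : ℝ} (h : -1 < s) : deriv leftStep s = 0 := by
  have : leftStep =ᶠ[𝓝 s] fun _ => 0 := by
    filter_upwards [Ioi_mem_nhds h] with x hx using leftStep_of_ge (le_of_lt hx)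
  rw [this.deriv_eq, deriv_const]

theorem continuous_deriv_leftStep : Continuous (deriv leftStep) :=
  contDiff_leftStep.continuous_deriv le_rfl

theorem hasCompactSupport_deriv_leftStep : HasCompactSupport (deriv leftStep) :=
  HasCompactSupport.intro (isCompact_Icc (a := -2) (b := -1)) fun s hs => by
    rcases lt_or_ge s (-2) with h | h
    · exact deriv_leftStep_of_lt h
    · exact deriv_leftStep_of_gt (not_le.1 fun h1 => hs ⟨h, h1⟩)

theorem integral_deriv_leftStep : ∫ s, deriv leftStep s = -1 := by
  have h1 : Function.support (deriv leftStep) ⊆ Ioc (-3) 0 := by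
    intro s hs
    constructor
    · by_contra h; exact hs (deriv_leftStep_of_lt (by linarith))
    · by_contra h; exact hs (deriv_leftStep_of_gt (by linarith))
  rw [← intervalIntegral.integral_eq_integral_of_support_subset h1,
    intervalIntegral.integral_deriv_eq_sub
      (fun x _ => contDiff_leftStep.differentiable (by norm_num) x)
      (continuous_deriv_leftStep.intervalIntegrable _ _),
    leftStep_of_ge (by norm_num), leftStep_of_le (by norm_num)]
  norm_num

theorem traceL_fderiv_smul {E : Type*} [NormedAddCommGroup E] [NormedSpace ℝ E]
    [FiniteDimensional ℝ E] {a : E → ℝ} {Y : E → E} {p : E} (ha : DifferentiableAt ℝ a p)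
    (hY : DifferentiableAt ℝ Y p) :
    traceL E (fderiv ℝ (fun q => a q • Y q) p) = a p * traceL E (fderiv ℝ Y p) +
      fderiv ℝ a p (Y p) := by
  rw [fderiv_fun_smul ha hY, map_add, map_smul, smul_eq_mul, traceL_smulRight]

namespace IsC2Domain

theorem continuousOn_fderivWithin (hD : IsC2Domain D ν) {F : Type*} [NormedAddCommGroup F]
    [NormedSpace ℝ F] {Y : Heis n → F} (hY : ContDiffOn ℝ 1 Y D) :
    ContinuousOn (fderivWithin ℝ Y D) D :=
  hY.continuousOn_fderivWithin hD.uniqueDiffOn le_rfl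

/-- Integration by parts on `D` against a cutoff. -/
theorem setIntegral_leftStep (hD : IsC2Domain D ν) {f : Heis n → ℝ} (hf : ContDiff ℝ 2 f)
    (hDf : ∀ q, q ∈ D ↔ f q ≤ 0) {Y : Heis n → Heis n} (hY : ContDiffOn ℝ 1 Y D) {ε : ℝ}
    (hε : 0 < ε) :
    ∫ p in D, leftStep (f p / ε) * traceL _ (fderivWithin ℝ Y D p) =
      -∫ p in D, ε⁻¹ * deriv leftStep (f p / ε) * fderiv ℝ f p (Y p) := by
  have hDm := hD.1.measurableSet
  have hmem : ∀ q, f q < 0 → D ∈ 𝓝 q := fun q hq => by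
    filter_upwards [(isOpen_lt hf.continuous continuous_const).mem_nhds hq] with x hx
    exact (hDf x).2 (le_of_lt hx)
  have hη : ContDiff ℝ 1 fun p => leftStep (f p / ε) :=
    contDiff_leftStep.comp ((hf.of_le (by norm_num)).div_const ε)
  have hfar : ∀ q, -ε < f q → (fun p => leftStep (f p / ε) • Y p) =ᶠ[𝓝 q] fun _ => 0 := by
    intro q hq
    filter_upwards [(isOpen_lt continuous_const hf.continuous).mem_nhds hq] with x hx
    rw [leftStep_of_ge, zero_smul]
    rw [le_div_iff₀ hε]; linarith [show -ε < f x from hx]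
  have hX : ContDiff ℝ 1 fun p => leftStep (f p / ε) • Y p := by
    rw [contDiff_iff_contDiffAt]
    intro q
    rcases lt_or_ge (f q) 0 with h | h
    · exact hη.contDiffAt.smul (hY.contDiffAt (hmem q h))
    · exact contDiffAt_const.congr_of_eventuallyEq (hfar q (by linarith))
  have hXc : HasCompactSupport fun p => leftStep (f p / ε) • Y p := by
    refine HasCompactSupport.intro hD.1 fun q hq => ?_
    exact (hfar q (by linarith [not_le.1 (mt (hDf q).2 hq)])).self_of_nhds
  have hcont : Continuous fun p => fderiv ℝ f p := hf.continuous_fderiv (by norm_num)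
  have hi1 : IntegrableOn (fun p => leftStep (f p / ε) * traceL _ (fderivWithin ℝ Y D p)) D :=
    (hη.continuous.continuousOn.mul ((traceL _).continuous.comp_continuousOn
      (hD.continuousOn_fderivWithin hY))).integrableOn_compact hD.1
  have hi2 : IntegrableOn (fun p => ε⁻¹ * deriv leftStep (f p / ε) * fderiv ℝ f p (Y p)) D :=
    ((continuous_const.mul (continuous_deriv_leftStep.comp
      (hf.continuous.div_const ε))).continuousOn.mul
      (hcont.continuousOn.clm_apply hY.continuousOn)).integrableOn_compact hD.1
  rw [eq_neg_iff_add_eq_zero, ← integral_add hi1 hi2]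
  refine Eq.trans ?_ (integral_trace_fderiv_eq_zero volume hX hXc)
  rw [← integral_indicator hDm]
  refine integral_congr_ae (Eventually.of_forall fun q => ?_)
  rcases lt_or_ge (f q) (-ε / 2) with h | h
  · have hq0 : f q < 0 := by linarith
    rw [indicator_of_mem ((hDf q).2 hq0.le)]
    have hYd : DifferentiableAt ℝ Y q := (hY.contDiffAt (hmem q hq0)).differentiableAt (by norm_num)
    beta_reduce
    rw [← traceL_apply, traceL_fderiv_smul (hη.differentiable (by norm_num) q) hYd,
      fderivWithin_of_mem_nhds (hmem q hq0)]
    congr 1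
    have h1 : HasFDerivAt (fun p => f p / ε) (ε⁻¹ • fderiv ℝ f q) q := by
      simpa [div_eq_inv_mul] using
        ((hf.differentiable (by norm_num) q).hasFDerivAt.const_mul ε⁻¹)
    have h2 : HasDerivAt leftStep (deriv leftStep (f q / ε)) (f q / ε) :=
      (contDiff_leftStep.differentiable (by norm_num) _).hasDerivAt
    have h3 := (h2.comp_hasFDerivAt q h1).fderiv
    have h4 : fderiv ℝ (fun p => leftStep (f p / ε)) q =
      deriv leftStep (f q / ε) • ε⁻¹ • fderiv ℝ f q := h3
    rw [h4]
    simp only [smul_apply, smul_eq_mul]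
    ring
  · have h1 : -1 < f q / ε := by rw [lt_div_iff₀ hε]; linarith
    beta_reduce
    rw [(hfar q (by linarith)).fderiv_eq]
    by_cases hq : q ∈ D <;> simp [hq, deriv_leftStep_of_gt h1, leftStep_of_ge h1.le]

/-- The divergence theorem. -/
theorem setIntegral_trace (hD : IsC2Domain D ν) {Y : Heis n → Heis n}
    (hY : ContDiffOn ℝ 1 Y D) :
    ∫ p in D, traceL _ (fderivWithin ℝ Y D p) =
      lerayConst n * ∫ p, metric (ν p) (toFrame p (Y p)) ∂(sigmaR (frontier D) ν) := by
  have hS := hD.isOrientedHypersurface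
  have hSc := hD.isCompact_frontier
  have hDm := hD.1.measurableSet
  obtain ⟨f, V, hf, hSV, hd, hDf, hSf⟩ := hD.exists_global
  obtain ⟨χ, hχ, hχc, hχV, hχ1, hχI⟩ := exists_smooth_cutoff hSc hd.isOpen hSV
  have hcont : ContinuousOn (fun p => fderiv ℝ f p (Y p)) D :=
    (hf.continuous_fderiv (by norm_num)).continuousOn.clm_apply hY.continuousOn
  obtain ⟨G, hG⟩ := ContinuousMap.exists_restrict_eq hD.1.isClosed
    ⟨D.domRestrict fun p => fderiv ℝ f p (Y p), hcont.domRestrict⟩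
  have hGD : ∀ p ∈ D, G p = fderiv ℝ f p (Y p) := fun p hp =>
    DFunLike.congr_fun hG ⟨p, hp⟩
  have hlim := tendsto_integral_leray (u := fun p => χ p * G p) hSc hS hd
    (hχ.continuous.mul G.continuous) hχc.mul_right
    ((tsupport_mul_subset_left).trans hχV) continuous_deriv_leftStep
    hasCompactSupport_deriv_leftStep
  rw [integral_deriv_leftStep] at hlim
  obtain ⟨δ, hδ, hδK⟩ := (hD.1.diff isOpen_interior (t := interior {p | χ p = 1})
    : IsCompact (D \ interior {p | χ p = 1})).exists_forall_le' (f := fun p => -f p)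
      hf.continuous.neg.continuousOn (a := 0) (fun p hp => by
        have h1 := (hDf p).1 hp.1
        have h2 : f p ≠ 0 := fun h => hp.2 (mem_interior_iff_mem_nhds.2
          (hχ1.filter_mono (nhds_le_nhdsSet ((hSf p).2 h))))
        have := lt_of_le_of_ne h1 h2
        linarith)
  have hev : ∀ᶠ ε : ℝ in 𝓝[>] 0, ∫ p, ε⁻¹ * deriv leftStep (f p / ε) * (χ p * G p) =
      -∫ p in D, leftStep (f p / ε) * traceL _ (fderivWithin ℝ Y D p) := by
    filter_upwards [self_mem_nhdsWithin,
      mem_nhdsWithin_of_mem_nhds (Iio_mem_nhds (half_pos hδ))] with ε hε hεδ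
    have hε' : 0 < ε := hε
    rw [hD.setIntegral_leftStep hf hDf hY hε', neg_neg, ← integral_indicator hDm]
    refine integral_congr_ae (Eventually.of_forall fun q => ?_)
    beta_reduce
    by_cases hq : q ∈ D
    · rw [indicator_of_mem hq, hGD q hq]
      by_cases h1 : q ∈ interior {p | χ p = 1}
      · have : χ q = 1 := (interior_subset h1 : q ∈ {p | χ p = 1})
        rw [this, one_mul]
      · have h2 := hδK q ⟨hq, h1⟩
        rw [deriv_leftStep_of_lt, mul_zero, zero_mul, zero_mul]
        rw [div_lt_iff₀ hε']
        linarith [show ε < δ / 2 from hεδ, show δ ≤ -f q from h2]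
    · rw [indicator_of_notMem hq, deriv_leftStep_of_gt, mul_zero, zero_mul]
      have := not_le.1 (mt (hDf q).2 hq)
      have := div_pos this hε'
      linarith
  have hT : ContinuousOn (fun p => traceL _ (fderivWithin ℝ Y D p)) D :=
    (traceL _).continuous.comp_continuousOn (hD.continuousOn_fderivWithin hY)
  have hlim2 : Tendsto (fun ε : ℝ => ∫ p in D, leftStep (f p / ε) *
      traceL _ (fderivWithin ℝ Y D p)) (𝓝[>] 0)
      (𝓝 (∫ p in D, traceL _ (fderivWithin ℝ Y D p))) := by
    refine tendsto_integral_filter_of_dominated_convergence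
      (fun p => |traceL _ (fderivWithin ℝ Y D p)|) ?_ ?_
      (hT.integrableOn_compact hD.1).abs ?_
    · refine Eventually.of_forall fun ε => ?_
      exact (((contDiff_leftStep.continuous.comp (hf.continuous.div_const ε)).continuousOn).mul
        hT).aestronglyMeasurable hDm
    · refine Eventually.of_forall fun ε => Eventually.of_forall fun p => ?_
      rw [Real.norm_eq_abs, abs_mul]
      exact mul_le_of_le_one_left (abs_nonneg _) (abs_leftStep_le _)
    · rw [ae_restrict_iff' hDm]
      filter_upwards [measure_eq_zero_iff_ae_notMem.1 hD.volume_frontier] with p hp hpD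
      have h1 : f p < 0 := lt_of_le_of_ne ((hDf p).1 hpD) fun h => hp ((hSf p).2 h)
      refine (tendsto_congr' ?_).2 tendsto_const_nhds
      filter_upwards [self_mem_nhdsWithin, mem_nhdsWithin_of_mem_nhds
        (Iio_mem_nhds (show (0 : ℝ) < -f p / 2 by linarith))] with ε hε hε2
      rw [leftStep_of_le, one_mul]
      rw [div_le_iff₀ hε]
      linarith [show ε < -f p / 2 from hε2]
  have h1 := tendsto_nhds_unique (hlim.congr' hev) hlim2.neg
  have h2 : ∫ p, χ p * G p / rnorm (rgrad f p) ∂(sigmaR (frontier D) ν) =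
      ∫ p, metric (ν p) (toFrame p (Y p)) ∂(sigmaR (frontier D) ν) := by
    rw [← IsOrientedHypersurface.restrict_sigmaR hSc.measurableSet]
    refine setIntegral_congr_fun hSc.measurableSet fun p hp => ?_
    beta_reduce
    have h3 := rnorm_pos (hd.rgrad_ne p ⟨hp, hSV hp⟩)
    rw [(hχ1.filter_mono (nhds_le_nhdsSet hp)).self_of_nhds, one_mul,
      hGD p (hD.1.isClosed.frontier_subset hp), fderiv_eq_fd, hd.fd_eq hp (hSV hp),
      mul_div_cancel_left₀ _ h3.ne']
  rw [h2] at h1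
  linarith

end IsC2Domain

end

/-! ## Calculus on space-time cylinders -/

section cylinder

variable {E F : Type*} [NormedAddCommGroup E] [NormedSpace ℝ E] [NormedAddCommGroup F]
  [NormedSpace ℝ F] {I : Set ℝ} {D : Set E} {g : ℝ × E → F} {t : ℝ} {p : E}

/-- The time derivative within a cylinder. -/
def timeDeriv (I : Set ℝ) (D : Set E) (g : ℝ × E → F) (x : ℝ × E) : F :=
  fderivWithin ℝ g (I ×ˢ D) x (1, 0)

/-- The spatial derivative within a cylinder. -/
def spaceDeriv (I : Set ℝ) (D : Set E) (g : ℝ × E → F) (x : ℝ × E) : E →L[ℝ] F :=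
  fderivWithin ℝ g (I ×ˢ D) x ∘L ContinuousLinearMap.inr ℝ ℝ E

theorem contDiffOn_timeDeriv (hI : IsOpen I) (hD : UniqueDiffOn ℝ D)
    (hg : ContDiffOn ℝ ∞ g (I ×ˢ D)) : ContDiffOn ℝ ∞ (timeDeriv I D g) (I ×ˢ D) :=
  (hg.fderivWithin (hI.uniqueDiffOn.prod hD) (by simp)).clm_apply contDiffOn_const

theorem contDiffOn_spaceDeriv (hI : IsOpen I) (hD : UniqueDiffOn ℝ D)
    (hg : ContDiffOn ℝ ∞ g (I ×ˢ D)) : ContDiffOn ℝ ∞ (spaceDeriv I D g) (I ×ˢ D) :=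
  (hg.fderivWithin (hI.uniqueDiffOn.prod hD) (by simp)).clm_comp contDiffOn_const

theorem hasDerivAt_timeDeriv (hI : IsOpen I) (hg : ContDiffOn ℝ ∞ g (I ×ˢ D)) (ht : t ∈ I)
    (hp : p ∈ D) : HasDerivAt (fun s => g (s, p)) (timeDeriv I D g (t, p)) t := by
  have h1 := (hg.differentiableOn (by simp) (t, p) ⟨ht, hp⟩).hasFDerivWithinAt
  have h2 : HasDerivWithinAt (fun s : ℝ => (s, p)) ((1 : ℝ), (0 : E)) I t :=
    ((hasDerivAt_id t).prodMk (hasDerivAt_const t p)).hasDerivWithinAt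
  have h3 : MapsTo (fun s : ℝ => (s, p)) I (I ×ˢ D) := fun s hs => ⟨hs, hp⟩
  exact (HasFDerivWithinAt.comp_hasDerivWithinAt t h1 h2 h3).hasDerivAt (hI.mem_nhds ht)

theorem hasFDerivWithinAt_spaceDeriv (hg : ContDiffOn ℝ ∞ g (I ×ˢ D)) (ht : t ∈ I)
    (hp : p ∈ D) : HasFDerivWithinAt (fun q => g (t, q)) (spaceDeriv I D g (t, p)) D p := by
  have h1 := (hg.differentiableOn (by simp) (t, p) ⟨ht, hp⟩).hasFDerivWithinAt
  have h2 : HasFDerivWithinAt (fun q : E => (t, q)) (ContinuousLinearMap.inr ℝ ℝ E) D p :=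
    (hasFDerivAt_prodMk_right t p).hasFDerivWithinAt
  exact h1.comp p h2 fun q hq => ⟨ht, hq⟩

theorem fderivWithin_eq_spaceDeriv (hD : UniqueDiffOn ℝ D) (hg : ContDiffOn ℝ ∞ g (I ×ˢ D))
    (ht : t ∈ I) (hp : p ∈ D) :
    fderivWithin ℝ (fun q => g (t, q)) D p = spaceDeriv I D g (t, p) :=
  (hasFDerivWithinAt_spaceDeriv hg ht hp).fderivWithin (hD p hp)

theorem contDiffOn_slice (hg : ContDiffOn ℝ ∞ g (I ×ˢ D)) (ht : t ∈ I) :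
    ContDiffOn ℝ ∞ (fun q => g (t, q)) D :=
  hg.comp (contDiff_const.prodMk contDiff_id).contDiffOn fun _ hq => ⟨ht, hq⟩

theorem hasDerivAt_spaceDeriv (hI : IsOpen I) (hD : UniqueDiffOn ℝ D)
    (hDi : D ⊆ closure (interior D)) (hg : ContDiffOn ℝ ∞ g (I ×ˢ D)) (ht : t ∈ I) (hp : p ∈ D) :
    HasDerivAt (fun s => spaceDeriv I D g (s, p))
      (spaceDeriv I D (timeDeriv I D g) (t, p)) t := by
  have hK := hI.uniqueDiffOn.prod hD
  have hx : (t, p) ∈ I ×ˢ D := ⟨ht, hp⟩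
  refine (hasDerivAt_timeDeriv hI (contDiffOn_spaceDeriv hI hD hg) ht hp).congr_deriv ?_
  have hd : DifferentiableWithinAt ℝ (fderivWithin ℝ g (I ×ˢ D)) (I ×ˢ D) (t, p) :=
    (hg.fderivWithin hK (m := ∞) (by simp)).differentiableOn (by simp) _ hx
  have hsymm : IsSymmSndFDerivWithinAt ℝ g (I ×ˢ D) (t, p) := by
    refine (hg _ hx).isSymmSndFDerivWithinAt
      (by simpa using (by norm_cast : (2 : WithTop ℕ∞) ≤ ∞)) hK ?_ hx
    rw [interior_prod_eq, hI.interior_eq, closure_prod_eq]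
    exact ⟨subset_closure ht, hDi hp⟩
  have h1 := hd.hasFDerivWithinAt.clm_comp
    (hasFDerivWithinAt_const (ContinuousLinearMap.inr ℝ ℝ E) (t, p) (I ×ˢ D))
  have h2 := hd.hasFDerivWithinAt.clm_apply
    (hasFDerivWithinAt_const ((1, 0) : ℝ × E) (t, p) (I ×ˢ D))
  ext v
  rw [timeDeriv, spaceDeriv]
  change fderivWithin ℝ (fun x => fderivWithin ℝ g (I ×ˢ D) x ∘L ContinuousLinearMap.inr ℝ ℝ E)
    (I ×ˢ D) (t, p) (1, 0) v = fderivWithin ℝ (fun x => fderivWithin ℝ g (I ×ˢ D) x (1, 0))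
    (I ×ˢ D) (t, p) (0, v)
  rw [h1.fderivWithin (hK _ hx), h2.fderivWithin (hK _ hx)]
  simpa using hsymm.eq (1, 0) (0, v)

theorem hasDerivAt_setIntegral [MeasurableSpace E] [BorelSpace E]
    [SecondCountableTopology E] (μ : Measure E) [IsFiniteMeasureOnCompacts μ] (hI : IsOpen I)
    (hD : UniqueDiffOn ℝ D) (hDc : IsCompact D) {g : ℝ × E → ℝ}
    (hg : ContDiffOn ℝ ∞ g (I ×ˢ D)) (ht : t ∈ I) :
    HasDerivAt (fun s => ∫ p in D, g (s, p) ∂μ) (∫ p in D, timeDeriv I D g (t, p) ∂μ) t := by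
  obtain ⟨δ, hδ, hδI⟩ := Metric.nhds_basis_closedBall.mem_iff.1 (hI.mem_nhds ht)
  have hT := contDiffOn_timeDeriv hI hD hg
  obtain ⟨C, hC⟩ := ((isCompact_closedBall t δ).prod hDc).exists_bound_of_continuousOn
    (hT.continuousOn.mono (prod_mono_left hδI))
  have hgc : ∀ s ∈ I, ContinuousOn (fun p => g (s, p)) D := fun s hs =>
    (contDiffOn_slice hg hs).continuousOn
  have hTc : ContinuousOn (fun p => timeDeriv I D g (t, p)) D := (contDiffOn_slice hT ht).continuousOn
  refine (hasDerivAt_integral_of_dominated_loc_of_deriv_le (𝕜 := ℝ)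
    (F := fun s p => g (s, p)) (F' := fun s p => timeDeriv I D g (s, p)) (bound := fun _ => C)
    (Metric.ball_mem_nhds t hδ) ?_ ?_ ?_ ?_ ?_ ?_).2
  · filter_upwards [hI.mem_nhds ht] with s hs
    exact (hgc s hs).aestronglyMeasurable hDc.measurableSet
  · exact (hgc t ht).integrableOn_compact hDc
  · exact hTc.aestronglyMeasurable hDc.measurableSet
  · rw [ae_restrict_iff' hDc.measurableSet]
    exact Eventually.of_forall fun p hp s hs => hC (s, p) ⟨Metric.ball_subset_closedBall hs, hp⟩
  · exact integrableOn_const hDc.measure_ne_top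
  · rw [ae_restrict_iff' hDc.measurableSet]
    exact Eventually.of_forall fun p hp s hs => hasDerivAt_timeDeriv hI hg
      (hδI (Metric.ball_subset_closedBall hs)) hp

/-- The divergence of `(div W) W - W' W`. -/
theorem traceL_fderivWithin_sub [FiniteDimensional ℝ E] (hD : UniqueDiffOn ℝ D)
    (hDi : D ⊆ closure (interior D)) {W Z : E → E} (hW : ContDiffOn ℝ ∞ W D)
    (hZ : ContDiffOn ℝ ∞ Z D) (hp : p ∈ D) :
    traceL E (fderivWithin ℝ (fun q => Z q + (traceL E (fderivWithin ℝ W D q) • W q -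
      fderivWithin ℝ W D q (W q))) D p) =
    traceL E (fderivWithin ℝ W D p) ^ 2 + traceL E (fderivWithin ℝ Z D p) -
      traceL E (fderivWithin ℝ W D p * fderivWithin ℝ W D p) := by
  have hsymm : IsSymmSndFDerivWithinAt ℝ W D p :=
    (hW p hp).isSymmSndFDerivWithinAt
      (by simpa using (by norm_cast : (2 : WithTop ℕ∞) ≤ ∞)) hD (hDi hp) hp
  have h1 : HasFDerivWithinAt (fderivWithin ℝ W D) (fderivWithin ℝ (fderivWithin ℝ W D) D p) D p :=
    ((hW.fderivWithin hD (m := ∞) (by simp)).differentiableOn (by simp) _ hp).hasFDerivWithinAt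
  have hW1 := (hW.differentiableOn (by simp) p hp).hasFDerivWithinAt
  have hZ1 := (hZ.differentiableOn (by simp) p hp).hasFDerivWithinAt
  have h2 := (traceL E).hasFDerivAt.comp_hasFDerivWithinAt p h1
  have h3 := hZ1.add ((h2.smul hW1).sub (h1.clm_apply hW1))
  have h4 : fderivWithin ℝ (fun q => Z q + (traceL E (fderivWithin ℝ W D q) • W q -
      fderivWithin ℝ W D q (W q))) D p = _ := h3.fderivWithin (hD p hp)
  rw [h4]
  have h5 : (fderivWithin ℝ (fderivWithin ℝ W D) D p).flip (W p) =
      fderivWithin ℝ (fderivWithin ℝ W D) D p (W p) := by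
    ext v
    exact hsymm.eq v (W p)
  simp only [map_add, map_sub, map_smul, smul_eq_mul, traceL_smulRight, h5,
    Function.comp_apply, ContinuousLinearMap.comp_apply]
  change _ + (_ - (traceL E (fderivWithin ℝ W D p * fderivWithin ℝ W D p) + _)) = _
  ring

end cylinder

section

/-! ## The second derivative of the volume -/

variable {D : Set (Heis n)} {ν : Heis n → FrameVec n} {ϑ : ℝ → Heis n → Heis n} {ε : ℝ}

/-- The variation, as a function on the cylinder. -/
def flowMap (ϑ : ℝ → Heis n → Heis n) (x : ℝ × Heis n) : Heis n := ϑ x.1 x.2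

/-- The variation field in coordinates. -/
def fieldVar (D : Set (Heis n)) (ϑ : ℝ → Heis n → Heis n) (ε : ℝ) : Heis n → Heis n := fun q =>
  timeDeriv (Ioo (-ε) ε) D (flowMap ϑ) (0, q)

/-- The acceleration of the variation in coordinates. -/
def accVar (D : Set (Heis n)) (ϑ : ℝ → Heis n → Heis n) (ε : ℝ) : Heis n → Heis n := fun q =>
  timeDeriv (Ioo (-ε) ε) D (timeDeriv (Ioo (-ε) ε) D (flowMap ϑ)) (0, q)

theorem IsC2Domain.subset_closure_interior (hD : IsC2Domain D ν) : D ⊆ closure (interior D) :=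
  hD.2.2.1.ge

namespace IsVariation

variable (hv : IsVariation D ϑ ε) (hD : IsC2Domain D ν)
include hv

theorem zero_mem : (0 : ℝ) ∈ Ioo (-ε) ε := ⟨neg_lt_zero.2 hv.1, hv.1⟩

theorem contDiffOn_flowMap : ContDiffOn ℝ ∞ (flowMap ϑ) (Ioo (-ε) ε ×ˢ D) := hv.2.1

include hD

theorem fderivWithin_eq {t : ℝ} (ht : t ∈ Ioo (-ε) ε) {p : Heis n} (hp : p ∈ D) :
    fderivWithin ℝ (ϑ t) D p = spaceDeriv (Ioo (-ε) ε) D (flowMap ϑ) (t, p) :=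
  fderivWithin_eq_spaceDeriv hD.uniqueDiffOn hv.contDiffOn_flowMap ht hp

theorem spaceDeriv_zero {p : Heis n} (hp : p ∈ D) :
    spaceDeriv (Ioo (-ε) ε) D (flowMap ϑ) (0, p) = 1 := by
  rw [← hv.fderivWithin_eq hD hv.zero_mem hp,
    fderivWithin_congr (f := fun q => q) (fun q hq => hv.2.2.2 q hq) (hv.2.2.2 p hp)]
  exact fderivWithin_id (hD.uniqueDiffOn p hp)

theorem isUnit_spaceDeriv {t : ℝ} (ht : t ∈ Ioo (-ε) ε) {p : Heis n} (hp : p ∈ D) :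
    IsUnit (spaceDeriv (Ioo (-ε) ε) D (flowMap ϑ) (t, p)) := by
  rw [ContinuousLinearMap.isUnit_iff_bijective, ← hv.fderivWithin_eq hD ht hp]
  have hi := hv.2.2.1 t ht p hp
  exact ⟨hi, LinearMap.injective_iff_surjective.1 hi⟩

theorem det_pos {t : ℝ} (ht : t ∈ Ioo (-ε) ε) {p : Heis n} (hp : p ∈ D) :
    0 < (spaceDeriv (Ioo (-ε) ε) D (flowMap ϑ) (t, p)).det := by
  have hne : ∀ s ∈ Ioo (-ε) ε, (spaceDeriv (Ioo (-ε) ε) D (flowMap ϑ) (s, p)).det ≠ 0 := by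
    intro s hs h0
    set A := spaceDeriv (Ioo (-ε) ε) D (flowMap ϑ) (s, p)
    have h1 : (Ring.inverse A * A).det = 1 := by
      rw [Ring.inverse_mul_cancel _ (hv.isUnit_spaceDeriv hD hs hp)]
      exact LinearMap.det_id
    have h2 : (Ring.inverse A * A).det = (Ring.inverse A).det * A.det := LinearMap.det_comp _ _
    rw [h0] at h2
    rw [h2, mul_zero] at h1
    exact zero_ne_one h1
  have hc : ContinuousOn (fun s => (spaceDeriv (Ioo (-ε) ε) D (flowMap ϑ) (s, p)).det)
      (Ioo (-ε) ε) :=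
    (contDiff_clm_det (k := 0)).continuous.comp_continuousOn
      ((contDiffOn_spaceDeriv isOpen_Ioo hD.uniqueDiffOn hv.contDiffOn_flowMap).continuousOn.comp
        (by fun_prop) fun s hs => ⟨hs, hp⟩)
  by_contra h
  have h0 : (spaceDeriv (Ioo (-ε) ε) D (flowMap ϑ) (0, p)).det = 1 := by
    rw [hv.spaceDeriv_zero hD hp]; exact LinearMap.det_id
  obtain ⟨s, hs, hs0⟩ := isPreconnected_Ioo.intermediate_value ht hv.zero_mem hc
    (show (0 : ℝ) ∈ Icc _ _ from ⟨not_lt.1 h, by beta_reduce; rw [h0]; norm_num⟩)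
  exact hne s hs hs0

theorem contDiffOn_fieldVar : ContDiffOn ℝ ∞ (fieldVar D ϑ ε) D :=
  contDiffOn_slice (contDiffOn_timeDeriv isOpen_Ioo hD.uniqueDiffOn hv.contDiffOn_flowMap)
    hv.zero_mem

theorem contDiffOn_accVar : ContDiffOn ℝ ∞ (accVar D ϑ ε) D :=
  contDiffOn_slice (contDiffOn_timeDeriv isOpen_Ioo hD.uniqueDiffOn
    (contDiffOn_timeDeriv isOpen_Ioo hD.uniqueDiffOn hv.contDiffOn_flowMap)) hv.zero_mem

theorem hasDerivAt_spaceDeriv_flowMap {t : ℝ} (ht : t ∈ Ioo (-ε) ε) {p : Heis n} (hp : p ∈ D) :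
    HasDerivAt (fun s => spaceDeriv (Ioo (-ε) ε) D (flowMap ϑ) (s, p))
      (spaceDeriv (Ioo (-ε) ε) D (timeDeriv (Ioo (-ε) ε) D (flowMap ϑ)) (t, p)) t :=
  hasDerivAt_spaceDeriv isOpen_Ioo hD.uniqueDiffOn hD.subset_closure_interior
    hv.contDiffOn_flowMap ht hp

theorem spaceDeriv_timeDeriv {p : Heis n} (hp : p ∈ D) :
    spaceDeriv (Ioo (-ε) ε) D (timeDeriv (Ioo (-ε) ε) D (flowMap ϑ)) (0, p) =
      fderivWithin ℝ (fieldVar D ϑ ε) D p :=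
  (fderivWithin_eq_spaceDeriv hD.uniqueDiffOn (contDiffOn_timeDeriv isOpen_Ioo hD.uniqueDiffOn
    hv.contDiffOn_flowMap) hv.zero_mem hp).symm

theorem hasDerivAt_spaceDeriv_timeDeriv {p : Heis n} (hp : p ∈ D) :
    HasDerivAt (fun s => spaceDeriv (Ioo (-ε) ε) D (timeDeriv (Ioo (-ε) ε) D (flowMap ϑ)) (s, p))
      (fderivWithin ℝ (accVar D ϑ ε) D p) 0 := by
  have hT := contDiffOn_timeDeriv isOpen_Ioo hD.uniqueDiffOn hv.contDiffOn_flowMap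
  refine (hasDerivAt_spaceDeriv isOpen_Ioo hD.uniqueDiffOn hD.subset_closure_interior hT
    hv.zero_mem hp).congr_deriv ?_
  exact (fderivWithin_eq_spaceDeriv hD.uniqueDiffOn (contDiffOn_timeDeriv isOpen_Ioo
    hD.uniqueDiffOn hT) hv.zero_mem hp).symm

/-- The second derivative of the volume along a volume-preserving variation vanishes. -/
theorem integral_accVar (hvp : IsVolumePreserving D ϑ ε) :
    ∫ p, metric (ν p) (toFrame p (accVar D ϑ ε p +
      (traceL _ (fderivWithin ℝ (fieldVar D ϑ ε) D p) • fieldVar D ϑ ε p -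
        fderivWithin ℝ (fieldVar D ϑ ε) D p (fieldVar D ϑ ε p)))) ∂(sigmaR (frontier D) ν) = 0 := by
  set I := Ioo (-ε) ε with hI
  have hIo : IsOpen I := isOpen_Ioo
  have hDu := hD.uniqueDiffOn
  have hDm := hD.1.measurableSet
  have hΦ := hv.contDiffOn_flowMap
  set J : ℝ × Heis n → ℝ := fun x => (spaceDeriv I D (flowMap ϑ) x).det with hJ
  have hJc : ContDiffOn ℝ ∞ J (I ×ˢ D) :=
    contDiff_clm_det.comp_contDiffOn (contDiffOn_spaceDeriv hIo hDu hΦ)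
  have hzero : ∀ {G : ℝ × Heis n → ℝ} {c : ℝ}, ContDiffOn ℝ ∞ G (I ×ˢ D) →
      (∀ s ∈ I, ∫ p in D, G (s, p) = c) → ∀ s ∈ I, ∫ p in D, timeDeriv I D G (s, p) = 0 := by
    intro G c hG hc s hs
    refine (hasDerivAt_setIntegral volume hIo hDu hD.1 hG hs).unique
      ((hasDerivAt_const s c).congr_of_eventuallyEq ?_)
    filter_upwards [hIo.mem_nhds hs] with r hr using hc r hr
  have h1 : ∀ s ∈ I, ∫ p in D, J (s, p) = volume.real D := by
    intro s hs
    rw [← hvp s hs, volAlong]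
    refine setIntegral_congr_fun hDm fun p hp => ?_
    beta_reduce
    rw [hv.fderivWithin_eq hD hs hp, abs_of_pos (hv.det_pos hD hs hp)]
  have hJ1 := contDiffOn_timeDeriv hIo hDu hJc
  have h2 := hzero hJ1 (hzero hJc h1) 0 hv.zero_mem
  have h3 : ∀ s ∈ I, ∀ p ∈ D, timeDeriv I D J (s, p) = (spaceDeriv I D (flowMap ϑ) (s, p)).det *
      traceL _ (Ring.inverse (spaceDeriv I D (flowMap ϑ) (s, p)) *
        spaceDeriv I D (timeDeriv I D (flowMap ϑ)) (s, p)) := fun s hs p hp =>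
    (hasDerivAt_timeDeriv hIo hJc hs hp).unique
      (hasDerivAt_det (hv.hasDerivAt_spaceDeriv_flowMap hD hs hp) (hv.isUnit_spaceDeriv hD hs hp))
  obtain ⟨Y, hY⟩ : ∃ Y : Heis n → Heis n, Y = fun q => accVar D ϑ ε q +
        (traceL _ (fderivWithin ℝ (fieldVar D ϑ ε) D q) • fieldVar D ϑ ε q -
        fderivWithin ℝ (fieldVar D ϑ ε) D q (fieldVar D ϑ ε q)) := ⟨_, rfl⟩
  have h4 : ∀ p ∈ D, timeDeriv I D (timeDeriv I D J) (0, p) =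
      traceL _ (fderivWithin ℝ Y D p) := by
    intro p hp
    rw [hY, traceL_fderivWithin_sub hDu hD.subset_closure_interior (hv.contDiffOn_fieldVar hD)
      (hv.contDiffOn_accVar hD) hp]
    have h5 := hasDerivAt_det_deriv (A₁ := fun s => spaceDeriv I D (timeDeriv I D (flowMap ϑ)) (s, p))
      (hv.hasDerivAt_spaceDeriv_flowMap hD hv.zero_mem hp)
      (hv.hasDerivAt_spaceDeriv_timeDeriv hD hp) (hv.isUnit_spaceDeriv hD hv.zero_mem hp)
    have h6 : (fun s => timeDeriv I D J (s, p)) =ᶠ[𝓝 0] fun s =>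
        (spaceDeriv I D (flowMap ϑ) (s, p)).det *
          traceL _ (Ring.inverse (spaceDeriv I D (flowMap ϑ) (s, p)) *
          spaceDeriv I D (timeDeriv I D (flowMap ϑ)) (s, p)) := by
      filter_upwards [hIo.mem_nhds hv.zero_mem] with s hs using h3 s hs p hp
    rw [(hasDerivAt_timeDeriv hIo hJ1 hv.zero_mem hp).unique (h5.congr_of_eventuallyEq h6)]
    have h7 : (1 : Heis n →L[ℝ] Heis n).det = 1 := LinearMap.det_id
    simp only [hI, hv.spaceDeriv_zero hD hp, hv.spaceDeriv_timeDeriv hD hp, Ring.inverse_one,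
      one_mul, h7]
  have hYc : ContDiffOn ℝ 1 Y D := by
    rw [hY]
    have hW := hv.contDiffOn_fieldVar hD
    have hW' : ContDiffOn ℝ ∞ (fderivWithin ℝ (fieldVar D ϑ ε) D) D :=
      hW.fderivWithin hDu (by simp)
    have hT : ContDiffOn ℝ ∞ (fun q => traceL _ (fderivWithin ℝ (fieldVar D ϑ ε) D q)) D :=
      (traceL (Heis n)).contDiff.comp_contDiffOn hW'
    have hTW := (hT.smul hW).sub (hW'.clm_apply hW)
    have h1 : (1 : WithTop ℕ∞) ≤ ∞ := by norm_cast
    exact ((hv.contDiffOn_accVar hD).of_le h1).add (hTW.of_le h1)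
  have h6 : ∫ p in D, traceL _ (fderivWithin ℝ Y D p) = 0 := by
    rw [← h2]
    exact setIntegral_congr_fun hDm fun p hp => (h4 p hp).symm
  rw [hD.setIntegral_trace hYc, hY] at h6
  exact (mul_eq_zero.1 h6).resolve_left (lerayConst_pos n).ne'

end IsVariation

end

section

/-! ## The variation field along the boundary -/

variable {S : Set (Heis n)} {ν : Heis n → FrameVec n} {f : Heis n → ℝ} {V : Set (Heis n)}
  {p : Heis n}

theorem fd_toCoord {X : Heis n → FrameVec n} (hX : DifferentiableAt ℝ X p) (v : FrameVec n) :
    fd (fun q => toCoord q (X q)) p v = toCoord p (fd X p v) + (0, 1 / 2 * symp v.1 (X p).1) := by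
  have h0 : (fun p : Heis n => toCoord p (X p)) = fun p => X p +
      (inrH) ((1 / 2 : ℝ) * sympL p.1 (X p).1) := by
    ext1 p; rw [toCoord_eq]; simp
  have ha : HasFDerivAt (fun p : Heis n => sympL p.1) (sympL ∘L fstH) p :=
    sympL.hasFDerivAt.comp p hasFDerivAt_fst
  have hb : HasFDerivAt (fun p : Heis n => (X p).1)
      (fstH ∘L fderiv ℝ X p) p := hX.hasFDerivAt.fst
  have h2 := hX.hasFDerivAt.add ((inrH).hasFDerivAt.comp p
    ((ha.clm_apply hb).const_mul (1 / 2)))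
  rw [fd_apply, h0]
  have h3 : fderiv ℝ (fun p => X p + (inrH)
    ((1 / 2 : ℝ) * sympL p.1 (X p).1)) p = _ := h2.fderiv
  rw [h3]
  refine Prod.ext ?_ ?_
  · simp [toCoord_apply, fd_apply]
  · simp [toCoord_apply, fd_apply]
    ring

theorem IsOrientedHypersurface.fderivWithin_of_toFrame_eq (hS : IsOrientedHypersurface S ν)
    (hp : p ∈ S) {v : FrameVec n} (hv : metric (ν p) v = 0) {A : Set (Heis n)} (hA : S ⊆ A)
    {Y : Heis n → Heis n} {X : Heis n → FrameVec n} (hY : DifferentiableWithinAt ℝ Y A p)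
    (hX : DifferentiableAt ℝ X p) (h : ∀ q ∈ S, toFrame q (Y q) = X q) :
    fderivWithin ℝ Y A p (toCoord p v) =
      toCoord p (fd X p v) + (0, 1 / 2 * symp v.1 (X p).1) := by
  have h1 : DifferentiableAt ℝ (fun q => toCoord q (X q)) p :=
    (contDiff_toCoord (k := 1)).differentiable (by norm_num) p |>.clm_apply hX
  rw [hS.fderivWithin_eq hp hv hA hY h1, fd_toCoord hX]
  filter_upwards [self_mem_nhdsWithin] with q hq
  rw [← h q hq, toCoord_toFrame]

/-- `tr L - ⟨Lν, ν⟩` depends only on `L` on the orthogonal complement of `ν`. -/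
theorem traceL_sub_metric {x : FrameVec n} (hx : metric x x = 1) {L M : FrameVec n →L[ℝ] FrameVec n}
    (h : ∀ v, metric x v = 0 → L v = M v) :
    traceL _ L - metric x (L x) = traceL _ M - metric x (M x) := by
  have h1 : L - M = (metricL x).smulRight (L x - M x) := by
    refine ContinuousLinearMap.ext fun v => ?_
    have h2 : metric x (v - metric x v • x) = 0 := by
      rw [← metricL_apply, map_sub, map_smul, metricL_apply, metricL_apply, hx]; simp
    have h3 := h _ h2
    simp only [map_sub, map_smul] at h3
    simp only [sub_apply, ContinuousLinearMap.smulRight_apply, metricL_apply, smul_sub]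
    exact sub_eq_sub_iff_sub_eq_sub.1 h3
  have h2 := congrArg (traceL _) h1
  rw [map_sub, traceL_smulRight, metricL_apply] at h2
  have h3 : metric x (L x - M x) = metric x (L x) - metric x (M x) := by
    simp only [← metricL_apply, map_sub]
  linarith

/-- The ambient extension of the field `ϖ |P_H ν| ν`. -/
def slopeField (f : Heis n → ℝ) (q : Heis n) : FrameVec n :=
  ((slope f q * horWeight (slope f q)) • unitH f q, slope f q ^ 2 * horWeight (slope f q))

namespace IsHorizontallyRegular

variable (hr : IsHorizontallyRegular f V)
include hr

theorem contDiffOn_slopeField : ContDiffOn ℝ 1 (slopeField f) V := by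
  have h1 := hr.contDiffOn_slope
  have h2 : ContDiffOn ℝ 1 (fun q => horWeight (slope f q)) V := contDiff_horWeight.comp_contDiffOn h1
  exact ((h1.mul h2).smul hr.contDiffOn_unitH).prodMk ((h1.pow 2).mul h2)

theorem fd_slopeField (hp : p ∈ V) (v : FrameVec n) : fd (slopeField f) p v =
    (((horWeight (slope f p) - slope f p * (2 * slope f p * horWeight (slope f p) ^ 2)) *
      fd (slope f) p v) • unitH f p + (slope f p * horWeight (slope f p)) • fd (unitH f) p v,
      2 * slope f p * horWeight (slope f p) ^ 2 * fd (slope f) p v) := by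
  have h1 := hr.differentiableAt_slope hp
  have h2 := hr.differentiableAt_unitH hp
  have e1 : ∀ w, HasDerivAt (fun w => w * horWeight w)
      (horWeight w - w * (2 * w * horWeight w ^ 2)) w := fun w =>
    HasDerivAt.congr_deriv (f := fun w => w * horWeight w)
      ((hasDerivAt_id w).mul (hasDerivAt_horWeight w)) (by simp; ring)
  have e2 : ∀ w, HasDerivAt (fun w => w ^ 2 * horWeight w) (2 * w * horWeight w ^ 2) w := fun w =>
    HasDerivAt.congr_deriv (f := fun w => w ^ 2 * horWeight w)
      ((hasDerivAt_pow 2 w).mul (hasDerivAt_horWeight w)) (by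
        have := horWeight_mul w
        simp only [Nat.cast_ofNat]
        linear_combination (-2 * w * horWeight w) * this)
  have d1 : DifferentiableAt ℝ (fun q => slope f q * horWeight (slope f q)) p :=
    (e1 _).differentiableAt.comp p h1
  have d2 : DifferentiableAt ℝ (fun q => slope f q ^ 2 * horWeight (slope f q)) p :=
    (e2 _).differentiableAt.comp p h1
  have f1 := fd_comp_real (g := fun w => w * horWeight w) (e1 (slope f p)).differentiableAt h1 v
  have f2 := fd_comp_real (g := fun w => w ^ 2 * horWeight w) (e2 (slope f p)).differentiableAt h1 v
  rw [(e1 _).deriv] at f1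
  rw [(e2 _).deriv] at f2
  have h3 := fd_prodMk (d1.smul h2) d2 v
  refine Eq.trans h3 ?_
  rw [f2]
  have h4 := fd_smul d1 h2 v
  refine Prod.ext ?_ rfl
  refine Eq.trans h4 ?_
  rw [f1]
  abel

/-- The tangential part of the derivative of the variation field, and the second variation of the
volume. -/
theorem traceL_sub_metric_slopeField (hp : p ∈ V) {s : ℝ} (hs : s ^ 2 = horWeight (slope f p))
    {L : FrameVec n →L[ℝ] FrameVec n}
    (hL : ∀ v, L v = fd (slopeField f) p v + (0, 1 / 2 * symp v.1 (slopeField f p).1)) :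
    slope f p * (traceL _ L - metric (s • (unitH f p, slope f p)) (L (s • (unitH f p, slope f p)))) =
      volVar f p := by
  set q := unitH f p with hq
  set w := slope f p with hw
  set ℓ := horWeight w with hℓ
  have hqq : inner ℝ q q = (1 : ℝ) := by
    rw [real_inner_self_eq_norm_sq, hr.norm_unitH hp]; norm_num
  have hqA : ∀ v, inner ℝ q (fd (unitH f) p v) = 0 := hr.inner_unitH_fd hp
  have hww := horWeight_mul w
  let om : FrameVec n →L[ℝ] ℝ := (sympL.flip q) ∘L fstH
  have hom : ∀ v, om v = symp v.1 q := fun v => by simp [om]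
  have hL' : L = (w * ℓ) • (inlH ∘L fd (unitH f) p) +
      ((ℓ - w * (2 * w * ℓ ^ 2)) • fd (slope f) p).smulRight ((q, 0) : FrameVec n) +
      ((2 * w * ℓ ^ 2) • fd (slope f) p + (1 / 2 * (w * ℓ)) • om).smulRight
        ((0, 1) : FrameVec n) := by
    refine ContinuousLinearMap.ext fun v => ?_
    rw [hL, hr.fd_slopeField hp]
    refine Prod.ext ?_ ?_
    · simp [slopeField]; module
    · simp [slopeField, hom]; ring
  have htr : traceL _ L = w * ℓ * horTrace (shape f p) +
      (ℓ - w * (2 * w * ℓ ^ 2)) * fd (slope f) p (q, 0) + 2 * w * ℓ ^ 2 * fd (slope f) p (0, 1) := by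
    have hom0 : om (0, 1) = 0 := by rw [hom]; simp [symp_eq_inner, perp_zero]
    have hT := traceL_inl_comp (fd (unitH f) p)
    rw [hL']
    simp only [map_add, map_smul, traceL_smulRight, smul_apply, add_apply, smul_eq_mul, hom0, hT]
    have h5 : horTrace (shape f p) = LinearMap.trace ℝ (Hor n) (shape f p : Hor n →ₗ[ℝ] Hor n) := rfl
    simp only [shape] at h5 ⊢
    ring
  have hqs : symp q q = 0 := by have := symp_swap q q; linarith
  have hm : metric (s • (q, w)) (L (s • (q, w))) = ℓ ^ 2 * fd (slope f) p (q, w) := by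
    rw [map_smul, metric_smul_left, metric_smul_right, hL, hr.fd_slopeField hp]
    simp only [metric, Prod.fst_add, Prod.snd_add, inner_add_right, inner_smul_right, hqA,
      slopeField, map_smul, inner_zero_right, smul_eq_mul]
    simp only [← hq, ← hw, ← hℓ, hqq, hqs]
    linear_combination (ℓ * fd (slope f) p (q, w)) * hs
  have e1 : fd (slope f) p (q, w) = fd (slope f) p (q, 0) + w * fd (slope f) p (0, 1) := by
    rw [← smul_eq_mul, ← map_smul, ← map_add]; simp
  have e2 : fd (slope f) p (transv f p) = -(w * fd (slope f) p (q, 0)) + fd (slope f) p (0, 1) := by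
    rw [transv, ← smul_eq_mul, ← map_smul, ← map_neg, ← map_add]; simp [hq, hw]
  rw [htr, hm, volVar, e1, e2]
  linear_combination (-w * ℓ * fd (slope f) p (q, 0)) * hww
end IsHorizontallyRegular

end

section

/-! ## The second variation of the perimeter density -/

variable {D : Set (Heis n)} {ν : Heis n → FrameVec n} {ϑ : ℝ → Heis n → Heis n} {ε : ℝ}
  {f : Heis n → ℝ} {V : Set (Heis n)} {p : Heis n}

/-- The linear map `v ↦ [v, z]`. -/
def bracketL (z : Hor n) : FrameVec n →L[ℝ] FrameVec n :=
  ((sympL.flip z) ∘L fstH).smulRight ((0, 1) : FrameVec n)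

theorem bracketL_apply (z : Hor n) (v : FrameVec n) : bracketL z v = (0, symp v.1 z) := by
  simp [bracketL]

/-- The linear part of `toFrame`, as a function of the base point. -/
def frameShift : Hor n →L[ℝ] FrameVec n →L[ℝ] FrameVec n :=
  (ContinuousLinearMap.compL ℝ (FrameVec n) ℝ (FrameVec n)
    ((-(1 / 2) : ℝ) • inrH)) ∘L
    ((ContinuousLinearMap.compL ℝ (FrameVec n) (Hor n) ℝ).flip
      (fstH)) ∘L sympL

theorem frameShift_apply (z : Hor n) (v : FrameVec n) :
    frameShift z v = (0, -(1 / 2 * symp z v.1)) := by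
  simp [frameShift]

theorem toFrame_eq_frameShift (x : Heis n) : toFrame x = 1 + frameShift x.1 := by
  refine ContinuousLinearMap.ext fun v => ?_
  rw [add_apply, frameShift_apply, toFrame_eq]
  simp [sub_eq_add_neg]

theorem IsDefiningOn.normal_eq_smul (hd : IsDefiningOn (frontier D) ν f V)
    (hp : p ∈ frontier D) (hV : p ∈ V) (h0 : (ν p).1 ≠ 0) :
    ν p = ‖(ν p).1‖ • (unitH f p, slope f p) := by
  refine Prod.ext ?_ ?_
  · change _ = ‖(ν p).1‖ • unitH f p
    rw [← hd.nuH_eq hp hV, smul_nuH]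
  · change _ = ‖(ν p).1‖ • slope f p
    rw [← hd.varpi_eq hp hV, varpi, smul_eq_mul, mul_div_cancel₀ _ (norm_ne_zero_iff.2 h0)]

theorem IsDefiningOn.sq_norm_normal (hd : IsDefiningOn (frontier D) ν f V)
    (hp : p ∈ frontier D) (hV : p ∈ V) (h0 : (ν p).1 ≠ 0) :
    ‖(ν p).1‖ ^ 2 = horWeight (slope f p) := by
  have h1 := hd.metric_normal hp hV
  have h2 : (ν p).2 = ‖(ν p).1‖ * slope f p := by
    rw [← hd.varpi_eq hp hV, varpi, mul_div_cancel₀ _ (norm_ne_zero_iff.2 h0)]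
  rw [metric, real_inner_self_eq_norm_sq, h2] at h1
  exact eq_inv_of_mul_eq_one_left (by linarith)

theorem smulRight_comp_normal {x : FrameVec n} (hx : metric x x = 1)
    {M B : FrameVec n →L[ℝ] FrameVec n} (h : ∀ v, metric x v = 0 → M v = B v) :
    M * (1 - (metricL x).smulRight x) + (metricL x).smulRight (B x) = B := by
  refine ContinuousLinearMap.ext fun v => ?_
  have h2 : metric x (v - metric x v • x) = 0 := by
    rw [← metricL_apply, map_sub, map_smul, metricL_apply, metricL_apply, hx]; simp
  have h3 := h _ h2
  simp only [add_apply, mul_apply_eq_comp, sub_apply, one_apply_eq_self,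
    ContinuousLinearMap.smulRight_apply, metricL_apply]
  rw [h3, map_sub, map_smul, sub_add_cancel]

namespace IsVariation

variable (hv : IsVariation D ϑ ε) (hD : IsC2Domain D ν) (hd : IsDefiningOn (frontier D) ν f V)
  (hr : IsHorizontallyRegular f V) (hSV : frontier D ⊆ V)
  (hvel : ∀ p ∈ frontier D, velocity ϑ 0 p = (varpi ν p * ‖(ν p).1‖) • ν p)
include hv hD hd hr hSV hvel

theorem toFrame_fieldVar (hp : p ∈ frontier D) :
    toFrame p (fieldVar D ϑ ε p) = slopeField f p := by
  have hpD := hD.1.isClosed.frontier_subset hp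
  have h0 := hd.normal_fst_ne hr hp (hSV hp)
  have h1 : HasDerivAt (fun s => ϑ s p) (fieldVar D ϑ ε p) 0 :=
    hasDerivAt_timeDeriv isOpen_Ioo hv.contDiffOn_flowMap hv.zero_mem hpD
  have h2 := hvel p hp
  rw [velocity, h1.deriv, hv.2.2.2 p hpD] at h2
  rw [h2, hd.varpi_eq hp (hSV hp)]
  have h3 := hd.sq_norm_normal hp (hSV hp) h0
  conv_lhs => rw [hd.normal_eq_smul hp (hSV hp) h0, smul_smul]
  rw [← hd.normal_eq_smul hp (hSV hp) h0, slopeField, ← h3]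
  refine Prod.ext ?_ ?_
  · change (_ : ℝ) • unitH f p = _
    congr 1; ring
  · change (_ : ℝ) * slope f p = _
    ring

theorem fderivWithin_fieldVar (hp : p ∈ frontier D) {v : FrameVec n} (hvn : metric (ν p) v = 0) :
    fderivWithin ℝ (fieldVar D ϑ ε) D p (toCoord p v) =
      toCoord p (fd (slopeField f) p v) + (0, 1 / 2 * symp v.1 (slopeField f p).1) := by
  have hpD := hD.1.isClosed.frontier_subset hp
  exact hD.isOrientedHypersurface.fderivWithin_of_toFrame_eq hp hvn hD.1.isClosed.frontier_subset
    ((hv.contDiffOn_fieldVar hD).differentiableOn (by simp) p hpD)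
    (hr.differentiableAt hr.contDiffOn_slopeField (hSV hp))
    fun q hq => hv.toFrame_fieldVar hD hd hr hSV hvel hq

/-- The second derivative of the volume in terms of the geometry of the boundary. -/
theorem integral_volVar (hvp : IsVolumePreserving D ϑ ε) :
    ∫ p, (metric (ν p) (toFrame p (accVar D ϑ ε p)) + ‖(ν p).1‖ * volVar f p)
      ∂(sigmaR (frontier D) ν) = 0 := by
  rw [← hv.integral_accVar hD hvp,
    ← IsOrientedHypersurface.restrict_sigmaR hD.isCompact_frontier.measurableSet]
  refine setIntegral_congr_fun hD.isCompact_frontier.measurableSet fun p hp => ?_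
  beta_reduce
  have hV := hSV hp
  have h0 := hd.normal_fst_ne hr hp hV
  set W' := fderivWithin ℝ (fieldVar D ϑ ε) D p with hW'
  set L : FrameVec n →L[ℝ] FrameVec n := toFrame p ∘L W' ∘L toCoord p with hL
  have htr : traceL _ W' = traceL _ L := by
    have h1 := LinearMap.trace_comp_comm' (R := ℝ) (toFrame p : Heis n →ₗ[ℝ] FrameVec n)
      ((W' ∘L toCoord p : FrameVec n →L[ℝ] Heis n) : FrameVec n →ₗ[ℝ] Heis n)
    refine Eq.trans ?_ h1
    rw [traceL_apply]
    congr 1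
    refine LinearMap.ext fun v => ?_
    simp [toCoord_toFrame]
  have hW := hv.toFrame_fieldVar hD hd hr hSV hvel hp
  have hLW : toFrame p (W' (fieldVar D ϑ ε p)) = L (slopeField f p) := by
    rw [← hW]; simp [hL, toCoord_toFrame]
  set M : FrameVec n →L[ℝ] FrameVec n := fd (slopeField f) p +
    (1 / 2 : ℝ) • bracketL (slopeField f p).1 with hM
  have hMv : ∀ v, M v = fd (slopeField f) p v + (0, 1 / 2 * symp v.1 (slopeField f p).1) := by
    intro v; simp [hM, bracketL_apply]
  have hLM := traceL_sub_metric (hd.metric_normal hp hV) (L := L) (M := M) fun v hvn => by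
    rw [hMv, hL, ContinuousLinearMap.comp_apply, ContinuousLinearMap.comp_apply, hW',
      hv.fderivWithin_fieldVar hD hd hr hSV hvel hp hvn, map_add, toFrame_toCoord]
    congr 1
    rw [toFrame_eq]; simp
  have hvol := hr.traceL_sub_metric_slopeField hV (hd.sq_norm_normal hp hV h0) hMv
  rw [← hd.normal_eq_smul hp hV h0, ← hLM] at hvol
  have hWν : slopeField f p = (slope f p * ‖(ν p).1‖) • ν p := by
    rw [← hW, ← hd.varpi_eq hp hV, ← hvel p hp]
    have hpD := hD.1.isClosed.frontier_subset hp
    have h1 : HasDerivAt (fun s => ϑ s p) (fieldVar D ϑ ε p) 0 :=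
      hasDerivAt_timeDeriv isOpen_Ioo hv.contDiffOn_flowMap hv.zero_mem hpD
    rw [velocity, h1.deriv, hv.2.2.2 p hpD]
  rw [map_add, map_sub, map_smul, hLW, hW, htr, hWν, map_smul, metric_add_right, ← metricL_apply _
    (_ - _), map_sub, metricL_apply, metricL_apply, metric_smul_right, metric_smul_right,
    metric_smul_right, hd.metric_normal hp hV, ← hvol]
  ring

set_option maxHeartbeats 1000000 in
/-- The second derivative of the perimeter density. -/
theorem iteratedDeriv_perimDensity (hp : p ∈ frontier D) {Z : Heis n → FrameVec n}
    (hZ : DifferentiableAt ℝ Z p) (hZS : ∀ q ∈ frontier D, toFrame q (accVar D ϑ ε q) = Z q) :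
    iteratedDeriv 2 (fun t => perimDensity D ν ϑ t p) 0 = ‖(ν p).1‖ * secVar f p +
      (‖(ν p).1‖ * frameDiv Z p - metric (ν p) (fd Z p (unitH f p, 0)) -
        (ν p).2 * symp (unitH f p) (Z p).1) := by
  have hpD := hD.1.isClosed.frontier_subset hp
  have hV := hSV hp
  have h0 := hd.normal_fst_ne hr hp hV
  have hνν := hd.metric_normal hp hV
  set I := Ioo (-ε) ε with hI
  set A : ℝ → FrameVec n →L[ℝ] FrameVec n := fun t => spaceDeriv I D (flowMap ϑ) (t, p) with hA
  set A₁ : ℝ → FrameVec n →L[ℝ] FrameVec n :=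
    fun t => spaceDeriv I D (timeDeriv I D (flowMap ϑ)) (t, p) with hA₁
  set Φ₁ : ℝ → Heis n := fun t => timeDeriv I D (flowMap ϑ) (t, p) with hΦ₁
  have hT := contDiffOn_timeDeriv isOpen_Ioo hD.uniqueDiffOn hv.contDiffOn_flowMap
  have dΦ : ∀ t ∈ I, HasDerivAt (fun s => frameShift (ϑ s p).1) (frameShift (Φ₁ t).1) t :=
    fun t ht => (frameShift ∘L fstH).hasFDerivAt.comp_hasDerivAt t
      (hasDerivAt_timeDeriv isOpen_Ioo hv.contDiffOn_flowMap ht hpD)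
  have dΦ₁ : HasDerivAt (fun s => frameShift (Φ₁ s).1) (frameShift (accVar D ϑ ε p).1) 0 :=
    (frameShift ∘L fstH).hasFDerivAt.comp_hasDerivAt 0
      (hasDerivAt_timeDeriv isOpen_Ioo hT hv.zero_mem hpD)
  have dA : ∀ t ∈ I, HasDerivAt A (A₁ t) t := fun t ht =>
    hv.hasDerivAt_spaceDeriv_flowMap hD ht hpD
  have dA₁ : HasDerivAt A₁ (fderivWithin ℝ (accVar D ϑ ε) D p) 0 :=
    hv.hasDerivAt_spaceDeriv_timeDeriv hD hpD
  have hA0 : A 0 = 1 := hv.spaceDeriv_zero hD hpD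
  have hA₁0 : A₁ 0 = fderivWithin ℝ (fieldVar D ϑ ε) D p := hv.spaceDeriv_timeDeriv hD hpD
  set C : FrameVec n →L[ℝ] FrameVec n := toCoord p with hC
  set M : ℝ → FrameVec n →L[ℝ] FrameVec n := fun t => (1 + frameShift (ϑ t p).1) * (A t * C) with hM
  set M₁ : ℝ → FrameVec n →L[ℝ] FrameVec n := fun t =>
    frameShift (Φ₁ t).1 * (A t * C) + (1 + frameShift (ϑ t p).1) * (A₁ t * C) with hM₁
  have dM : ∀ t ∈ I, HasDerivAt M (M₁ t) t := fun t ht =>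
    ((dΦ t ht).const_add 1).mul ((dA t ht).mul_const C)
  have dM₁ := (dΦ₁.mul ((dA 0 hv.zero_mem).mul_const C)).add
    (((dΦ 0 hv.zero_mem).const_add 1).mul (dA₁.mul_const C))
  set z := (accVar D ϑ ε p).1 with hz
  have hzZ : (Z p).1 = z := by rw [← hZS p hp]; rfl
  have hWH : (Φ₁ 0).1 = (slopeField f p).1 := by
    rw [← hv.toFrame_fieldVar hD hd hr hSV hvel hp]; rfl
  set B : FrameVec n →L[ℝ] FrameVec n := fd (slopeField f) p + bracketL (slopeField f p).1 with hB
  set E : FrameVec n →L[ℝ] FrameVec n := fd Z p + bracketL z +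
    bracketL (slopeField f p).1 * fd (slopeField f) p with hE
  set N := fun x : FrameVec n => (metricL (ν p)).smulRight x with hN
  have dN : ∀ {γ : ℝ → FrameVec n} {γ' : FrameVec n} {t : ℝ}, HasDerivAt γ γ' t →
      HasDerivAt (fun s => N (γ s)) (N γ') t := fun h =>
    (ContinuousLinearMap.smulRightL ℝ (FrameVec n) (FrameVec n)
      (metricL (ν p))).hasFDerivAt.comp_hasDerivAt _ h
  set P : FrameVec n →L[ℝ] FrameVec n := 1 - N (ν p) with hP
  set R : ℝ → FrameVec n →L[ℝ] FrameVec n := fun t =>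
    M t * P + N (ν p + t • B (ν p) + (t ^ 2 / 2) • E (ν p)) with hR
  set R₁ : ℝ → FrameVec n →L[ℝ] FrameVec n := fun t => M₁ t * P + N (B (ν p) + t • E (ν p)) with hR₁
  have dR : ∀ t ∈ I, HasDerivAt R (R₁ t) t := fun t ht =>
    ((dM t ht).mul_const P).add (dN (HasDerivAt.congr_deriv
      ((((hasDerivAt_id t).smul_const (B (ν p))).const_add (ν p)).add
        (((hasDerivAt_pow 2 t).div_const 2).smul_const (E (ν p)))) (by simp)))
  have hx0 : ϑ 0 p = p := hv.2.2.2 p hpD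
  have hfr : (1 + frameShift p.1 : FrameVec n →L[ℝ] FrameVec n) = toFrame p :=
    (toFrame_eq_frameShift p).symm
  have hM0 : M 0 = 1 := by
    simp only [hM, hA0, hx0, hfr, one_mul]
    exact ContinuousLinearMap.ext fun v => toFrame_toCoord p v
  have hdW := fun {v : FrameVec n} (hvn : metric (ν p) v = 0) =>
    hv.fderivWithin_fieldVar hD hd hr hSV hvel hp hvn
  have hdZ := fun {v : FrameVec n} (hvn : metric (ν p) v = 0) =>
    hD.isOrientedHypersurface.fderivWithin_of_toFrame_eq hp hvn hD.1.isClosed.frontier_subset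
      ((hv.contDiffOn_accVar hD).differentiableOn (by simp) p hpD) hZ hZS
  have hM₁0 : ∀ v, metric (ν p) v = 0 → M₁ 0 v = B v := by
    intro v hvn
    simp only [hM₁, hA0, hx0, hfr, one_mul, add_apply, mul_apply_eq_comp, hA₁0, hC, hdW hvn,
      map_add, toFrame_toCoord, frameShift_apply, hWH, hB, bracketL_apply]
    have := symp_swap v.1 (slopeField f p).1
    refine Prod.ext ?_ ?_
    · simp [toCoord_eq, toFrame_eq]
    · simp [toCoord_eq, toFrame_eq]
      linarith
  have hM₂0 : ∀ v, metric (ν p) v = 0 → (frameShift z * (A 0 * C) +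
      frameShift (Φ₁ 0).1 * (A₁ 0 * C) + (frameShift (Φ₁ 0).1 * (A₁ 0 * C) +
      (1 + frameShift (ϑ 0 p).1) * (fderivWithin ℝ (accVar D ϑ ε) D p * C))) v = E v := by
    intro v hvn
    simp only [hA0, hx0, hfr, one_mul, add_apply, mul_apply_eq_comp, hA₁0, hC, hdW hvn, hdZ hvn,
      map_add, toFrame_toCoord, frameShift_apply, hWH, hE, bracketL_apply, hzZ]
    have h1 := symp_swap v.1 z
    have h2 := symp_swap (fd (slopeField f) p v).1 (slopeField f p).1
    refine Prod.ext ?_ ?_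
    · simp [toCoord_eq, toFrame_eq]
    · simp [toCoord_eq, toFrame_eq]
      linarith
  have hR0 : R 0 = 1 := by
    have := smulRight_comp_normal hνν (M := M 0) (B := 1) fun v _ => by rw [hM0]
    simpa [hR] using this
  have hR₁0 : R₁ 0 = B := by
    have := smulRight_comp_normal hνν hM₁0
    simpa [hR₁] using this
  have dR₁ : HasDerivAt R₁ E 0 := by
    have h1 := (dM₁.mul_const P).add (dN (((hasDerivAt_id (0 : ℝ)).smul_const
      (E (ν p))).const_add (B (ν p))))
    refine HasDerivAt.congr_deriv (f := R₁) h1 ?_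
    rw [one_smul]
    exact smulRight_comp_normal hνν hM₂0
  have hIn : I ∈ 𝓝 (0 : ℝ) := isOpen_Ioo.mem_nhds hv.zero_mem
  have hunit : ∀ᶠ t in 𝓝 0, IsUnit (R t) :=
    (dR 0 hv.zero_mem).continuousAt.eventually (Units.isOpen.mem_nhds (by
      rw [hR0]; exact isUnit_one))
  have hg : (fun t => perimDensity D ν ϑ t p) =ᶠ[𝓝 0]
      fun t => ‖(R t).det • horDual (ν p) (Ring.inverse (R t))‖ := by
    filter_upwards [hIn, hunit] with t ht hu
    rw [perimDensity, normalVar_fst_eq hu hνν fun v hvn => ?_]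
    rw [diffVar, hv.fderivWithin_eq hD ht hpD]
    simp only [hR, hM, add_apply, mul_apply_eq_comp, hP, hN, sub_apply, one_apply_eq_self,
      ContinuousLinearMap.smulRight_apply, metricL_apply, hvn, zero_smul, sub_zero, add_zero]
    rw [toFrame_eq_frameShift]
    rfl
  have key := iteratedDeriv_two_norm_horDual (A := R) (A₁ := R₁) (B := B) (C := E)
    (by filter_upwards [hIn] with t ht using dR t ht) dR₁ hR0 hR₁0 h0 hg
  rw [key]
  have hq : ‖(ν p).1‖⁻¹ • (ν p).1 = unitH f p := hd.nuH_eq hp hV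
  rw [hq]
  have h1 := second_variation_algebra (hr.norm_unitH hV) (hr.inner_unitH_fd hV)
    (ξ := transvU f p) rfl (fun v hvq => hr.fd_slope_eq hV hvq)
    (hr.fd_slopeField hV) (B := B) (DZ := fd Z p) (z := z) (C := E)
    (fun v => by rw [hB, add_apply, bracketL_apply]; rfl)
    (fun v => by rw [hE]; simp only [add_apply, mul_apply_eq_comp, bracketL_apply]; rfl)
    (hd.normal_eq_smul hp hV h0)
  rw [h1, hzZ]
  rfl

end IsVariation

end

section

/-! ## The second variation formula -/

variable {D : Set (Heis n)} {ν : Heis n → FrameVec n} {ϑ : ℝ → Heis n → Heis n}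
  {f : Heis n → ℝ} {V : Set (Heis n)}

namespace IsC2Domain

/-- A defining function with nonvanishing horizontal gradient near a boundary without
characteristic points. -/
theorem exists_regular (hD : IsC2Domain D ν) (hchar : charSet (frontier D) ν = ∅) :
    ∃ f V, IsDefiningOn (frontier D) ν f V ∧ IsHorizontallyRegular f V ∧ frontier D ⊆ V := by
  obtain ⟨f, V, -, hSV, hd, -, -⟩ := hD.exists_global
  obtain ⟨h1, h2⟩ := hd.restrict_hgrad
  refine ⟨f, _, h1, h2, fun p hp => ⟨hSV hp, fun h => ?_⟩⟩
  have h0 : (ν p).1 = 0 := by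
    rw [hd.hgrad_eq hp (hSV hp)] at h
    exact (smul_eq_zero.1 h).resolve_left (hd.rnorm_pos hp (hSV hp)).ne'
  exact (hchar ▸ (⟨hp, h0⟩ : p ∈ charSet (frontier D) ν) : p ∈ (∅ : Set (Heis n)))

theorem secondVariation_eq (hD : IsC2Domain D ν) (hd : IsDefiningOn (frontier D) ν f V)
    (hr : IsHorizontallyRegular f V) (hSV : frontier D ⊆ V) (hchar : charSet (frontier D) ν = ∅)
    (hH : HasConstantMeanCurv (frontier D) ν) (hϑ : IsTestVariation D ν (varpi ν) ϑ) :
    secondVariation D ν ϑ = ∫ p, (‖gradHS (frontier D) ν (varpi ν) p‖ ^ 2 -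
      varpi ν p ^ 2 * (normSqSymm (frontier D) ν p +
      (3 - (n : ℝ)) / 6 * varpi ν p ^ 2)) ∂(sigmaH (frontier D) ν) := by
  obtain ⟨⟨ε, hv, hvp, -⟩, -, hvel, -⟩ := hϑ
  obtain ⟨c, hc⟩ := hH
  rw [hchar, sdiff_empty] at hvel hc
  have hS := hD.isOrientedHypersurface
  have hSc := hD.isCompact_frontier
  have hSD := hD.1.isClosed.frontier_subset
  have hκ : ∀ p ∈ frontier D, horTrace (shape f p) = -c := fun p hp => by
    have := hd.meanCurv_eq hr hS hp (hSV hp)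
    rw [hc p hp] at this
    linarith
  have hZ₀ : ContDiffOn ℝ 1 (fun q => toFrame q (accVar D ϑ ε q)) (frontier D) :=
    contDiff_toFrame.contDiffOn.clm_apply
      (((hv.contDiffOn_accVar hD).of_le (by norm_cast)).mono hSD)
  obtain ⟨Z, hZ, -, hZS⟩ := hS.exists_extension hSc hZ₀
  have hZS' : ∀ q ∈ frontier D, toFrame q (accVar D ϑ ε q) = Z q := fun q hq => (hZS hq).symm
  have hI := hd.integral_frameDiv_sub hr hS hSc hSV hZ.contDiffOn
  have hvol := hv.integral_volVar hD hd hr hSV hvel hvp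
  rw [← hd.integral_secVar hr hS hSV hSc hchar hκ]
  have hνc := hS.continuousOn_normal
  have hNc : ContinuousOn (fun p => ‖(ν p).1‖) (frontier D) := hνc.fst.norm
  have hq : ContinuousOn (unitH f) (frontier D) := hr.contDiffOn_unitH.continuousOn.mono hSV
  have hmet : ∀ {X : Heis n → FrameVec n}, ContinuousOn X (frontier D) →
      ContinuousOn (fun p => metric (ν p) (X p)) (frontier D) := fun hX =>
    (ContinuousOn.inner (𝕜 := ℝ) hνc.fst hX.fst).add (hνc.snd.mul hX.snd)
  have hfdZ : Continuous (fd Z) :=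
    continuousOn_univ.1 (contDiffOn_fd isOpen_univ hZ.contDiffOn (k := 0) (by norm_num)).continuousOn
  have hκc : ContinuousOn (fun p => horTrace (shape f p)) (frontier D) :=
    hr.continuousOn_horTrace_shape.mono hSV
  have i1 : Integrable (fun p => ‖(ν p).1‖ * (secVar f p - -c * volVar f p))
      (sigmaR (frontier D) ν) := hS.integrable_of_continuousOn hSc
    (hNc.mul ((hr.continuousOn_secVar.mono hSV).sub
      (continuousOn_const.mul (hr.continuousOn_volVar.mono hSV))))
  have i2 : Integrable (fun p => ‖(ν p).1‖ * frameDiv Z p - metric (ν p) (fd Z p (unitH f p, 0)) -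
      (ν p).2 * symp (unitH f p) (Z p).1 - horTrace (shape f p) * metric (ν p) (Z p))
      (sigmaR (frontier D) ν) := by
    refine hS.integrable_of_continuousOn hSc ((((hNc.mul (continuous_frameDiv hZ).continuousOn).sub
      (hmet (hfdZ.continuousOn.clm_apply (hq.prodMk continuousOn_const)))).sub
      (hνc.snd.mul ?_)).sub (hκc.mul (hmet hZ.continuous.continuousOn)))
    have h1 : ContinuousOn (fun p => sympL (unitH f p)) (frontier D) :=
      sympL.continuous.comp_continuousOn hq
    exact (h1.clm_apply hZ.continuous.fst.continuousOn).congr fun p _ =>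
      (sympL_apply _ _).symm
  have i3 : Integrable (fun p => metric (ν p) (toFrame p (accVar D ϑ ε p)) +
      ‖(ν p).1‖ * volVar f p) (sigmaR (frontier D) ν) := hS.integrable_of_continuousOn hSc
    ((hmet hZ₀.continuousOn).add (hNc.mul (hr.continuousOn_volVar.mono hSV)))
  rw [secondVariation, hchar, sdiff_empty]
  have h1 : ∫ p in frontier D, iteratedDeriv 2 (fun t => perimDensity D ν ϑ t p) 0
      ∂(sigmaR (frontier D) ν) = ∫ p in frontier D, (‖(ν p).1‖ * (secVar f p - -c * volVar f p) +
        ((‖(ν p).1‖ * frameDiv Z p - metric (ν p) (fd Z p (unitH f p, 0)) -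
      (ν p).2 * symp (unitH f p) (Z p).1 - horTrace (shape f p) * metric (ν p) (Z p)) +
      -c * (metric (ν p) (toFrame p (accVar D ϑ ε p)) + ‖(ν p).1‖ * volVar f p)))
      ∂(sigmaR (frontier D) ν) := by
    refine setIntegral_congr_fun hSc.measurableSet fun p hp => ?_
    beta_reduce
    rw [hv.iteratedDeriv_perimDensity hD hd hr hSV hvel hp
      (hZ.differentiable (by norm_num) p) hZS', hκ p hp, hZS' p hp]
    ring
  rw [h1, IsOrientedHypersurface.restrict_sigmaR hSc.measurableSet]
  have h2 := integral_add i2 (i3.const_mul (-c))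
  rw [hI, integral_const_mul, hvol, mul_zero, add_zero] at h2
  refine (integral_add i1 (i2.add (i3.const_mul (-c)))).trans ?_
  refine (congrArg (_ + ·) h2).trans (add_zero _)

/-- The second variation formula and the stability inequality. -/
theorem integral_of_isTestVariation (hn : 1 ≤ n) (hD : IsC2Domain D ν)
    (hH : HasConstantMeanCurv (frontier D) ν)
    (hX : Admissible (frontier D) ν fun p => varpi ν p ^ 3 • nuPerp ν p)
    (hϑ : IsTestVariation D ν (varpi ν) ϑ) :
    Integrable (fun p => ‖gradHS (frontier D) ν (varpi ν) p‖ ^ 2) (sigmaH (frontier D) ν) ∧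
    Integrable (fun p => varpi ν p ^ 2 * (normSqSymm (frontier D) ν p +
      (3 - (n : ℝ)) / 6 * varpi ν p ^ 2)) (sigmaH (frontier D) ν) ∧
    secondVariation D ν ϑ = ∫ p, (‖gradHS (frontier D) ν (varpi ν) p‖ ^ 2 -
      varpi ν p ^ 2 * (normSqSymm (frontier D) ν p +
      (3 - (n : ℝ)) / 6 * varpi ν p ^ 2)) ∂(sigmaH (frontier D) ν) ∧
    (IsWeaklyStable D ν →
      ∫ p, varpi ν p ^ 2 * (normSqSymm (frontier D) ν p +
        (3 - (n : ℝ)) / 6 * varpi ν p ^ 2) ∂(sigmaH (frontier D) ν) ≤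
      ∫ p, ‖gradHS (frontier D) ν (varpi ν) p‖ ^ 2 ∂(sigmaH (frontier D) ν)) := by
  have hS := hD.isOrientedHypersurface
  have hSc := hD.isCompact_frontier
  have hchar := charSet_eq_empty hS hn hX.2.2.1
  obtain ⟨f, V, hd, hr, hSV⟩ := hD.exists_regular hchar
  have h1 := hS.integrable_sigmaH_of_continuousOn hSc (hd.continuousOn_normSq_gradHS hr hS hSV)
  have h2 := hS.integrable_sigmaH_of_continuousOn hSc (hd.continuousOn_normSqSymm hr hS hSV)
  have h3 := hD.secondVariation_eq hd hr hSV hchar hH hϑ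
  refine ⟨h1, h2, h3, fun hst => ?_⟩
  by_cases hne : ∃ p ∈ frontier D, velocity ϑ 0 p ≠ 0
  · have h4 := hst.2 _ ϑ hϑ hne
    rw [h3, integral_sub h1 h2] at h4
    linarith
  · push Not at hne
    have h0 : ∀ p ∈ frontier D, varpi ν p = 0 := by
      intro p hp
      have hν : (ν p).1 ≠ 0 := hd.normal_fst_ne hr hp (hSV hp)
      have h4 := hϑ.2.2.1 p (by rw [hchar, sdiff_empty]; exact hp)
      rw [hne p hp] at h4
      have h5 := (smul_eq_zero.1 h4.symm).resolve_right fun h => hν (by rw [h]; rfl)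
      exact (mul_eq_zero.1 h5).resolve_right (norm_ne_zero_iff.2 hν)
    refine integral_mono_ae h2 h1 ?_
    filter_upwards [mem_ae_iff.2 (contractionMeasure_compl hSc.measurableSet)] with p hp
    rw [h0 p hp]
    simp

end IsC2Domain

end

section

/-! ## Integrability from integration by parts -/

theorem deriv_leftStep_nonpos (s : ℝ) : deriv leftStep s ≤ 0 := by
  have h : Antitone leftStep := fun a b h => Real.smoothTransition.monotone (by linarith)
  exact h.deriv_nonpos

/-- The cutoff `w ↦ 1` for `w² ≤ R`, `w ↦ 0` for `w² ≥ 2R`. -/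
def truncation (R w : ℝ) : ℝ := leftStep (w ^ 2 / R - 3)

variable {Ω : Type*} [MeasurableSpace Ω] {μ : Measure Ω} {w : Ω → ℝ} {N : ℝ}

theorem integrable_comp_of_hasCompactSupport [IsFiniteMeasure μ] (hw : AEStronglyMeasurable w μ) {g : ℝ → ℝ}
    (hg : Continuous g) (hc : HasCompactSupport g) : Integrable (fun p => g (w p)) μ := by
  obtain ⟨C, hC⟩ := hg.bounded_above_of_compact_support hc
  exact Integrable.of_bound (hg.comp_aestronglyMeasurable hw) C (Eventually.of_forall fun p => hC _)

theorem hasDerivAt_truncation (R w : ℝ) :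
    HasDerivAt (truncation R) (deriv leftStep (w ^ 2 / R - 3) * (2 * w / R)) w := by
  have h1 : HasDerivAt leftStep (deriv leftStep (w ^ 2 / R - 3)) (w ^ 2 / R - 3) :=
    (contDiff_leftStep.differentiable (by norm_num) _).hasDerivAt
  exact HasDerivAt.congr_deriv (f := truncation R) (h1.comp w
    (((hasDerivAt_pow 2 w).div_const R).sub_const 3)) (by simp)

theorem contDiff_truncation (R : ℝ) : ContDiff ℝ 1 (truncation R) :=
  contDiff_leftStep.comp (((contDiff_id.pow 2).div_const R).sub contDiff_const)

theorem hasCompactSupport_truncation {R : ℝ} (hR : 0 < R) : HasCompactSupport (truncation R) :=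
  HasCompactSupport.intro (isCompact_closedBall (0 : ℝ) (2 * R + 1)) fun s hs => by
    rw [mem_closedBall_zero_iff, Real.norm_eq_abs, not_le] at hs
    refine leftStep_of_ge ?_
    have h1 : 2 ≤ s ^ 2 / R := by
      rw [le_div_iff₀ hR, ← sq_abs]
      nlinarith
    linarith

theorem integral_truncation (H : ∀ F : ℝ → ℝ, ContDiff ℝ 1 F → HasCompactSupport F →
      ∫ p, (deriv F (w p) * (w p ^ 2 + 4) / 2 - N * w p * F (w p)) ∂μ = 0)
    (a b : ℝ) {R : ℝ} (hR : 0 < R) :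
    ∫ p, (truncation R (w p) * ((3 * a * w p ^ 2 + b) * (w p ^ 2 + 4) / 2 -
      N * w p ^ 2 * (a * w p ^ 2 + b)) +
      deriv leftStep (w p ^ 2 / R - 3) * (w p ^ 2 / R) * ((a * w p ^ 2 + b) * (w p ^ 2 + 4))) ∂μ =
      0 := by
  have hF : ContDiff ℝ 1 fun s => (a * s ^ 3 + b * s) * truncation R s :=
    ((contDiff_const.mul (contDiff_id.pow 3)).add (contDiff_const.mul contDiff_id)).mul
      (contDiff_truncation R)
  refine Eq.trans (integral_congr_ae (Eventually.of_forall fun p => ?_))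
    (H _ hF (hasCompactSupport_truncation hR).mul_left)
  have h1 : HasDerivAt (fun s => (a * s ^ 3 + b * s) * truncation R s)
      ((a * (3 * w p ^ 2) + b) * truncation R (w p) + (a * w p ^ 3 + b * w p) *
        (deriv leftStep (w p ^ 2 / R - 3) * (2 * w p / R))) (w p) :=
    HasDerivAt.congr_deriv (((((hasDerivAt_pow 3 (w p)).const_mul a).add
      ((hasDerivAt_id (w p)).const_mul b))).mul (hasDerivAt_truncation R (w p))) (by simp)
  beta_reduce
  rw [h1.deriv]
  ring

theorem tendsto_truncation (s : ℝ) :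
    ∀ᶠ R : ℝ in atTop, truncation R s = 1 ∧ deriv leftStep (s ^ 2 / R - 3) = 0 := by
  filter_upwards [eventually_gt_atTop (s ^ 2 + 1)] with R hR
  have h0 : 0 < R := by nlinarith [sq_nonneg s]
  have h1 : s ^ 2 / R < 1 := by rw [div_lt_one h0]; linarith
  exact ⟨leftStep_of_le (by linarith), deriv_leftStep_of_lt (by linarith)⟩

/-- The fourth power is integrable, and the resulting integral identity. -/
theorem integrable_pow_four_of_integral_eq_zero [IsFiniteMeasure μ] (hN : 2 ≤ N) (hw : AEStronglyMeasurable w μ)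
    (H : ∀ F : ℝ → ℝ, ContDiff ℝ 1 F → HasCompactSupport F →
      ∫ p, (deriv F (w p) * (w p ^ 2 + 4) / 2 - N * w p * F (w p)) ∂μ = 0) :
    Integrable (fun p => w p ^ 4) μ ∧
      ∫ p, (4 - 2 * N * w p ^ 2 + (N / 6 - 1 / 4) * w p ^ 4) ∂μ = 0 := by
  obtain ⟨C, hC⟩ := continuous_deriv_leftStep.bounded_above_of_compact_support
    hasCompactSupport_deriv_leftStep
  have hχ0 : ∀ R s, 0 ≤ truncation R s := fun R s => Real.smoothTransition.nonneg _
  have hχ1 : ∀ R s, truncation R s ≤ 1 := fun R s => Real.smoothTransition.le_one _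
  have hpos : ∀ j : ℕ, (0 : ℝ) < j + 1 := fun j => by positivity
  have hTj : Tendsto (fun j : ℕ => (j : ℝ) + 1) atTop atTop :=
    tendsto_atTop_add_const_right _ _ tendsto_natCast_atTop_atTop
  have hcs : ∀ (R : ℝ), 0 < R → ∀ P : ℝ → ℝ, Continuous P →
      Integrable (fun p => truncation R (w p) * P (w p)) μ := fun R hR P hP =>
    integrable_comp_of_hasCompactSupport (g := fun s => truncation R s * P s) hw
      ((contDiff_truncation R).continuous.mul hP) (hasCompactSupport_truncation hR).mul_right
  have hbound : ∀ j : ℕ, ∫ p, truncation (j + 1) (w p) * w p ^ 4 ∂μ ≤ 16 * μ.real univ := by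
    intro j
    have h1 := integral_truncation H 1 4 (hpos j)
    have hE : HasCompactSupport fun s : ℝ => deriv leftStep (s ^ 2 / (j + 1 : ℝ) - 3) *
        (s ^ 2 / (j + 1)) * ((1 * s ^ 2 + 4) * (s ^ 2 + 4)) := by
      refine HasCompactSupport.intro (isCompact_closedBall (0 : ℝ) (2 * (j + 1) + 1)) fun s hs => ?_
      rw [mem_closedBall_zero_iff, Real.norm_eq_abs, not_le] at hs
      rw [deriv_leftStep_of_gt, zero_mul, zero_mul]
      have h1 : 2 < s ^ 2 / (j + 1 : ℝ) := by
        rw [lt_div_iff₀ (hpos j), ← sq_abs]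
        nlinarith [hpos j]
      linarith
    have hEc : Continuous fun s : ℝ => deriv leftStep (s ^ 2 / (j + 1 : ℝ) - 3) *
        (s ^ 2 / (j + 1)) * ((1 * s ^ 2 + 4) * (s ^ 2 + 4)) := by
      have := continuous_deriv_leftStep
      fun_prop
    have i1 := hcs _ (hpos j) (fun s => (3 * 1 * s ^ 2 + 4) * (s ^ 2 + 4) / 2 -
      N * s ^ 2 * (1 * s ^ 2 + 4)) (by fun_prop)
    have i2 := integrable_comp_of_hasCompactSupport hw hEc hE
    have i3 := hcs _ (hpos j) (fun s => s ^ 4) (by fun_prop)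
    have h2 := integral_mono (i1.add i2) ((integrable_const (8 : ℝ)).sub (i3.const_mul (1 / 2)))
      fun p => ?_
    · simp only [Pi.add_apply] at h2
      rw [h1, integral_sub' (integrable_const _) (i3.const_mul _), integral_const_mul,
        integral_const, smul_eq_mul] at h2
      linarith
    · simp only [Pi.add_apply, Pi.sub_apply]
      have h3 := deriv_leftStep_nonpos (w p ^ 2 / (j + 1 : ℝ) - 3)
      have h4 : 0 ≤ w p ^ 2 / (j + 1 : ℝ) * ((1 * w p ^ 2 + 4) * (w p ^ 2 + 4)) := by
        have := hpos j; positivity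
      have h5 := mul_nonpos_of_nonpos_of_nonneg h3 h4
      have h6 : (3 * 1 * w p ^ 2 + 4) * (w p ^ 2 + 4) / 2 - N * w p ^ 2 * (1 * w p ^ 2 + 4) ≤
          8 - 1 / 2 * w p ^ 4 := by
        nlinarith [mul_nonneg (sub_nonneg.2 hN) (by positivity : 0 ≤ w p ^ 2 * (1 * w p ^ 2 + 4))]
      have h7 := mul_le_mul_of_nonneg_left h6 (hχ0 (j + 1) (w p))
      have h8 := hχ1 (j + 1) (w p)
      nlinarith
  have hi : Integrable (fun p => w p ^ 4) μ := by
    have hlim : ∀ p, Tendsto (fun j : ℕ => truncation (j + 1) (w p) * w p ^ 4) atTop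
        (𝓝 (w p ^ 4)) := by
      refine fun p => (tendsto_congr' ?_).2 tendsto_const_nhds
      filter_upwards [hTj.eventually (tendsto_truncation (w p))] with j hj
      rw [hj.1, one_mul]
    have hm := fun j : ℕ => (hcs _ (hpos j) _ (continuous_id.pow 4)).aestronglyMeasurable
    refine ⟨(continuous_id.pow 4).comp_aestronglyMeasurable hw, lt_of_le_of_lt
      ((lintegral_congr fun p => (hlim p).enorm.liminf_eq.symm).trans_le
        (lintegral_liminf_le' fun j => (hm j).aemeasurable.enorm)) (lt_top_iff_ne_top.2 ?_)⟩
    · refine ne_top_of_le_ne_top (ENNReal.ofReal_ne_top (r := 16 * μ.real univ))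
        (liminf_le_of_le (by isBoundedDefault) fun b hb => ?_)
      obtain ⟨j, hj⟩ := hb.exists
      refine hj.trans ?_
      have h0 : ∀ p, 0 ≤ truncation (j + 1) (w p) * w p ^ 4 := fun p =>
        mul_nonneg (hχ0 _ _) (by positivity)
      have : ∫⁻ p, ‖truncation (j + 1) (w p) * w p ^ 4‖ₑ ∂μ =
          ENNReal.ofReal (∫ p, truncation (j + 1) (w p) * w p ^ 4 ∂μ) := by
        rw [ofReal_integral_eq_lintegral_ofReal (hcs _ (hpos j) (fun s => s ^ 4) (by fun_prop))
          (Eventually.of_forall h0)]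
        exact lintegral_congr fun p => Real.enorm_of_nonneg (h0 p)
      rw [this]
      exact ENNReal.ofReal_le_ofReal (hbound j)
  refine ⟨hi, ?_⟩
  have hC0 : 0 ≤ C := (norm_nonneg _).trans (hC 0)
  refine tendsto_nhds_unique ?_ (tendsto_const_nhds (x := (0 : ℝ)) (f := (atTop : Filter ℕ)))
  have hlim := tendsto_integral_of_dominated_convergence (μ := μ)
    (F := fun (j : ℕ) p => truncation (j + 1) (w p) * ((3 * (-1 / 6) * w p ^ 2 + 2) *
      (w p ^ 2 + 4) / 2 - N * w p ^ 2 * (-1 / 6 * w p ^ 2 + 2)) +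
      deriv leftStep (w p ^ 2 / (j + 1 : ℝ) - 3) * (w p ^ 2 / (j + 1)) *
        ((-1 / 6 * w p ^ 2 + 2) * (w p ^ 2 + 4)))
    (f := fun p => 4 - 2 * N * w p ^ 2 + (N / 6 - 1 / 4) * w p ^ 4)
    (fun p => (20 + 3 * N + 40 * C) * (1 + w p ^ 4)) ?_ ((integrable_const _).add hi |>.const_mul _) ?_ ?_
  · exact hlim.congr fun j => integral_truncation H (-1 / 6) 2 (hpos j)
  · intro j
    have h1 := continuous_deriv_leftStep
    have h2 := (contDiff_truncation (j + 1)).continuous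
    exact Continuous.comp_aestronglyMeasurable (g := fun s : ℝ => truncation (j + 1) s *
      ((3 * (-1 / 6) * s ^ 2 + 2) * (s ^ 2 + 4) / 2 - N * s ^ 2 * (-1 / 6 * s ^ 2 + 2)) +
      deriv leftStep (s ^ 2 / (j + 1 : ℝ) - 3) * (s ^ 2 / (j + 1)) *
        ((-1 / 6 * s ^ 2 + 2) * (s ^ 2 + 4))) (by fun_prop) hw
  · intro j
    refine Eventually.of_forall fun p => ?_
    set s := w p ^ 2 with hs
    have hs0 : 0 ≤ s := sq_nonneg _
    have e4 : w p ^ 4 = s ^ 2 := by rw [hs]; ring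
    rw [e4]
    have hA : |truncation (j + 1) (w p) * ((3 * (-1 / 6) * s + 2) * (s + 4) / 2 -
        N * s * (-1 / 6 * s + 2))| ≤ (20 + 3 * N) * (1 + s ^ 2) := by
      rw [abs_mul, abs_of_nonneg (hχ0 _ _)]
      refine (mul_le_of_le_one_left (abs_nonneg _) (hχ1 _ _)).trans (abs_le.2 ⟨?_, ?_⟩)
      · nlinarith [sq_nonneg (s - 1), mul_nonneg hs0 hs0,
          mul_nonneg (by linarith : (0 : ℝ) ≤ N) (sq_nonneg (s - 1)),
          mul_nonneg (by linarith : (0 : ℝ) ≤ N) (sq_nonneg s)]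
      · nlinarith [sq_nonneg (s - 1), mul_nonneg hs0 hs0,
          mul_nonneg (by linarith : (0 : ℝ) ≤ N) (sq_nonneg (s - 1)),
          mul_nonneg (by linarith : (0 : ℝ) ≤ N) (sq_nonneg s),
          mul_nonneg (by linarith : (0 : ℝ) ≤ N) hs0]
    have hB : |deriv leftStep (s / (j + 1 : ℝ) - 3) * (s / (j + 1)) *
        ((-1 / 6 * s + 2) * (s + 4))| ≤ 40 * C * (1 + s ^ 2) := by
      have hP : |(-1 / 6 * s + 2) * (s + 4)| ≤ 20 * (1 + s ^ 2) :=
        abs_le.2 ⟨by nlinarith [sq_nonneg (s - 1)], by nlinarith [sq_nonneg (s - 1)]⟩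
      by_cases h2 : s / (j + 1 : ℝ) ≤ 2
      · rw [abs_mul, abs_mul, abs_of_nonneg (div_nonneg hs0 (hpos j).le)]
        calc _ ≤ C * 2 * (20 * (1 + s ^ 2)) := by
              gcongr
              · exact hC _
          _ = _ := by ring
      · rw [deriv_leftStep_of_gt (by linarith), zero_mul, zero_mul, abs_zero]
        positivity
    refine (norm_add_le _ _).trans ?_
    rw [Real.norm_eq_abs, Real.norm_eq_abs]
    linarith
  · refine Eventually.of_forall fun p => (tendsto_congr' ?_).2 tendsto_const_nhds
    filter_upwards [hTj.eventually (tendsto_truncation (w p))] with j hj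
    rw [hj.1, hj.2]
    ring

end

/-! ## The profile away from its poles -/

/-- The height of the points of the profile at which `ϖ = 2c`. -/
def cotTime (c : ℝ) : ℝ := 1 / 4 * (c / (1 + c ^ 2) + Real.arctan c)

theorem hasDerivAt_cotTime (c : ℝ) : HasDerivAt cotTime (2 * (1 + c ^ 2) ^ 2)⁻¹ c := by
  have h0 : (1 + c ^ 2 : ℝ) ≠ 0 := by positivity
  have h := (((hasDerivAt_id c).div ((hasDerivAt_pow 2 c).const_add 1) h0).add
    (Real.hasDerivAt_arctan c)).const_mul (1 / 4)
  refine HasDerivAt.congr_deriv (f := cotTime) h ?_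
  simp only [id]
  field_simp
  norm_num
  ring

theorem contDiff_cotTime {k : WithTop ℕ∞} : ContDiff ℝ k cotTime :=
  contDiff_const.mul ((contDiff_id.div (contDiff_const.add (contDiff_id.pow 2))
    fun c => by positivity).add Real.contDiff_arctan)

theorem strictMono_cotTime : StrictMono cotTime :=
  strictMono_of_deriv_pos fun c => by rw [(hasDerivAt_cotTime c).deriv]; positivity

theorem cotTime_neg (c : ℝ) : cotTime (-c) = -cotTime c := by
  simp [cotTime, Real.arctan_neg]; ring

/-- The inverse function of `cotTime`. -/
def timeCot : ℝ → ℝ := Function.invFun cotTime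

theorem timeCot_cotTime (c : ℝ) : timeCot (cotTime c) = c :=
  Function.leftInverse_invFun strictMono_cotTime.injective c

theorem eventually_cotTime_timeCot (c : ℝ) : (∀ᶠ t in 𝓝 (cotTime c), cotTime (timeCot t) = t) ∧
    ContDiffAt ℝ 2 timeCot (cotTime c) := by
  have h0 : (2 * (1 + c ^ 2) ^ 2)⁻¹ ≠ (0 : ℝ) := by positivity
  have hd : HasFDerivAt cotTime ((ContinuousLinearEquiv.unitsEquivAut ℝ (Units.mk0 _ h0) :
      ℝ ≃L[ℝ] ℝ) : ℝ →L[ℝ] ℝ) c := by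
    refine (hasDerivAt_cotTime c).hasFDerivAt.congr_fderiv ?_
    ext; simp
  have hc : ContDiffAt ℝ 2 cotTime c := contDiff_cotTime.contDiffAt
  have h1 := (hc.hasStrictFDerivAt' hd (by norm_num)).eventually_right_inverse
  have h2 := hc.to_localInverse hd (by norm_num)
  have h3 : timeCot =ᶠ[𝓝 (cotTime c)] hc.localInverse hd (by norm_num) := by
    filter_upwards [h1] with t ht
    conv_lhs => rw [← ht]
    exact timeCot_cotTime _
  refine ⟨?_, h2.congr_of_eventuallyEq h3⟩
  filter_upwards [h1, h3] with t ht ht'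
  rw [ht']; exact ht

theorem isOpen_range_cotTime : IsOpen (range cotTime) := by
  rw [isOpen_iff_mem_nhds]
  rintro _ ⟨c, rfl⟩
  filter_upwards [(eventually_cotTime_timeCot c).1] with t ht using ⟨_, ht⟩

theorem cotTime_timeCot {t : ℝ} (ht : t ∈ range cotTime) : cotTime (timeCot t) = t := by
  obtain ⟨c, rfl⟩ := ht
  rw [timeCot_cotTime]

theorem contDiffOn_timeCot : ContDiffOn ℝ 2 timeCot (range cotTime) := by
  rintro _ ⟨c, rfl⟩
  exact (eventually_cotTime_timeCot c).2.contDiffWithinAt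

theorem hasDerivAt_timeCot {t : ℝ} (ht : t ∈ range cotTime) :
    HasDerivAt timeCot (2 * (1 + timeCot t ^ 2) ^ 2) t := by
  obtain ⟨c, rfl⟩ := ht
  have h := (eventually_cotTime_timeCot c)
  rw [timeCot_cotTime]
  have h1 := HasDerivAt.of_local_left_inverse (f := cotTime) (g := timeCot) (a := cotTime c)
    h.2.continuousAt (by rw [timeCot_cotTime]; exact hasDerivAt_cotTime c) (by positivity) h.1
  rwa [inv_inv] at h1

theorem profileFun_eq_cotTime {c : ℝ} (hc : 0 ≤ c) :
    profileFun (Real.sqrt (1 + c ^ 2))⁻¹ = cotTime c := by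
  have h0 : (0 : ℝ) < 1 + c ^ 2 := by positivity
  have h1 : Real.sqrt (1 - (Real.sqrt (1 + c ^ 2))⁻¹ ^ 2) = c / Real.sqrt (1 + c ^ 2) := by
    rw [inv_pow, Real.sq_sqrt h0.le, show 1 - (1 + c ^ 2)⁻¹ = c ^ 2 / (1 + c ^ 2) by field_simp; ring,
      Real.sqrt_div (sq_nonneg c), Real.sqrt_sq hc]
  have h2 : Real.arcsin (Real.sqrt (1 + c ^ 2))⁻¹ = Real.pi / 2 - Real.arctan c := by
    have h3 := Real.arctan_lt_pi_div_two c
    have h4 : 0 ≤ Real.arctan c := Real.arctan_nonneg.2 hc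
    rw [← one_div, ← Real.cos_arctan, ← Real.sin_pi_div_two_sub,
      Real.arcsin_sin (by linarith [Real.pi_pos]) (by linarith)]
  rw [profileFun, h1, h2, cotTime]
  have h3 : (Real.sqrt (1 + c ^ 2))⁻¹ / 4 * (c / Real.sqrt (1 + c ^ 2)) = 1 / 4 * (c / (1 + c ^ 2)) := by
    have := Real.sq_sqrt h0.le
    have h4 := (Real.sqrt_pos.2 h0).ne'
    field_simp
    rw [this]
  rw [h3]
  ring

/-- Points of the profile other than the poles. -/
theorem mem_profile_iff {p : Heis n} (hp : p.1 ≠ 0) :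
    p ∈ profile n ↔ p.2 ∈ range cotTime ∧ ‖p.1‖ ^ 2 * (1 + timeCot p.2 ^ 2) = 1 := by
  have hr : 0 < ‖p.1‖ := norm_pos_iff.2 hp
  constructor
  · rintro ⟨h1, h2⟩
    set x := Real.sqrt (1 - ‖p.1‖ ^ 2) / ‖p.1‖ with hx
    have hx0 : 0 ≤ x := by positivity
    have hx2 : ‖p.1‖ ^ 2 * (1 + x ^ 2) = 1 := by
      rw [hx, div_pow, Real.sq_sqrt (by nlinarith)]
      field_simp
      ring
    have h3 : ‖p.1‖ = (Real.sqrt (1 + x ^ 2))⁻¹ := by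
      rw [← Real.sqrt_inv, ← eq_inv_of_mul_eq_one_left hx2, Real.sqrt_sq hr.le]
    rw [h3, profileFun_eq_cotTime hx0, ← cotTime_neg] at h2
    rcases h2 with h2 | h2 <;> rw [h2, timeCot_cotTime]
    · exact ⟨⟨x, rfl⟩, hx2⟩
    · exact ⟨⟨-x, rfl⟩, by rw [neg_sq]; exact hx2⟩
  · rintro ⟨⟨c, hc⟩, h⟩
    rw [← hc, timeCot_cotTime] at h
    have h3 : ‖p.1‖ = (Real.sqrt (1 + |c| ^ 2))⁻¹ := by
      rw [sq_abs, ← Real.sqrt_inv, ← eq_inv_of_mul_eq_one_left h, Real.sqrt_sq hr.le]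
    refine ⟨by nlinarith [sq_nonneg c, mul_nonneg (sq_nonneg ‖p.1‖) (sq_nonneg c)], ?_⟩
    rw [h3, profileFun_eq_cotTime (abs_nonneg c), ← hc]
    rcases abs_choice c with h4 | h4 <;> rw [h4]
    · exact Or.inl rfl
    · exact Or.inr (by rw [cotTime_neg, neg_neg])

/-- The region in which the profile has the defining function `profileDef`. -/
def profileDom (n : ℕ) : Set (Heis n) := {p | p.1 ≠ 0 ∧ p.2 ∈ range cotTime}

/-- A defining function of the profile away from the poles. -/
def profileDef (p : Heis n) : ℝ := 1 / 2 * (‖p.1‖ ^ 2 - (1 + timeCot p.2 ^ 2)⁻¹)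

/-- The gradient of `profileDef`. -/
def profileNormal (p : Heis n) : FrameVec n := (p.1 + timeCot p.2 • perp p.1, 2 * timeCot p.2)

theorem isOpen_profileDom : IsOpen (profileDom n) :=
  (isOpen_ne_fun continuous_fst continuous_const).inter
    (isOpen_range_cotTime.preimage continuous_snd)

theorem contDiffOn_timeCot_snd : ContDiffOn ℝ 2 (fun p : Heis n => timeCot p.2) (profileDom n) :=
  contDiffOn_timeCot.comp contDiff_snd.contDiffOn fun _ hp => hp.2

theorem contDiffOn_profileDef : ContDiffOn ℝ 2 (profileDef (n := n)) (profileDom n) :=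
  contDiffOn_const.mul (((contDiff_fst.norm_sq ℝ).contDiffOn).sub
    ((contDiffOn_const.add (contDiffOn_timeCot_snd.pow 2)).inv fun p _ => by positivity))

theorem hasFDerivAt_timeCot_snd {p : Heis n} (hp : p ∈ profileDom n) :
    HasFDerivAt (fun q : Heis n => timeCot q.2)
      ((2 * (1 + timeCot p.2 ^ 2) ^ 2) • sndH) p := by
  exact (hasDerivAt_timeCot hp.2).comp_hasFDerivAt p hasFDerivAt_snd

theorem rgrad_profileDef {p : Heis n} (hp : p ∈ profileDom n) :
    rgrad profileDef p = profileNormal p := by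
  refine rgrad_eq_of_metric fun v => ?_
  have h1 : HasFDerivAt (fun q : Heis n => ‖q.1‖ ^ 2)
      ((2 • innerSL ℝ p.1) ∘L fstH) p :=
    (hasStrictFDerivAt_norm_sq p.1).hasFDerivAt.comp p hasFDerivAt_fst
  have h2 : HasDerivAt (fun c : ℝ => (1 + c ^ 2)⁻¹)
      (-(2 * timeCot p.2) / (1 + timeCot p.2 ^ 2) ^ 2) (timeCot p.2) :=
    HasDerivAt.congr_deriv (((hasDerivAt_pow 2 (timeCot p.2)).const_add 1).inv (by positivity))
      (by simp)
  have h3 := (h1.sub (h2.comp_hasFDerivAt p (hasFDerivAt_timeCot_snd hp))).const_mul (1 / 2)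
  have h4 : fderiv ℝ profileDef p = _ := h3.fderiv
  rw [fd_apply, h4, toCoord_eq]
  have h5 : (1 + timeCot p.2 ^ 2 : ℝ) ≠ 0 := by positivity
  simp [metric, profileNormal, inner_add_left, inner_smul_left, symp_eq_inner]
  field_simp
  ring

theorem isDefiningOn_profileDef {ν : Heis n → FrameVec n} {e : ℝ} (he : e = 1 ∨ e = -1)
    (hν : ∀ p ∈ profile n ∩ profileDom n,
      ν p = e • (rnorm (profileNormal p))⁻¹ • profileNormal p) :
    IsDefiningOn (profile n) ν (fun p => e * profileDef p) (profileDom n) ∧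
    IsHorizontallyRegular (fun p => e * profileDef (n := n) p) (profileDom n) ∧
    ∀ p ∈ profileDom n, rgrad (fun p => e * profileDef p) p = e • profileNormal p := by
  have he0 : e ≠ 0 := by rcases he with rfl | rfl <;> norm_num
  have hrg : ∀ p ∈ profileDom n, rgrad (fun p => e * profileDef p) p = e • profileNormal p := by
    intro p hp
    have hd := (contDiffOn_profileDef.contDiffAt (isOpen_profileDom.mem_nhds hp)).differentiableAt
      (by norm_num)
    refine rgrad_eq_of_metric fun v => ?_
    rw [fd_apply, fderiv_const_mul hd, smul_apply, ← fd_apply, fd_eq_metric, rgrad_profileDef hp,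
      metric_smul_left, smul_eq_mul]
  have hne : ∀ p ∈ profileDom n, p.1 + timeCot p.2 • perp p.1 ≠ 0 := by
    intro p hp h
    have h1 := congrArg (inner ℝ p.1) h
    rw [inner_add_right, inner_smul_right, inner_self_perp, inner_zero_right,
      real_inner_self_eq_norm_sq] at h1
    exact hp.1 (norm_eq_zero.1 (pow_eq_zero_iff two_ne_zero |>.1 (by linarith)))
  have hN : ∀ p ∈ profileDom n, profileNormal p ≠ 0 := fun p hp h => hne p hp (congrArg Prod.fst h)
  have hcd := contDiffOn_const (c := e).mul (contDiffOn_profileDef (n := n))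
  refine ⟨⟨isOpen_profileDom, hcd, ?_, fun p hp => ?_, fun p hp => ?_⟩,
    ⟨isOpen_profileDom, hcd, fun p hp => ?_⟩, hrg⟩
  · ext p
    refine ⟨fun h => ⟨h.2, ?_⟩, fun h => ⟨(mem_profile_iff h.1.1).2 ⟨h.1.2, ?_⟩, h.1⟩⟩
    · have h1 := ((mem_profile_iff h.2.1).1 h.1).2
      rw [profileDef, eq_inv_of_mul_eq_one_left h1]; ring
    · have h1 := (mul_eq_zero.1 h.2).resolve_left he0
      have h2 : ‖p.1‖ ^ 2 = (1 + timeCot p.2 ^ 2)⁻¹ := by rw [profileDef] at h1; linarith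
      rw [h2, inv_mul_cancel₀ (by positivity)]
  · rw [hrg p hp.2]; exact smul_ne_zero he0 (hN p hp.2)
  · rw [hν p hp, hrg p hp.2]
    have h1 : rnorm (e • profileNormal p) = rnorm (profileNormal p) := by
      rcases he with rfl | rfl
      · rw [one_smul]
      · simp [rnorm, metric]
    rw [h1, smul_comm]
  · rw [hgrad, hrg p hp]
    exact smul_ne_zero he0 (hne p hp)

/-! ## The poles of the profile -/

theorem contDiff_norm_smul : ContDiff ℝ 1 fun z : Hor n => ‖z‖ • z := by
  rw [contDiff_one_iff_hasFDerivAt]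
  refine ⟨fun z => ‖z‖ • ContinuousLinearMap.id ℝ (Hor n) +
    (‖z‖⁻¹ • innerSL ℝ z).smulRight z, ?_, fun z => ?_⟩
  · refine (continuous_norm.smul continuous_const).add (continuous_iff_continuousAt.2 fun z => ?_)
    by_cases hz : z = 0
    · subst hz
      rw [ContinuousAt, map_zero, smul_zero]
      have h0 : (0 : Hor n →L[ℝ] ℝ).smulRight (0 : Hor n) = 0 := by ext; simp
      rw [h0]
      refine squeeze_zero_norm (a := fun z => ‖z‖) (fun z => ?_) (by simpa using tendsto_norm_zero)
      rw [ContinuousLinearMap.norm_smulRight_apply, norm_smul, innerSL_apply_norm, norm_inv, norm_norm]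
      exact mul_le_of_le_one_left (norm_nonneg z) inv_mul_le_one
    · have h1 : ContinuousAt (fun z : Hor n => ‖z‖⁻¹ • innerSL ℝ z) z :=
        (continuous_norm.continuousAt.inv₀ (norm_ne_zero_iff.2 hz)).smul
          (innerSL ℝ).continuous.continuousAt
      exact ((ContinuousLinearMap.smulRightL ℝ (Hor n) (Hor n)).continuous.continuousAt.comp
        h1).clm_apply continuousAt_id
  · by_cases hz : z = 0
    · subst hz
      rw [hasFDerivAt_iff_isLittleO_nhds_zero]
      have h1 : (fun z : Hor n => ‖z‖) =o[𝓝 0] fun _ => (1 : ℝ) := by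
        rw [Asymptotics.isLittleO_one_iff]; simpa using tendsto_norm_zero
      have h2 := h1.smul_isBigO (Asymptotics.isBigO_refl (fun z : Hor n => z) (𝓝 0))
      simpa using h2
    · have h1 : HasFDerivAt (fun z : Hor n => ‖z‖) (‖z‖⁻¹ • innerSL ℝ z) z := by
        have h2 := (hasStrictFDerivAt_norm_sq z).hasFDerivAt.sqrt
          (pow_ne_zero 2 (norm_ne_zero_iff.2 hz))
        simp only [Real.sqrt_sq (norm_nonneg _)] at h2
        refine h2.congr_fderiv ?_
        ext v
        simp
        ring
      exact (h1.smul (hasFDerivAt_id z)).congr_fderiv (by ext v; simp)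

theorem hasDerivAt_profileFun {r : ℝ} (h0 : -1 < r) (h1 : r < 1) :
    HasDerivAt profileFun (-(r ^ 2 / (2 * Real.sqrt (1 - r ^ 2)))) r := by
  have h2 : 0 < 1 - r ^ 2 := by nlinarith
  have h3 := ((hasDerivAt_pow 2 r).const_sub 1).sqrt h2.ne'
  have h4 := ((((hasDerivAt_id r).div_const 4).mul h3).const_add (Real.pi / 8)).sub
    ((Real.hasDerivAt_arcsin h0.ne' h1.ne).const_mul (1 / 4))
  refine HasDerivAt.congr_deriv (f := profileFun) h4 ?_
  have h5 := Real.sq_sqrt h2.le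
  have h6 := (Real.sqrt_pos.2 h2).ne'
  simp only [id]
  field_simp
  rw [h5]
  norm_num
  ring

theorem hasFDerivAt_profileFun_norm {z : Hor n} (hz : ‖z‖ < 1) :
    HasFDerivAt (fun z => profileFun ‖z‖)
      (-(2 * Real.sqrt (1 - ‖z‖ ^ 2))⁻¹ • innerSL ℝ (‖z‖ • z)) z := by
  by_cases h0 : z = 0
  · subst h0
    have h1 := (hasDerivAt_profileFun (r := 0) (by norm_num) (by norm_num)).isLittleO
    have h2 := h1.comp_tendsto (show Tendsto (fun z : Hor n => ‖z‖) (𝓝 0) (𝓝 0) by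
      simpa using tendsto_norm_zero)
    rw [hasFDerivAt_iff_isLittleO_nhds_zero]
    refine (Asymptotics.IsLittleO.congr_left (f₁ := fun h : Hor n => profileFun ‖h‖ - profileFun 0)
      ?_ fun h => by simp)
    have h4 : (fun h : Hor n => ‖h‖) =O[𝓝 0] fun h : Hor n => h :=
      (Asymptotics.isBigO_refl _ _).norm_left
    have h3 := h2.trans_isBigO (by simpa [Function.comp_def] using h4)
    simpa [Function.comp_def] using h3
  · have h2 := (hasStrictFDerivAt_norm_sq z).hasFDerivAt.sqrt
      (pow_ne_zero 2 (norm_ne_zero_iff.2 h0))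
    simp only [Real.sqrt_sq (norm_nonneg _)] at h2
    have h3 := (hasDerivAt_profileFun (by linarith [norm_nonneg z]) hz).comp_hasFDerivAt z h2
    refine h3.congr_fderiv ?_
    ext v
    have := norm_ne_zero_iff.2 h0
    simp
    field_simp

theorem contDiffOn_profileFun_norm :
    ContDiffOn ℝ 2 (fun z : Hor n => profileFun ‖z‖) (Metric.ball 0 1) := by
  have hb : ∀ z ∈ Metric.ball (0 : Hor n) 1, ‖z‖ < 1 := fun z hz => by simpa using hz
  rw [show (2 : WithTop ℕ∞) = 1 + 1 by norm_num, contDiffOn_succ_iff_fderiv_of_isOpen Metric.isOpen_ball]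
  refine ⟨fun z hz => (hasFDerivAt_profileFun_norm (hb z hz)).differentiableAt.differentiableWithinAt,
    by simp, ?_⟩
  have h1 : ContDiffOn ℝ 1 (fun z : Hor n => -(2 * Real.sqrt (1 - ‖z‖ ^ 2))⁻¹ • innerSL ℝ (‖z‖ • z))
      (Metric.ball 0 1) := by
    have h2 : ∀ z ∈ Metric.ball (0 : Hor n) 1, 1 - ‖z‖ ^ 2 ≠ 0 := fun z hz => by
      nlinarith [hb z hz, norm_nonneg z]
    refine ((contDiffOn_const.mul ((contDiffOn_const.sub
      (contDiff_id.norm_sq ℝ).contDiffOn).sqrt h2)).inv fun z hz => ?_).neg.smul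
      ((innerSL ℝ).contDiff.comp_contDiffOn contDiff_norm_smul.contDiffOn)
    have : 0 < 1 - ‖z‖ ^ 2 := by nlinarith [hb z hz, norm_nonneg z]
    exact mul_ne_zero two_ne_zero (Real.sqrt_pos.2 this).ne'
  exact h1.congr fun z hz => (hasFDerivAt_profileFun_norm (hb z hz)).fderiv

theorem cotTime_zero : cotTime 0 = 0 := by simp [cotTime]

theorem continuous_profileFun : Continuous profileFun := by
  unfold profileFun
  fun_prop

theorem strictAntiOn_profileFun : StrictAntiOn profileFun (Icc 0 1) := by
  refine strictAntiOn_of_deriv_neg (convex_Icc 0 1) continuous_profileFun.continuousOn fun r hr => ?_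
  rw [interior_Icc] at hr
  rw [(hasDerivAt_profileFun (by linarith [hr.1]) hr.2).deriv]
  have h1 := hr.1
  have h2 : 0 < 1 - r ^ 2 := by nlinarith [hr.2]
  have := Real.sqrt_pos.2 h2
  exact neg_neg_of_pos (by positivity)

theorem profileFun_zero : profileFun 0 = Real.pi / 8 := by simp [profileFun]

theorem profileFun_pos {r : ℝ} (h0 : 0 ≤ r) (h1 : r < 1) : 0 < profileFun r := by
  have h := strictAntiOn_profileFun ⟨h0, h1.le⟩ (right_mem_Icc.2 zero_le_one) h1
  have h2 : profileFun 1 = 0 := by simp [profileFun]; ring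
  rwa [h2] at h

theorem abs_cotTime_lt (c : ℝ) : |cotTime c| < Real.pi / 8 := by
  have key : ∀ c : ℝ, 0 ≤ c → |cotTime c| < Real.pi / 8 := by
    intro c hc
    have h1 : 0 ≤ cotTime c := by rw [← cotTime_zero]; exact strictMono_cotTime.monotone hc
    have h2 : 0 < (Real.sqrt (1 + c ^ 2))⁻¹ := by positivity
    have h3 : (Real.sqrt (1 + c ^ 2))⁻¹ ≤ 1 :=
      inv_le_one_of_one_le₀ (Real.one_le_sqrt.2 (by linarith [sq_nonneg c]))
    rw [abs_of_nonneg h1, ← profileFun_eq_cotTime hc, ← profileFun_zero]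
    exact strictAntiOn_profileFun (left_mem_Icc.2 zero_le_one) ⟨h2.le, h3⟩ h2
  rcases le_total 0 c with hc | hc
  · exact key c hc
  · rw [← abs_neg, ← cotTime_neg]; exact key (-c) (by linarith)

/-- A unit normal of the profile. -/
def profileUnit (p : Heis n) : FrameVec n :=
  if p.1 = 0 then (0, if 0 < p.2 then 1 else -1)
  else (rnorm (profileNormal p))⁻¹ • profileNormal p

theorem normalize_smul {a : ℝ} (ha : 0 < a) (v : FrameVec n) :
    (rnorm (a • v))⁻¹ • (a • v) = (rnorm v)⁻¹ • v := by
  rw [rnorm_smul ha.le, smul_smul, mul_inv, mul_right_comm, inv_mul_cancel₀ ha.ne', one_mul]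

theorem isDefiningOn_pole {e : ℝ} (he : e = 1 ∨ e = -1) :
    IsDefiningOn (profile n) profileUnit (fun p => e * p.2 - profileFun ‖p.1‖)
      {p | ‖p.1‖ < 1 ∧ 0 < e * p.2} := by
  have hee : e * e = 1 := by rcases he with rfl | rfl <;> norm_num
  have hrg : ∀ p : Heis n, ‖p.1‖ < 1 → rgrad (fun p => e * p.2 - profileFun ‖p.1‖) p =
      ((2 * Real.sqrt (1 - ‖p.1‖ ^ 2))⁻¹ • ‖p.1‖ • p.1 + (e / 2) • perp p.1, e) := by
    intro p hp
    refine rgrad_eq_of_metric fun v => ?_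
    have h1 : HasFDerivAt (fun p : Heis n => e * p.2) (e • sndH) p :=
      hasFDerivAt_snd.const_mul e
    have h2 := h1.sub ((hasFDerivAt_profileFun_norm hp).comp p hasFDerivAt_fst)
    have h4 : fderiv ℝ (fun p : Heis n => e * p.2 - profileFun ‖p.1‖) p = _ := h2.fderiv
    rw [fd_apply, h4, toCoord_eq]
    simp [metric, inner_add_left, inner_smul_left, symp_eq_inner]
    ring
  have key : ∀ p ∈ profile n ∩ {p | ‖p.1‖ < 1 ∧ 0 < e * p.2},
      rgrad (fun p => e * p.2 - profileFun ‖p.1‖) p ≠ 0 ∧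
      profileUnit p = (rnorm (rgrad (fun p => e * p.2 - profileFun ‖p.1‖) p))⁻¹ •
        rgrad (fun p => e * p.2 - profileFun ‖p.1‖) p := by
    rintro p ⟨hpS, hp1, hpe⟩
    rw [hrg p hp1]
    refine ⟨fun h => ?_, ?_⟩
    · have := congrArg Prod.snd h
      change e = 0 at this
      rw [this] at hee; norm_num at hee
    by_cases h0 : p.1 = 0
    · rw [profileUnit, if_pos h0, h0]
      have hif : (if 0 < p.2 then 1 else -1 : ℝ) = e := by
        rcases he with rfl | rfl
        · rw [if_pos (by linarith)]
        · rw [if_neg (by linarith)]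
      rw [hif, smul_zero, smul_zero, perp_zero, smul_zero, add_zero]
      simp [rnorm, metric, hee]
    · rw [profileUnit, if_neg h0]
      obtain ⟨⟨c, hc⟩, h2⟩ := (mem_profile_iff h0).1 hpS
      have hr : 0 < ‖p.1‖ := norm_pos_iff.2 h0
      have hc' : timeCot p.2 = c := by rw [← hc, timeCot_cotTime]
      rw [hc'] at h2
      have hec : 0 < e * c := by
        rw [← hc] at hpe
        rcases he with rfl | rfl
        · rw [one_mul, ← cotTime_zero] at hpe
          simpa using strictMono_cotTime.lt_iff_lt.1 hpe
        · have h3 : cotTime c < cotTime 0 := by rw [cotTime_zero]; linarith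
          linarith [strictMono_cotTime.lt_iff_lt.1 h3]
      have hsq : Real.sqrt (1 - ‖p.1‖ ^ 2) = e * c * ‖p.1‖ := by
        rw [← Real.sqrt_sq (by positivity : 0 ≤ e * c * ‖p.1‖)]
        congr 1
        linear_combination -h2 - c ^ 2 * ‖p.1‖ ^ 2 * hee
      have h5 : profileNormal p = (2 * (e * c)) • ((2 * Real.sqrt (1 - ‖p.1‖ ^ 2))⁻¹ • ‖p.1‖ • p.1 +
          (e / 2) • perp p.1, e) := by
        rw [profileNormal, hc', hsq]
        refine Prod.ext ?_ ?_
        · simp only [Prod.smul_mk, smul_add, smul_smul]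
          congr 1
          · rw [show 2 * (e * c) * ((2 * (e * c * ‖p.1‖))⁻¹ * ‖p.1‖) = 1 by
              obtain ⟨a, ha⟩ : ∃ a, a = e * c := ⟨_, rfl⟩
              rw [← ha] at hec ⊢
              field_simp, one_smul]
          · rw [show 2 * (e * c) * (e / 2) = c by linear_combination c * hee]
        · change 2 * c = 2 * (e * c) * e
          linear_combination (-2 * c) * hee
      rw [h5, normalize_smul (by linarith)]
  refine ⟨?_, ?_, ?_, fun p hp => (key p hp).1, fun p hp => (key p hp).2⟩
  · exact (isOpen_lt continuous_fst.norm continuous_const).inter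
      (isOpen_lt continuous_const (continuous_const.mul continuous_snd))
  · exact (contDiff_const.mul contDiff_snd).contDiffOn.sub
      (contDiffOn_profileFun_norm.comp contDiff_fst.contDiffOn fun p hp => by simpa using hp.1)
  · ext p
    refine ⟨fun h => ⟨h.2, ?_⟩, fun h => ⟨⟨h.1.1.le, ?_⟩, h.1⟩⟩
    · have h3 := profileFun_pos (norm_nonneg p.1) h.2.1
      have h4 := h.2.2
      rcases h.1.2 with h5 | h5 <;> rcases he with rfl | rfl <;> rw [h5] at h4 ⊢ <;>
        first | (exfalso; linarith) | rw [one_mul, sub_self] | (ring_nf; done)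
    · have h2 : e * p.2 - profileFun ‖p.1‖ = 0 := h.2
      rcases he with rfl | rfl
      · exact Or.inl (by linarith)
      · exact Or.inr (by linarith)

theorem isOrientedHypersurface_profile : IsOrientedHypersurface (profile n) profileUnit := by
  refine isOrientedHypersurface_iff.2 fun p hp => ?_
  by_cases h0 : p.1 = 0
  · have h1 : profileFun ‖p.1‖ = Real.pi / 8 := by rw [h0, norm_zero, profileFun_zero]
    have hpi := Real.pi_pos
    rcases hp.2 with h | h
    · exact ⟨{p | ‖p.1‖ < 1 ∧ 0 < (1 : ℝ) * p.2}, _, ⟨by simp [h0], by rw [h, h1]; linarith⟩,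
        isDefiningOn_pole (Or.inl rfl)⟩
    · exact ⟨{p | ‖p.1‖ < 1 ∧ 0 < (-1 : ℝ) * p.2}, _, ⟨by simp [h0], by rw [h, h1]; linarith⟩,
        isDefiningOn_pole (Or.inr rfl)⟩
  · exact ⟨profileDom n, _, ⟨h0, ((mem_profile_iff h0).1 hp).1⟩, (isDefiningOn_profileDef (Or.inl rfl)
      fun q hq => by rw [profileUnit, if_neg hq.2.1, one_smul]).1⟩

/-! ## Orientations of the profile -/

theorem IsOrientedHypersurface.normal_eq_or_eq_neg {S : Set (Heis n)} {ν ν' : Heis n → FrameVec n}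
    (hS : IsOrientedHypersurface S ν) (hS' : IsOrientedHypersurface S ν') {p : Heis n}
    (hp : p ∈ S) : ν' p = ν p ∨ ν' p = -ν p := by
  obtain ⟨U, f, hpU, hd⟩ := isOrientedHypersurface_iff.1 hS' p hp
  have h1 := hS.metric_normal hp
  have h1' := hS'.metric_normal hp
  have key : ∀ v, metric (ν p) v = 0 → metric (ν' p) v = 0 := by
    intro v hv
    have h2 : f =ᶠ[𝓝[S] p] fun _ => (0 : ℝ) := by
      filter_upwards [self_mem_nhdsWithin, mem_nhdsWithin_of_mem_nhds (hd.isOpen.mem_nhds hpU)]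
        with q hq hqU using hd.eq_zero hq hqU
    have h3 := hS.fd_eq_of_eqOn hp hv ((hd.contDiffOn.contDiffAt
      (hd.isOpen.mem_nhds hpU)).differentiableAt (by norm_num)) (differentiableAt_const _) h2
    rw [hd.fd_eq hp hpU] at h3
    have h4 : fd (fun _ : Heis n => (0 : ℝ)) p v = 0 := by simp [fd]
    rw [h4] at h3
    exact (mul_eq_zero.1 h3).resolve_left (rnorm_pos (hd.rgrad_ne p ⟨hp, hpU⟩)).ne'
  obtain ⟨a, ha⟩ : ∃ a, a = metric (ν p) (ν' p) := ⟨_, rfl⟩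
  have h5 : metric (ν p) (ν' p - a • ν p) = 0 := by
    rw [sub_eq_add_neg, ← neg_smul, metric_add_right, metric_smul_right, h1, ← ha]; ring
  have h6 : ν' p - a • ν p = 0 := by
    rw [← metric_self_eq_zero, metric_sub_left, metric_smul_left, h5, key _ h5]; ring
  have h7 : ν' p = a • ν p := sub_eq_zero.1 h6
  have h8 : a * a = 1 := by
    rw [h7, metric_smul_left, metric_smul_right, h1] at h1'; linarith
  rcases mul_self_eq_one_iff.1 h8 with rfl | rfl
  · exact Or.inl (by rw [h7, one_smul])
  · exact Or.inr (by rw [h7, neg_one_smul])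

theorem isPreconnected_profile_inter (hn : 1 ≤ n) :
    IsPreconnected (profile n ∩ profileDom n) := by
  have hrank : 1 < Module.rank ℝ (Hor n) := by
    rw [← Module.finrank_eq_rank, finrank_euclideanSpace]
    simp only [Fintype.card_prod, Fintype.card_fin]
    exact_mod_cast (by omega : 1 < n * 2)
  have h1 : IsPreconnected (Metric.sphere (0 : Hor n) 1 ×ˢ (univ : Set ℝ)) :=
    (isPreconnected_sphere hrank 0 1).prod isPreconnected_univ
  have hpos : ∀ x : ℝ, 0 < 1 + x ^ 2 := fun x => by positivity
  have h2 : Continuous fun y : Hor n × ℝ =>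
      (((Real.sqrt (1 + y.2 ^ 2))⁻¹ • y.1, cotTime y.2) : Heis n) :=
    (((continuous_const.add (continuous_snd.pow 2)).sqrt.inv₀ fun y =>
      (Real.sqrt_pos.2 (hpos y.2)).ne').smul continuous_fst).prodMk
      ((contDiff_cotTime (k := 0)).continuous.comp continuous_snd)
  convert h1.image _ h2.continuousOn using 1
  ext p
  constructor
  · rintro ⟨hp, h0, -⟩
    obtain ⟨⟨c, hc⟩, h3⟩ := (mem_profile_iff h0).1 hp
    rw [← hc, timeCot_cotTime] at h3
    have h4 := Real.sqrt_pos.2 (hpos c)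
    refine ⟨(Real.sqrt (1 + c ^ 2) • p.1, c), ⟨?_, mem_univ _⟩, Prod.ext ?_ hc⟩
    · rw [mem_sphere_zero_iff_norm, norm_smul, Real.norm_eq_abs, abs_of_pos h4,
        ← pow_eq_one_iff_of_nonneg (mul_nonneg h4.le (norm_nonneg p.1)) two_ne_zero, mul_pow,
        Real.sq_sqrt (hpos c).le, mul_comm, h3]
    · exact inv_smul_smul₀ h4.ne' _
  · rintro ⟨⟨ζ, c⟩, ⟨hζ, -⟩, rfl⟩
    have h4 := Real.sqrt_pos.2 (hpos c)
    rw [mem_sphere_zero_iff_norm] at hζ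
    have h0 : (Real.sqrt (1 + c ^ 2))⁻¹ • ζ ≠ 0 :=
      smul_ne_zero (inv_ne_zero h4.ne') (norm_ne_zero_iff.1 (by rw [hζ]; norm_num))
    refine ⟨(mem_profile_iff h0).2 ⟨⟨c, rfl⟩, ?_⟩, h0, ⟨c, rfl⟩⟩
    change ‖(Real.sqrt (1 + c ^ 2))⁻¹ • ζ‖ ^ 2 * (1 + timeCot (cotTime c) ^ 2) = 1
    rw [timeCot_cotTime, norm_smul, hζ, mul_one, norm_inv, inv_pow, Real.norm_eq_abs, sq_abs,
      Real.sq_sqrt (hpos c).le, inv_mul_cancel₀ (hpos c).ne']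

theorem IsOrientedHypersurface.exists_sign_profile (hn : 1 ≤ n) {ν : Heis n → FrameVec n}
    (hS : IsOrientedHypersurface (profile n) ν) : ∃ e : ℝ, (e = 1 ∨ e = -1) ∧
    ∀ p ∈ profile n ∩ profileDom n, ν p = e • (rnorm (profileNormal p))⁻¹ • profileNormal p := by
  have hS' := isOrientedHypersurface_profile (n := n)
  have hc : ContinuousOn (fun p => metric (ν p) (profileUnit p)) (profile n ∩ profileDom n) := by
    have : ContinuousOn (fun p => metricL (ν p) (profileUnit p)) (profile n) :=
      (metricL.continuous.comp_continuousOn hS.continuousOn_normal).clm_apply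
        hS'.continuousOn_normal
    exact (this.mono inter_subset_left).congr fun p _ => (metricL_apply _ _).symm
  have h1 : ∀ p ∈ profile n ∩ profileDom n,
      ν p = metric (ν p) (profileUnit p) • (rnorm (profileNormal p))⁻¹ • profileNormal p ∧
      metric (ν p) (profileUnit p) ^ 2 = 1 := by
    intro p hp
    have h2 : profileUnit p = (rnorm (profileNormal p))⁻¹ • profileNormal p := by
      rw [profileUnit, if_neg hp.2.1]
    have h3 := hS'.metric_normal hp.1
    rw [← h2]
    rcases hS'.normal_eq_or_eq_neg hS hp.1 with h | h
    · rw [h, h3]; simp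
    · rw [h, ← neg_one_smul ℝ (profileUnit p), metric_smul_left, h3]; simp
  rcases (isPreconnected_profile_inter hn).eq_one_or_eq_neg_one_of_sq_eq hc
    (fun p hp => (h1 p hp).2) with h | h
  · refine ⟨1, Or.inl rfl, fun p hp => ?_⟩
    have := (h1 p hp).1
    rwa [show metric (ν p) (profileUnit p) = 1 from h hp] at this
  · refine ⟨-1, Or.inr rfl, fun p hp => ?_⟩
    have := (h1 p hp).1
    rwa [show metric (ν p) (profileUnit p) = -1 from h hp] at this

theorem fst_ne_zero_of_mem_profile {p : Heis n} (hp : p ∈ profile n) (h : p.2 ∈ range cotTime) :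
    p.1 ≠ 0 := by
  obtain ⟨c, hc⟩ := h
  intro h0
  have h1 := abs_cotTime_lt c
  rw [hc] at h1
  have h2 := hp.2
  rw [h0, norm_zero, profileFun_zero] at h2
  rcases h2 with h2 | h2 <;> rw [h2] at h1
  · exact absurd h1 (le_abs_self _).not_gt
  · exact absurd h1 (by rw [abs_neg]; exact (le_abs_self _).not_gt)

theorem IsOrientedHypersurface.mem_profileDom {ν : Heis n → FrameVec n}
    (hS : IsOrientedHypersurface (profile n) ν) {p : Heis n} (hp : p ∈ profile n)
    (h : (ν p).1 ≠ 0) : p ∈ profileDom n := by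
  have h0 : p.1 ≠ 0 := by
    intro h0
    apply h
    have h1 : (profileUnit p).1 = 0 := by rw [profileUnit, if_pos h0]
    rcases isOrientedHypersurface_profile.normal_eq_or_eq_neg hS hp with h2 | h2 <;> rw [h2]
    · exact h1
    · rw [Prod.fst_neg, h1, neg_zero]
  exact ⟨h0, ((mem_profile_iff h0).1 hp).1⟩

theorem isCompact_profile : IsCompact (profile n) := by
  have hu : Continuous fun z : Hor n => profileFun ‖z‖ := continuous_profileFun.comp continuous_norm
  have h1 := (isCompact_closedBall (0 : Hor n) 1).image (continuous_id.prodMk hu)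
  have h2 := (isCompact_closedBall (0 : Hor n) 1).image (continuous_id.prodMk hu.neg)
  convert h1.union h2 using 1
  ext ⟨z, t⟩
  simp only [profile, mem_ofPred_eq, mem_union, mem_image, mem_closedBall_zero_iff, id, Prod.mk.injEq]
  constructor
  · rintro ⟨h, h' | h'⟩
    · exact Or.inl ⟨z, h, rfl, h'.symm⟩
    · exact Or.inr ⟨z, h, rfl, h'.symm⟩
  · rintro (⟨_, h, rfl, h'⟩ | ⟨_, h, rfl, h'⟩)
    · exact ⟨h, Or.inl h'.symm⟩
    · exact ⟨h, Or.inr h'.symm⟩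

/-! ## The geometry of the profile -/

theorem fd_timeCot_snd {p : Heis n} (hp : p ∈ profileDom n) (v : Hor n) :
    fd (fun q : Heis n => timeCot q.2) p (v, 0) =
      (1 + timeCot p.2 ^ 2) ^ 2 * inner ℝ (perp p.1) v := by
  rw [fd_apply, (hasFDerivAt_timeCot_snd hp).fderiv, toCoord_eq]
  simp [symp_eq_inner]
  ring

theorem norm_profileNormal_fst {p : Heis n} (h : ‖p.1‖ ^ 2 * (1 + timeCot p.2 ^ 2) = 1) :
    ‖(profileNormal p).1‖ = 1 := by
  rw [← pow_eq_one_iff_of_nonneg (norm_nonneg _) two_ne_zero, profileNormal, norm_add_sq_real,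
    norm_smul, inner_smul_right, inner_self_perp, mul_pow, Real.norm_eq_abs, sq_abs,
    ← real_inner_self_eq_norm_sq (perp p.1), inner_perp_perp, real_inner_self_eq_norm_sq]
  linear_combination h

theorem inner_perp_profileNormal (p : Heis n) :
    inner ℝ (perp p.1) (profileNormal p).1 = timeCot p.2 * ‖p.1‖ ^ 2 := by
  rw [profileNormal, inner_add_right, inner_smul_right, inner_perp_perp, inner_perp_self,
    real_inner_self_eq_norm_sq, zero_add]

section profile

variable {ν : Heis n → FrameVec n} {e : ℝ} {p : Heis n}
  (hS : IsOrientedHypersurface (profile n) ν) (he : e = 1 ∨ e = -1)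
  (hν : ∀ p ∈ profile n ∩ profileDom n, ν p = e • (rnorm (profileNormal p))⁻¹ • profileNormal p)

include he hν

theorem unitH_profile (hp : p ∈ profile n) (hV : p ∈ profileDom n) :
    unitH (fun p => e * profileDef p) p = e • (profileNormal p).1 ∧
      slope (fun p => e * profileDef p) p = e * (2 * timeCot p.2) := by
  have h1 := (isDefiningOn_profileDef he hν).2.2 p hV
  have h2 : ‖e • (profileNormal p).1‖ = 1 := by
    rw [norm_smul, norm_profileNormal_fst ((mem_profile_iff hV.1).1 hp).2, mul_one]
    rcases he with rfl | rfl <;> norm_num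
  rw [unitH, slope, hgrad, vder, h1, Prod.smul_fst, Prod.smul_snd, h2, inv_one, one_smul, div_one]
  exact ⟨rfl, rfl⟩

theorem varpi_profile (hp : p ∈ profile n) (hV : p ∈ profileDom n) :
    varpi ν p = e * (2 * timeCot p.2) := by
  rw [(isDefiningOn_profileDef he hν).1.varpi_eq hp hV, (unitH_profile he hν hp hV).2]

include hS

theorem norm_gradHS_profile (hp : p ∈ profile n) (hV : p ∈ profileDom n) :
    ‖gradHS (profile n) ν (varpi ν) p‖ ^ 2 = ((2 * timeCot p.2) ^ 2 + 4) ^ 2 / 4 := by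
  obtain ⟨hd, hr, -⟩ := isDefiningOn_profileDef he hν
  obtain ⟨hu, -⟩ := unitH_profile he hν hp hV
  have h1 := ((mem_profile_iff hV.1).1 hp).2
  have hN := norm_profileNormal_fst h1
  have hz := inner_perp_profileNormal p
  have hee : e * e = 1 := by rcases he with rfl | rfl <;> norm_num
  set c := timeCot p.2 with hc
  set q := (profileNormal p).1 with hq
  have h2 : gradHS (profile n) ν (varpi ν) p =
      (2 * e * (1 + c ^ 2) ^ 2) • (perp p.1 - (c * ‖p.1‖ ^ 2) • q) := by
    refine ext_inner_right ℝ fun v => ?_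
    rw [gradHS, InnerProductSpace.toDual_symm_apply]
    simp only [ContinuousLinearMap.comp_apply, ContinuousLinearMap.inl_apply,
      starProjection_HS (hd.normal_fst_ne hr hp hV) ((hd.nuH_eq hp hV).trans hu)]
    have hv : inner ℝ (unitH (fun p => e * profileDef p) p)
        (v - inner ℝ (e • q) v • (e • q)) = 0 := by
      rw [hu, inner_sub_right, inner_smul_right, inner_smul_left, inner_smul_left,
        inner_smul_right, real_inner_self_eq_norm_sq, hN]
      simp only [conj_trivial]
      linear_combination (-e * inner ℝ q v) * hee
    have h3 : varpi ν =ᶠ[𝓝[profile n] p] fun q => (2 * e) • timeCot q.2 := by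
      filter_upwards [self_mem_nhdsWithin,
        mem_nhdsWithin_of_mem_nhds (isOpen_profileDom.mem_nhds hV)] with x hx hxV
      rw [varpi_profile he hν hx hxV, smul_eq_mul]; ring
    have h4 := (hasFDerivAt_timeCot_snd hV).const_smul (2 * e)
    refine (hS.fderivWithin_self_eq hp (hd.metric_normal_hor_eq_zero hp hV hv)
      h4.differentiableAt h3).trans ?_
    have h5 : ∀ v, fd ((2 * e) • fun q : Heis n => timeCot q.2) p (v, 0) =
        (2 * e) * fd (fun q : Heis n => timeCot q.2) p (v, 0) := fun v => by
      rw [fd_apply, h4.fderiv, fd_apply, (hasFDerivAt_timeCot_snd hV).fderiv]; rfl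
    rw [h5, fd_timeCot_snd hV, ← hc, inner_sub_right, inner_smul_right, inner_smul_right, hz,
      inner_smul_left, inner_smul_left, inner_sub_left, inner_smul_left]
    simp only [conj_trivial]
    linear_combination (-2 * e * (1 + c ^ 2) ^ 2 * c * ‖p.1‖ ^ 2 * inner ℝ q v) * hee
  have h3 : ‖perp p.1 - (c * ‖p.1‖ ^ 2) • q‖ ^ 2 = (‖p.1‖ ^ 2) ^ 2 := by
    rw [norm_sub_sq_real, norm_smul, hN, inner_smul_right, hz, ← real_inner_self_eq_norm_sq (perp p.1),
      inner_perp_perp, real_inner_self_eq_norm_sq, mul_one, Real.norm_eq_abs, sq_abs]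
    linear_combination (-‖p.1‖ ^ 2) * h1
  rw [h2, norm_smul, mul_pow, h3, Real.norm_eq_abs, sq_abs]
  linear_combination 4 * (1 + c ^ 2) ^ 4 * (‖p.1‖ ^ 2) ^ 2 * hee +
    4 * (1 + c ^ 2) ^ 2 * (‖p.1‖ ^ 2 * (1 + c ^ 2) + 1) * h1

theorem normSqSymm_profile (hp : p ∈ profile n) (hV : p ∈ profileDom n) :
    normSqSymm (profile n) ν p = 2 * n + 2 := by
  obtain ⟨hd, hr, -⟩ := isDefiningOn_profileDef he hν
  obtain ⟨hu, -⟩ := unitH_profile he hν hp hV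
  have h1 := ((mem_profile_iff hV.1).1 hp).2
  have hN := norm_profileNormal_fst h1
  have hz := inner_perp_profileNormal p
  have hee : e * e = 1 := by rcases he with rfl | rfl <;> norm_num
  have hb := hd.inner_basis_HS hr hp hV
  have h0 := hd.normal_fst_ne hr hp hV
  have hnu := (hd.nuH_eq hp hV).trans hu
  obtain ⟨b, hbdef⟩ : ∃ b, b = fun i => (stdOrthonormalBasis ℝ (HS ν p) i : Hor n) := ⟨_, rfl⟩
  set c := timeCot p.2 with hc
  have hshape : ∀ v, inner ℝ (unitH (fun p => e * profileDef p) p) v = 0 →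
      shape (fun p => e * profileDef p) p v =
        e • (v + (c • perp v + ((1 + c ^ 2) ^ 2 * inner ℝ (perp p.1) v) • perp p.1)) := by
    intro v hv
    have h3 : unitH (fun p => e * profileDef p) =ᶠ[𝓝[profile n] p]
        fun q => e • (q.1 + timeCot q.2 • perp q.1) := by
      filter_upwards [self_mem_nhdsWithin,
        mem_nhdsWithin_of_mem_nhds (isOpen_profileDom.mem_nhds hV)] with x hx hxV
      exact (unitH_profile he hν hx hxV).1
    have h4 : HasFDerivAt (fun q : Heis n => e • (q.1 + timeCot q.2 • perp q.1)) _ p :=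
      (hasFDerivAt_fst.add ((hasFDerivAt_timeCot_snd hV).smul
        (perpL.comp (fstH)).hasFDerivAt)).const_smul e
    refine (hS.fd_eq_of_eqOn hp (hd.metric_normal_hor_eq_zero hp hV hv)
      (hr.differentiableAt_unitH hV) h4.differentiableAt h3).trans ?_
    have h5 : fd (fun q : Heis n => e • (q.1 + timeCot q.2 • perp q.1)) p (v, 0) =
        e • (v + (c • perp v + fd (fun q : Heis n => timeCot q.2) p (v, 0) • perp p.1)) := by
      rw [fd_apply, h4.fderiv, fd_apply, (hasFDerivAt_timeCot_snd hV).fderiv]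
      simp [toCoord_eq, hc]
    rw [h5, fd_timeCot_snd hV]
  have hent : ∀ i j, ((secondForm (profile n) ν p (b i) (b j) +
      secondForm (profile n) ν p (b j) (b i)) / 2) ^ 2 =
      inner ℝ (b i) (b j) * inner ℝ (b i) (b j) + 2 * (1 + c ^ 2) ^ 2 * (inner ℝ (perp p.1) (b i) *
        (inner ℝ (b i) (b j) * inner ℝ (perp p.1) (b j))) + (1 + c ^ 2) ^ 4 *
        ((inner ℝ (perp p.1) (b i) * inner ℝ (perp p.1) (b i)) *
          (inner ℝ (perp p.1) (b j) * inner ℝ (perp p.1) (b j))) := by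
    intro i j
    have hi : inner ℝ (unitH (fun p => e * profileDef p) p) (b i) = 0 := by rw [hbdef]; exact hb i
    have hj : inner ℝ (unitH (fun p => e * profileDef p) p) (b j) = 0 := by rw [hbdef]; exact hb j
    rw [hd.secondForm_eq hr hS hp hV hi, hd.secondForm_eq hr hS hp hV hj, hshape _ hi, hshape _ hj]
    simp only [inner_smul_left, inner_add_left, conj_trivial]
    rw [inner_perp_left (b j) (b i), real_inner_comm (b i) (b j), real_inner_comm (perp (b i)) (b j)]
    linear_combination (inner ℝ (b i) (b j) + (1 + c ^ 2) ^ 2 * inner ℝ (perp p.1) (b i) *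
      inner ℝ (perp p.1) (b j)) ^ 2 * hee
  have hs1 : ∀ u v : Hor n, ∑ i, inner ℝ u (b i) * inner ℝ v (b i) = inner ℝ u v -
      inner ℝ (e • (profileNormal p).1) u * inner ℝ (e • (profileNormal p).1) v := by
    intro u v
    rw [hbdef]; exact sum_inner_mul_inner_HS h0 hnu u v
  have hq : ∀ i, inner ℝ (e • (profileNormal p).1) (b i) = 0 := by
    intro i
    rw [← hu, hbdef]; exact hb i
  have hs2 : ∑ i, inner ℝ (b i) (b i) = 2 * n - 1 := by
    have h := sum_inner_HS h0 hnu (ContinuousLinearMap.id ℝ (Hor n))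
    rw [horTrace_id, ContinuousLinearMap.id_apply, ← hu, real_inner_self_eq_norm_sq, hr.norm_unitH hV] at h
    rw [hbdef]
    simpa using h
  have hβ : inner ℝ (perp p.1) (perp p.1) - inner ℝ (e • (profileNormal p).1) (perp p.1) *
      inner ℝ (e • (profileNormal p).1) (perp p.1) = (‖p.1‖ ^ 2) ^ 2 := by
    rw [inner_perp_perp, inner_smul_left, real_inner_comm (perp p.1), hz, real_inner_self_eq_norm_sq]
    simp only [conj_trivial]
    linear_combination (-(c * ‖p.1‖ ^ 2) ^ 2) * hee - ‖p.1‖ ^ 2 * h1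
  have hcomm : ∀ i, inner ℝ (b i) (perp p.1) = inner ℝ (perp p.1) (b i) := fun i =>
    real_inner_comm _ _
  have hsum : normSqSymm (profile n) ν p = ∑ i, ∑ j, ((secondForm (profile n) ν p (b i) (b j) +
      secondForm (profile n) ν p (b j) (b i)) / 2) ^ 2 := by rw [hbdef]; rfl
  rw [hsum]
  simp only [hent, Finset.sum_add_distrib, ← Finset.mul_sum, hs1, hq, zero_mul, sub_zero, hβ, hs2,
    ← Finset.sum_mul, hcomm]
  linear_combination ((1 + c ^ 2) ^ 2 * (‖p.1‖ ^ 2) ^ 2 + 3) * (‖p.1‖ ^ 2 * (1 + c ^ 2) + 1) * h1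

end profile

section profile

variable {ν : Heis n → FrameVec n} (hS : IsOrientedHypersurface (profile n) ν)
include hS

theorem ae_mem_profileDom :
    ∀ᵐ p ∂(sigmaH (profile n) ν), p ∈ profile n ∩ profileDom n := by
  have hSm := (isCompact_profile (n := n)).measurableSet
  rw [hS.sigmaH_eq hSm, ae_withDensity_iff' (hS.aemeasurable_norm_normal hSm)]
  filter_upwards [ae_mem_sigmaR hSm] with p hp h
  exact ⟨hp, hS.mem_profileDom hp fun h0 => h (by rw [h0]; simp)⟩

theorem aestronglyMeasurable_timeCot :
    AEStronglyMeasurable (fun p : Heis n => 2 * timeCot p.2) (sigmaH (profile n) ν) := by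
  rw [← Measure.restrict_eq_self_of_ae_mem (ae_mem_profileDom hS)]
  refine ContinuousOn.aestronglyMeasurable ?_
    ((isCompact_profile (n := n)).measurableSet.inter isOpen_profileDom.measurableSet)
  exact (continuousOn_const.mul contDiffOn_timeCot_snd.continuousOn).mono inter_subset_right

/-- Integration by parts along the profile. -/
theorem integral_deriv_timeCot (hn : 1 ≤ n) {F : ℝ → ℝ} (hF : ContDiff ℝ 1 F)
    (hFc : HasCompactSupport F) :
    ∫ p : Heis n, (deriv F (2 * timeCot p.2) * ((2 * timeCot p.2) ^ 2 + 4) / 2 -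
      n * (2 * timeCot p.2) * F (2 * timeCot p.2)) ∂(sigmaH (profile n) ν) = 0 := by
  have hSc := isCompact_profile (n := n)
  obtain ⟨e, he, hν⟩ := hS.exists_sign_profile hn
  obtain ⟨hd, hr, -⟩ := isDefiningOn_profileDef he hν
  have he0 : e ≠ 0 := by rcases he with rfl | rfl <;> norm_num
  obtain ⟨R, hR⟩ := hFc.isCompact.isBounded.subset_closedBall 0
  have hw : ContDiffOn ℝ 1 (fun p : Heis n => 2 * timeCot p.2) (profileDom n) :=
    contDiffOn_const.mul (contDiffOn_timeCot_snd.of_le (by norm_num))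
  obtain ⟨K, hKdef⟩ : ∃ K, K = profile n ∩ {p : Heis n | p.2 ∈ cotTime '' Icc (-R) R} := ⟨_, rfl⟩
  have hK : IsCompact K := hKdef ▸
    hSc.inter_right ((isCompact_Icc.image (contDiff_cotTime (k := 0)).continuous).isClosed.preimage
      continuous_snd)
  have hKV : K ⊆ profileDom n := hKdef ▸ fun p hp =>
    ⟨fst_ne_zero_of_mem_profile hp.1 (image_subset_range _ _ hp.2),
      image_subset_range _ _ hp.2⟩
  have hout : ∀ p ∈ profile n ∩ profileDom n,
      p ∉ K →
      F =ᶠ[𝓝 (2 * timeCot p.2)] fun _ => 0 := by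
    intro p hp hpK
    refine notMem_tsupport_iff_eventuallyEq.1 ?_
    intro h
    have h1 := hR h
    rw [mem_closedBall_zero_iff, Real.norm_eq_abs, abs_le] at h1
    refine hpK (hKdef ▸ ⟨hp.1, timeCot p.2, ?_, cotTime_timeCot hp.2.2⟩)
    rcases le_total 0 (timeCot p.2) with h2 | h2
    · exact ⟨by linarith, by linarith⟩
    · exact ⟨by linarith, by linarith⟩
  have h := hd.setIntegral_perp hr hS hSc (F := fun p => F (2 * timeCot p.2))
    (hF.comp_contDiffOn hw) hK hKV fun p hp hpK =>
      ((hw.continuousOn.continuousAt (isOpen_profileDom.mem_nhds hp.2)).eventually (hout p hp hpK))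
  rw [setIntegral_eq_integral_of_ae_compl_eq_zero] at h
  · rw [hS.integral_sigmaH hSc.measurableSet]
    refine (mul_eq_zero.1 (?_ : e * _ = 0)).resolve_left he0
    rw [← integral_const_mul, ← h]
    refine integral_congr_ae ?_
    filter_upwards [ae_mem_sigmaR hSc.measurableSet] with p hp
    by_cases hp0 : (ν p).1 = 0
    · rw [hp0, norm_zero]; ring
    have hV := hS.mem_profileDom hp hp0
    obtain ⟨hu, hs⟩ := unitH_profile he hν hp hV
    have h1 := ((mem_profile_iff hV.1).1 hp).2
    have hψ : DifferentiableAt ℝ (fun q : Heis n => timeCot q.2) p :=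
      (hasFDerivAt_timeCot_snd hV).differentiableAt
    have h3 : inner ℝ (perp p.1) (perp (profileNormal p).1) = ‖p.1‖ ^ 2 := by
      rw [inner_perp_perp, profileNormal, inner_add_right, inner_smul_right, inner_self_perp,
        real_inner_self_eq_norm_sq]
      ring
    have h4 : fd (fun q : Heis n => 2 * timeCot q.2) p (perp (e • (profileNormal p).1), 0) =
        e * (2 * (1 + timeCot p.2 ^ 2)) := by
      rw [fd_apply, fderiv_const_mul hψ, smul_apply, ← fd_apply, fd_timeCot_snd hV, perp_smul,
        inner_smul_right, h3, smul_eq_mul]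
      linear_combination (2 * e * (1 + timeCot p.2 ^ 2)) * h1
    rw [hu, hs, fd_comp_real (hF.differentiable (by norm_num)).differentiableAt
      (hψ.const_mul 2), h4]
    ring
  · filter_upwards [ae_mem_sigmaR hSc.measurableSet] with p hp hpK
    by_cases hp0 : (ν p).1 = 0
    · rw [hp0, norm_zero, zero_mul]
    have hV := hS.mem_profileDom hp hp0
    have h2 := hout p ⟨hp, hV⟩ hpK
    have h3 : (fun q : Heis n => F (2 * timeCot q.2)) =ᶠ[𝓝 p] fun _ => 0 :=
      (hw.continuousOn.continuousAt (isOpen_profileDom.mem_nhds hV)).eventually h2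
    rw [fd_congr h3, h2.self_of_nhds]
    simp [fd]

/-- For the isoperimetric profile the stability inequality is an equality. -/
theorem integral_profile (hn : 2 ≤ n) :
    Integrable (fun p => ‖gradHS (profile n) ν (varpi ν) p‖ ^ 2) (sigmaH (profile n) ν) ∧
    Integrable (fun p => varpi ν p ^ 2 * (normSqSymm (profile n) ν p +
      (3 - (n : ℝ)) / 6 * varpi ν p ^ 2)) (sigmaH (profile n) ν) ∧
    ∫ p, ‖gradHS (profile n) ν (varpi ν) p‖ ^ 2 ∂(sigmaH (profile n) ν) =
      ∫ p, varpi ν p ^ 2 * (normSqSymm (profile n) ν p + (3 - (n : ℝ)) / 6 * varpi ν p ^ 2)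
        ∂(sigmaH (profile n) ν) := by
  have hSc := isCompact_profile (n := n)
  have hn1 : 1 ≤ n := by omega
  obtain ⟨e, he, hν⟩ := hS.exists_sign_profile hn1
  have hee : e ^ 2 = 1 := by rcases he with rfl | rfl <;> norm_num
  have hfin : IsFiniteMeasure (sigmaH (profile n) ν) := by
    have h := hS.integrable_sigmaH_of_continuousOn hSc (g := fun _ => (1 : ℝ)) continuousOn_const
    exact (integrable_const_iff.1 h).resolve_left one_ne_zero
  have hwm := aestronglyMeasurable_timeCot hS
  obtain ⟨w, hwdef⟩ : ∃ w, w = fun p : Heis n => 2 * timeCot p.2 := ⟨_, rfl⟩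
  obtain ⟨h4, h0⟩ := integrable_pow_four_of_integral_eq_zero (μ := sigmaH (profile n) ν)
    (w := w) (N := n) (by exact_mod_cast hn) (by rw [hwdef]; exact hwm)
    fun F hF hFc => by rw [hwdef]; exact integral_deriv_timeCot hS hn1 hF hFc
  have h2 : Integrable (fun p => w p ^ 2) (sigmaH (profile n) ν) := by
    refine ((integrable_const (1 : ℝ)).add h4).mono' ((hwdef ▸ hwm : AEStronglyMeasurable w _).pow 2)
      (Eventually.of_forall fun p => ?_)
    rw [Real.norm_eq_abs, abs_of_nonneg (sq_nonneg _)]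
    change w p ^ 2 ≤ 1 + w p ^ 4
    nlinarith [sq_nonneg (w p ^ 2 - 1)]
  have e1 : (fun p => ‖gradHS (profile n) ν (varpi ν) p‖ ^ 2) =ᵐ[sigmaH (profile n) ν]
      fun p => 4 + (2 * w p ^ 2 + 1 / 4 * w p ^ 4) := by
    filter_upwards [ae_mem_profileDom hS] with p hp
    rw [norm_gradHS_profile hS he hν hp.1 hp.2, hwdef]
    ring
  have e2 : (fun p => varpi ν p ^ 2 * (normSqSymm (profile n) ν p +
      (3 - (n : ℝ)) / 6 * varpi ν p ^ 2)) =ᵐ[sigmaH (profile n) ν]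
      fun p => (2 * n + 2) * w p ^ 2 + (3 - (n : ℝ)) / 6 * w p ^ 4 := by
    filter_upwards [ae_mem_profileDom hS] with p hp
    rw [normSqSymm_profile hS he hν hp.1 hp.2, varpi_profile he hν hp.1 hp.2, hwdef, mul_pow, hee]
    ring
  have i1 : Integrable (fun p => 4 + (2 * w p ^ 2 + 1 / 4 * w p ^ 4)) (sigmaH (profile n) ν) :=
    (integrable_const _).add ((h2.const_mul _).add (h4.const_mul _))
  have i2 : Integrable (fun p => (2 * n + 2) * w p ^ 2 + (3 - (n : ℝ)) / 6 * w p ^ 4)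
      (sigmaH (profile n) ν) := (h2.const_mul _).add (h4.const_mul _)
  refine ⟨i1.congr e1.symm, i2.congr e2.symm, ?_⟩
  rw [integral_congr_ae e1, integral_congr_ae e2, ← sub_eq_zero, ← integral_sub i1 i2, ← h0]
  refine integral_congr_ae (Eventually.of_forall fun p => ?_)
  ring

end profile

end Heisenberg

end

theorem mainTheorem9 (n : ℕ) :
    (1 ≤ n → ∀ (S : Set (Heisenberg.Heis n)) (ν : Heisenberg.Heis n → Heisenberg.FrameVec n),
      Heisenberg.IsOrientedHypersurface S ν → IsCompact S →
      Heisenberg.Admissible S ν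
        (fun p => Heisenberg.varpi ν p ^ 3 • Heisenberg.nuPerp ν p) →
      MeasureTheory.Integrable (fun p => 2 * Heisenberg.varpi ν p ^ 2 * Heisenberg.dVarpi S ν p -
        2 * (n : ℝ) / 3 * Heisenberg.varpi ν p ^ 4) (Heisenberg.sigmaH S ν) ∧
      ∫ p, (2 * Heisenberg.varpi ν p ^ 2 * Heisenberg.dVarpi S ν p -
        2 * (n : ℝ) / 3 * Heisenberg.varpi ν p ^ 4) ∂(Heisenberg.sigmaH S ν) = 0) ∧
    (2 ≤ n → ∀ (D : Set (Heisenberg.Heis n)) (ν : Heisenberg.Heis n → Heisenberg.FrameVec n),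
      Heisenberg.IsC2Domain D ν → Heisenberg.HasConstantMeanCurv (frontier D) ν →
      Heisenberg.Admissible (frontier D) ν
        (fun p => Heisenberg.varpi ν p ^ 3 • Heisenberg.nuPerp ν p) →
      ∀ ϑ : ℝ → Heisenberg.Heis n → Heisenberg.Heis n,
      Heisenberg.IsTestVariation D ν (Heisenberg.varpi ν) ϑ →
      MeasureTheory.Integrable
        (fun p => ‖Heisenberg.gradHS (frontier D) ν (Heisenberg.varpi ν) p‖ ^ 2)
        (Heisenberg.sigmaH (frontier D) ν) ∧
      MeasureTheory.Integrable
        (fun p => Heisenberg.varpi ν p ^ 2 * (Heisenberg.normSqSymm (frontier D) ν p +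
          (3 - (n : ℝ)) / 6 * Heisenberg.varpi ν p ^ 2)) (Heisenberg.sigmaH (frontier D) ν) ∧
      Heisenberg.secondVariation D ν ϑ =
        ∫ p, (‖Heisenberg.gradHS (frontier D) ν (Heisenberg.varpi ν) p‖ ^ 2 -
          Heisenberg.varpi ν p ^ 2 * (Heisenberg.normSqSymm (frontier D) ν p +
          (3 - (n : ℝ)) / 6 * Heisenberg.varpi ν p ^ 2)) ∂(Heisenberg.sigmaH (frontier D) ν) ∧
      (Heisenberg.IsWeaklyStable D ν →
        ∫ p, Heisenberg.varpi ν p ^ 2 * (Heisenberg.normSqSymm (frontier D) ν p +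
          (3 - (n : ℝ)) / 6 * Heisenberg.varpi ν p ^ 2) ∂(Heisenberg.sigmaH (frontier D) ν) ≤
        ∫ p, ‖Heisenberg.gradHS (frontier D) ν (Heisenberg.varpi ν) p‖ ^ 2
          ∂(Heisenberg.sigmaH (frontier D) ν))) ∧
    (2 ≤ n →
      (∃ ν : Heisenberg.Heis n → Heisenberg.FrameVec n,
        Heisenberg.IsOrientedHypersurface (Heisenberg.profile n) ν) ∧
      ∀ ν : Heisenberg.Heis n → Heisenberg.FrameVec n,
      Heisenberg.IsOrientedHypersurface (Heisenberg.profile n) ν →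
      MeasureTheory.Integrable
        (fun p => ‖Heisenberg.gradHS (Heisenberg.profile n) ν (Heisenberg.varpi ν) p‖ ^ 2)
        (Heisenberg.sigmaH (Heisenberg.profile n) ν) ∧
      MeasureTheory.Integrable
        (fun p => Heisenberg.varpi ν p ^ 2 * (Heisenberg.normSqSymm (Heisenberg.profile n) ν p +
          (3 - (n : ℝ)) / 6 * Heisenberg.varpi ν p ^ 2))
        (Heisenberg.sigmaH (Heisenberg.profile n) ν) ∧
      ∫ p, ‖Heisenberg.gradHS (Heisenberg.profile n) ν (Heisenberg.varpi ν) p‖ ^ 2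
          ∂(Heisenberg.sigmaH (Heisenberg.profile n) ν) =
        ∫ p, Heisenberg.varpi ν p ^ 2 * (Heisenberg.normSqSymm (Heisenberg.profile n) ν p +
          (3 - (n : ℝ)) / 6 * Heisenberg.varpi ν p ^ 2)
          ∂(Heisenberg.sigmaH (Heisenberg.profile n) ν)) :=
  ⟨fun hn _ _ hS hSc hX => hS.integral_of_admissible hn hSc hX,
    fun hn _ _ hD hH hX _ hϑ => hD.integral_of_isTestVariation (by omega) hH hX hϑ,
    fun hn => ⟨⟨_, Heisenberg.isOrientedHypersurface_profile⟩,
      fun _ hS => Heisenberg.integral_profile hS hn⟩⟩
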